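/- Let $\mathcal C$ be a closed symmetric monoidal category with unit $\mathbf 1$, tensor product $\otimes$ and internal hom $\multimap$ (small; sets are taken in a universe that contains its objects and morphisms). Regard $\mathcal C$ as a symmetric polycategory in which morphisms $(A_1,\dots,A_n)\to\Delta$ exist only for a one-element list $\Delta=(B)$, and are the morphisms $A_1\otimes\cdots\otimes A_n\to B$ of $\mathcal C$. Let $\mathcal P$ be the free $\ast$-polycategory on it: its objects are two copies $A$, $\overline A$ of the objects of $\mathcal C$, with $A^\ast=\overline A$ and $\overline A^\ast=A$; its morphisms are $\mathcal P(\Gamma,\overline\Pi;\Delta,\overline\Sigma)=\mathcal C(\Gamma,\Sigma;\Delta,\Pi)$; and its composition is that of $\mathcal C$. Let $\mathcal J$ consist of the canonical morphisms $(A,B)\to A\otimes B$, $()\to\mathbf 1$ and $A\multimap B\to(\overline A,B)$ of $\mathcal P$. A $\mathcal P$-module $\mathcal U$ is a family of sets $\mathcal U(\Gamma;\Delta)$, indexed by finite lists of objects of $\mathcal P$, with actions of permutations and left and right actions of $\mathcal P$ that satisfy the laws of composition in a symmetric polycategory. It is a $(\mathcal P,\mathcal J)$-module if the induced maps $\mathcal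 U(A\otimes B,\Gamma;\Delta)\to\mathcal U(A,B,\Gamma;\Delta)$, $\mathcal U(\mathbf 1,\Gamma;\Delta)\to\mathcal U(\Gamma;\Delta)$ and $\mathcal U(\Gamma;A\multimap B,\Delta)\to\mathcal U(\Gamma;\Delta,\overline A,B)$ are all bijections. A multimorphism of modules $(\mathcal U,\mathcal V)\to\mathcal W$ is a family of functions $\mathcal U(\Gamma_1;\Delta_1)\times\mathcal V(\Gamma_2;\Delta_2)\to\mathcal W(\Gamma_1,\Gamma_2;\Delta_1,\Delta_2)$ that commute with all the actions, and similarly for any number of arguments. Let $\mathcal E=\mathrm{Chu}(\mathrm{Mod}(\mathcal P,\mathcal J),\mathcal P)$ be the category whose objects are triples $(A^+,A^-,\underline A)$ of two $(\mathcal P,\mathcal J)$-modules and a multimorphism $\underline A:(A^+,A^-)\to\mathcal P$, and whose morphisms $A\to B$ are pairs of module morphisms $f^+:A^+\to B^+$ and $f^-:B^-\to A^-$ with $\underline B(f^+a,b)=\underline A(a,f^-b)$. More generally, a Chu morphism $(A,B)\to C$ consists of multimorphisms $(A^+,B^+)\to C^+$, $(B^+,C^-)\to A^-$ and $(A^+,C^-)\to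 B^-$ that induce (up to permutation of arguments) the same multimorphism $(A^+,B^+,C^-)\to\mathcal P$, and a Chu morphism $()\to C$ is an element of $C^+(\,;\,)$. **Theorem.** 1. $\mathcal P$ is a $\ast$-polycategory, and the morphisms in $\mathcal J$ exhibit $A\otimes B$, $\mathbf 1$ as a tensor product and unit, and $A\multimap B$ as a cotensor product of $\overline A$ and $B$, in $\mathcal P$; so $\mathcal P$ is a $(\mathcal P,\mathcal J)$-module over itself. 2. $\mathcal E$ is a $\ast$-autonomous category (a closed symmetric monoidal category with an object $\bot$ such that every canonical morphism $A\to(A\multimap\bot)\multimap\bot$ is invertible). Its structure is that of the Chu construction: $A\otimes B$ and the unit carry universal Chu morphisms $(A,B)\to A\otimes B$ and $()\to\mathbf 1$, which determine the action of $\otimes$ on morphisms, the braiding, the associator and the unitors in the canonical way; and $A\multimap\bot$ is naturally isomorphic to $(A^-,A^+,\underline A\sigma)$, where $\sigma$ exchanges the arguments. 3. There is a fully faithful strong symmetric monoidal closed functor $F:\mathcal C\to\mathcal E$; that is, $F$ is strong symmetric monoidal and the canonical morphisms $F(A\multimap B)\to F A\multimap F B$ are invertible. Up to natural isomorphism, $F$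 is the Yoneda embedding: $F A$ consists of the representable modules $(\Gamma;\Delta)\mapsto\mathcal P(\Gamma;A,\Delta)$ and $(\Gamma;\Delta)\mapsto\mathcal P(A,\Gamma;\Delta)$, with composition along $A$ as the pairing, and $F$ acts on morphisms by composition. In particular, every closed symmetric monoidal category embeds fully in a $\ast$-autonomous category by a strong symmetric monoidal closed functor. -/

import Mathlib

universe u v w

open CategoryTheory MonoidalCategory

/-! ## Permutations of finite lists -/

/-- Permutations of finite lists of objects, presented by words in adjacent transpositions.
The bijection of positions denoted by a word is `ListPerm.idx`; in all the structures below, two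
words with the same bijection of positions are required to act in the same way. -/
inductive ListPerm {α : Type u} : List α → List α → Type u
  | refl (Γ : List α) : ListPerm Γ Γ
  | cons (A : α) {Γ Γ' : List α} (σ : ListPerm Γ Γ') : ListPerm (A :: Γ) (A :: Γ')
  | swap (A B : α) (Γ : List α) : ListPerm (A :: B :: Γ) (B :: A :: Γ)
  | trans {Γ Γ' Γ'' : List α} (σ : ListPerm Γ Γ') (τ : ListPerm Γ' Γ'') : ListPerm Γ Γ''

namespace ListPerm

variable {α : Type u}

/-- The bijection of positions: `σ.idx i` is the position in the target list of the entry that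
stands at position `i` in the source list (positions beyond the end are fixed). -/
def idx : {Γ Γ' : List α} → ListPerm Γ Γ' → ℕ → ℕ
  | _, _, refl _, i => i
  | _, _, cons _ _, 0 => 0
  | _, _, cons _ σ, i + 1 => σ.idx i + 1
  | _, _, swap _ _ _, 0 => 1
  | _, _, swap _ _ _, 1 => 0
  | _, _, swap _ _ _, i + 2 => i + 2
  | _, _, trans σ τ, i => τ.idx (σ.idx i)

def symm : {Γ Γ' : List α} → ListPerm Γ Γ' → ListPerm Γ' Γ
  | _, _, refl Γ => refl Γ
  | _, _, cons A σ => cons A σ.symm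
  | _, _, swap A B Γ => swap B A Γ
  | _, _, trans σ τ => trans τ.symm σ.symm

def appendRight : {Γ Γ' : List α} → ListPerm Γ Γ' → (Δ : List α) → ListPerm (Γ ++ Δ) (Γ' ++ Δ)
  | _, _, refl Γ, Δ => refl (Γ ++ Δ)
  | _, _, cons A σ, Δ => cons A (σ.appendRight Δ)
  | _, _, swap A B Γ, Δ => swap A B (Γ ++ Δ)
  | _, _, trans σ τ, Δ => trans (σ.appendRight Δ) (τ.appendRight Δ)

def appendLeft : (Γ : List α) → {Δ Δ' : List α} → ListPerm Δ Δ' → ListPerm (Γ ++ Δ) (Γ ++ Δ')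
  | [], _, _, σ => σ
  | A :: Γ, _, _, σ => cons A (appendLeft Γ σ)

/-- The block sum of two permutations. -/
def append {Γ Γ' Δ Δ' : List α} (σ : ListPerm Γ Γ') (τ : ListPerm Δ Δ') :
    ListPerm (Γ ++ Δ) (Γ' ++ Δ') :=
  trans (σ.appendRight Δ) (appendLeft Γ' τ)

/-- Move `A` to the front. -/
def front : (Γ : List α) → (A : α) → (Δ : List α) → ListPerm (Γ ++ A :: Δ) (A :: (Γ ++ Δ))
  | [], A, Δ => refl (A :: Δ)
  | B :: Γ, A, Δ => trans (cons B (front Γ A Δ)) (swap B A (Γ ++ Δ))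

def assoc : (Γ Δ Θ : List α) → ListPerm ((Γ ++ Δ) ++ Θ) (Γ ++ (Δ ++ Θ))
  | [], Δ, Θ => refl (Δ ++ Θ)
  | A :: Γ, Δ, Θ => cons A (assoc Γ Δ Θ)

def appendNil : (Γ : List α) → ListPerm Γ (Γ ++ [])
  | [] => refl []
  | A :: Γ => cons A (appendNil Γ)

/-- Interchange two consecutive blocks. -/
def comm : (Γ Δ : List α) → ListPerm (Γ ++ Δ) (Δ ++ Γ)
  | [], Δ => appendNil Δ
  | A :: Γ, Δ => trans (cons A (comm Γ Δ)) (front Δ A Γ).symm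

def leftComm (Γ Δ Θ : List α) : ListPerm (Γ ++ (Δ ++ Θ)) (Δ ++ (Γ ++ Θ)) :=
  trans (assoc Γ Δ Θ).symm (trans ((comm Γ Δ).appendRight Θ) (assoc Δ Γ Θ))

def rightComm (Γ Δ Θ : List α) : ListPerm ((Γ ++ Δ) ++ Θ) ((Γ ++ Θ) ++ Δ) :=
  trans (assoc Γ Δ Θ) (trans (appendLeft Γ (comm Δ Θ)) (assoc Γ Θ Δ).symm)

/-- Interchange the two middle blocks. -/
def interchange (Γ Δ Θ Ξ : List α) :
    ListPerm ((Γ ++ Δ) ++ (Θ ++ Ξ)) ((Γ ++ Θ) ++ (Δ ++ Ξ)) :=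
  trans (assoc Γ Δ (Θ ++ Ξ)) (trans (appendLeft Γ (leftComm Δ Θ Ξ)) (assoc Γ Θ (Δ ++ Ξ)).symm)

/-- The permutation `A, Δ ↦ Δ, A`. -/
def rotate (A : α) (Δ : List α) : ListPerm (A :: Δ) (Δ ++ [A]) :=
  comm [A] Δ

theorem toPerm {Γ Γ' : List α} (σ : ListPerm Γ Γ') : Γ.Perm Γ' := by
  induction σ with
  | refl Γ => exact List.Perm.refl Γ
  | cons A _ ih => exact List.Perm.cons A ih
  | swap A B Γ => exact List.Perm.swap B A Γ
  | trans _ _ ih₁ ih₂ => exact List.Perm.trans ih₁ ih₂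

end ListPerm

open ListPerm (front assoc leftComm rightComm)

/-! ## Symmetric polycategories and their modules -/

/-- The operations of a (symmetric) polycategory: morphisms `Γ → Δ` between finite lists of
objects, the actions of permutations, identities, and composition along one object. Since the
object may be moved to the head of a list by a permutation, it suffices to compose there.
The laws are in `PolycategoryStruct.IsPolycategory`. -/
structure PolycategoryStruct where
  Ob : Type u
  Hom : List Ob → List Ob → Type w
  perm : ∀ {Γ Γ' Δ Δ' : List Ob}, ListPerm Γ Γ' → ListPerm Δ Δ' → Hom Γ Δ → Hom Γ' Δ'
  id : ∀ A : Ob, Hom [A] [A]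
  comp : ∀ {Γ Δ S T : List Ob} {A : Ob},
    Hom Γ (A :: Δ) → Hom (A :: S) T → Hom (Γ ++ S) (Δ ++ T)

/-- The operations of a `P`-module: a family of sets `U(Γ;Δ)` with permutation actions and with
left and right actions of `P`. The laws are in `ModuleStruct.IsModule`. -/
structure ModuleStruct (P : PolycategoryStruct.{u, w}) where
  obj : List P.Ob → List P.Ob → Type w
  perm : ∀ {Γ Γ' Δ Δ' : List P.Ob}, ListPerm Γ Γ' → ListPerm Δ Δ' → obj Γ Δ → obj Γ' Δ'
  left : ∀ {Γ Δ S T : List P.Ob} {A : P.Ob},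
    P.Hom Γ (A :: Δ) → obj (A :: S) T → obj (Γ ++ S) (Δ ++ T)
  right : ∀ {Γ Δ S T : List P.Ob} {A : P.Ob},
    obj Γ (A :: Δ) → P.Hom (A :: S) T → obj (Γ ++ S) (Δ ++ T)

namespace ModuleStruct

variable {P : PolycategoryStruct.{u, w}}

/-- The laws of a `P`-module: those of the composition of a polycategory, in which one of the
morphisms that are composed is taken from the module. -/
structure IsModule (U : ModuleStruct P) : Prop where
  perm_refl : ∀ {Γ Δ : List P.Ob} (x : U.obj Γ Δ), U.perm (.refl Γ) (.refl Δ) x = x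
  perm_trans : ∀ {Γ Γ' Γ'' Δ Δ' Δ'' : List P.Ob} (σ : ListPerm Γ Γ') (σ' : ListPerm Γ' Γ'')
    (τ : ListPerm Δ Δ') (τ' : ListPerm Δ' Δ'') (x : U.obj Γ Δ),
    U.perm (σ.trans σ') (τ.trans τ') x = U.perm σ' τ' (U.perm σ τ x)
  perm_congr : ∀ {Γ Γ' Δ Δ' : List P.Ob} (σ σ' : ListPerm Γ Γ') (τ τ' : ListPerm Δ Δ'),
    σ.idx = σ'.idx → τ.idx = τ'.idx → ∀ x : U.obj Γ Δ, U.perm σ τ x = U.perm σ' τ' x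
  left_perm : ∀ {Γ Γ' Δ Δ' S S' T T' : List P.Ob} {A : P.Ob} (σ : ListPerm Γ Γ')
    (τ : ListPerm Δ Δ') (σ' : ListPerm S S') (τ' : ListPerm T T')
    (f : P.Hom Γ (A :: Δ)) (x : U.obj (A :: S) T),
    U.left (P.perm σ (.cons A τ) f) (U.perm (.cons A σ') τ' x) =
      U.perm (σ.append σ') (τ.append τ') (U.left f x)
  right_perm : ∀ {Γ Γ' Δ Δ' S S' T T' : List P.Ob} {A : P.Ob} (σ : ListPerm Γ Γ')
    (τ : ListPerm Δ Δ') (σ' : ListPerm S S') (τ' : ListPerm T T')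
    (x : U.obj Γ (A :: Δ)) (g : P.Hom (A :: S) T),
    U.right (U.perm σ (.cons A τ) x) (P.perm (.cons A σ') τ' g) =
      U.perm (σ.append σ') (τ.append τ') (U.right x g)
  id_left : ∀ {S T : List P.Ob} {A : P.Ob} (x : U.obj (A :: S) T), U.left (P.id A) x = x
  right_id : ∀ {Γ Δ : List P.Ob} {A : P.Ob} (x : U.obj Γ (A :: Δ)),
    U.right x (P.id A) = U.perm (.appendNil Γ) (.rotate A Δ) x
  -- three morphisms composed in a chain, with the module element in last, middle, first place
  left_left : ∀ {Γ Δ S T Φ Ψ : List P.Ob} {A B : P.Ob} (f : P.Hom Γ (A :: Δ))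
    (g : P.Hom (A :: S) (B :: T)) (x : U.obj (B :: Φ) Ψ),
    U.perm (assoc Γ S Φ) (assoc Δ T Ψ)
        (U.left (P.perm (.refl _) (front Δ B T) (P.comp f g)) x) =
      U.left f (U.left g x)
  left_right : ∀ {Γ Δ S T Φ Ψ : List P.Ob} {A B : P.Ob} (f : P.Hom Γ (A :: Δ))
    (x : U.obj (A :: S) (B :: T)) (h : P.Hom (B :: Φ) Ψ),
    U.perm (assoc Γ S Φ) (assoc Δ T Ψ)
        (U.right (U.perm (.refl _) (front Δ B T) (U.left f x)) h) =
      U.left f (U.right x h)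
  right_right : ∀ {Γ Δ S T Φ Ψ : List P.Ob} {A B : P.Ob} (x : U.obj Γ (A :: Δ))
    (g : P.Hom (A :: S) (B :: T)) (h : P.Hom (B :: Φ) Ψ),
    U.perm (assoc Γ S Φ) (assoc Δ T Ψ)
        (U.right (U.perm (.refl _) (front Δ B T) (U.right x g)) h) =
      U.right x (P.comp g h)
  -- two morphisms composed into a third, which is the module element
  left_left_comm : ∀ {Γ₁ Δ₁ Γ₂ Δ₂ S T : List P.Ob} {A B : P.Ob} (f₁ : P.Hom Γ₁ (A :: Δ₁))
    (f₂ : P.Hom Γ₂ (B :: Δ₂)) (x : U.obj (A :: B :: S) T),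
    U.perm (leftComm Γ₂ Γ₁ S) (leftComm Δ₂ Δ₁ T)
        (U.left f₂ (U.perm (front Γ₁ B S) (.refl _) (U.left f₁ x))) =
      U.left f₁ (U.perm (front Γ₂ A S) (.refl _) (U.left f₂ (U.perm (.swap A B S) (.refl _) x)))
  -- two morphisms composed into a third, the module element being one of the two
  left_right_comm : ∀ {Γ₁ Δ₁ Γ₂ Δ₂ S T : List P.Ob} {A B : P.Ob} (x : U.obj Γ₁ (A :: Δ₁))
    (f₂ : P.Hom Γ₂ (B :: Δ₂)) (g : P.Hom (A :: B :: S) T),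
    U.perm (leftComm Γ₂ Γ₁ S) (leftComm Δ₂ Δ₁ T)
        (U.left f₂ (U.perm (front Γ₁ B S) (.refl _) (U.right x g))) =
      U.right x
        (P.perm (front Γ₂ A S) (.refl _) (P.comp f₂ (P.perm (.swap A B S) (.refl _) g)))
  -- two morphisms composed after a third, which is the module element
  right_right_comm : ∀ {Γ Δ S₁ T₁ S₂ T₂ : List P.Ob} {A B : P.Ob} (x : U.obj Γ (A :: B :: Δ))
    (g₁ : P.Hom (A :: S₁) T₁) (g₂ : P.Hom (B :: S₂) T₂),
    U.perm (rightComm Γ S₁ S₂) (rightComm Δ T₁ T₂) (U.right (U.right x g₁ : U.obj _ (B :: _)) g₂) =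
      U.right (U.right (U.perm (.refl _) (.swap A B Δ) x) g₂ : U.obj _ (A :: _)) g₁
  -- two morphisms composed after a third, the module element being one of the two
  right_left_comm : ∀ {Γ Δ S₁ T₁ S₂ T₂ : List P.Ob} {A B : P.Ob} (f : P.Hom Γ (A :: B :: Δ))
    (x : U.obj (A :: S₁) T₁) (g₂ : P.Hom (B :: S₂) T₂),
    U.perm (rightComm Γ S₁ S₂) (rightComm Δ T₁ T₂) (U.right (U.left f x : U.obj _ (B :: _)) g₂) =
      U.left (P.comp (P.perm (.refl _) (.swap A B Δ) f) g₂ : P.Hom _ (A :: _)) x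

/-- The hom-sets of `P`, as a module over `P`. -/
def self (P : PolycategoryStruct.{u, w}) : ModuleStruct P where
  obj := P.Hom
  perm := P.perm
  left := P.comp
  right := P.comp

/-- The representable module `Γ, Δ ↦ P(Γ; A, Δ)`. -/
def yo (A : P.Ob) : ModuleStruct P where
  obj Γ Δ := P.Hom Γ (A :: Δ)
  perm σ τ := P.perm σ (.cons A τ)
  left {Γ Δ S T _} f x := P.perm (.refl (Γ ++ S)) (front Δ A T) (P.comp f x)
  right {Γ Δ _ _ B} x g := P.comp (P.perm (.refl Γ) (.swap A B Δ) x) g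

/-- The representable module `Γ, Δ ↦ P(A, Γ; Δ)`. -/
def noy (A : P.Ob) : ModuleStruct P where
  obj Γ Δ := P.Hom (A :: Γ) Δ
  perm σ τ := P.perm (.cons A σ) τ
  left {Γ Δ S T B} f x :=
    P.perm (front Γ A S) (.refl (Δ ++ T)) (P.comp f (P.perm (.swap A B S) (.refl T) x))
  right x g := P.comp x g

/-- Morphisms of modules `U → V`. -/
@[ext]
structure Hom (U V : ModuleStruct P) where
  toFun : ∀ {Γ Δ : List P.Ob}, U.obj Γ Δ → V.obj Γ Δ
  map_perm : ∀ {Γ Γ' Δ Δ' : List P.Ob} (σ : ListPerm Γ Γ') (τ : ListPerm Δ Δ') (x : U.obj Γ Δ),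
    toFun (U.perm σ τ x) = V.perm σ τ (toFun x)
  map_left : ∀ {Γ Δ S T : List P.Ob} {A : P.Ob} (f : P.Hom Γ (A :: Δ)) (x : U.obj (A :: S) T),
    toFun (U.left f x) = V.left f (toFun x)
  map_right : ∀ {Γ Δ S T : List P.Ob} {A : P.Ob} (x : U.obj Γ (A :: Δ)) (g : P.Hom (A :: S) T),
    toFun (U.right x g) = V.right (toFun x) g

instance (U V : ModuleStruct P) :
    CoeFun (Hom U V) (fun _ => ∀ {Γ Δ : List P.Ob}, U.obj Γ Δ → V.obj Γ Δ) :=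
  ⟨Hom.toFun⟩

def Hom.id (U : ModuleStruct P) : Hom U U where
  toFun x := x
  map_perm _ _ _ := rfl
  map_left _ _ := rfl
  map_right _ _ := rfl

def Hom.comp {U V W : ModuleStruct P} (φ : Hom U V) (ψ : Hom V W) : Hom U W where
  toFun x := ψ (φ x)
  map_perm σ τ x := by rw [φ.map_perm, ψ.map_perm]
  map_left f x := by rw [φ.map_left, ψ.map_left]
  map_right x g := by rw [φ.map_right, ψ.map_right]

/-- An invertible morphism of modules. -/
def Hom.IsBijective {U V : ModuleStruct P} (φ : Hom U V) : Prop :=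
  ∀ Γ Δ : List P.Ob, Function.Bijective (fun x : U.obj Γ Δ => φ x)

/-- Binary multimorphisms of modules `(U, V) → W`: functions
`U(Γ₁;Δ₁) × V(Γ₂;Δ₂) → W(Γ₁,Γ₂;Δ₁,Δ₂)` that commute with the permutations and with the actions
of `P` in each variable. -/
@[ext]
structure Hom₂ (U V W : ModuleStruct P) where
  toFun : ∀ {Γ₁ Δ₁ Γ₂ Δ₂ : List P.Ob}, U.obj Γ₁ Δ₁ → V.obj Γ₂ Δ₂ → W.obj (Γ₁ ++ Γ₂) (Δ₁ ++ Δ₂)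
  map_perm : ∀ {Γ₁ Γ₁' Δ₁ Δ₁' Γ₂ Γ₂' Δ₂ Δ₂' : List P.Ob} (σ₁ : ListPerm Γ₁ Γ₁')
    (τ₁ : ListPerm Δ₁ Δ₁') (σ₂ : ListPerm Γ₂ Γ₂') (τ₂ : ListPerm Δ₂ Δ₂')
    (x : U.obj Γ₁ Δ₁) (y : V.obj Γ₂ Δ₂),
    toFun (U.perm σ₁ τ₁ x) (V.perm σ₂ τ₂ y) = W.perm (σ₁.append σ₂) (τ₁.append τ₂) (toFun x y)
  map_left₁ : ∀ {Γ Δ S T Φ Ψ : List P.Ob} {A : P.Ob} (f : P.Hom Γ (A :: Δ))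
    (x : U.obj (A :: S) T) (y : V.obj Φ Ψ),
    W.perm (assoc Γ S Φ) (assoc Δ T Ψ) (toFun (U.left f x) y) =
      W.left f (toFun x y : W.obj (A :: (S ++ Φ)) (T ++ Ψ))
  map_right₁ : ∀ {Γ Δ S T Φ Ψ : List P.Ob} {A : P.Ob} (x : U.obj Γ (A :: Δ))
    (g : P.Hom (A :: S) T) (y : V.obj Φ Ψ),
    W.perm (rightComm Γ S Φ) (rightComm Δ T Ψ) (toFun (U.right x g) y) =
      W.right (toFun x y : W.obj (Γ ++ Φ) (A :: (Δ ++ Ψ))) g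
  map_left₂ : ∀ {Γ Δ S T Φ Ψ : List P.Ob} {A : P.Ob} (f : P.Hom Γ (A :: Δ))
    (x : U.obj Φ Ψ) (y : V.obj (A :: S) T),
    W.perm (leftComm Φ Γ S) (leftComm Ψ Δ T) (toFun x (V.left f y)) =
      W.left f (W.perm (front Φ A S) (.refl _) (toFun x y))
  map_right₂ : ∀ {Γ Δ S T Φ Ψ : List P.Ob} {A : P.Ob} (x : U.obj Φ Ψ)
    (y : V.obj Γ (A :: Δ)) (g : P.Hom (A :: S) T),
    toFun x (V.right y g) =
      W.perm (assoc Φ Γ S) (assoc Ψ Δ T) (W.right (W.perm (.refl _) (front Ψ A Δ) (toFun x y)) g)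

instance (U V W : ModuleStruct P) :
    CoeFun (Hom₂ U V W) (fun _ => ∀ {Γ₁ Δ₁ Γ₂ Δ₂ : List P.Ob}, U.obj Γ₁ Δ₁ → V.obj Γ₂ Δ₂ →
      W.obj (Γ₁ ++ Γ₂) (Δ₁ ++ Δ₂)) :=
  ⟨Hom₂.toFun⟩

end ModuleStruct

namespace PolycategoryStruct

/-- The laws of a (symmetric) polycategory; equivalently, the hom-sets form a module over it. -/
def IsPolycategory (P : PolycategoryStruct.{u, w}) : Prop :=
  (ModuleStruct.self P).IsModule

/-- `P` is a `∗`-polycategory: a polycategory with a strictly involutive duality `A ↦ A*` whose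
counits `ε : (A*, A) → ()` induce bijections `P(Γ; A*, Δ) ≅ P(Γ, A; Δ)`. -/
structure IsStarPolycategory (P : PolycategoryStruct.{u, w}) (star : P.Ob → P.Ob)
    (ε : ∀ A B : P.Ob, star A = B → P.Hom [B, A] []) : Prop where
  isPolycategory : P.IsPolycategory
  star_star : ∀ A, star (star A) = A
  ε_symm : ∀ (A B : P.Ob) (h : star A = B) (h' : star B = A),
    P.perm (.swap B A []) (.refl []) (ε A B h) = ε B A h'
  bijective : ∀ (A : P.Ob) (Γ Δ : List P.Ob), Function.Bijective
    (fun f : P.Hom Γ (star A :: Δ) => (P.comp f (ε A (star A) rfl) : P.Hom (Γ ++ [A]) (Δ ++ [])))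

/-- A collection of distinguished candidates `t : Γ → X` for tensor products and `s : X → Δ` for
cotensor products in `P` (nullary ones being units and counits). -/
structure Distinguished (P : PolycategoryStruct.{u, w}) where
  IsTensor : ∀ {Γ : List P.Ob} {X : P.Ob}, P.Hom Γ [X] → Prop
  IsCotensor : ∀ {X : P.Ob} {Δ : List P.Ob}, P.Hom [X] Δ → Prop

end PolycategoryStruct

/-- A module respects the distinguished tensor and cotensor products if the maps
`U(X,Γ;Δ) → U(A₁,…,Aₙ,Γ;Δ)` and `U(Γ;X,Δ) → U(Γ;Δ,A₁,…,Aₙ)` that they induce are bijections. -/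
structure ModuleStruct.Respects {P : PolycategoryStruct.{u, w}} (U : ModuleStruct P)
    (J : P.Distinguished) : Prop where
  tensor : ∀ {As : List P.Ob} {X : P.Ob} (t : P.Hom As [X]), J.IsTensor t →
    ∀ Γ Δ : List P.Ob, Function.Bijective (fun x : U.obj (X :: Γ) Δ => U.left t x)
  cotensor : ∀ {X : P.Ob} {As : List P.Ob} (s : P.Hom [X] As), J.IsCotensor s →
    ∀ Γ Δ : List P.Ob, Function.Bijective (fun x : U.obj Γ (X :: Δ) => U.right x s)

/-- `(P,J)`-modules. -/
structure PJModule (P : PolycategoryStruct.{u, w}) (J : P.Distinguished) extends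
    ModuleStruct P where
  isModule : toModuleStruct.IsModule
  respects : toModuleStruct.Respects J

/-! ## The Chu construction on modules -/

/-- The envelope `Chu(Mod(P,J), P)`: its objects are triples `(U, V, e)` of two `(P,J)`-modules
and a multimorphism `e : (U, V) → P`. -/
structure Envelope (P : PolycategoryStruct.{u, w}) (J : P.Distinguished) where
  pos : PJModule P J
  neg : PJModule P J
  pair : ModuleStruct.Hom₂ pos.toModuleStruct neg.toModuleStruct (ModuleStruct.self P)

namespace Envelope

variable {P : PolycategoryStruct.{u, w}} {J : P.Distinguished}

/-- Unary morphisms of the Chu construction. The component `(A⁺, B⁻) → P` is the common value of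
the two sides of `compat`. -/
@[ext]
structure Hom (A B : Envelope P J) where
  pos : ModuleStruct.Hom A.pos.toModuleStruct B.pos.toModuleStruct
  neg : ModuleStruct.Hom B.neg.toModuleStruct A.neg.toModuleStruct
  compat : ∀ {Γ₁ Δ₁ Γ₂ Δ₂ : List P.Ob} (a : A.pos.obj Γ₁ Δ₁) (b : B.neg.obj Γ₂ Δ₂),
    B.pair (pos a) b = A.pair a (neg b)

instance : Category.{max u w} (Envelope P J) where
  Hom := Hom
  id A := ⟨.id _, .id _, fun _ _ => rfl⟩
  comp f g := ⟨f.pos.comp g.pos, g.neg.comp f.neg, fun a b =>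
    (g.compat (f.pos a) b).trans (f.compat a (g.neg b))⟩

/-- The action of a morphism of the envelope on the positive parts. -/
def mapPos {A B : Envelope P J} (f : A ⟶ B) {Γ Δ : List P.Ob} (a : A.pos.obj Γ Δ) :
    B.pos.obj Γ Δ :=
  Hom.pos f a

/-- The action of a morphism of the envelope on the negative parts. -/
def mapNeg {A B : Envelope P J} (f : A ⟶ B) {Γ Δ : List P.Ob} (b : B.neg.obj Γ Δ) :
    A.neg.obj Γ Δ :=
  Hom.neg f b

/-- Binary morphisms `(A, B) → C` of the Chu construction. The component `(A⁺, B⁺, C⁻) → P` is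
the common value of the sides of `compat_fst` and `compat_snd`. -/
structure Hom₂ (A B C : Envelope P J) where
  pos : ModuleStruct.Hom₂ A.pos.toModuleStruct B.pos.toModuleStruct C.pos.toModuleStruct
  fst : ModuleStruct.Hom₂ B.pos.toModuleStruct C.neg.toModuleStruct A.neg.toModuleStruct
  snd : ModuleStruct.Hom₂ A.pos.toModuleStruct C.neg.toModuleStruct B.neg.toModuleStruct
  compat_fst : ∀ {Γ₁ Δ₁ Γ₂ Δ₂ Γ₃ Δ₃ : List P.Ob} (a : A.pos.obj Γ₁ Δ₁) (b : B.pos.obj Γ₂ Δ₂)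
    (c : C.neg.obj Γ₃ Δ₃),
    P.perm (assoc Γ₁ Γ₂ Γ₃) (assoc Δ₁ Δ₂ Δ₃) (C.pair (pos a b) c) = A.pair a (fst b c)
  compat_snd : ∀ {Γ₁ Δ₁ Γ₂ Δ₂ Γ₃ Δ₃ : List P.Ob} (a : A.pos.obj Γ₁ Δ₁) (b : B.pos.obj Γ₂ Δ₂)
    (c : C.neg.obj Γ₃ Δ₃),
    P.perm (leftComm Γ₁ Γ₂ Γ₃) (leftComm Δ₁ Δ₂ Δ₃) (A.pair a (fst b c)) = B.pair b (snd a c)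

/-- The symmetric monoidal structure is that of the Chu construction: the binary morphisms
`u A B : (A, B) → A ⊗ B` and the nullary morphism `e : () → 𝟙_` (which is an element of
`(𝟙_)⁺(;)`) are universal, and the action of `⊗` on morphisms, the braiding, the associator and
the unitors are the ones that these universal morphisms determine. -/
structure IsChuTensor [MonoidalCategory (Envelope P J)] [SymmetricCategory (Envelope P J)]
    (u : ∀ A B : Envelope P J, Hom₂ A B (A ⊗ B)) (e : (𝟙_ (Envelope P J)).pos.obj [] []) :
    Prop where
  tensor_universal : ∀ {A B C : Envelope P J} (k : Hom₂ A B C), ∃! h : A ⊗ B ⟶ C,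
    (∀ {Γ₁ Δ₁ Γ₂ Δ₂ : List P.Ob} (a : A.pos.obj Γ₁ Δ₁) (b : B.pos.obj Γ₂ Δ₂),
      mapPos h ((u A B).pos a b) = k.pos a b) ∧
    (∀ {Γ₁ Δ₁ Γ₂ Δ₂ : List P.Ob} (b : B.pos.obj Γ₁ Δ₁) (c : C.neg.obj Γ₂ Δ₂),
      (u A B).fst b (mapNeg h c) = k.fst b c) ∧
    (∀ {Γ₁ Δ₁ Γ₂ Δ₂ : List P.Ob} (a : A.pos.obj Γ₁ Δ₁) (c : C.neg.obj Γ₂ Δ₂),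
      (u A B).snd a (mapNeg h c) = k.snd a c)
  unit_universal : ∀ {C : Envelope P J} (k : C.pos.obj [] []),
    ∃! h : 𝟙_ (Envelope P J) ⟶ C, mapPos h e = k
  tensorHom_pos : ∀ {A A' B B' : Envelope P J} (f : A ⟶ A') (g : B ⟶ B')
    {Γ₁ Δ₁ Γ₂ Δ₂ : List P.Ob} (a : A.pos.obj Γ₁ Δ₁) (b : B.pos.obj Γ₂ Δ₂),
    mapPos (f ⊗ₘ g) ((u A B).pos a b) = (u A' B').pos (mapPos f a) (mapPos g b)
  tensorHom_fst : ∀ {A A' B B' : Envelope P J} (f : A ⟶ A') (g : B ⟶ B')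
    {Γ₁ Δ₁ Γ₂ Δ₂ : List P.Ob} (b : B.pos.obj Γ₁ Δ₁) (c : (A' ⊗ B').neg.obj Γ₂ Δ₂),
    (u A B).fst b (mapNeg (f ⊗ₘ g) c) = mapNeg f ((u A' B').fst (mapPos g b) c)
  tensorHom_snd : ∀ {A A' B B' : Envelope P J} (f : A ⟶ A') (g : B ⟶ B')
    {Γ₁ Δ₁ Γ₂ Δ₂ : List P.Ob} (a : A.pos.obj Γ₁ Δ₁) (c : (A' ⊗ B').neg.obj Γ₂ Δ₂),
    (u A B).snd a (mapNeg (f ⊗ₘ g) c) = mapNeg g ((u A' B').snd (mapPos f a) c)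
  braiding_pos : ∀ {A B : Envelope P J} {Γ₁ Δ₁ Γ₂ Δ₂ : List P.Ob} (a : A.pos.obj Γ₁ Δ₁)
    (b : B.pos.obj Γ₂ Δ₂),
    (B ⊗ A).pos.perm (.comm Γ₁ Γ₂) (.comm Δ₁ Δ₂) (mapPos (β_ A B).hom ((u A B).pos a b)) =
      (u B A).pos b a
  braiding_fst : ∀ {A B : Envelope P J} {Γ₁ Δ₁ Γ₂ Δ₂ : List P.Ob} (b : B.pos.obj Γ₁ Δ₁)
    (c : (B ⊗ A).neg.obj Γ₂ Δ₂),
    (u A B).fst b (mapNeg (β_ A B).hom c) = (u B A).snd b c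
  braiding_snd : ∀ {A B : Envelope P J} {Γ₁ Δ₁ Γ₂ Δ₂ : List P.Ob} (a : A.pos.obj Γ₁ Δ₁)
    (c : (B ⊗ A).neg.obj Γ₂ Δ₂),
    (u A B).snd a (mapNeg (β_ A B).hom c) = (u B A).fst a c
  associator_pos : ∀ {A B C : Envelope P J} {Γ₁ Δ₁ Γ₂ Δ₂ Γ₃ Δ₃ : List P.Ob}
    (a : A.pos.obj Γ₁ Δ₁) (b : B.pos.obj Γ₂ Δ₂) (c : C.pos.obj Γ₃ Δ₃),
    (A ⊗ (B ⊗ C)).pos.perm (assoc Γ₁ Γ₂ Γ₃) (assoc Δ₁ Δ₂ Δ₃)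
        (mapPos (α_ A B C).hom ((u (A ⊗ B) C).pos ((u A B).pos a b) c)) =
      (u A (B ⊗ C)).pos a ((u B C).pos b c)
  associator_fst : ∀ {A B C : Envelope P J} {Γ₁ Δ₁ Γ₂ Δ₂ Γ₃ Δ₃ : List P.Ob}
    (b : B.pos.obj Γ₁ Δ₁) (c : C.pos.obj Γ₂ Δ₂) (d : (A ⊗ (B ⊗ C)).neg.obj Γ₃ Δ₃),
    (u A B).fst b ((u (A ⊗ B) C).fst c (mapNeg (α_ A B C).hom d)) =
      A.neg.perm (assoc Γ₁ Γ₂ Γ₃) (assoc Δ₁ Δ₂ Δ₃) ((u A (B ⊗ C)).fst ((u B C).pos b c) d)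
  associator_snd : ∀ {A B C : Envelope P J} {Γ₁ Δ₁ Γ₂ Δ₂ Γ₃ Δ₃ : List P.Ob}
    (a : A.pos.obj Γ₁ Δ₁) (c : C.pos.obj Γ₂ Δ₂) (d : (A ⊗ (B ⊗ C)).neg.obj Γ₃ Δ₃),
    B.neg.perm (leftComm Γ₁ Γ₂ Γ₃) (leftComm Δ₁ Δ₂ Δ₃)
        ((u A B).snd a ((u (A ⊗ B) C).fst c (mapNeg (α_ A B C).hom d))) =
      (u B C).fst c ((u A (B ⊗ C)).snd a d)
  associator_trd : ∀ {A B C : Envelope P J} {Γ₁ Δ₁ Γ₂ Δ₂ Γ₃ Δ₃ : List P.Ob}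
    (a : A.pos.obj Γ₁ Δ₁) (b : B.pos.obj Γ₂ Δ₂) (d : (A ⊗ (B ⊗ C)).neg.obj Γ₃ Δ₃),
    C.neg.perm ((assoc Γ₁ Γ₂ Γ₃).trans (leftComm Γ₁ Γ₂ Γ₃))
        ((assoc Δ₁ Δ₂ Δ₃).trans (leftComm Δ₁ Δ₂ Δ₃))
        ((u (A ⊗ B) C).snd ((u A B).pos a b) (mapNeg (α_ A B C).hom d)) =
      (u B C).snd b ((u A (B ⊗ C)).snd a d)
  leftUnitor_pos : ∀ {A : Envelope P J} {Γ Δ : List P.Ob} (a : A.pos.obj Γ Δ),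
    mapPos (λ_ A).hom ((u (𝟙_ _) A).pos e a) = a
  leftUnitor_snd : ∀ {A : Envelope P J} {Γ Δ : List P.Ob} (a : A.neg.obj Γ Δ),
    (u (𝟙_ _) A).snd e (mapNeg (λ_ A).hom a) = a
  rightUnitor_pos : ∀ {A : Envelope P J} {Γ Δ : List P.Ob} (a : A.pos.obj Γ Δ),
    mapPos (ρ_ A).hom ((u A (𝟙_ _)).pos a e) = A.pos.perm (.appendNil Γ) (.appendNil Δ) a
  rightUnitor_fst : ∀ {A : Envelope P J} {Γ Δ : List P.Ob} (a : A.neg.obj Γ Δ),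
    (u A (𝟙_ _)).fst e (mapNeg (ρ_ A).hom a) = a

/-- The duality `A ↦ A ⊸ bot` is (isomorphic to) that of the Chu construction, which takes
`(A⁺, A⁻, e)` to `(A⁻, A⁺, e ∘ swap)` and a morphism `(f⁺, f⁻)` to `(f⁻, f⁺)`. -/
def IsChuDuality [MonoidalCategory (Envelope P J)] [MonoidalClosed (Envelope P J)]
    (bot : Envelope P J) : Prop :=
  ∃ (i : ∀ A : Envelope P J, ModuleStruct.Hom A.neg.toModuleStruct
      ((ihom A).obj bot).pos.toModuleStruct)
    (j : ∀ A : Envelope P J, ModuleStruct.Hom A.pos.toModuleStruct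
      ((ihom A).obj bot).neg.toModuleStruct),
    (∀ A, (i A).IsBijective) ∧ (∀ A, (j A).IsBijective) ∧
    (∀ (A : Envelope P J) {Γ₁ Δ₁ Γ₂ Δ₂ : List P.Ob} (a : A.pos.obj Γ₁ Δ₁) (b : A.neg.obj Γ₂ Δ₂),
      ((ihom A).obj bot).pair (i A b) (j A a) =
        P.perm (.comm Γ₁ Γ₂) (.comm Δ₁ Δ₂) (A.pair a b)) ∧
    (∀ {A B : Envelope P J} (f : A ⟶ B) {Γ Δ : List P.Ob} (b : B.neg.obj Γ Δ),
      mapPos ((MonoidalClosed.pre f).app bot) (i B b) = i A (mapNeg f b)) ∧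
    (∀ {A B : Envelope P J} (f : A ⟶ B) {Γ Δ : List P.Ob} (a : A.pos.obj Γ Δ),
      mapNeg ((MonoidalClosed.pre f).app bot) (j A a) = j B (mapPos f a))

end Envelope

/-! ## `∗`-autonomous categories and closed functors -/

/-- The canonical morphism `A ⟶ (A ⊸ b) ⊸ b`. -/
noncomputable def toDoubleDual {D : Type u} [Category.{v} D] [MonoidalCategory D]
    [SymmetricCategory D] [MonoidalClosed D] (b A : D) :
    A ⟶ (ihom ((ihom A).obj b)).obj b :=
  MonoidalClosed.curry ((β_ ((ihom A).obj b) A).hom ≫ (ihom.ev A).app b)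

/-- The object `b` of a closed symmetric monoidal category is dualizing. A `∗`-autonomous category
is a closed symmetric monoidal category with a dualizing object. -/
def IsDualizing {D : Type u} [Category.{v} D] [MonoidalCategory D]
    [SymmetricCategory D] [MonoidalClosed D] (b : D) : Prop :=
  ∀ A : D, IsIso (toDoubleDual b A)

/-- The canonical comparison `F (A ⊸ B) ⟶ F A ⊸ F B` of a monoidal functor. -/
noncomputable def ihomComparison {C : Type u} [Category.{v} C] [MonoidalCategory C]
    [MonoidalClosed C] {D : Type*} [Category* D] [MonoidalCategory D] [MonoidalClosed D]
    (F : C ⥤ D) [F.LaxMonoidal] (A B : C) :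
    F.obj ((ihom A).obj B) ⟶ (ihom (F.obj A)).obj (F.obj B) :=
  MonoidalClosed.curry (Functor.LaxMonoidal.μ F A ((ihom A).obj B) ≫ F.map ((ihom.ev A).app B))

/-! ## A symmetric monoidal category as a co-unary polycategory -/

namespace Counary

variable {C : Type u} [Category.{v} C] [MonoidalCategory C]

/-- The tensor product of a finite list of objects. -/
def tens : List C → C
  | [] => 𝟙_ C
  | A :: Γ => A ⊗ tens Γ

/-- The canonical morphism from the tensor product of a concatenated list. -/
def split : (Γ Δ : List C) → (tens (Γ ++ Δ) ⟶ tens Γ ⊗ tens Δ)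
  | [], Δ => (λ_ (tens Δ)).inv
  | A :: Γ, Δ => A ◁ split Γ Δ ≫ (α_ A (tens Γ) (tens Δ)).inv

/-- The canonical (contravariant) action of permutations on tensor products. -/
def act [SymmetricCategory C] : {Γ Γ' : List C} → ListPerm Γ Γ' → (tens Γ' ⟶ tens Γ)
  | _, _, .refl Γ => 𝟙 (tens Γ)
  | _, _, .cons A σ => A ◁ act σ
  | _, _, .swap A B Γ =>
      (α_ B A (tens Γ)).inv ≫ (β_ B A).hom ▷ tens Γ ≫ (α_ A B (tens Γ)).hom
  | _, _, .trans σ τ => act τ ≫ act σ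

/-- Morphisms `Γ → Δ` exist only if `Δ` consists of one object `B`, and are then the morphisms
`A₁ ⊗ ⋯ ⊗ Aₙ ⟶ B`. -/
structure Hom (Γ Δ : List C) where
  cod : C
  hom : tens Γ ⟶ cod
  eq : Δ = [cod]

variable (C) in
/-- The multicategory underlying a symmetric monoidal category, as a co-unary polycategory. -/
def poly [SymmetricCategory C] : PolycategoryStruct.{u, max u v} where
  Ob := C
  Hom := Hom
  perm σ τ f :=
    ⟨f.cod, act σ ≫ f.hom, by
      have h := τ.toPerm
      rw [f.eq] at h
      exact List.perm_singleton.mp h.symm⟩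
  id A := ⟨A, (ρ_ A).hom, rfl⟩
  comp {Γ _ S _ _} f g :=
    ⟨g.cod, split Γ S ≫ (f.hom ≫ eqToHom (List.cons.inj f.eq).1.symm) ▷ tens S ≫ g.hom, by
      rw [(List.cons.inj f.eq).2, List.nil_append]
      exact g.eq⟩

end Counary

/-! ## The free `∗`-polycategory on a polycategory -/

/-- Two copies of the objects: `pos A` is `A` itself, and `neg A` its formal dual. -/
inductive Signed (α : Type u) : Type u
  | pos (A : α)
  | neg (A : α)

namespace Signed

variable {α : Type u}

/-- The duality on objects. -/
def star : Signed α → Signed α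
  | pos A => neg A
  | neg A => pos A

def posPart : List (Signed α) → List α
  | [] => []
  | pos A :: Γ => A :: posPart Γ
  | neg _ :: Γ => posPart Γ

def negPart : List (Signed α) → List α
  | [] => []
  | pos _ :: Γ => negPart Γ
  | neg A :: Γ => A :: negPart Γ

def posPerm : {Γ Γ' : List (Signed α)} → ListPerm Γ Γ' → ListPerm (posPart Γ) (posPart Γ')
  | _, _, .refl Γ => .refl (posPart Γ)
  | _, _, .cons (pos A) σ => .cons A (posPerm σ)
  | _, _, .cons (neg _) σ => (posPerm σ :)
  | _, _, .swap (pos A) (pos B) Γ => .swap A B (posPart Γ)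
  | _, _, .swap (pos A) (neg _) Γ => .refl (A :: posPart Γ)
  | _, _, .swap (neg _) (pos B) Γ => .refl (B :: posPart Γ)
  | _, _, .swap (neg _) (neg _) Γ => .refl (posPart Γ)
  | _, _, .trans σ τ => .trans (posPerm σ) (posPerm τ)

def negPerm : {Γ Γ' : List (Signed α)} → ListPerm Γ Γ' → ListPerm (negPart Γ) (negPart Γ')
  | _, _, .refl Γ => .refl (negPart Γ)
  | _, _, .cons (pos _) σ => (negPerm σ :)
  | _, _, .cons (neg A) σ => .cons A (negPerm σ)
  | _, _, .swap (pos _) (pos _) Γ => .refl (negPart Γ)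
  | _, _, .swap (pos _) (neg B) Γ => .refl (B :: negPart Γ)
  | _, _, .swap (neg A) (pos _) Γ => .refl (A :: negPart Γ)
  | _, _, .swap (neg A) (neg B) Γ => .swap A B (negPart Γ)
  | _, _, .trans σ τ => .trans (negPerm σ) (negPerm τ)

def posAppend : (Γ Δ : List (Signed α)) → ListPerm (posPart Γ ++ posPart Δ) (posPart (Γ ++ Δ))
  | [], Δ => .refl (posPart Δ)
  | pos A :: Γ, Δ => .cons A (posAppend Γ Δ)
  | neg _ :: Γ, Δ => posAppend Γ Δ

def negAppend : (Γ Δ : List (Signed α)) → ListPerm (negPart Γ ++ negPart Δ) (negPart (Γ ++ Δ))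
  | [], Δ => .refl (negPart Δ)
  | pos _ :: Γ, Δ => negAppend Γ Δ
  | neg A :: Γ, Δ => .cons A (negAppend Γ Δ)

/-- From the blocks of the two contexts `(Γ⁺,Δ⁻)` and `(Σ⁺,Π⁻)` to the blocks of the
concatenated contexts. -/
def merge (Γ Δ S T : List (Signed α)) :
    ListPerm ((posPart Γ ++ negPart Δ) ++ (posPart S ++ negPart T))
      (posPart (Γ ++ S) ++ negPart (Δ ++ T)) :=
  (ListPerm.interchange _ _ _ _).trans ((posAppend Γ S).append (negAppend Δ T))

end Signed

namespace PolycategoryStruct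

open Signed

/-- The free `∗`-polycategory on `P`. Its objects are two copies `A`, `A̅` of the objects of `P`,
its morphisms are given by `(Γ, Π̅) → (Δ, Σ̅)` in the free `∗`-polycategory being `(Γ, Σ) → (Δ, Π)`
in `P`, and composition is that of `P`, in the other order along an object `A̅`. -/
def freeStar (P : PolycategoryStruct.{u, w}) : PolycategoryStruct.{u, w} where
  Ob := Signed P.Ob
  Hom Γ Δ := P.Hom (posPart Γ ++ negPart Δ) (posPart Δ ++ negPart Γ)
  perm σ τ := P.perm ((posPerm σ).append (negPerm τ)) ((posPerm τ).append (negPerm σ))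
  id
    | .pos A => P.id A
    | .neg A => P.id A
  comp {Γ Δ S T A} := match A with
    | .pos _ => fun f g => P.perm (merge Γ Δ S T) (merge Δ Γ T S) (P.comp f g)
    | .neg A => fun f g =>
        P.perm ((ListPerm.comm _ _).trans (merge Γ Δ S T))
          ((ListPerm.comm _ _).trans (merge Δ Γ T S))
          (P.comp (P.perm (.refl _) (front (posPart T) A (negPart S)) g)
            (P.perm (front (posPart Γ) A (negPart Δ)) (.refl _) f))

/-- The duality counits `(A*, A) → ()` of the free `∗`-polycategory. -/
def freeStarCounit (P : PolycategoryStruct.{u, w}) :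
    ∀ A B : P.freeStar.Ob, Signed.star A = B → P.freeStar.Hom [B, A] []
  | .pos A, _, rfl => P.id A
  | .neg A, _, rfl => P.id A

end PolycategoryStruct

/-! ## The envelope of a closed symmetric monoidal category -/

namespace SMCC

variable (C : Type u) [Category.{v} C] [MonoidalCategory C] [SymmetricCategory C]

/-- The free `∗`-polycategory on `C`. -/
def starPoly : PolycategoryStruct.{u, max u v} :=
  (Counary.poly C).freeStar

variable {C}

/-- An object `A` of `C`, as an object of the free `∗`-polycategory. -/
abbrev pos (A : C) : (starPoly C).Ob :=
  Signed.pos A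

/-- The formal dual `A̅` of an object `A` of `C`. -/
abbrev neg (A : C) : (starPoly C).Ob :=
  Signed.neg A

/-- A morphism of `C` as a morphism of the free `∗`-polycategory. -/
def ofHom {A B : C} (f : A ⟶ B) : (starPoly C).Hom [pos A] [pos B] :=
  (⟨B, (ρ_ A).hom ≫ f, rfl⟩ : Counary.Hom [A] [B])

/-- The canonical morphism `(A, B) → A ⊗ B`. -/
def tensorMor (A B : C) : (starPoly C).Hom [pos A, pos B] [pos (A ⊗ B)] :=
  (⟨A ⊗ B, A ◁ (ρ_ B).hom, rfl⟩ : Counary.Hom [A, B] [A ⊗ B])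

variable (C) in
/-- The canonical morphism `() → 𝟙_`. -/
def unitMor : (starPoly C).Hom [] [pos (𝟙_ C)] :=
  (⟨𝟙_ C, 𝟙 (𝟙_ C), rfl⟩ : Counary.Hom [] [𝟙_ C])

/-- The canonical morphism `A ⊸ B → (A̅, B)`, given by the evaluation `(A ⊸ B) ⊗ A ⟶ B`. -/
def homMor [MonoidalClosed C] (A B : C) :
    (starPoly C).Hom [pos ((ihom A).obj B)] [neg A, pos B] :=
  (⟨B, (ihom A).obj B ◁ (ρ_ A).hom ≫ (β_ ((ihom A).obj B) A).hom ≫ (ihom.ev A).app B, rfl⟩ :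
    Counary.Hom [(ihom A).obj B, A] [B])

inductive IsTensorMor :
    ∀ {Γ : List (starPoly C).Ob} {X : (starPoly C).Ob}, (starPoly C).Hom Γ [X] → Prop
  | tensor (A B : C) : IsTensorMor (tensorMor A B)
  | unit : IsTensorMor (unitMor C)

inductive IsCotensorMor [MonoidalClosed C] :
    ∀ {X : (starPoly C).Ob} {Δ : List (starPoly C).Ob}, (starPoly C).Hom [X] Δ → Prop
  | hom (A B : C) : IsCotensorMor (homMor A B)

variable (C) in
/-- The distinguished tensor products `A ⊗ B` and `𝟙_`, and cotensor products
`A ⊸ B = A̅ ⅋ B`. -/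
def distinguished [MonoidalClosed C] : (starPoly C).Distinguished where
  IsTensor := IsTensorMor
  IsCotensor := IsCotensorMor

variable (C) in
/-- The enhanced Hyland envelope of `C`. -/
abbrev Env [MonoidalClosed C] : Type (max u v + 1) :=
  Envelope (starPoly C) (distinguished C)

/-- `F : C ⥤ Env C` is (isomorphic to) the Yoneda embedding, which takes `A` to the triple of the
two representable modules at `A` and the composition of `P` along `A`, and a morphism of `C` to the
composition with it. -/
def IsYoneda [MonoidalClosed C] (F : C ⥤ Env C) : Prop :=
  ∃ (i : ∀ A : C, ModuleStruct.Hom (ModuleStruct.yo (P := starPoly C) (pos A))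
      (F.obj A).pos.toModuleStruct)
    (j : ∀ A : C, ModuleStruct.Hom (ModuleStruct.noy (P := starPoly C) (pos A))
      (F.obj A).neg.toModuleStruct),
    (∀ A, (i A).IsBijective) ∧ (∀ A, (j A).IsBijective) ∧
    (∀ (A : C) {Γ₁ Δ₁ Γ₂ Δ₂ : List (starPoly C).Ob} (f : (starPoly C).Hom Γ₁ (pos A :: Δ₁))
      (g : (starPoly C).Hom (pos A :: Γ₂) Δ₂),
      (F.obj A).pair (i A f) (j A g) = (starPoly C).comp f g) ∧
    (∀ {A B : C} (h : A ⟶ B) {Γ Δ : List (starPoly C).Ob}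
      (f : (starPoly C).Hom Γ (pos A :: Δ)) (k : (starPoly C).Hom Γ (pos B :: Δ)),
      (starPoly C).perm (.appendNil Γ) (.rotate (pos B) Δ) k = (starPoly C).comp f (ofHom h) →
        Envelope.mapPos (F.map h) (i A f) = i B k) ∧
    (∀ {A B : C} (h : A ⟶ B) {Γ Δ : List (starPoly C).Ob}
      (g : (starPoly C).Hom (pos B :: Γ) Δ),
      Envelope.mapNeg (F.map h) (j B g) = j A ((starPoly C).comp (ofHom h) g))

end SMCC

/-!
The envelope of `C` is a Chu construction on modules, and each part of the theorem comes down to a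
universal property that is checked on universal elements.

*Permutations.* The contexts are lists, so every law is an equation up to permutations of lists. A
permutation is determined by what it does to a labelling of the positions by numbers
(`ListPerm.idx_ext`), and the structural permutations are computed by `simp` on labellings that are
assembled from blocks. This decides all equations between permutations, and
`ModuleStruct.IsModule.perm_eq` transfers them to modules.

*Modules.* The shift `(Γ;Δ) ↦ U(Γ,Φ;Δ,Ψ)` of a `(P,J)`-module is again one, and the actions of `P`
on the blocks `Φ` and `Ψ` commute with those on `Γ` and `Δ`. Hence the morphisms from `U` to the
shifts of `W` form a module, the internal hom `PJModule.homModule`. The tensor product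
`PJModule.tensor` consists of formal expressions in pairs of elements, the actions, and inverses for
the maps induced by `J`, where two expressions are equal if every multimorphism identifies them.
So its laws hold because they hold in every target. Multimorphisms are morphisms in each argument
separately, which gives currying and the factorization of ternary multimorphisms.

*The Chu construction.* The positive part of `A ⊗ B` is the tensor product of `A⁺` and `B⁺`. The
negative part `Envelope.tensorNeg` is the pullback of the modules of morphisms `B⁺ → A⁻` and
`A⁺ → B⁻` over that of multimorphisms to `P`. A morphism out of an iterated tensor product is
determined by one multimorphism for its positive part and one for each factor
(`Envelope.tensor_ext₃`, `Envelope.tensor_ext₄`), so the pentagon and the hexagon are equations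
between permutations. As a binary morphism `(A, B) → C` is the same as one `(A, C*) → B*`, the object
`(A ⊗ B*)*` is an internal hom. The object that represents `𝟏` is a unit for the tensor product, since
modules respect the distinguished morphism `() → 𝟏`. Its dual `⊥` is dualizing because
`A ⊸ ⊥ = (A ⊗ ⊥*)* ≅ A*` (`Envelope.isChuDuality`, `Envelope.isDualizing_bot`).

*The polycategory.* Coherence in `C` is Yang–Baxter, naturality and involutivity of adjacent
transpositions. They imply that a word of transpositions acts on tensor products through its
underlying bijection (`Counary.act_congr`), so that `C` is a polycategory
(`Counary.isPolycategory_poly`). A composite in the free `∗`-polycategory is a composite in the given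
polycategory along an object in some position (`PolycategoryStruct.cut`). By the signs of the objects
involved, each of its laws is then associativity or an interchange law, with permutations that agree
on labellings (`PolycategoryStruct.IsPolycategory.freeStar`).

*The embedding.* By Yoneda's lemma, `Envelope.yonedaObj` is fully faithful on the morphisms of `C`.
A module respects `J`, so a distinguished tensor product in `P` remains one among representable
objects (`Envelope.tensorYonedaIso`), and the internal hom of `C`, a cotensor product in `P`, remains
an internal hom (`Envelope.isIso_of_isCotensor`). A morphism out of a tensor product of representable
objects is determined by the image of `id ⊗ id`, as the pairings of these objects separate the
elements of the negative part. Hence the monoidal coherence of the embedding consists of equations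
between morphisms of `C`.
-/

/-! ### Permutations of lists, by their action on labellings -/

/-- Labellings of the positions of a list by natural numbers. A permutation is determined by its
action on labellings, and on a labelling that is assembled from blocks the structural permutations
are computed by `simp`: this decides all the equalities of permutations below. -/
def Lab {α : Type u} : List α → Type
  | [] => Unit
  | _ :: Γ => ℕ × Lab Γ

namespace Lab

variable {α : Type u}

/-- The labelling of the empty list. -/
def nil : Lab ([] : List α) := ()

/-- The labelling with the label `n` in front of the labels `v`. -/
def cons {A : α} {Γ : List α} (n : ℕ) (v : Lab Γ) : Lab (A :: Γ) := (n, v)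

/-- The concatenation of two labellings. -/
def append : {Γ Δ : List α} → Lab Γ → Lab Δ → Lab (Γ ++ Δ)
  | [], _, _, w => w
  | _ :: _, _, v, w => (v.1, append v.2 w)

@[simp] theorem nil_append {Δ : List α} (w : Lab Δ) : append (nil : Lab ([] : List α)) w = w := rfl

@[simp] theorem cons_append {A : α} {Γ Δ : List α} (n : ℕ) (v : Lab Γ) (w : Lab Δ) :
    append (cons n v : Lab (A :: Γ)) w = (cons n (append v w) : Lab (A :: (Γ ++ Δ))) := rfl

@[simp] theorem forall_nil {p : Lab ([] : List α) → Prop} : (∀ v, p v) ↔ p nil :=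
  ⟨fun h => h _, fun h _ => h⟩

@[simp] theorem forall_cons {A : α} {Γ : List α} {p : Lab (A :: Γ) → Prop} :
    (∀ v, p v) ↔ ∀ n v, p (cons n v) :=
  ⟨fun h _ _ => h _, fun h v => h v.1 v.2⟩

theorem exists_append : {Γ Δ : List α} → (x : Lab (Γ ++ Δ)) →
    ∃ (v : Lab Γ) (w : Lab Δ), x = append v w
  | [], _, x => ⟨nil, x, rfl⟩
  | _ :: _, _, x => by
    obtain ⟨v, w, h⟩ := exists_append x.2
    exact ⟨(x.1, v), w, Prod.ext rfl h⟩

@[simp] theorem forall_append {Γ Δ : List α} {p : Lab (Γ ++ Δ) → Prop} :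
    (∀ v, p v) ↔ ∀ v w, p (append v w) :=
  ⟨fun h _ _ => h _, fun h x => by
    obtain ⟨v, w, rfl⟩ := exists_append x
    exact h v w⟩

/-- The label at a position. -/
def get : {Γ : List α} → Lab Γ → ℕ → Option ℕ
  | [], _, _ => none
  | _ :: _, v, 0 => some v.1
  | _ :: _, v, i + 1 => get v.2 i

theorem ext_get : {Γ : List α} → {v w : Lab Γ} → (∀ i, get v i = get w i) → v = w
  | [], _, _, _ => rfl
  | _ :: _, _, _, h => Prod.ext (Option.some.inj (h 0)) (ext_get fun i => h (i + 1))

/-- The labelling by `k, k + 1, …`. -/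
def count : (Γ : List α) → ℕ → Lab Γ
  | [], _ => ()
  | _ :: Γ, k => (k, count Γ (k + 1))

theorem get_count : (Γ : List α) → (k i j : ℕ) → get (count Γ k) i = some j → j = k + i
  | [], _, _, _, h => by simp [get] at h
  | _ :: _, _, 0, _, h => (Option.some.inj h).symm
  | _ :: Γ, k, i + 1, j, h => by
    rw [get_count Γ (k + 1) i j h]
    omega

theorem get_count_lt : (Γ : List α) → (k i : ℕ) → i < Γ.length →
    get (count Γ k) i = some (k + i)
  | [], _, _, h => by simp at h
  | _ :: _, _, 0, _ => rfl
  | _ :: Γ, k, i + 1, h => by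
    have := get_count_lt Γ (k + 1) i (by simpa using h)
    rw [show k + (i + 1) = k + 1 + i by omega]
    exact this

end Lab

namespace ListPerm

variable {α : Type u}

/-- The action of a permutation on labellings. -/
def app : {Γ Γ' : List α} → ListPerm Γ Γ' → Lab Γ → Lab Γ'
  | _, _, refl _, v => v
  | _, _, cons _ σ, v => (v.1, σ.app v.2)
  | _, _, swap _ _ _, v => (v.2.1, v.1, v.2.2)
  | _, _, trans σ τ, v => τ.app (σ.app v)

theorem get_app {Γ Γ' : List α} (σ : ListPerm Γ Γ') :
    ∀ (v : Lab Γ) (i : ℕ), (σ.app v).get (σ.idx i) = v.get i := by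
  induction σ with
  | refl => intro v i; rfl
  | cons A σ ih =>
    rintro v (_ | i)
    · rfl
    · exact ih v.2 i
  | swap A B Γ => rintro v (_ | _ | i) <;> rfl
  | trans σ τ ih₁ ih₂ =>
    intro v i
    exact (ih₂ _ _).trans (ih₁ _ _)

theorem idx_symm_idx {Γ Γ' : List α} (σ : ListPerm Γ Γ') :
    ∀ i : ℕ, σ.symm.idx (σ.idx i) = i := by
  induction σ with
  | refl => intro i; rfl
  | cons A σ ih =>
    rintro (_ | i)
    · rfl
    · exact congrArg (· + 1) (ih i)
  | swap A B Γ => rintro (_ | _ | i) <;> rfl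
  | trans σ τ ih₁ ih₂ =>
    intro i
    exact (congrArg _ (ih₂ _)).trans (ih₁ _)

@[simp] theorem symm_symm {Γ Γ' : List α} (σ : ListPerm Γ Γ') : σ.symm.symm = σ := by
  induction σ with
  | refl => rfl
  | cons A σ ih => exact congrArg _ ih
  | swap A B Γ => rfl
  | trans σ τ ih₁ ih₂ => exact congrArg₂ _ ih₁ ih₂

theorem idx_idx_symm {Γ Γ' : List α} (σ : ListPerm Γ Γ') (i : ℕ) : σ.idx (σ.symm.idx i) = i := by
  simpa using idx_symm_idx σ.symm i

/-- Outside the positions of the list, the function `idx` is the identity. -/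
theorem idx_of_length_le {Γ Γ' : List α} (σ : ListPerm Γ Γ') :
    ∀ i : ℕ, Γ.length ≤ i → σ.idx i = i := by
  induction σ with
  | refl => intro i _; rfl
  | cons A σ ih =>
    rintro (_ | i) h
    · simp at h
    · exact congrArg (· + 1) (ih i (by simpa using h))
  | swap A B Γ =>
    rintro (_ | _ | i) h
    · simp at h
    · simp at h
    · rfl
  | trans σ τ ih₁ ih₂ =>
    intro i h
    exact (congrArg _ (ih₁ i h)).trans (ih₂ i (σ.toPerm.length_eq ▸ h))

theorem get_app' {Γ Γ' : List α} (σ : ListPerm Γ Γ') (v : Lab Γ) (j : ℕ) :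
    (σ.app v).get j = v.get (σ.symm.idx j) := by
  conv_lhs => rw [← idx_idx_symm σ j]
  exact get_app σ v _

/-- Permutations that act equally on labellings have the same bijection of positions. -/
theorem idx_ext {Γ Γ' : List α} {σ τ : ListPerm Γ Γ'}
    (h : ∀ v, σ.app v = τ.app v := by simp) : σ.idx = τ.idx := by
  funext i
  rcases lt_or_ge i Γ.length with hi | hi
  · have h₁ := get_app' σ (Lab.count Γ 0) (τ.idx i)
    rw [h, get_app, Lab.get_count_lt Γ 0 i hi] at h₁
    have h₂ := Lab.get_count Γ 0 _ _ h₁.symm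
    rw [← idx_idx_symm σ (τ.idx i)]
    exact congrArg _ (by omega)
  · rw [idx_of_length_le σ i hi, idx_of_length_le τ i hi]

theorem app_congr {Γ Γ' : List α} {σ τ : ListPerm Γ Γ'} (h : σ.idx = τ.idx) (v : Lab Γ) :
    σ.app v = τ.app v := by
  refine Lab.ext_get fun j => ?_
  rw [get_app', get_app']
  congr 1
  rw [← idx_symm_idx τ (σ.symm.idx j), ← h, idx_idx_symm]

@[simp] theorem app_refl (Γ : List α) (v : Lab Γ) : (refl Γ).app v = v := rfl

@[simp] theorem app_cons (A : α) {Γ Γ' : List α} (σ : ListPerm Γ Γ') (n : ℕ) (v : Lab Γ) :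
    (cons A σ).app (.cons n v) = .cons n (σ.app v) := rfl

@[simp] theorem app_swap (A B : α) (Γ : List α) (n m : ℕ) (v : Lab Γ) :
    (swap A B Γ).app (.cons n (.cons m v)) = .cons m (.cons n v) := rfl

@[simp] theorem app_trans {Γ Γ' Γ'' : List α} (σ : ListPerm Γ Γ') (τ : ListPerm Γ' Γ'')
    (v : Lab Γ) : (trans σ τ).app v = τ.app (σ.app v) := rfl

@[simp] theorem app_symm_app {Γ Γ' : List α} (σ : ListPerm Γ Γ') (v : Lab Γ) :
    σ.symm.app (σ.app v) = v := by
  refine Lab.ext_get fun j => ?_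
  rw [get_app', get_app', symm_symm, idx_symm_idx]

@[simp] theorem app_app_symm {Γ Γ' : List α} (σ : ListPerm Γ Γ') (v : Lab Γ') :
    σ.app (σ.symm.app v) = v := by
  simpa using app_symm_app σ.symm v

theorem app_symm_eq {Γ Γ' : List α} {σ : ListPerm Γ Γ'} {v : Lab Γ} {w : Lab Γ'}
    (h : σ.app v = w) : σ.symm.app w = v := by
  rw [← h, app_symm_app]

@[simp] theorem app_appendRight {Γ Γ' : List α} (σ : ListPerm Γ Γ') (Δ : List α) (v : Lab Γ)
    (w : Lab Δ) : (σ.appendRight Δ).app (v.append w) = (σ.app v).append w := by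
  induction σ with
  | refl => rfl
  | cons A σ ih => exact Prod.ext rfl (ih _)
  | swap A B Γ => rfl
  | trans σ τ ih₁ ih₂ => exact (congrArg _ (ih₁ _)).trans (ih₂ _)

@[simp] theorem app_appendLeft : (Γ : List α) → {Δ Δ' : List α} → (σ : ListPerm Δ Δ') →
    (v : Lab Γ) → (w : Lab Δ) → (appendLeft Γ σ).app (v.append w) = v.append (σ.app w)
  | [], _, _, _, _, _ => rfl
  | _ :: Γ, _, _, σ, v, w => Prod.ext rfl (app_appendLeft Γ σ v.2 w)

@[simp] theorem app_appendLeft_cons (A : α) (Γ : List α) {Δ Δ' : List α} (σ : ListPerm Δ Δ')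
    (n : ℕ) (v : Lab Γ) (w : Lab Δ) :
    (appendLeft (A :: Γ) σ).app (.cons n (v.append w)) = .cons n (v.append (σ.app w)) :=
  app_appendLeft (A :: Γ) σ (.cons n v) w

@[simp] theorem app_append {Γ Γ' Δ Δ' : List α} (σ : ListPerm Γ Γ') (τ : ListPerm Δ Δ')
    (v : Lab Γ) (w : Lab Δ) : (σ.append τ).app (v.append w) = (σ.app v).append (τ.app w) := by
  simp [append]

@[simp] theorem app_appendRight_cons {A : α} {Γ Γ' : List α} (σ : ListPerm (A :: Γ) Γ')
    (Δ : List α) (n : ℕ) (v : Lab Γ) (w : Lab Δ) :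
    (σ.appendRight Δ).app (.cons n (v.append w)) = (σ.app (.cons n v)).append w :=
  app_appendRight σ Δ (.cons n v) w

@[simp] theorem app_front : (Γ : List α) → (A : α) → (Δ : List α) → (v : Lab Γ) → (n : ℕ) →
    (w : Lab Δ) → (front Γ A Δ).app (v.append (.cons n w)) = .cons n (v.append w)
  | [], _, _, _, _, _ => rfl
  | _ :: Γ, A, Δ, v, n, w => by
    have h := app_front Γ A Δ v.2 n w
    show (swap _ _ _).app (v.1, (front Γ A Δ).app (v.2.append (.cons n w))) = _
    rw [h]
    rfl

@[simp] theorem app_front_symm (Γ : List α) (A : α) (Δ : List α) (v : Lab Γ) (n : ℕ)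
    (w : Lab Δ) : (front Γ A Δ).symm.app (.cons n (v.append w)) = v.append (.cons n w) :=
  app_symm_eq (app_front _ _ _ _ _ _)

@[simp] theorem app_front_cons (B : α) (Γ : List α) (A : α) (Δ : List α) (m : ℕ) (v : Lab Γ)
    (n : ℕ) (w : Lab Δ) :
    (front (B :: Γ) A Δ).app (.cons m (v.append (.cons n w))) = .cons n (.cons m (v.append w)) :=
  app_front (B :: Γ) A Δ (.cons m v) n w

@[simp] theorem app_front_nil (A : α) (Δ : List α) (v : Lab (A :: Δ)) :
    (front [] A Δ).app v = v :=
  rfl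

@[simp] theorem app_front_singleton (B A : α) (Δ : List α) (m n : ℕ) (w : Lab Δ) :
    (front [B] A Δ).app (.cons m (.cons n w)) = .cons n (.cons m w) :=
  rfl

@[simp] theorem app_assoc : (Γ Δ Θ : List α) → (v : Lab Γ) → (w : Lab Δ) → (x : Lab Θ) →
    (assoc Γ Δ Θ).app ((v.append w).append x) = v.append (w.append x)
  | [], _, _, _, _, _ => rfl
  | _ :: Γ, Δ, Θ, v, w, x => Prod.ext rfl (app_assoc Γ Δ Θ v.2 w x)

@[simp] theorem app_assoc_symm (Γ Δ Θ : List α) (v : Lab Γ) (w : Lab Δ) (x : Lab Θ) :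
    (assoc Γ Δ Θ).symm.app (v.append (w.append x)) = (v.append w).append x :=
  app_symm_eq (app_assoc _ _ _ _ _ _)

@[simp] theorem app_assoc_nil_middle_symm (Γ Θ : List α) (v : Lab Γ) (x : Lab Θ) :
    (assoc Γ [] Θ).symm.app (v.append x) = (v.append .nil).append x :=
  app_assoc_symm Γ [] Θ v .nil x

@[simp] theorem app_assoc_cons (A : α) (Γ Δ Θ : List α) (n : ℕ) (v : Lab Γ) (w : Lab Δ)
    (x : Lab Θ) : (assoc (A :: Γ) Δ Θ).app (.cons n ((v.append w).append x)) =
      .cons n (v.append (w.append x)) :=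
  app_assoc (A :: Γ) Δ Θ (.cons n v) w x

@[simp] theorem app_assoc_symm_cons (A : α) (Γ Δ Θ : List α) (n : ℕ) (v : Lab Γ) (w : Lab Δ)
    (x : Lab Θ) : (assoc (A :: Γ) Δ Θ).symm.app (.cons n (v.append (w.append x))) =
      .cons n ((v.append w).append x) :=
  app_assoc_symm (A :: Γ) Δ Θ (.cons n v) w x

@[simp] theorem app_assoc_singleton_symm (A : α) (Δ Θ : List α) (n : ℕ) (w : Lab Δ)
    (x : Lab Θ) : (assoc [A] Δ Θ).symm.app (.cons n (w.append x)) = .cons n (w.append x) :=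
  rfl

@[simp] theorem app_assoc_nil_symm (Δ Θ : List α) (w : Lab (Δ ++ Θ)) :
    (assoc [] Δ Θ).symm.app w = w :=
  rfl

@[simp] theorem app_assoc_singleton (A : α) (Δ Θ : List α) (n : ℕ) (w : Lab Δ)
    (x : Lab Θ) : (assoc [A] Δ Θ).app (.cons n (w.append x)) = .cons n (w.append x) :=
  rfl

@[simp] theorem app_assoc_nil (Δ Θ : List α) (w : Lab (Δ ++ Θ)) :
    (assoc [] Δ Θ).app w = w :=
  rfl

@[simp] theorem app_assoc_symm_middle (A : α) (Γ Δ Θ : List α) (n : ℕ) (v : Lab Γ) (w : Lab Δ)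
    (x : Lab Θ) : (assoc Γ (A :: Δ) Θ).symm.app (v.append (.cons n (w.append x))) =
      (v.append (.cons n w)).append x :=
  app_assoc_symm Γ (A :: Δ) Θ v (.cons n w) x

@[simp] theorem app_appendNil : (Γ : List α) → (v : Lab Γ) →
    (appendNil Γ).app v = v.append .nil
  | [], _ => rfl
  | _ :: Γ, v => Prod.ext rfl (app_appendNil Γ v.2)

@[simp] theorem app_appendNil_symm (Γ : List α) (v : Lab Γ) :
    (appendNil Γ).symm.app (v.append .nil) = v :=
  app_symm_eq (app_appendNil Γ v)

@[simp] theorem app_comm : (Γ Δ : List α) → (v : Lab Γ) → (w : Lab Δ) →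
    (comm Γ Δ).app (v.append w) = w.append v
  | [], _, _, w => app_appendNil _ w
  | A :: Γ, Δ, v, w => by
    show (front Δ A Γ).symm.app (v.1, (comm Γ Δ).app (v.2.append w)) = _
    rw [app_comm Γ Δ v.2 w]
    exact app_front_symm Δ A Γ w v.1 v.2

@[simp] theorem app_comm_nil (Δ : List α) (w : Lab Δ) : (comm [] Δ).app w = w.append .nil :=
  app_comm [] Δ .nil w

@[simp] theorem app_comm_cons (A : α) (Γ Δ : List α) (n : ℕ) (v : Lab Γ) (w : Lab Δ) :
    (comm (A :: Γ) Δ).app (.cons n (v.append w)) = w.append (.cons n v) :=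
  app_comm (A :: Γ) Δ (.cons n v) w

@[simp] theorem app_leftComm (Γ Δ Θ : List α) (v : Lab Γ) (w : Lab Δ) (x : Lab Θ) :
    (leftComm Γ Δ Θ).app (v.append (w.append x)) = w.append (v.append x) := by
  simp [leftComm]

@[simp] theorem app_leftComm_symm (Γ Δ Θ : List α) (v : Lab Γ) (w : Lab Δ) (x : Lab Θ) :
    (leftComm Γ Δ Θ).symm.app (w.append (v.append x)) = v.append (w.append x) :=
  app_symm_eq (app_leftComm _ _ _ _ _ _)

@[simp] theorem app_leftComm_middle (A : α) (Γ Δ Θ : List α) (n : ℕ) (v : Lab Γ) (w : Lab Δ)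
    (x : Lab Θ) : (leftComm Γ (A :: Δ) Θ).app (v.append (.cons n (w.append x))) =
      .cons n (w.append (v.append x)) :=
  app_leftComm Γ (A :: Δ) Θ v (.cons n w) x

@[simp] theorem app_leftComm_nil_left (Δ Θ : List α) (w : Lab Δ) (x : Lab Θ) :
    (leftComm [] Δ Θ).app (w.append x) = w.append x :=
  app_leftComm [] Δ Θ .nil w x

@[simp] theorem app_leftComm_nil (Γ Θ : List α) (v : Lab Γ) (x : Lab Θ) :
    (leftComm Γ [] Θ).app (v.append x) = v.append x :=
  app_leftComm Γ [] Θ v .nil x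

@[simp] theorem app_leftComm_singleton (A : α) (Γ Θ : List α) (n : ℕ) (v : Lab Γ) (x : Lab Θ) :
    (leftComm Γ [A] Θ).app (v.append (.cons n x)) = .cons n (v.append x) :=
  app_leftComm Γ [A] Θ v (.cons n .nil) x

@[simp] theorem app_rightComm (Γ Δ Θ : List α) (v : Lab Γ) (w : Lab Δ) (x : Lab Θ) :
    (rightComm Γ Δ Θ).app ((v.append w).append x) = (v.append x).append w := by
  simp [rightComm]

@[simp] theorem app_rightComm_symm (Γ Δ Θ : List α) (v : Lab Γ) (w : Lab Δ) (x : Lab Θ) :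
    (rightComm Γ Δ Θ).symm.app ((v.append x).append w) = (v.append w).append x :=
  app_symm_eq (app_rightComm _ _ _ _ _ _)

@[simp] theorem app_rightComm_cons (A : α) (Γ Δ Θ : List α) (n : ℕ) (v : Lab Γ) (w : Lab Δ)
    (x : Lab Θ) : (rightComm (A :: Γ) Δ Θ).app (.cons n ((v.append w).append x)) =
      .cons n ((v.append x).append w) :=
  app_rightComm (A :: Γ) Δ Θ (.cons n v) w x

@[simp] theorem app_rotate (A : α) (Δ : List α) (n : ℕ) (w : Lab Δ) :
    (rotate A Δ).app (.cons n w) = w.append (.cons n .nil) :=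
  app_comm [A] Δ (.cons n .nil) w

@[simp] theorem app_rotate_symm (A : α) (Δ : List α) (n : ℕ) (w : Lab Δ) :
    (rotate A Δ).symm.app (w.append (.cons n .nil)) = .cons n w :=
  app_symm_eq (app_rotate A Δ n w)

end ListPerm

/-! ### Modules and their shifts -/

namespace ModuleStruct

variable {P : PolycategoryStruct.{u, w}}

namespace IsModule

variable {U : ModuleStruct P} (hU : U.IsModule)
include hU

theorem perm_perm {Γ Γ' Γ'' Δ Δ' Δ'' : List P.Ob} (σ : ListPerm Γ Γ') (σ' : ListPerm Γ' Γ'')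
    (τ : ListPerm Δ Δ') (τ' : ListPerm Δ' Δ'') (x : U.obj Γ Δ) :
    U.perm σ' τ' (U.perm σ τ x) = U.perm (σ.trans σ') (τ.trans τ') x :=
  (hU.perm_trans _ _ _ _ _).symm

/-- Permutations that act equally on labellings act equally on the elements of a module. The
hypotheses are left to `simp`, for labellings assembled from blocks. -/
theorem perm_eq {Γ Γ' Δ Δ' : List P.Ob} {σ σ' : ListPerm Γ Γ'} {τ τ' : ListPerm Δ Δ'}
    {x : U.obj Γ Δ} (h₁ : ∀ v, σ.app v = σ'.app v := by simp)
    (h₂ : ∀ v, τ.app v = τ'.app v := by simp) : U.perm σ τ x = U.perm σ' τ' x :=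
  hU.perm_congr _ _ _ _ (ListPerm.idx_ext h₁) (ListPerm.idx_ext h₂) _

theorem perm_eq_self {Γ Δ : List P.Ob} {σ : ListPerm Γ Γ} {τ : ListPerm Δ Δ}
    {x : U.obj Γ Δ} (h₁ : ∀ v, σ.app v = v := by simp)
    (h₂ : ∀ v, τ.app v = v := by simp) : U.perm σ τ x = x :=
  (hU.perm_eq h₁ h₂).trans (hU.perm_refl x)

theorem perm_perm_self {Γ Γ' Δ Δ' : List P.Ob} {σ : ListPerm Γ Γ'} {σ' : ListPerm Γ' Γ}
    {τ : ListPerm Δ Δ'} {τ' : ListPerm Δ' Δ} {x : U.obj Γ Δ}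
    (h₁ : ∀ v, σ'.app (σ.app v) = v := by simp) (h₂ : ∀ v, τ'.app (τ.app v) = v := by simp) :
    U.perm σ' τ' (U.perm σ τ x) = x :=
  (hU.perm_perm _ _ _ _ _).trans (hU.perm_eq_self h₁ h₂)

theorem eq_perm_symm {Γ Γ' Δ Δ' : List P.Ob} {σ : ListPerm Γ Γ'} {τ : ListPerm Δ Δ'}
    {x : U.obj Γ Δ} {y : U.obj Γ' Δ'} (h : U.perm σ τ x = y) :
    x = U.perm σ.symm τ.symm y := by
  rw [← h]
  exact hU.perm_perm_self.symm

/-- Two sequences of permutations that move labels in the same way act equally on elements. The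
first index counts the permutations on the left hand side, the second those on the right. -/
theorem perm_eq₁₂ {Γ₀ Γ₁ Δ₀ Δ₁ Θ₁ Ξ₁ : List P.Ob}
    {σ₁ : ListPerm Γ₀ Γ₁} {τ₁ : ListPerm Δ₀ Δ₁}
    {σ₁' : ListPerm Γ₀ Θ₁} {τ₁' : ListPerm Δ₀ Ξ₁} {σ₂' : ListPerm Θ₁ Γ₁} {τ₂' : ListPerm Ξ₁ Δ₁}
    {x : U.obj Γ₀ Δ₀} (h₁ : ∀ v, σ₁.app v = σ₂'.app (σ₁'.app v) := by simp)
    (h₂ : ∀ v, τ₁.app v = τ₂'.app (τ₁'.app v) := by simp) :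
    U.perm σ₁ τ₁ x =
      U.perm σ₂' τ₂' (U.perm σ₁' τ₁' x) := by
  simp only [hU.perm_perm]
  exact hU.perm_eq h₁ h₂

theorem perm_eq₂₁ {Γ₀ Γ₁ Γ₂ Δ₀ Δ₁ Δ₂ : List P.Ob}
    {σ₁ : ListPerm Γ₀ Γ₁} {τ₁ : ListPerm Δ₀ Δ₁} {σ₂ : ListPerm Γ₁ Γ₂} {τ₂ : ListPerm Δ₁ Δ₂}
    {σ₁' : ListPerm Γ₀ Γ₂} {τ₁' : ListPerm Δ₀ Δ₂}
    {x : U.obj Γ₀ Δ₀} (h₁ : ∀ v, σ₂.app (σ₁.app v) = σ₁'.app v := by simp)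
    (h₂ : ∀ v, τ₂.app (τ₁.app v) = τ₁'.app v := by simp) :
    U.perm σ₂ τ₂ (U.perm σ₁ τ₁ x) =
      U.perm σ₁' τ₁' x := by
  simp only [hU.perm_perm]
  exact hU.perm_eq h₁ h₂

theorem perm_eq₂₂ {Γ₀ Γ₁ Γ₂ Δ₀ Δ₁ Δ₂ Θ₁ Ξ₁ : List P.Ob}
    {σ₁ : ListPerm Γ₀ Γ₁} {τ₁ : ListPerm Δ₀ Δ₁} {σ₂ : ListPerm Γ₁ Γ₂} {τ₂ : ListPerm Δ₁ Δ₂}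
    {σ₁' : ListPerm Γ₀ Θ₁} {τ₁' : ListPerm Δ₀ Ξ₁} {σ₂' : ListPerm Θ₁ Γ₂} {τ₂' : ListPerm Ξ₁ Δ₂}
    {x : U.obj Γ₀ Δ₀} (h₁ : ∀ v, σ₂.app (σ₁.app v) = σ₂'.app (σ₁'.app v) := by simp)
    (h₂ : ∀ v, τ₂.app (τ₁.app v) = τ₂'.app (τ₁'.app v) := by simp) :
    U.perm σ₂ τ₂ (U.perm σ₁ τ₁ x) =
      U.perm σ₂' τ₂' (U.perm σ₁' τ₁' x) := by
  simp only [hU.perm_perm]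
  exact hU.perm_eq h₁ h₂

theorem perm_eq₂₃ {Γ₀ Γ₁ Γ₂ Δ₀ Δ₁ Δ₂ Θ₁ Θ₂ Ξ₁ Ξ₂ : List P.Ob}
    {σ₁ : ListPerm Γ₀ Γ₁} {τ₁ : ListPerm Δ₀ Δ₁} {σ₂ : ListPerm Γ₁ Γ₂} {τ₂ : ListPerm Δ₁ Δ₂}
    {σ₁' : ListPerm Γ₀ Θ₁} {τ₁' : ListPerm Δ₀ Ξ₁} {σ₂' : ListPerm Θ₁ Θ₂} {τ₂' : ListPerm Ξ₁ Ξ₂}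
      {σ₃' : ListPerm Θ₂ Γ₂} {τ₃' : ListPerm Ξ₂ Δ₂}
    {x : U.obj Γ₀ Δ₀} (h₁ : ∀ v, σ₂.app (σ₁.app v) = σ₃'.app (σ₂'.app (σ₁'.app v)) := by simp)
    (h₂ : ∀ v, τ₂.app (τ₁.app v) = τ₃'.app (τ₂'.app (τ₁'.app v)) := by simp) :
    U.perm σ₂ τ₂ (U.perm σ₁ τ₁ x) =
      U.perm σ₃' τ₃' (U.perm σ₂' τ₂' (U.perm σ₁' τ₁' x)) := by
  simp only [hU.perm_perm]
  exact hU.perm_eq h₁ h₂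

theorem perm_eq₃₂ {Γ₀ Γ₁ Γ₂ Γ₃ Δ₀ Δ₁ Δ₂ Δ₃ Θ₁ Ξ₁ : List P.Ob}
    {σ₁ : ListPerm Γ₀ Γ₁} {τ₁ : ListPerm Δ₀ Δ₁} {σ₂ : ListPerm Γ₁ Γ₂} {τ₂ : ListPerm Δ₁ Δ₂}
      {σ₃ : ListPerm Γ₂ Γ₃} {τ₃ : ListPerm Δ₂ Δ₃}
    {σ₁' : ListPerm Γ₀ Θ₁} {τ₁' : ListPerm Δ₀ Ξ₁} {σ₂' : ListPerm Θ₁ Γ₃} {τ₂' : ListPerm Ξ₁ Δ₃}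
    {x : U.obj Γ₀ Δ₀} (h₁ : ∀ v, σ₃.app (σ₂.app (σ₁.app v)) = σ₂'.app (σ₁'.app v) := by simp)
    (h₂ : ∀ v, τ₃.app (τ₂.app (τ₁.app v)) = τ₂'.app (τ₁'.app v) := by simp) :
    U.perm σ₃ τ₃ (U.perm σ₂ τ₂ (U.perm σ₁ τ₁ x)) =
      U.perm σ₂' τ₂' (U.perm σ₁' τ₁' x) := by
  simp only [hU.perm_perm]
  exact hU.perm_eq h₁ h₂

theorem perm_eq₁₃ {Γ₀ Γ₁ Δ₀ Δ₁ Θ₁ Θ₂ Ξ₁ Ξ₂ : List P.Ob}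
    {σ₁ : ListPerm Γ₀ Γ₁} {τ₁ : ListPerm Δ₀ Δ₁}
    {σ₁' : ListPerm Γ₀ Θ₁} {τ₁' : ListPerm Δ₀ Ξ₁} {σ₂' : ListPerm Θ₁ Θ₂} {τ₂' : ListPerm Ξ₁ Ξ₂}
      {σ₃' : ListPerm Θ₂ Γ₁} {τ₃' : ListPerm Ξ₂ Δ₁}
    {x : U.obj Γ₀ Δ₀} (h₁ : ∀ v, σ₁.app v = σ₃'.app (σ₂'.app (σ₁'.app v)) := by simp)
    (h₂ : ∀ v, τ₁.app v = τ₃'.app (τ₂'.app (τ₁'.app v)) := by simp) :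
    U.perm σ₁ τ₁ x =
      U.perm σ₃' τ₃' (U.perm σ₂' τ₂' (U.perm σ₁' τ₁' x)) := by
  simp only [hU.perm_perm]
  exact hU.perm_eq h₁ h₂

theorem perm_eq₃₁ {Γ₀ Γ₁ Γ₂ Γ₃ Δ₀ Δ₁ Δ₂ Δ₃ : List P.Ob}
    {σ₁ : ListPerm Γ₀ Γ₁} {τ₁ : ListPerm Δ₀ Δ₁} {σ₂ : ListPerm Γ₁ Γ₂} {τ₂ : ListPerm Δ₁ Δ₂}
      {σ₃ : ListPerm Γ₂ Γ₃} {τ₃ : ListPerm Δ₂ Δ₃}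
    {σ₁' : ListPerm Γ₀ Γ₃} {τ₁' : ListPerm Δ₀ Δ₃}
    {x : U.obj Γ₀ Δ₀} (h₁ : ∀ v, σ₃.app (σ₂.app (σ₁.app v)) = σ₁'.app v := by simp)
    (h₂ : ∀ v, τ₃.app (τ₂.app (τ₁.app v)) = τ₁'.app v := by simp) :
    U.perm σ₃ τ₃ (U.perm σ₂ τ₂ (U.perm σ₁ τ₁ x)) =
      U.perm σ₁' τ₁' x := by
  simp only [hU.perm_perm]
  exact hU.perm_eq h₁ h₂

theorem perm_eq₃₃ {Γ₀ Γ₁ Γ₂ Γ₃ Δ₀ Δ₁ Δ₂ Δ₃ Θ₁ Θ₂ Ξ₁ Ξ₂ : List P.Ob}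
    {σ₁ : ListPerm Γ₀ Γ₁} {τ₁ : ListPerm Δ₀ Δ₁} {σ₂ : ListPerm Γ₁ Γ₂} {τ₂ : ListPerm Δ₁ Δ₂}
      {σ₃ : ListPerm Γ₂ Γ₃} {τ₃ : ListPerm Δ₂ Δ₃}
    {σ₁' : ListPerm Γ₀ Θ₁} {τ₁' : ListPerm Δ₀ Ξ₁} {σ₂' : ListPerm Θ₁ Θ₂} {τ₂' : ListPerm Ξ₁ Ξ₂}
      {σ₃' : ListPerm Θ₂ Γ₃} {τ₃' : ListPerm Ξ₂ Δ₃}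
    {x : U.obj Γ₀ Δ₀} (h₁ : ∀ v, σ₃.app (σ₂.app (σ₁.app v)) = σ₃'.app (σ₂'.app (σ₁'.app v)) := by
      simp)
    (h₂ : ∀ v, τ₃.app (τ₂.app (τ₁.app v)) = τ₃'.app (τ₂'.app (τ₁'.app v)) := by simp) :
    U.perm σ₃ τ₃ (U.perm σ₂ τ₂ (U.perm σ₁ τ₁ x)) =
      U.perm σ₃' τ₃' (U.perm σ₂' τ₂' (U.perm σ₁' τ₁' x)) := by
  simp only [hU.perm_perm]
  exact hU.perm_eq h₁ h₂

theorem perm_bijective {Γ Γ' Δ Δ' : List P.Ob} (σ : ListPerm Γ Γ') (τ : ListPerm Δ Δ') :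
    Function.Bijective (U.perm σ τ) := by
  refine Function.bijective_iff_has_inverse.2 ⟨U.perm σ.symm τ.symm, fun _ =>
    hU.perm_perm_self, fun _ => hU.perm_perm_self⟩

/-- An action of `P` on a permuted element, the permutation fixing the object that is composed. -/
theorem left_perm_right (hP : P.IsPolycategory) {Γ Δ S S' T T' : List P.Ob} {A : P.Ob}
    (σ : ListPerm S S') (τ : ListPerm T T') (f : P.Hom Γ (A :: Δ)) (x : U.obj (A :: S) T) :
    U.left f (U.perm (.cons A σ) τ x) =
      U.perm (.appendLeft Γ σ) (.appendLeft Δ τ) (U.left f x) := by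
  have h := hU.left_perm (.refl Γ) (.refl Δ) σ τ f x
  rw [show P.perm (.refl Γ) (.cons A (.refl Δ)) f = f from hP.perm_eq_self (U := self P)] at h
  exact h.trans hU.perm_eq

theorem right_perm_left (hP : P.IsPolycategory) {Γ Γ' Δ Δ' S T : List P.Ob} {A : P.Ob}
    (σ : ListPerm Γ Γ') (τ : ListPerm Δ Δ') (x : U.obj Γ (A :: Δ)) (g : P.Hom (A :: S) T) :
    U.right (U.perm σ (.cons A τ) x) g =
      U.perm (σ.appendRight S) (τ.appendRight T) (U.right x g) := by
  have h := hU.right_perm σ τ (.refl S) (.refl T) x g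
  rw [show P.perm (.cons A (.refl S)) (.refl T) g = g from hP.perm_eq_self (U := self P)] at h
  exact h.trans hU.perm_eq

theorem left_of_eq (hP : P.IsPolycategory) {Γ Δ S S' T T' : List P.Ob} {A : P.Ob}
    {σ : ListPerm S S'} {τ : ListPerm T T'} (f : P.Hom Γ (A :: Δ)) {x : U.obj (A :: S) T}
    {y : U.obj (A :: S') T'} (h : y = U.perm (.cons A σ) τ x) :
    U.left f y = U.perm (.appendLeft Γ σ) (.appendLeft Δ τ) (U.left f x) :=
  h ▸ hU.left_perm_right hP σ τ f x

theorem right_of_eq (hP : P.IsPolycategory) {Γ Γ' Δ Δ' S T : List P.Ob} {A : P.Ob}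
    {σ : ListPerm Γ Γ'} {τ : ListPerm Δ Δ'} {x : U.obj Γ (A :: Δ)} {y : U.obj Γ' (A :: Δ')}
    (h : y = U.perm σ (.cons A τ) x) (g : P.Hom (A :: S) T) :
    U.right y g = U.perm (σ.appendRight S) (τ.appendRight T) (U.right x g) :=
  h ▸ hU.right_perm_left hP σ τ x g

omit hU in
theorem perm_arg {Γ Γ' Δ Δ' : List P.Ob} {σ : ListPerm Γ Γ'} {τ : ListPerm Δ Δ'}
    {x y : U.obj Γ Δ} (h : x = y) : U.perm σ τ x = U.perm σ τ y :=
  h ▸ rfl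

end IsModule

/-- The module `Γ, Δ ↦ U(Γ,Φ;Δ,Ψ)`. -/
def shiftR (U : ModuleStruct P) (Φ Ψ : List P.Ob) : ModuleStruct P where
  obj Γ Δ := U.obj (Γ ++ Φ) (Δ ++ Ψ)
  perm σ τ := U.perm (σ.appendRight Φ) (τ.appendRight Ψ)
  left {Γ Δ S T A} f x := U.perm (assoc Γ S Φ).symm (assoc Δ T Ψ).symm
    (U.left (S := S ++ Φ) (T := T ++ Ψ) (A := A) f x)
  right {Γ Δ S T A} x g := U.perm (rightComm Γ Φ S) (rightComm Δ Ψ T)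
    (U.right (Γ := Γ ++ Φ) (Δ := Δ ++ Ψ) (A := A) x g)

variable [hP : Fact P.IsPolycategory]

theorem IsModule.shiftR {U : ModuleStruct P} (hU : U.IsModule) (Φ Ψ : List P.Ob) :
    (U.shiftR Φ Ψ).IsModule where
  perm_refl x := hU.perm_refl x
  perm_trans σ σ' τ τ' x := hU.perm_trans _ _ _ _ x
  perm_congr σ σ' τ τ' h₁ h₂ x :=
    hU.perm_eq (by simp [ListPerm.app_congr h₁]) (by simp [ListPerm.app_congr h₂])
  left_perm σ τ σ' τ' f x := by
    refine (congrArg _ (hU.left_perm σ τ (σ'.appendRight Φ) (τ'.appendRight Ψ) f x)).trans ?_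
    simp only [ModuleStruct.shiftR, hU.perm_perm]
    exact hU.perm_eq
  right_perm σ τ σ' τ' x g := by
    refine (congrArg _ (hU.right_perm (σ.appendRight Φ) (τ.appendRight Ψ) σ' τ' x g)).trans ?_
    simp only [ModuleStruct.shiftR, hU.perm_perm]
    exact hU.perm_eq
  id_left x := by
    refine (congrArg _ (hU.id_left x)).trans ?_
    exact hU.perm_eq_self
  right_id x := (congrArg _ (hU.right_id x)).trans hU.perm_eq₂₁
  left_left {Γ Δ S T Φ' Ψ' A B} f g x := by
    refine Eq.trans ?_ (congrArg _ ((hU.left_perm_right hP.out (assoc S Φ' Φ).symm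
      (assoc T Ψ' Ψ).symm f (U.left (T := Ψ' ++ Ψ) (S := Φ' ++ Φ) g x)).trans
      (congrArg (U.perm _ _) (hU.left_left f g x).symm))).symm
    exact hU.perm_eq₂₃
  left_right {Γ Δ S T Φ' Ψ' A B} f x h := by
    have e₁ : (U.shiftR Φ Ψ).right x h = U.perm (.cons A (rightComm S Φ Φ')) (rightComm T Ψ Ψ')
        (U.right (Γ := A :: (S ++ Φ)) (Δ := T ++ Ψ) x h) := hU.perm_eq
    have e₂ : (U.shiftR Φ Ψ).perm (.refl _) (front Δ B T) ((U.shiftR Φ Ψ).left f x) =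
        U.perm (assoc Γ S Φ).symm (.cons B (assoc Δ T Ψ).symm) (U.perm (.refl _)
          (front Δ B (T ++ Ψ)) (U.left (S := S ++ Φ) (T := B :: (T ++ Ψ)) f x)) := hU.perm_eq₂₂
    refine (perm_arg (perm_arg (hU.right_of_eq hP.out e₂ h))).trans (Eq.trans ?_
      (perm_arg ((hU.left_of_eq hP.out f e₁).trans (perm_arg (hU.left_right f x h).symm))).symm)
    exact hU.perm_eq₃₃
  right_right {Γ Δ S T Φ' Ψ' A B} x g h := by
    have e₂ : (U.shiftR Φ Ψ).perm (.refl _) (front Δ B T) ((U.shiftR Φ Ψ).right x g) =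
        U.perm (rightComm Γ Φ S) (.cons B (rightComm Δ Ψ T)) (U.perm (.refl _)
          (front (Δ ++ Ψ) B T) (U.right (Γ := Γ ++ Φ) (Δ := Δ ++ Ψ) x g)) := hU.perm_eq₂₂
    refine (perm_arg (perm_arg (hU.right_of_eq hP.out e₂ h))).trans (Eq.trans ?_
      (perm_arg (hU.right_right (Γ := Γ ++ Φ) (Δ := Δ ++ Ψ) x g h)))
    exact hU.perm_eq₃₂
  left_left_comm {Γ₁ Δ₁ Γ₂ Δ₂ S T A B} f₁ f₂ x := by
    have e₁ : (U.shiftR Φ Ψ).perm (front Γ₁ B S) (.refl _) ((U.shiftR Φ Ψ).left f₁ x) =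
        U.perm (.cons B (assoc Γ₁ S Φ).symm) (assoc Δ₁ T Ψ).symm (U.perm (front Γ₁ B (S ++ Φ))
          (.refl _) (U.left (S := B :: (S ++ Φ)) (T := T ++ Ψ) f₁ x)) := hU.perm_eq₂₂
    have e₂ : (U.shiftR Φ Ψ).perm (front Γ₂ A S) (.refl _) ((U.shiftR Φ Ψ).left f₂
        ((U.shiftR Φ Ψ).perm (.swap A B S) (.refl _) x)) =
        U.perm (.cons A (assoc Γ₂ S Φ).symm) (assoc Δ₂ T Ψ).symm (U.perm (front Γ₂ A (S ++ Φ))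
          (.refl _) (U.left (S := A :: (S ++ Φ)) (T := T ++ Ψ) f₂
            (U.perm (.swap A B (S ++ Φ)) (.refl _) x))) := hU.perm_eq₂₂
    refine (perm_arg (perm_arg (hU.left_of_eq hP.out f₂ e₁))).trans (Eq.trans ?_
      (perm_arg ((hU.left_of_eq hP.out f₁ e₂).trans
        (perm_arg (hU.left_left_comm f₁ f₂ x).symm))).symm)
    exact hU.perm_eq₃₃
  left_right_comm {Γ₁ Δ₁ Γ₂ Δ₂ S T A B} x f₂ g := by
    have e₁ : (U.shiftR Φ Ψ).perm (front Γ₁ B S) (.refl _) ((U.shiftR Φ Ψ).right x g) =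
        U.perm (.cons B (rightComm Γ₁ Φ S)) (rightComm Δ₁ Ψ T) (U.perm (front (Γ₁ ++ Φ) B S)
          (.refl _) (U.right (Γ := Γ₁ ++ Φ) (Δ := Δ₁ ++ Ψ) x g)) := hU.perm_eq₂₂
    refine (perm_arg (perm_arg (hU.left_of_eq hP.out f₂ e₁))).trans (Eq.trans ?_
      (perm_arg (hU.left_right_comm (Γ₁ := Γ₁ ++ Φ) (Δ₁ := Δ₁ ++ Ψ) x f₂ g)))
    exact hU.perm_eq₃₂
  right_right_comm {Γ Δ S₁ T₁ S₂ T₂ A B} x g₁ g₂ := by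
    have e₁ : (U.shiftR Φ Ψ).right x g₁ = U.perm (rightComm Γ Φ S₁) (.cons B (rightComm Δ Ψ T₁))
        (U.right (Γ := Γ ++ Φ) (Δ := B :: (Δ ++ Ψ)) x g₁) := hU.perm_eq
    have e₂ : (U.shiftR Φ Ψ).right ((U.shiftR Φ Ψ).perm (.refl _) (.swap A B Δ) x) g₂ =
        U.perm (rightComm Γ Φ S₂) (.cons A (rightComm Δ Ψ T₂))
        (U.right (Γ := Γ ++ Φ) (Δ := A :: (Δ ++ Ψ))
          (U.perm (.refl _) (.swap A B (Δ ++ Ψ)) x) g₂) := hU.perm_eq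
    refine (perm_arg (perm_arg (hU.right_of_eq hP.out e₁ g₂))).trans (Eq.trans ?_
      (perm_arg ((hU.right_of_eq hP.out e₂ g₁).trans
        (perm_arg (hU.right_right_comm (Γ := Γ ++ Φ) (Δ := Δ ++ Ψ) x g₁ g₂).symm))).symm)
    exact hU.perm_eq₃₃
  right_left_comm {Γ Δ S₁ T₁ S₂ T₂ A B} f x g₂ := by
    have e₁ : (U.shiftR Φ Ψ).left f x = U.perm (assoc Γ S₁ Φ).symm
        (.cons B (assoc Δ T₁ Ψ).symm) (U.left (S := S₁ ++ Φ) (T := T₁ ++ Ψ) f x) := hU.perm_eq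
    refine (perm_arg (perm_arg (hU.right_of_eq hP.out e₁ g₂))).trans (Eq.trans ?_
      (perm_arg (hU.right_left_comm (S₁ := S₁ ++ Φ) (T₁ := T₁ ++ Ψ) f x g₂)))
    exact hU.perm_eq₃₂

namespace Hom

omit hP in
theorem ext' {U V : ModuleStruct P} {φ ψ : Hom U V}
    (h : ∀ (Γ Δ : List P.Ob) (x : U.obj Γ Δ), φ x = ψ x) : φ = ψ :=
  Hom.ext (by funext Γ Δ x; exact h Γ Δ x)

/-- A family of functions is a morphism if its composite with an injective morphism is one. -/
def ofComp {U V W : ModuleStruct P} (ψ : Hom V W) (hψ : ∀ Γ Δ, Function.Injective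
    (fun x : V.obj Γ Δ => ψ x)) (χ : Hom U W) (f : ∀ {Γ Δ : List P.Ob}, U.obj Γ Δ → V.obj Γ Δ)
    (h : ∀ {Γ Δ : List P.Ob} (x : U.obj Γ Δ), ψ (f x) = χ x) : Hom U V where
  toFun := f
  map_perm σ τ x := hψ _ _ <| by
    show ψ _ = ψ _
    rw [h, χ.map_perm, ψ.map_perm, h]
  map_left g x := hψ _ _ <| by
    show ψ _ = ψ _
    rw [h, χ.map_left, ψ.map_left, h]
  map_right x g := hψ _ _ <| by
    show ψ _ = ψ _
    rw [h, χ.map_right, ψ.map_right, h]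

/-- The inverse of a bijective morphism. -/
def inverse {U V : ModuleStruct P} (φ : Hom U V) (f : ∀ {Γ Δ : List P.Ob}, V.obj Γ Δ → U.obj Γ Δ)
    (h₁ : ∀ {Γ Δ : List P.Ob} (x : U.obj Γ Δ), f (φ x) = x)
    (h₂ : ∀ {Γ Δ : List P.Ob} (x : V.obj Γ Δ), φ (f x) = x) : Hom V U :=
  ofComp φ (fun _ _ x y h => by
    rw [← h₁ x, ← h₁ y]
    exact congrArg f h) (Hom.id V) f h₂

/-- A morphism with another description of its function. -/
def copy {U V : ModuleStruct P} (φ : Hom U V) (f : ∀ {Γ Δ : List P.Ob}, U.obj Γ Δ → V.obj Γ Δ)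
    (h : ∀ {Γ Δ : List P.Ob} (x : U.obj Γ Δ), f x = φ x) : Hom U V :=
  ofComp (Hom.id V) (fun _ _ _ _ h => h) φ f h

/-- The action of the shift on morphisms of modules. -/
def shiftR {U V : ModuleStruct P} (φ : Hom U V) (Φ Ψ : List P.Ob) :
    Hom (U.shiftR Φ Ψ) (V.shiftR Φ Ψ) where
  toFun x := φ x
  map_perm _ _ _ := φ.map_perm _ _ _
  map_left _ _ := (φ.map_perm _ _ _).trans (IsModule.perm_arg (φ.map_left _ _))
  map_right _ _ := (φ.map_perm _ _ _).trans (IsModule.perm_arg (φ.map_right _ _))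

end Hom

omit hP in
/-- The laws of a module are inherited along injective families that commute with the actions. -/
theorem IsModule.of_injective {U V : ModuleStruct P} (hU : U.IsModule) (φ : Hom V U)
    (h : ∀ Γ Δ, Function.Injective (fun x : V.obj Γ Δ => φ x)) : V.IsModule := by
  constructor <;> intros <;> apply h <;>
    simp only [φ.map_perm, φ.map_left, φ.map_right]
  · exact hU.perm_refl _
  · exact hU.perm_trans _ _ _ _ _
  · exact hU.perm_congr _ _ _ _ ‹_› ‹_› _
  · exact hU.left_perm _ _ _ _ _ _
  · exact hU.right_perm _ _ _ _ _ _
  · exact hU.id_left _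
  · exact hU.right_id _
  · exact hU.left_left _ _ _
  · exact hU.left_right _ _ _
  · exact hU.right_right _ _ _
  · exact hU.left_left_comm _ _ _
  · exact hU.left_right_comm _ _ _
  · exact hU.right_right_comm _ _ _
  · exact hU.right_left_comm _ _ _

/-- The module `Γ, Δ ↦ U(Φ,Γ;Ψ,Δ)`. -/
def shiftL (U : ModuleStruct P) (Φ Ψ : List P.Ob) : ModuleStruct P where
  obj Γ Δ := U.obj (Φ ++ Γ) (Ψ ++ Δ)
  perm σ τ := U.perm (.appendLeft Φ σ) (.appendLeft Ψ τ)
  left {Γ Δ S T A} f x := U.perm (leftComm Γ Φ S) (leftComm Δ Ψ T)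
    (U.left f (U.perm (front Φ A S) (.refl _) x))
  right {Γ Δ S T A} x g := U.perm (assoc Φ Γ S) (assoc Ψ Δ T)
    (U.right (U.perm (.refl _) (front Ψ A Δ) x) g)

/-- The action of the other shift on morphisms of modules. -/
def Hom.shiftL {U V : ModuleStruct P} (φ : Hom U V) (Φ Ψ : List P.Ob) :
    Hom (U.shiftL Φ Ψ) (V.shiftL Φ Ψ) where
  toFun x := φ x
  map_perm _ _ _ := φ.map_perm _ _ _
  map_left f _ := (φ.map_perm _ _ _).trans (IsModule.perm_arg
    ((φ.map_left _ _).trans (congrArg (V.left f) (φ.map_perm _ _ _))))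
  map_right _ g := (φ.map_perm _ _ _).trans (IsModule.perm_arg
    ((φ.map_right _ _).trans (congrArg (V.right · g) (φ.map_perm _ _ _))))

namespace IsModule

variable {U : ModuleStruct P} (hU : U.IsModule)
include hU

/-- The two shifts of a module are isomorphic. -/
def commHom (Φ Ψ : List P.Ob) : ModuleStruct.Hom (U.shiftL Φ Ψ) (U.shiftR Φ Ψ) where
  toFun {Γ Δ} x := U.perm (.comm Φ Γ) (.comm Ψ Δ) x
  map_perm _ _ _ := hU.perm_eq₂₂
  map_left {Γ Δ S T A} f x := by
    have e : U.perm (.comm Φ (A :: S)) (.comm Ψ T) x = U.perm (.cons A (.comm Φ S)) (.comm Ψ T)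
        (U.perm (front Φ A S) (.refl _) x) := hU.perm_eq₁₂
    refine Eq.trans ?_ (perm_arg (hU.left_of_eq hP.out f e)).symm
    exact hU.perm_eq₂₂
  map_right {Γ Δ S T A} x g := by
    have e : U.perm (.comm Φ Γ) (.comm Ψ (A :: Δ)) x = U.perm (.comm Φ Γ) (.cons A (.comm Ψ Δ))
        (U.perm (.refl _) (front Ψ A Δ) x) := hU.perm_eq₁₂
    refine Eq.trans ?_ (perm_arg (hU.right_of_eq hP.out e g)).symm
    exact hU.perm_eq₂₂

theorem commHom_injective (Φ Ψ Γ Δ : List P.Ob) :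
    Function.Injective (fun x : (U.shiftL Φ Ψ).obj Γ Δ => hU.commHom Φ Ψ x) :=
  (hU.perm_bijective _ _).1

theorem shiftL (Φ Ψ : List P.Ob) : (U.shiftL Φ Ψ).IsModule :=
  (hU.shiftR Φ Ψ).of_injective (hU.commHom Φ Ψ) (hU.commHom_injective Φ Ψ)

/-! The actions on the second block of `U(Θ,Φ;Ξ,Ψ)` commute with those on the first. -/

/-- Permutations of the second block, as a morphism of modules in the first. -/
def permHom {Φ Φ' Ψ Ψ' : List P.Ob} (σ : ListPerm Φ Φ') (τ : ListPerm Ψ Ψ') :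
    ModuleStruct.Hom (U.shiftR Φ Ψ) (U.shiftR Φ' Ψ') where
  toFun {Θ Ξ} x := (U.shiftL Θ Ξ).perm σ τ x
  map_perm _ _ _ := hU.perm_eq₂₂
  map_left {Γ Δ S T A} f x := by
    have e : U.perm (.appendLeft (A :: S) σ) (.appendLeft T τ) x = U.perm
        (.cons A (.appendLeft S σ)) (.appendLeft T τ) x := hU.perm_eq
    refine Eq.trans ?_ (perm_arg (hU.left_of_eq hP.out f e)).symm
    exact hU.perm_eq₂₂
  map_right {Γ Δ S T A} x g := by
    have e : U.perm (.appendLeft Γ σ) (.appendLeft (A :: Δ) τ) x = U.perm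
        (.appendLeft Γ σ) (.cons A (.appendLeft Δ τ)) x := hU.perm_eq
    refine Eq.trans ?_ (perm_arg (hU.right_of_eq hP.out e g)).symm
    exact hU.perm_eq₂₂

/-- The left action on the second block, as a morphism of modules in the first. -/
def leftHom {Γ Δ S T : List P.Ob} {A : P.Ob} (f : P.Hom Γ (A :: Δ)) :
    ModuleStruct.Hom (U.shiftR (A :: S) T) (U.shiftR (Γ ++ S) (Δ ++ T)) where
  toFun {Θ Ξ} x := (U.shiftL Θ Ξ).left f x
  map_perm {Θ Θ' Ξ Ξ'} σ τ x := by
    have e : U.perm (front Θ' A S) (.refl _) (U.perm (σ.appendRight (A :: S)) (τ.appendRight T) x) =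
        U.perm (.cons A (σ.appendRight S)) (τ.appendRight T) (U.perm (front Θ A S) (.refl _) x) :=
      hU.perm_eq₂₂
    refine (perm_arg (hU.left_of_eq hP.out f e)).trans ?_
    exact hU.perm_eq₂₂
  map_left {Γ' Δ' Θ Ξ B} h x := by
    obtain ⟨y, rfl⟩ := (hU.perm_bijective (.cons B (front Θ A S).symm) (.refl _)).2 x
    have e₁ : U.perm (front (Γ' ++ Θ) A S) (.refl _) ((U.shiftR (A :: S) T).left h
        (U.perm (.cons B (front Θ A S).symm) (.refl _) y)) = U.perm (.cons A (assoc Γ' Θ S).symm)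
        (assoc Δ' Ξ T).symm (U.perm (front Γ' A (Θ ++ S)) (.refl _)
          (U.left (S := A :: (Θ ++ S)) (T := Ξ ++ T) h y)) :=
      (perm_arg (perm_arg (hU.left_of_eq hP.out h rfl))).trans hU.perm_eq₃₂
    have e₂ : (U.shiftL (B :: Θ) Ξ).left f (U.perm (.cons B (front Θ A S).symm) (.refl _) y) =
        U.perm (.cons B (leftComm Γ Θ S)) (leftComm Δ Ξ T) (U.perm (front Γ B (Θ ++ S)) (.refl _)
          (U.left (S := B :: (Θ ++ S)) (T := Ξ ++ T) f
            (U.perm (.swap B A (Θ ++ S)) (.refl _) y))) := by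
      refine (perm_arg (congrArg (U.left (S := B :: (Θ ++ S)) (T := Ξ ++ T) f)
        (?_ : _ = U.perm (.swap B A (Θ ++ S)) (.refl _) y))).trans ?_
      · exact hU.perm_eq₂₁
      · exact hU.perm_eq₁₂
    refine (perm_arg (hU.left_of_eq hP.out f e₁)).trans (Eq.trans ?_ (perm_arg
      ((hU.left_of_eq hP.out h e₂).trans (perm_arg (hU.left_left_comm h f y).symm))).symm)
    exact hU.perm_eq₂₃
  map_right {Θ Ξ Γ' Δ' B} x h := by
    have e₁ : U.perm (front (Θ ++ Γ') A S) (.refl _) ((U.shiftR (A :: S) T).right x h) =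
        U.perm (.cons A (rightComm Θ S Γ')) (rightComm Ξ T Δ')
          (U.right (Γ := A :: (Θ ++ S)) (Δ := Ξ ++ T)
            (U.perm (front Θ A S) (.refl _) x) h) := by
      refine Eq.trans ?_ (perm_arg (hU.right_of_eq hP.out (σ := front Θ A S) (τ := .refl _)
        (hU.perm_eq : U.perm (front Θ A S) (.refl _) x = _) h)).symm
      exact hU.perm_eq₂₂
    have e₂ : (U.shiftL Θ (B :: Ξ)).left f x = U.perm (leftComm Γ Θ S)
        (.cons B (leftComm Δ Ξ T)) (U.perm (.refl _) (front Δ B (Ξ ++ T)) (U.left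
          (S := Θ ++ S) (T := B :: (Ξ ++ T)) f (U.perm (front Θ A S) (.refl _) x))) := hU.perm_eq₁₂
    refine (perm_arg (hU.left_of_eq hP.out f e₁)).trans (Eq.trans ?_ (perm_arg
      (hU.right_of_eq hP.out e₂ h)).symm)
    refine (perm_arg (perm_arg (hU.left_right (S := Θ ++ S) (T := Ξ ++ T) f
      (U.perm (front Θ A S) (.refl _) x) h).symm)).trans ?_
    exact hU.perm_eq₃₂

/-- The right action on the second block, as a morphism of modules in the first. -/
def rightHom {Γ Δ S T : List P.Ob} {A : P.Ob} (g : P.Hom (A :: S) T) :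
    ModuleStruct.Hom (U.shiftR Γ (A :: Δ)) (U.shiftR (Γ ++ S) (Δ ++ T)) where
  toFun {Θ Ξ} x := (U.shiftL Θ Ξ).right x g
  map_perm {Θ Θ' Ξ Ξ'} σ τ x := by
    have e : U.perm (.refl _) (front Ξ' A Δ) (U.perm (σ.appendRight Γ) (τ.appendRight (A :: Δ)) x) =
        U.perm (σ.appendRight Γ) (.cons A (τ.appendRight Δ)) (U.perm (.refl _) (front Ξ A Δ) x) :=
      hU.perm_eq₂₂
    refine (perm_arg (hU.right_of_eq hP.out e g)).trans ?_
    exact hU.perm_eq₂₂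
  map_left {Γ' Δ' Θ Ξ B} h x := by
    have e₁ : U.perm (.refl _) (front (Δ' ++ Ξ) A Δ) ((U.shiftR Γ (A :: Δ)).left h x) =
        U.perm (assoc Γ' Θ Γ).symm (.cons A (assoc Δ' Ξ Δ).symm) (U.perm (.refl _)
          (front Δ' A (Ξ ++ Δ)) (U.left (S := Θ ++ Γ) (T := A :: (Ξ ++ Δ)) h
            (U.perm (.refl _) (front Ξ A Δ) x))) := by
      refine Eq.trans ?_ (perm_arg (perm_arg (hU.left_of_eq hP.out (σ := .refl _)
        (τ := front Ξ A Δ) h (hU.perm_eq : U.perm (.refl _) (front Ξ A Δ) x = _)))).symm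
      exact hU.perm_eq₂₃
    have e₂ : (U.shiftL (B :: Θ) Ξ).right x g = U.perm (.cons B (assoc Θ Γ S)) (assoc Ξ Δ T)
      (U.right (Γ := B :: (Θ ++ Γ)) (Δ := Ξ ++ Δ) (U.perm (.refl _) (front Ξ A Δ) x) g) :=
        hU.perm_eq
    refine (perm_arg (hU.right_of_eq hP.out e₁ g)).trans (Eq.trans ?_ (perm_arg
      ((hU.left_of_eq hP.out h e₂).trans (perm_arg (hU.left_right (S := Θ ++ Γ) (T := Ξ ++ Δ) h
        (U.perm (.refl _) (front Ξ A Δ) x) g).symm))).symm)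
    exact hU.perm_eq₂₃
  map_right {Θ Ξ Γ' Δ' B} x h := by
    obtain ⟨y, rfl⟩ := (hU.perm_bijective (.refl _) (.cons B (front Ξ A Δ).symm)).2 x
    have e₁ : U.perm (.refl _) (front (Ξ ++ Δ') A Δ) ((U.shiftR Γ (A :: Δ)).right
        (U.perm (.refl _) (.cons B (front Ξ A Δ).symm) y) h) = U.perm (rightComm Θ Γ Γ')
        (.cons A (rightComm Ξ Δ Δ')) (U.right (Γ := Θ ++ Γ) (Δ := A :: (Ξ ++ Δ)) y h) :=
      (perm_arg (perm_arg (hU.right_of_eq hP.out rfl h))).trans hU.perm_eq₃₁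
    have e₂ : (U.shiftL Θ (B :: Ξ)).right (U.perm (.refl _) (.cons B (front Ξ A Δ).symm) y) g =
        U.perm (assoc Θ Γ S) (.cons B (assoc Ξ Δ T)) (U.right (Γ := Θ ++ Γ) (Δ := B :: (Ξ ++ Δ))
          (U.perm (.refl _) (.swap B A (Ξ ++ Δ)) y) g) := by
      refine (perm_arg (congrArg (U.right (Γ := Θ ++ Γ) (Δ := B :: (Ξ ++ Δ)) · g)
        (?_ : _ = U.perm (.refl _) (.swap B A (Ξ ++ Δ)) y))).trans ?_
      · exact hU.perm_eq₂₁
      · exact hU.perm_eq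
    refine (perm_arg (hU.right_of_eq hP.out e₁ g)).trans (Eq.trans ?_ (perm_arg
      ((hU.right_of_eq hP.out e₂ h).trans (perm_arg (hU.right_right_comm y h g).symm))).symm)
    exact hU.perm_eq₂₃

end IsModule

end ModuleStruct

/-! ### Comparison of iterated shifts -/

namespace ModuleStruct

variable {P : PolycategoryStruct.{u, w}} [hP : Fact P.IsPolycategory]

namespace IsModule

variable {U : ModuleStruct P} (hU : U.IsModule)
include hU

/-- The associativity `U((Γ,Φ),Φ') ≅ U(Γ,(Φ,Φ'))`. -/
def assocRR (Φ Ψ Φ' Ψ' : List P.Ob) :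
    ModuleStruct.Hom ((U.shiftR Φ' Ψ').shiftR Φ Ψ) (U.shiftR (Φ ++ Φ') (Ψ ++ Ψ')) where
  toFun {Γ Δ} x := U.perm (assoc Γ Φ Φ') (assoc Δ Ψ Ψ') x
  map_perm _ _ _ := hU.perm_eq₂₂
  map_left {Γ Δ S T A} f x := by
    have e : U.perm (assoc (A :: S) Φ Φ') (assoc T Ψ Ψ') x = U.perm (.cons A (assoc S Φ Φ'))
        (assoc T Ψ Ψ') x := hU.perm_eq
    refine Eq.trans ?_ (perm_arg (hU.left_of_eq hP.out f e)).symm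
    exact hU.perm_eq₃₂
  map_right {Γ Δ S T A} x g := by
    have e : U.perm (assoc Γ Φ Φ') (assoc (A :: Δ) Ψ Ψ') x = U.perm (assoc Γ Φ Φ')
        (.cons A (assoc Δ Ψ Ψ')) x := hU.perm_eq
    refine Eq.trans ?_ (perm_arg (hU.right_of_eq hP.out e g)).symm
    exact hU.perm_eq₃₂

/-- The inverse of `assocRR`. -/
def assocRRSymm (Φ Ψ Φ' Ψ' : List P.Ob) :
    ModuleStruct.Hom (U.shiftR (Φ ++ Φ') (Ψ ++ Ψ')) ((U.shiftR Φ' Ψ').shiftR Φ Ψ) :=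
  (hU.assocRR Φ Ψ Φ' Ψ').inverse (fun {Γ Δ} x => U.perm (assoc Γ Φ Φ').symm (assoc Δ Ψ Ψ').symm x)
    (fun x => (hU.eq_perm_symm (rfl : _ = hU.assocRR Φ Ψ Φ' Ψ' x)).symm)
    (fun _ => hU.perm_perm_self)

/-- The exchange `U(Φ,(Γ,Φ')) ≅ U(Γ,(Φ,Φ'))`. -/
def leftCommLR (Φ Ψ Φ' Ψ' : List P.Ob) :
    ModuleStruct.Hom ((U.shiftL Φ Ψ).shiftR Φ' Ψ') (U.shiftR (Φ ++ Φ') (Ψ ++ Ψ')) :=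
  ((((hU.commHom Φ Ψ).shiftR Φ' Ψ').comp (hU.assocRR Φ' Ψ' Φ Ψ)).comp
    (hU.permHom (.comm Φ' Φ) (.comm Ψ' Ψ))).copy
    (fun {Γ Δ} x => U.perm (leftComm Φ Γ Φ') (leftComm Ψ Δ Ψ') x)
    (fun _ => hU.perm_eq₁₃)

/-- The inverse of `leftCommLR`. -/
def leftCommRL (Φ Ψ Φ' Ψ' : List P.Ob) :
    ModuleStruct.Hom (U.shiftR (Φ ++ Φ') (Ψ ++ Ψ')) ((U.shiftL Φ Ψ).shiftR Φ' Ψ') :=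
  (hU.leftCommLR Φ Ψ Φ' Ψ').inverse
    (fun {Γ Δ} x => U.perm (leftComm Γ Φ Φ') (leftComm Δ Ψ Ψ') x)
    (fun _ => hU.perm_perm_self)
    (fun _ => hU.perm_perm_self)

/-- The associativity `U((Φ,Γ),Φ') ≅ U(Φ,(Γ,Φ'))`. -/
def assocLR (Φ Ψ Φ' Ψ' : List P.Ob) :
    ModuleStruct.Hom ((U.shiftR Φ' Ψ').shiftL Φ Ψ) ((U.shiftL Φ Ψ).shiftR Φ' Ψ') :=
  ((((hU.shiftR Φ' Ψ').commHom Φ Ψ).comp (hU.assocRR Φ Ψ Φ' Ψ')).comp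
    (hU.leftCommRL Φ Ψ Φ' Ψ')).copy
    (fun {Γ Δ} x => U.perm (assoc Φ Γ Φ') (assoc Ψ Δ Ψ') x)
    (fun _ => hU.perm_eq₁₃)

/-- The inverse of `assocLR`. -/
def assocLRSymm (Φ Ψ Φ' Ψ' : List P.Ob) :
    ModuleStruct.Hom ((U.shiftL Φ Ψ).shiftR Φ' Ψ') ((U.shiftR Φ' Ψ').shiftL Φ Ψ) :=
  (hU.assocLR Φ Ψ Φ' Ψ').inverse
    (fun {Γ Δ} x => U.perm (assoc Φ Γ Φ').symm (assoc Ψ Δ Ψ').symm x)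
    (fun _ => hU.perm_perm_self)
    (fun _ => hU.perm_perm_self)

/-- The associativity `U((Φ,Φ'),Γ) ≅ U(Φ,(Φ',Γ))`. -/
def assocLL (Φ Ψ Φ' Ψ' : List P.Ob) :
    ModuleStruct.Hom (U.shiftL (Φ ++ Φ') (Ψ ++ Ψ')) ((U.shiftL Φ Ψ).shiftL Φ' Ψ') :=
  .ofComp (((hU.shiftL Φ Ψ).commHom Φ' Ψ').comp (hU.leftCommLR Φ Ψ Φ' Ψ'))
    (fun _ _ => (hU.perm_bijective _ _).1.comp (hU.perm_bijective _ _).1)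
    (hU.commHom (Φ ++ Φ') (Ψ ++ Ψ'))
    (fun {Γ Δ} x => U.perm (assoc Φ Φ' Γ) (assoc Ψ Ψ' Δ) x)
    (fun _ => hU.perm_eq₃₁)

/-- The inverse of `assocLL`. -/
def assocLLSymm (Φ Ψ Φ' Ψ' : List P.Ob) :
    ModuleStruct.Hom ((U.shiftL Φ Ψ).shiftL Φ' Ψ') (U.shiftL (Φ ++ Φ') (Ψ ++ Ψ')) :=
  (hU.assocLL Φ Ψ Φ' Ψ').inverse
    (fun {Γ Δ} x => U.perm (assoc Φ Φ' Γ).symm (assoc Ψ Ψ' Δ).symm x)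
    (fun _ => hU.perm_perm_self)
    (fun _ => hU.perm_perm_self)

/-- The exchange `U(Φ,(Φ',Γ)) ≅ U(Φ',(Φ,Γ))`. -/
def leftCommLL (Φ Ψ Φ' Ψ' : List P.Ob) :
    ModuleStruct.Hom ((U.shiftL Φ Ψ).shiftL Φ' Ψ') ((U.shiftL Φ' Ψ').shiftL Φ Ψ) :=
  .ofComp (((hU.shiftL Φ' Ψ').commHom Φ Ψ).comp (hU.leftCommLR Φ' Ψ' Φ Ψ))
    (fun _ _ => (hU.perm_bijective _ _).1.comp (hU.perm_bijective _ _).1)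
    ((((hU.shiftL Φ Ψ).commHom Φ' Ψ').comp (hU.leftCommLR Φ Ψ Φ' Ψ')).comp
      (hU.permHom (.comm Φ Φ') (.comm Ψ Ψ')))
    (fun {Γ Δ} x => U.perm (leftComm Φ Φ' Γ) (leftComm Ψ Ψ' Δ) x)
    (fun _ => hU.perm_eq₃₃)

end IsModule

end ModuleStruct

/-! ### Internal homs and tensor products of modules -/

namespace PJModule

variable {P : PolycategoryStruct.{u, max u w}} {J : P.Distinguished}

/-- Morphisms of `(P,J)`-modules. -/
abbrev Hom (U V : PJModule P J) := ModuleStruct.Hom U.toModuleStruct V.toModuleStruct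

/-- Binary multimorphisms of `(P,J)`-modules. -/
abbrev Hom₂ (U V W : PJModule P J) :=
  ModuleStruct.Hom₂ U.toModuleStruct V.toModuleStruct W.toModuleStruct

variable [hP : Fact P.IsPolycategory]

open ModuleStruct ModuleStruct.IsModule

/-- Shifts of `(P,J)`-modules are `(P,J)`-modules, since permutations act by bijections. -/
def shiftR (U : PJModule P J) (Φ Ψ : List P.Ob) : PJModule P J where
  toModuleStruct := U.toModuleStruct.shiftR Φ Ψ
  isModule := U.isModule.shiftR Φ Ψ
  respects :=
    { tensor := fun t ht Γ Δ => (U.isModule.perm_bijective _ _).comp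
        (U.respects.tensor t ht (Γ ++ Φ) (Δ ++ Ψ))
      cotensor := fun s hs Γ Δ => (U.isModule.perm_bijective _ _).comp
        (U.respects.cotensor s hs (Γ ++ Φ) (Δ ++ Ψ)) }

/-- Shifts by a block on the left. -/
def shiftL (U : PJModule P J) (Φ Ψ : List P.Ob) : PJModule P J where
  toModuleStruct := U.toModuleStruct.shiftL Φ Ψ
  isModule := U.isModule.shiftL Φ Ψ
  respects :=
    { tensor := fun t ht Γ Δ => (U.isModule.perm_bijective _ _).comp
        ((U.respects.tensor t ht (Φ ++ Γ) (Ψ ++ Δ)).comp (U.isModule.perm_bijective _ _))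
      cotensor := fun s hs Γ Δ => (U.isModule.perm_bijective _ _).comp
        ((U.respects.cotensor s hs (Φ ++ Γ) (Ψ ++ Δ)).comp (U.isModule.perm_bijective _ _)) }

omit hP in
/-- Composition with a bijective morphism is bijective. This makes internal homs respect the
distinguished morphisms. -/
theorem comp_bijective {U V W : PJModule P J} (φ : Hom V W) (h : φ.IsBijective) :
    Function.Bijective (fun ψ : Hom U V => ψ.comp φ) := by
  refine ⟨fun ψ ψ' e => Hom.ext' fun Γ Δ x => (h Γ Δ).1 ?_, fun ψ => ?_⟩
  · exact congrArg (fun χ : Hom U W => χ x) e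
  · refine ⟨ψ.comp (φ.inverse (fun {Γ Δ} => Function.surjInv (h Γ Δ).2)
      (fun x => (h _ _).1 (Function.surjInv_eq (h _ _).2 _))
      (fun x => Function.surjInv_eq (h _ _).2 _)), Hom.ext' fun Γ Δ x => ?_⟩
    exact Function.surjInv_eq (h _ _).2 _

/-- The internal hom of modules: its elements over `(Γ;Δ)` are the morphisms to the shift by
`(Γ;Δ)`. -/
def homModule (U W : PJModule P J) : PJModule P J where
  obj Γ Δ := Hom U (W.shiftR Γ Δ)
  perm σ τ φ := φ.comp (W.isModule.permHom σ τ)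
  left f φ := φ.comp (W.isModule.leftHom f)
  right φ g := φ.comp (W.isModule.rightHom g)
  isModule := by
    constructor <;> intros <;> apply Hom.ext' <;> intro Θ Ξ z
    · exact (W.isModule.shiftL Θ Ξ).perm_refl _
    · exact (W.isModule.shiftL Θ Ξ).perm_trans _ _ _ _ _
    · exact (W.isModule.shiftL Θ Ξ).perm_congr _ _ _ _ ‹_› ‹_› _
    · exact (W.isModule.shiftL Θ Ξ).left_perm _ _ _ _ _ _
    · exact (W.isModule.shiftL Θ Ξ).right_perm _ _ _ _ _ _
    · exact (W.isModule.shiftL Θ Ξ).id_left _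
    · exact (W.isModule.shiftL Θ Ξ).right_id _
    · exact (W.isModule.shiftL Θ Ξ).left_left _ _ _
    · exact (W.isModule.shiftL Θ Ξ).left_right _ _ _
    · exact (W.isModule.shiftL Θ Ξ).right_right _ _ _
    · exact (W.isModule.shiftL Θ Ξ).left_left_comm _ _ _
    · exact (W.isModule.shiftL Θ Ξ).left_right_comm _ _ _
    · exact (W.isModule.shiftL Θ Ξ).right_right_comm _ _ _
    · exact (W.isModule.shiftL Θ Ξ).right_left_comm _ _ _
  respects :=
    { tensor := fun t ht Γ Δ => comp_bijective (V := W.shiftR _ _) (W := W.shiftR _ _)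
        (W.isModule.leftHom t) fun Θ Ξ => (W.shiftL Θ Ξ).respects.tensor t ht Γ Δ
      cotensor := fun s hs Γ Δ => comp_bijective (V := W.shiftR _ _) (W := W.shiftR _ _)
        (W.isModule.rightHom s) fun Θ Ξ => (W.shiftL Θ Ξ).respects.cotensor s hs Γ Δ }

section Bilinear

variable {U V W : PJModule P J}

/-- A multimorphism with its second argument fixed. -/
def homR (k : Hom₂ U V W) {Φ Ψ : List P.Ob} (y : V.obj Φ Ψ) : Hom U (W.shiftR Φ Ψ) where
  toFun x := k x y
  map_perm σ τ x := by
    have h := k.map_perm σ τ (.refl Φ) (.refl Ψ) x y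
    rw [V.isModule.perm_refl] at h
    exact h.trans W.isModule.perm_eq
  map_left f x := (W.isModule.eq_perm_symm (k.map_left₁ f x y))
  map_right x g := (W.isModule.eq_perm_symm (k.map_right₁ x g y)).trans W.isModule.perm_eq

/-- A multimorphism with its first argument fixed. -/
def homL (k : Hom₂ U V W) {Φ Ψ : List P.Ob} (x : U.obj Φ Ψ) : Hom V (W.shiftL Φ Ψ) where
  toFun y := k x y
  map_perm σ τ y := by
    have h := k.map_perm (.refl Φ) (.refl Ψ) σ τ x y
    rw [U.isModule.perm_refl] at h
    exact h.trans W.isModule.perm_eq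
  map_left f y := (W.isModule.eq_perm_symm (k.map_left₂ f x y)).trans W.isModule.perm_eq
  map_right y g := k.map_right₂ x y g

/-- A multimorphism is a family that is a morphism in each of its arguments. -/
def ofHoms (r : ∀ {Φ Ψ : List P.Ob}, V.obj Φ Ψ → Hom U (W.shiftR Φ Ψ))
    (l : ∀ {Φ Ψ : List P.Ob}, U.obj Φ Ψ → Hom V (W.shiftL Φ Ψ))
    (h : ∀ {Γ₁ Δ₁ Γ₂ Δ₂ : List P.Ob} (x : U.obj Γ₁ Δ₁) (y : V.obj Γ₂ Δ₂), l x y = r y x) :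
    Hom₂ U V W where
  toFun x y := r y x
  map_perm σ₁ τ₁ σ₂ τ₂ x y := by
    refine ((r _).map_perm σ₁ τ₁ x).trans ?_
    rw [← h]
    refine (perm_arg (U := W.toModuleStruct) ((l x).map_perm σ₂ τ₂ y)).trans ?_
    rw [h]
    exact W.isModule.perm_eq₂₁
  map_left₁ f x y := (perm_arg (U := W.toModuleStruct) ((r y).map_left f x)).trans
    W.isModule.perm_perm_self
  map_right₁ x g y := (perm_arg (U := W.toModuleStruct) ((r y).map_right x g)).trans
    W.isModule.perm_perm_self
  map_left₂ f x y := by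
    rw [← h, ← h]
    exact (perm_arg (U := W.toModuleStruct) ((l x).map_left f y)).trans
      W.isModule.perm_perm_self
  map_right₂ x y g := by
    rw [← h, ← h]
    exact (l x).map_right y g

omit hP in
theorem hom₂_ext {k l : Hom₂ U V W} (h : ∀ {Γ₁ Δ₁ Γ₂ Δ₂ : List P.Ob} (x : U.obj Γ₁ Δ₁)
    (y : V.obj Γ₂ Δ₂), k x y = l x y) : k = l :=
  Hom₂.ext (by funext Γ₁ Δ₁ Γ₂ Δ₂ x y; exact h x y)

/-- A multimorphism `(U, V) → W` as a morphism from `V` to the internal hom. -/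
def curry (k : Hom₂ U V W) : Hom V (homModule U W) where
  toFun y := homR k y
  map_perm σ τ y := Hom.ext' fun _ _ x => (homL k x).map_perm σ τ y
  map_left f y := Hom.ext' fun _ _ x => (homL k x).map_left f y
  map_right y g := Hom.ext' fun _ _ x => (homL k x).map_right y g

/-- Evaluation at an element, as a morphism out of the internal hom. -/
def evalAt (W : PJModule P J) {Φ Ψ : List P.Ob} (x : U.obj Φ Ψ) :
    Hom (homModule U W) (W.shiftL Φ Ψ) where
  toFun φ := φ.toFun x
  map_perm _ _ _ := rfl
  map_left _ _ := rfl
  map_right _ _ := rfl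

/-- A morphism from `V` to the internal hom as a multimorphism `(U, V) → W`. -/
def uncurry (φ : Hom V (homModule U W)) : Hom₂ U V W :=
  ofHoms (fun y => φ y) (fun x => φ.comp (evalAt W x)) (fun _ _ => rfl)

/-- Exchange of the arguments of a multimorphism. -/
def flip (k : Hom₂ U V W) : Hom₂ V U W :=
  ofHoms (fun x => (homL k x).comp (W.isModule.commHom _ _))
    (fun y => ((homR k y).comp ((W.isModule.commHom _ _).inverse
      (fun {Γ Δ} z => W.perm (.comm Γ _) (.comm Δ _) z)
      (fun _ => W.isModule.perm_perm_self)
      (fun _ => W.isModule.perm_perm_self))))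
    (fun _ _ => rfl)

/-- Composition of a multimorphism with a morphism. -/
def compHom {W' : PJModule P J} (k : Hom₂ U V W) (φ : Hom W W') : Hom₂ U V W' :=
  ofHoms (fun y => (homR k y).comp (φ.shiftR _ _)) (fun x => (homL k x).comp (φ.shiftL _ _))
    (fun _ _ => rfl)

/-- Composition of morphisms with a multimorphism. -/
def precomp {U' V' : PJModule P J} (φ : Hom U' U) (ψ : Hom V' V) (k : Hom₂ U V W) :
    Hom₂ U' V' W :=
  ofHoms (fun y => φ.comp (homR k (ψ y))) (fun x => ψ.comp (homL k (φ x))) (fun _ _ => rfl)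

end Bilinear

section Tensor

/-- Formal expressions for the elements of the tensor product of two modules: they are generated
by the pairs of elements under the actions of permutations and of `P`, and under inverses of the
maps that the distinguished tensor and cotensor products induce. -/
inductive TensorTerm (U V : PJModule P J) : List P.Ob → List P.Ob → Type (max u w)
  | pure {Γ₁ Δ₁ Γ₂ Δ₂ : List P.Ob} (x : U.obj Γ₁ Δ₁) (y : V.obj Γ₂ Δ₂) :
      TensorTerm U V (Γ₁ ++ Γ₂) (Δ₁ ++ Δ₂)
  | perm {Γ Γ' Δ Δ' : List P.Ob} (σ : ListPerm Γ Γ') (τ : ListPerm Δ Δ') (x : TensorTerm U V Γ Δ) :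
      TensorTerm U V Γ' Δ'
  | left {Γ Δ S T : List P.Ob} {A : P.Ob} (f : P.Hom Γ (A :: Δ)) (x : TensorTerm U V (A :: S) T) :
      TensorTerm U V (Γ ++ S) (Δ ++ T)
  | right {Γ Δ S T : List P.Ob} {A : P.Ob} (x : TensorTerm U V Γ (A :: Δ)) (g : P.Hom (A :: S) T) :
      TensorTerm U V (Γ ++ S) (Δ ++ T)
  | leftInv {As : List P.Ob} {X : P.Ob} (t : P.Hom As [X]) (ht : J.IsTensor t) {Γ Δ : List P.Ob}
      (x : TensorTerm U V (As ++ Γ) Δ) : TensorTerm U V (X :: Γ) Δ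
  | rightInv {X : P.Ob} {As : List P.Ob} (s : P.Hom [X] As) (hs : J.IsCotensor s)
      {Γ Δ : List P.Ob} (x : TensorTerm U V (Γ ++ []) (Δ ++ As)) : TensorTerm U V Γ (X :: Δ)

variable {U V : PJModule P J}

/-- The value of an expression under a multimorphism. -/
noncomputable def TensorTerm.eval {W : PJModule P J} (k : Hom₂ U V W) :
    {Γ Δ : List P.Ob} → TensorTerm U V Γ Δ → W.obj Γ Δ
  | _, _, .pure x y => k x y
  | _, _, .perm σ τ x => W.perm σ τ (x.eval k)
  | _, _, .left f x => W.left f (x.eval k)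
  | _, _, .right x g => W.right (x.eval k) g
  | _, _, .leftInv t ht x => Function.surjInv (W.respects.tensor t ht _ _).2 (x.eval k)
  | _, _, .rightInv s hs x => Function.surjInv (W.respects.cotensor s hs _ _).2 (x.eval k)

/-- Two expressions are equal in the tensor product if all multimorphisms identify them. -/
def tensorRel (U V : PJModule P J) (Γ Δ : List P.Ob) (x y : TensorTerm U V Γ Δ) : Prop :=
  ∀ {W : PJModule P J} (k : Hom₂ U V W), x.eval k = y.eval k

/-- The tensor product of modules. -/
def tensor (U V : PJModule P J) : PJModule P J where
  obj Γ Δ := Quot (tensorRel U V Γ Δ)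
  perm σ τ := Quot.map (.perm σ τ) fun _ _ h {W} k =>
    congrArg (W.perm σ τ) (h k)
  left f := Quot.map (.left f) fun _ _ h {W} k => congrArg (W.left f) (h k)
  right x g := Quot.map (.right · g) (fun _ _ h {W} k => congrArg (W.right · g) (h k)) x
  isModule :=
    { perm_refl x := Quot.inductionOn x fun _ => Quot.sound fun {W} _ => W.isModule.perm_refl _
      perm_trans _ _ _ _ x := Quot.inductionOn x fun _ => Quot.sound fun {W} _ =>
          W.isModule.perm_trans _ _ _ _ _
      perm_congr _ _ _ _ h₁ h₂ x := Quot.inductionOn x fun _ => Quot.sound fun {W} _ =>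
          W.isModule.perm_congr _ _ _ _ h₁ h₂ _
      left_perm _ _ _ _ _ x := Quot.inductionOn x fun _ => Quot.sound fun {W} _ =>
          W.isModule.left_perm _ _ _ _ _ _
      right_perm _ _ _ _ x _ := Quot.inductionOn x fun _ => Quot.sound fun {W} _ =>
          W.isModule.right_perm _ _ _ _ _ _
      id_left x := Quot.inductionOn x fun _ => Quot.sound fun {W} _ => W.isModule.id_left _
      right_id x := Quot.inductionOn x fun _ => Quot.sound fun {W} _ => W.isModule.right_id _
      left_left _ _ x := Quot.inductionOn x fun _ => Quot.sound fun {W} _ =>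
          W.isModule.left_left _ _ _
      left_right _ x _ := Quot.inductionOn x fun _ => Quot.sound fun {W} _ =>
          W.isModule.left_right _ _ _
      right_right x _ _ := Quot.inductionOn x fun _ => Quot.sound fun {W} _ =>
          W.isModule.right_right _ _ _
      left_left_comm _ _ x := Quot.inductionOn x fun _ => Quot.sound fun {W} _ =>
          W.isModule.left_left_comm _ _ _
      left_right_comm x _ _ := Quot.inductionOn x fun _ => Quot.sound fun {W} _ =>
          W.isModule.left_right_comm _ _ _
      right_right_comm x _ _ := Quot.inductionOn x fun _ => Quot.sound fun {W} _ =>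
          W.isModule.right_right_comm _ _ _
      right_left_comm _ x _ := Quot.inductionOn x fun _ => Quot.sound fun {W} _ =>
          W.isModule.right_left_comm _ _ _ }
  respects :=
    { tensor := fun t ht _ _ => Function.bijective_iff_has_inverse.2
        ⟨Quot.map (.leftInv t ht) fun _ _ h {W} k =>
            congrArg (Function.surjInv (W.respects.tensor t ht _ _).2) (h k),
          fun x => Quot.inductionOn x fun _ => Quot.sound fun {W} _ =>
            (W.respects.tensor t ht _ _).1 (Function.surjInv_eq (W.respects.tensor t ht _ _).2 _),
          fun x => Quot.inductionOn x fun _ => Quot.sound fun {W} _ =>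
            Function.surjInv_eq (W.respects.tensor t ht _ _).2 _⟩
      cotensor := fun s hs _ _ => Function.bijective_iff_has_inverse.2
        ⟨Quot.map (.rightInv s hs) fun _ _ h {W} k =>
            congrArg (Function.surjInv (W.respects.cotensor s hs _ _).2) (h k),
          fun x => Quot.inductionOn x fun _ => Quot.sound fun {W} _ =>
            (W.respects.cotensor s hs _ _).1 (Function.surjInv_eq (W.respects.cotensor s hs _ _).2
              _),
          fun x => Quot.inductionOn x fun _ => Quot.sound fun {W} _ =>
            Function.surjInv_eq (W.respects.cotensor s hs _ _).2 _⟩ }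

/-- The element of the tensor product that an expression denotes. -/
def tensorMk {Γ Δ : List P.Ob} (x : TensorTerm U V Γ Δ) : (tensor U V).obj Γ Δ :=
  Quot.mk (tensorRel U V Γ Δ) x

/-- The universal multimorphism. -/
def tmul (U V : PJModule P J) : Hom₂ U V (tensor U V) where
  toFun x y := Quot.mk (tensorRel U V _ _) (.pure x y)
  map_perm _ _ _ _ _ _ := Quot.sound fun {_} k => k.map_perm _ _ _ _ _ _
  map_left₁ _ _ _ := Quot.sound fun {_} k => k.map_left₁ _ _ _
  map_right₁ _ _ _ := Quot.sound fun {_} k => k.map_right₁ _ _ _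
  map_left₂ _ _ _ := Quot.sound fun {_} k => k.map_left₂ _ _ _
  map_right₂ _ _ _ := Quot.sound fun {_} k => k.map_right₂ _ _ _

/-- The morphism out of the tensor product that a multimorphism induces, by evaluation of
expressions. -/
noncomputable def lift {W : PJModule P J} (k : Hom₂ U V W) : Hom (tensor U V) W where
  toFun {Γ Δ} := Quot.lift (r := tensorRel U V Γ Δ) (TensorTerm.eval k) fun _ _ h => h k
  map_perm _ _ x := Quot.inductionOn x fun _ => rfl
  map_left _ x := Quot.inductionOn x fun _ => rfl
  map_right x _ := Quot.inductionOn x fun _ => rfl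

omit hP in
/-- The universal multimorphism is jointly epic. At the inverses of the distinguished maps, this
holds because the distinguished maps are injective in the target. -/
theorem tensor_hom_ext {W : PJModule P J} {φ ψ : Hom (tensor U V) W}
    (h : ∀ {Γ₁ Δ₁ Γ₂ Δ₂ : List P.Ob} (x : U.obj Γ₁ Δ₁) (y : V.obj Γ₂ Δ₂),
      φ (tmul U V x y) = ψ (tmul U V x y)) : φ = ψ := by
  have key : ∀ {Γ Δ : List P.Ob} (x : TensorTerm U V Γ Δ),
      φ (tensorMk x) = ψ (tensorMk x) := by
    intro Γ Δ x
    induction x with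
    | pure x y => exact h x y
    | perm σ τ x ih =>
      exact (φ.map_perm σ τ (tensorMk x)).trans
        ((congrArg (W.perm σ τ) ih).trans (ψ.map_perm σ τ (tensorMk x)).symm)
    | left f x ih =>
      exact (φ.map_left f (tensorMk x)).trans
        ((congrArg (W.left f) ih).trans (ψ.map_left f (tensorMk x)).symm)
    | right x g ih =>
      exact (φ.map_right (tensorMk x) g).trans
        ((congrArg (W.right · g) ih).trans (ψ.map_right (tensorMk x) g).symm)
    | leftInv t ht x ih =>
      refine (W.respects.tensor t ht _ _).1 ?_
      have e : (tensor U V).left t (tensorMk (.leftInv t ht x)) = tensorMk x :=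
        Quot.sound fun {W} _ => Function.surjInv_eq (W.respects.tensor t ht _ _).2 _
      exact (φ.map_left t _).symm.trans ((congrArg φ.toFun e).trans (ih.trans
        ((congrArg ψ.toFun e.symm).trans (ψ.map_left t _))))
    | rightInv s hs x ih =>
      refine (W.respects.cotensor s hs _ _).1 ?_
      have e : (tensor U V).right (tensorMk (.rightInv s hs x)) s = tensorMk x :=
        Quot.sound fun {W} _ => Function.surjInv_eq (W.respects.cotensor s hs _ _).2 _
      exact (φ.map_right _ s).symm.trans ((congrArg φ.toFun e).trans (ih.trans
        ((congrArg ψ.toFun e.symm).trans (ψ.map_right _ s))))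
  exact Hom.ext' fun Γ Δ x => Quot.inductionOn x fun x => key x

end Tensor

end PJModule

/-! ### Ternary multimorphisms of modules -/

namespace PJModule

open ModuleStruct ModuleStruct.IsModule

variable {P : PolycategoryStruct.{u, max u w}} {J : P.Distinguished} [hP : Fact P.IsPolycategory]

/-- Ternary multimorphisms `(U, V, W) → Z`: families of functions that are morphisms of modules
in each argument, given as three such families with the same values. -/
structure Hom₃ (U V W Z : PJModule P J) where
  hom₁ : ∀ {Γ₂ Δ₂ Γ₃ Δ₃ : List P.Ob}, V.obj Γ₂ Δ₂ → W.obj Γ₃ Δ₃ →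
    Hom U (Z.shiftR (Γ₂ ++ Γ₃) (Δ₂ ++ Δ₃))
  hom₂ : ∀ {Γ₁ Δ₁ Γ₃ Δ₃ : List P.Ob}, U.obj Γ₁ Δ₁ → W.obj Γ₃ Δ₃ →
    Hom V ((Z.shiftL Γ₁ Δ₁).shiftR Γ₃ Δ₃)
  hom₃ : ∀ {Γ₁ Δ₁ Γ₂ Δ₂ : List P.Ob}, U.obj Γ₁ Δ₁ → V.obj Γ₂ Δ₂ →
    Hom W ((Z.shiftL Γ₁ Δ₁).shiftL Γ₂ Δ₂)
  eq₂ : ∀ {Γ₁ Δ₁ Γ₂ Δ₂ Γ₃ Δ₃ : List P.Ob} (x : U.obj Γ₁ Δ₁) (y : V.obj Γ₂ Δ₂)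
    (z : W.obj Γ₃ Δ₃), hom₂ x z y = hom₁ y z x
  eq₃ : ∀ {Γ₁ Δ₁ Γ₂ Δ₂ Γ₃ Δ₃ : List P.Ob} (x : U.obj Γ₁ Δ₁) (y : V.obj Γ₂ Δ₂)
    (z : W.obj Γ₃ Δ₃), hom₃ x y z = hom₁ y z x

namespace Hom₃

variable {U V W Z M : PJModule P J}

/-- The value of a ternary multimorphism. -/
def app (k : Hom₃ U V W Z) {Γ₁ Δ₁ Γ₂ Δ₂ Γ₃ Δ₃ : List P.Ob} (x : U.obj Γ₁ Δ₁) (y : V.obj Γ₂ Δ₂)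
    (z : W.obj Γ₃ Δ₃) : Z.obj (Γ₁ ++ (Γ₂ ++ Γ₃)) (Δ₁ ++ (Δ₂ ++ Δ₃)) :=
  k.hom₁ y z x

/-- The multimorphism `(x, y, z) ↦ k (l (x, y), z)`. -/
def comp₁ (k : Hom₂ M W Z) (l : Hom₂ U V M) : Hom₃ U V W Z where
  hom₁ y z := ((homR l y).comp ((homR k z).shiftR _ _)).comp (Z.isModule.assocRR _ _ _ _)
  hom₂ x z := ((homL l x).comp ((homR k z).shiftL _ _)).comp (Z.isModule.assocLR _ _ _ _)
  hom₃ x y := (homL k (l x y)).comp (Z.isModule.assocLL _ _ _ _)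
  eq₂ _ _ _ := rfl
  eq₃ _ _ _ := rfl

/-- The multimorphism `(x, y, z) ↦ k (x, l (y, z))`. -/
def comp₂ (k : Hom₂ U M Z) (l : Hom₂ V W M) : Hom₃ U V W Z where
  hom₁ y z := homR k (l y z)
  hom₂ x z := (homR l z).comp ((homL k x).shiftR _ _)
  hom₃ x y := (homL l y).comp ((homL k x).shiftL _ _)
  eq₂ _ _ _ := rfl
  eq₃ _ _ _ := rfl

/-- Exchange of the first two arguments. -/
def swap (k : Hom₃ U V W Z) : Hom₃ V U W Z where
  hom₁ x z := (k.hom₂ x z).comp (Z.isModule.leftCommLR _ _ _ _)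
  hom₂ y z := (k.hom₁ y z).comp (Z.isModule.leftCommRL _ _ _ _)
  hom₃ y x := (k.hom₃ x y).comp (Z.isModule.leftCommLL _ _ _ _)
  eq₂ y x z := (perm_arg (U := Z.toModuleStruct) (k.eq₂ x y z)).symm
  eq₃ y x z := perm_arg (U := Z.toModuleStruct) ((k.eq₃ x y z).trans (k.eq₂ x y z).symm)

theorem swap_app (k : Hom₃ U V W Z) {Γ₁ Δ₁ Γ₂ Δ₂ Γ₃ Δ₃ : List P.Ob} (x : U.obj Γ₁ Δ₁)
    (y : V.obj Γ₂ Δ₂) (z : W.obj Γ₃ Δ₃) : k.swap.app y x z =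
      Z.perm (leftComm Γ₁ Γ₂ Γ₃) (leftComm Δ₁ Δ₂ Δ₃) (k.app x y z) :=
  perm_arg (U := Z.toModuleStruct) (k.eq₂ x y z)

/-- A ternary multimorphism with its last argument fixed. -/
def fix (k : Hom₃ U V W Z) {Γ₃ Δ₃ : List P.Ob} (z : W.obj Γ₃ Δ₃) : Hom₂ U V (Z.shiftR Γ₃ Δ₃) :=
  ofHoms (fun y => (k.hom₁ y z).comp (Z.isModule.assocRRSymm _ _ _ _))
    (fun x => (k.hom₂ x z).comp (Z.isModule.assocLRSymm _ _ _ _))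
    (fun x y => perm_arg (U := Z.toModuleStruct) (k.eq₂ x y z))

theorem fix_apply (k : Hom₃ U V W Z) {Γ₁ Δ₁ Γ₂ Δ₂ Γ₃ Δ₃ : List P.Ob} (x : U.obj Γ₁ Δ₁)
    (y : V.obj Γ₂ Δ₂) (z : W.obj Γ₃ Δ₃) : k.fix z x y =
      ((k.hom₃ x y).comp (Z.isModule.assocLLSymm _ _ _ _)) z :=
  perm_arg (U := Z.toModuleStruct) (k.eq₃ x y z).symm

/-- The factorization of a ternary multimorphism through the tensor product of its first two
arguments. -/
noncomputable def lift (k : Hom₃ U V W Z) : Hom₂ (tensor U V) W Z :=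
  uncurry
    { toFun := fun z => PJModule.lift (k.fix z)
      map_perm := fun σ τ z => tensor_hom_ext fun x y => by
        refine (k.fix_apply x y _).trans ?_
        refine (Hom.map_perm _ σ τ z).trans ?_
        exact perm_arg (U := (Z.shiftL _ _).toModuleStruct) (k.fix_apply x y z).symm
      map_left := fun f z => tensor_hom_ext fun x y => by
        refine (k.fix_apply x y _).trans ?_
        refine (Hom.map_left _ f z).trans ?_
        exact congrArg ((Z.shiftL _ _).left f) (k.fix_apply x y z).symm
      map_right := fun z g => tensor_hom_ext fun x y => by
        refine (k.fix_apply x y _).trans ?_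
        refine (Hom.map_right _ z g).trans ?_
        exact congrArg ((Z.shiftL _ _).right · g) (k.fix_apply x y z).symm }

/-- A ternary multimorphism as a binary one, with values in functions of the first argument. -/
def curry (k : Hom₃ U V W Z) : Hom₂ V W (homModule U Z) :=
  ofHoms
    (fun z =>
      { toFun := fun y => k.hom₁ y z
        map_perm := fun σ τ y => Hom.ext' fun _ _ x => by
          refine (k.eq₂ x _ z).symm.trans ((Hom.map_perm _ σ τ y).trans ?_)
          exact perm_arg (U := ((Z.shiftL _ _).shiftR _ _).toModuleStruct) (k.eq₂ x y z)
        map_left := fun f y => Hom.ext' fun _ _ x => by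
          refine (k.eq₂ x _ z).symm.trans ((Hom.map_left _ f y).trans ?_)
          exact congrArg (((Z.shiftL _ _).shiftR _ _).left f) (k.eq₂ x y z)
        map_right := fun y g => Hom.ext' fun _ _ x => by
          refine (k.eq₂ x _ z).symm.trans ((Hom.map_right _ y g).trans ?_)
          exact congrArg (((Z.shiftL _ _).shiftR _ _).right · g) (k.eq₂ x y z) })
    (fun y =>
      { toFun := fun z => k.hom₁ y z
        map_perm := fun σ τ z => Hom.ext' fun _ _ x => by
          refine (k.eq₃ x y _).symm.trans ((Hom.map_perm _ σ τ z).trans ?_)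
          exact perm_arg (U := ((Z.shiftL _ _).shiftL _ _).toModuleStruct) (k.eq₃ x y z)
        map_left := fun f z => Hom.ext' fun _ _ x => by
          refine (k.eq₃ x y _).symm.trans ((Hom.map_left _ f z).trans ?_)
          exact congrArg (((Z.shiftL _ _).shiftL _ _).left f) (k.eq₃ x y z)
        map_right := fun z g => Hom.ext' fun _ _ x => by
          refine (k.eq₃ x y _).symm.trans ((Hom.map_right _ z g).trans ?_)
          exact congrArg (((Z.shiftL _ _).shiftL _ _).right · g) (k.eq₃ x y z) })
    (fun _ _ => rfl)

end Hom₃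

end PJModule

/-! ### The tensor product of the Chu construction -/

namespace Envelope

open ModuleStruct ModuleStruct.IsModule PJModule

variable {P : PolycategoryStruct.{u, max u w}} {J : P.Distinguished} [hP : Fact P.IsPolycategory]
  [hJ : Fact ((ModuleStruct.self P).Respects J)]

/-- `P` as a module over itself. -/
def selfModule (P : PolycategoryStruct.{u, max u w}) (J : P.Distinguished)
    [hP : Fact P.IsPolycategory] [hJ : Fact ((ModuleStruct.self P).Respects J)] :
    PJModule P J :=
  ⟨ModuleStruct.self P, hP.out, hJ.out⟩

/-- The pairing of an object of the envelope. -/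
def pairing (A : Envelope P J) : PJModule.Hom₂ A.pos A.neg (selfModule P J) :=
  A.pair

/-- The two functions `b ↦ φ b` and `a ↦ ψ a` induce the same pairing with `a` and `b`. -/
def Compatible {A B : Envelope P J} {Γ Δ : List P.Ob} (φ : (homModule B.pos A.neg).obj Γ Δ)
    (ψ : (homModule A.pos B.neg).obj Γ Δ) : Prop :=
  ∀ {Γ₁ Δ₁ Γ₂ Δ₂ : List P.Ob} (a : A.pos.obj Γ₁ Δ₁) (b : B.pos.obj Γ₂ Δ₂),
    (((evalAt A.neg b).comp ((homL A.pairing a).shiftL Γ₂ Δ₂)).comp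
        ((selfModule P J).isModule.leftCommLL Γ₁ Δ₁ Γ₂ Δ₂)) φ =
      ((evalAt B.neg a).comp ((homL B.pairing b).shiftL Γ₁ Δ₁)) ψ

/-- The negative part of the tensor product: the pullback of the modules of morphisms
`B⁺ → A⁻` and `A⁺ → B⁻` over that of multimorphisms `(A⁺, B⁺) → P`. -/
def tensorNeg (A B : Envelope P J) : PJModule P J where
  obj Γ Δ := { c : (homModule B.pos A.neg).obj Γ Δ × (homModule A.pos B.neg).obj Γ Δ //
    Compatible c.1 c.2 }
  perm σ τ c := ⟨((homModule _ _).perm σ τ c.1.1, (homModule _ _).perm σ τ c.1.2), fun a b =>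
    (Hom.map_perm _ σ τ c.1.1).trans ((congrArg _ (c.2 a b)).trans
      (Hom.map_perm _ σ τ c.1.2).symm)⟩
  left f c := ⟨((homModule _ _).left f c.1.1, (homModule _ _).left f c.1.2), fun a b =>
    (Hom.map_left _ f c.1.1).trans ((congrArg _ (c.2 a b)).trans (Hom.map_left _ f c.1.2).symm)⟩
  right c g := ⟨((homModule _ _).right c.1.1 g, (homModule _ _).right c.1.2 g), fun a b =>
    (Hom.map_right _ c.1.1 g).trans ((congrArg (ModuleStruct.right _ · g) (c.2 a b)).trans
      (Hom.map_right _ c.1.2 g).symm)⟩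
  isModule := by
    constructor <;> intros <;> refine Subtype.ext (Prod.ext ?_ ?_)
    · exact (homModule _ _).isModule.perm_refl _
    · exact (homModule _ _).isModule.perm_refl _
    · exact (homModule _ _).isModule.perm_trans _ _ _ _ _
    · exact (homModule _ _).isModule.perm_trans _ _ _ _ _
    · exact (homModule _ _).isModule.perm_congr _ _ _ _ ‹_› ‹_› _
    · exact (homModule _ _).isModule.perm_congr _ _ _ _ ‹_› ‹_› _
    · exact (homModule _ _).isModule.left_perm _ _ _ _ _ _
    · exact (homModule _ _).isModule.left_perm _ _ _ _ _ _
    · exact (homModule _ _).isModule.right_perm _ _ _ _ _ _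
    · exact (homModule _ _).isModule.right_perm _ _ _ _ _ _
    · exact (homModule _ _).isModule.id_left _
    · exact (homModule _ _).isModule.id_left _
    · exact (homModule _ _).isModule.right_id _
    · exact (homModule _ _).isModule.right_id _
    · exact (homModule _ _).isModule.left_left _ _ _
    · exact (homModule _ _).isModule.left_left _ _ _
    · exact (homModule _ _).isModule.left_right _ _ _
    · exact (homModule _ _).isModule.left_right _ _ _
    · exact (homModule _ _).isModule.right_right _ _ _
    · exact (homModule _ _).isModule.right_right _ _ _
    · exact (homModule _ _).isModule.left_left_comm _ _ _
    · exact (homModule _ _).isModule.left_left_comm _ _ _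
    · exact (homModule _ _).isModule.left_right_comm _ _ _
    · exact (homModule _ _).isModule.left_right_comm _ _ _
    · exact (homModule _ _).isModule.right_right_comm _ _ _
    · exact (homModule _ _).isModule.right_right_comm _ _ _
    · exact (homModule _ _).isModule.right_left_comm _ _ _
    · exact (homModule _ _).isModule.right_left_comm _ _ _
  respects :=
    { tensor := fun t ht Γ Δ => by
        refine ⟨fun c d h => Subtype.ext (Prod.ext ?_ ?_), fun c => ?_⟩
        · exact ((homModule _ _).respects.tensor t ht Γ Δ).1 (congrArg (fun c => c.1.1) h)
        · exact ((homModule _ _).respects.tensor t ht Γ Δ).1 (congrArg (fun c => c.1.2) h)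
        · obtain ⟨φ, hφ⟩ := ((homModule _ _).respects.tensor t ht Γ Δ).2 c.1.1
          obtain ⟨ψ, hψ⟩ := ((homModule _ _).respects.tensor t ht Γ Δ).2 c.1.2
          refine ⟨⟨(φ, ψ), fun a b => ?_⟩, Subtype.ext (Prod.ext hφ hψ)⟩
          refine ((((selfModule P J).shiftL _ _).shiftL _ _).respects.tensor t ht Γ Δ).1 ?_
          refine (Hom.map_left _ t φ).symm.trans (Eq.trans ?_ (Hom.map_left _ t ψ))
          exact (congrArg _ hφ).trans ((c.2 a b).trans (congrArg _ hψ.symm))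
      cotensor := fun s hs Γ Δ => by
        refine ⟨fun c d h => Subtype.ext (Prod.ext ?_ ?_), fun c => ?_⟩
        · exact ((homModule _ _).respects.cotensor s hs Γ Δ).1 (congrArg (fun c => c.1.1) h)
        · exact ((homModule _ _).respects.cotensor s hs Γ Δ).1 (congrArg (fun c => c.1.2) h)
        · obtain ⟨φ, hφ⟩ := ((homModule _ _).respects.cotensor s hs Γ Δ).2 c.1.1
          obtain ⟨ψ, hψ⟩ := ((homModule _ _).respects.cotensor s hs Γ Δ).2 c.1.2
          refine ⟨⟨(φ, ψ), fun a b => ?_⟩, Subtype.ext (Prod.ext hφ hψ)⟩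
          refine ((((selfModule P J).shiftL _ _).shiftL _ _).respects.cotensor s hs Γ Δ).1 ?_
          refine (Hom.map_right _ φ s).symm.trans (Eq.trans ?_ (Hom.map_right _ ψ s))
          exact (congrArg _ hφ).trans ((c.2 a b).trans (congrArg _ hψ.symm)) }

/-- Evaluation of the first component of an element of the negative part. -/
def negFst (A B : Envelope P J) : PJModule.Hom₂ B.pos (tensorNeg A B) A.neg :=
  uncurry
    { toFun := fun c => c.1.1
      map_perm := fun _ _ _ => rfl
      map_left := fun _ _ => rfl
      map_right := fun _ _ => rfl }

/-- Evaluation of the second component of an element of the negative part. -/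
def negSnd (A B : Envelope P J) : PJModule.Hom₂ A.pos (tensorNeg A B) B.neg :=
  uncurry
    { toFun := fun c => c.1.2
      map_perm := fun _ _ _ => rfl
      map_left := fun _ _ => rfl
      map_right := fun _ _ => rfl }

/-- The tensor product of the Chu construction. -/
noncomputable def tensor (A B : Envelope P J) : Envelope P J where
  pos := PJModule.tensor A.pos B.pos
  neg := tensorNeg A B
  pair := (Hom₃.comp₂ A.pairing (negFst A B)).lift

/-- The universal binary morphism. -/
noncomputable def univ (A B : Envelope P J) : Hom₂ A B (tensor A B) where
  pos := tmul A.pos B.pos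
  fst := negFst A B
  snd := negSnd A B
  compat_fst _ _ _ := (selfModule P J).isModule.perm_perm_self
  compat_snd a b c := c.2 a b

/-- The morphism out of the tensor product that a binary morphism induces. -/
noncomputable def desc {A B C : Envelope P J} (k : Hom₂ A B C) : tensor A B ⟶ C where
  pos := lift (U := A.pos) (V := B.pos) (W := C.pos) k.pos
  neg :=
    { toFun := fun c => ⟨(curry (U := B.pos) (V := C.neg) (W := A.neg) k.fst c,
        curry (U := A.pos) (V := C.neg) (W := B.neg) k.snd c), fun a b => k.compat_snd a b c⟩
      map_perm := fun σ τ c => Subtype.ext (Prod.ext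
        ((curry (U := B.pos) (V := C.neg) (W := A.neg) k.fst).map_perm σ τ c)
        ((curry (U := A.pos) (V := C.neg) (W := B.neg) k.snd).map_perm σ τ c))
      map_left := fun f c => Subtype.ext (Prod.ext
        ((curry (U := B.pos) (V := C.neg) (W := A.neg) k.fst).map_left f c)
        ((curry (U := A.pos) (V := C.neg) (W := B.neg) k.snd).map_left f c))
      map_right := fun c g => Subtype.ext (Prod.ext
        ((curry (U := B.pos) (V := C.neg) (W := A.neg) k.fst).map_right c g)
        ((curry (U := A.pos) (V := C.neg) (W := B.neg) k.snd).map_right c g)) }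
  compat {_ _ Γ₂ Δ₂} z c := by
    refine congrArg (fun φ : PJModule.Hom (PJModule.tensor A.pos B.pos)
      ((selfModule P J).shiftR Γ₂ Δ₂) => φ z) (tensor_hom_ext
      (φ := (lift (U := A.pos) (V := B.pos) (W := C.pos) k.pos).comp (homR C.pairing c))
      (ψ := homR (tensor A B).pairing ⟨(curry (U := B.pos) (V := C.neg) (W := A.neg) k.fst c,
        curry (U := A.pos) (V := C.neg) (W := B.neg) k.snd c), fun a b => k.compat_snd a b c⟩)
      fun a b => ?_)
    exact (selfModule P J).isModule.eq_perm_symm (k.compat_fst a b c)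

/-- Morphisms out of a tensor product are determined by their values on the universal binary
morphism, in all three of its components. -/
theorem tensor_ext {A B C : Envelope P J} {f g : tensor A B ⟶ C}
    (hp : ∀ {Γ₁ Δ₁ Γ₂ Δ₂ : List P.Ob} (a : A.pos.obj Γ₁ Δ₁) (b : B.pos.obj Γ₂ Δ₂),
      mapPos f ((univ A B).pos a b) = mapPos g ((univ A B).pos a b))
    (h₁ : ∀ {Γ₁ Δ₁ Γ₂ Δ₂ : List P.Ob} (b : B.pos.obj Γ₁ Δ₁) (c : C.neg.obj Γ₂ Δ₂),
      (univ A B).fst b (mapNeg f c) = (univ A B).fst b (mapNeg g c))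
    (h₂ : ∀ {Γ₁ Δ₁ Γ₂ Δ₂ : List P.Ob} (a : A.pos.obj Γ₁ Δ₁) (c : C.neg.obj Γ₂ Δ₂),
      (univ A B).snd a (mapNeg f c) = (univ A B).snd a (mapNeg g c)) : f = g :=
  Hom.ext (tensor_hom_ext hp) (Hom.ext' fun _ _ c => Subtype.ext (Prod.ext
    (Hom.ext' fun _ _ b => h₁ b c) (Hom.ext' fun _ _ a => h₂ a c)))

end Envelope

/-! ### Operations on binary morphisms of the envelope -/

namespace PJModule

open ModuleStruct ModuleStruct.IsModule

variable {P : PolycategoryStruct.{u, max u w}} {J : P.Distinguished}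

theorem perm_perm (U : PJModule P J) {Γ Γ' Γ'' Δ Δ' Δ'' : List P.Ob} (σ : ListPerm Γ Γ')
    (σ' : ListPerm Γ' Γ'') (τ : ListPerm Δ Δ') (τ' : ListPerm Δ' Δ'') (x : U.obj Γ Δ) :
    U.perm σ' τ' (U.perm σ τ x) = U.perm (σ.trans σ') (τ.trans τ') x :=
  U.isModule.perm_perm _ _ _ _ _

variable {U V W : PJModule P J} [hP : Fact P.IsPolycategory]

theorem map_perm_left (k : Hom₂ U V W) {Γ₁ Γ₁' Δ₁ Δ₁' Γ₂ Δ₂ : List P.Ob} (σ : ListPerm Γ₁ Γ₁')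
    (τ : ListPerm Δ₁ Δ₁') (x : U.obj Γ₁ Δ₁) (y : V.obj Γ₂ Δ₂) :
    k (U.perm σ τ x) y = W.perm (σ.appendRight Γ₂) (τ.appendRight Δ₂) (k x y) :=
  (homR k y).map_perm σ τ x

theorem map_perm_right (k : Hom₂ U V W) {Γ₁ Δ₁ Γ₂ Γ₂' Δ₂ Δ₂' : List P.Ob} (σ : ListPerm Γ₂ Γ₂')
    (τ : ListPerm Δ₂ Δ₂') (x : U.obj Γ₁ Δ₁) (y : V.obj Γ₂ Δ₂) :
    k x (V.perm σ τ y) = W.perm (.appendLeft Γ₁ σ) (.appendLeft Δ₁ τ) (k x y) :=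
  (homL k x).map_perm σ τ y

theorem flip_flip (k : Hom₂ U V W) : flip (flip k) = k :=
  hom₂_ext fun _ _ => W.isModule.perm_perm_self

end PJModule

namespace Envelope

open ModuleStruct ModuleStruct.IsModule PJModule

variable {P : PolycategoryStruct.{u, max u w}} {J : P.Distinguished} [hP : Fact P.IsPolycategory]
  [hJ : Fact ((ModuleStruct.self P).Respects J)]

section Basic

variable {A B C D : Envelope P J}

omit hP hJ in
theorem hom_ext {f g : A ⟶ B} (hp : ∀ {Γ Δ : List P.Ob} (a : A.pos.obj Γ Δ), mapPos f a = mapPos g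
    a)
    (hn : ∀ {Γ Δ : List P.Ob} (b : B.neg.obj Γ Δ), mapNeg f b = mapNeg g b) : f = g :=
  Hom.ext (Hom.ext' fun _ _ a => hp a) (Hom.ext' fun _ _ b => hn b)

omit hP hJ in
theorem mapPos_perm (f : A ⟶ B) {Γ Γ' Δ Δ' : List P.Ob} (σ : ListPerm Γ Γ') (τ : ListPerm Δ Δ')
    (a : A.pos.obj Γ Δ) : mapPos f (A.pos.perm σ τ a) = B.pos.perm σ τ (mapPos f a) :=
  (Hom.pos f).map_perm σ τ a

omit hP hJ in
theorem mapNeg_perm (f : A ⟶ B) {Γ Γ' Δ Δ' : List P.Ob} (σ : ListPerm Γ Γ') (τ : ListPerm Δ Δ')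
    (b : B.neg.obj Γ Δ) : mapNeg f (B.neg.perm σ τ b) = A.neg.perm σ τ (mapNeg f b) :=
  (Hom.neg f).map_perm σ τ b

omit hP hJ in
theorem mapPos_comp (f : A ⟶ B) (g : B ⟶ C) {Γ Δ : List P.Ob} (a : A.pos.obj Γ Δ) :
    mapPos (f ≫ g) a = mapPos g (mapPos f a) := rfl

omit hP hJ in
theorem mapNeg_comp (f : A ⟶ B) (g : B ⟶ C) {Γ Δ : List P.Ob} (c : C.neg.obj Γ Δ) :
    mapNeg (f ≫ g) c = mapNeg f (mapNeg g c) := rfl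

omit hP hJ in
theorem mapPos_id {Γ Δ : List P.Ob} (a : A.pos.obj Γ Δ) : mapPos (𝟙 A) a = a := rfl

omit hP hJ in
theorem mapNeg_id {Γ Δ : List P.Ob} (a : A.neg.obj Γ Δ) : mapNeg (𝟙 A) a = a := rfl

omit hP hJ in
theorem pair_map (f : A ⟶ B) {Γ₁ Δ₁ Γ₂ Δ₂ : List P.Ob} (a : A.pos.obj Γ₁ Δ₁)
    (b : B.neg.obj Γ₂ Δ₂) : B.pair (mapPos f a) b = A.pair a (mapNeg f b) :=
  Hom.compat f a b

theorem pair_perm_left (A : Envelope P J) {Γ₁ Γ₁' Δ₁ Δ₁' Γ₂ Δ₂ : List P.Ob}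
    (σ : ListPerm Γ₁ Γ₁') (τ : ListPerm Δ₁ Δ₁') (x : A.pos.obj Γ₁ Δ₁) (y : A.neg.obj Γ₂ Δ₂) :
    A.pair (A.pos.perm σ τ x) y = P.perm (σ.appendRight Γ₂) (τ.appendRight Δ₂) (A.pair x y) :=
  map_perm_left A.pairing σ τ x y

theorem pair_perm_right (A : Envelope P J) {Γ₁ Δ₁ Γ₂ Γ₂' Δ₂ Δ₂' : List P.Ob}
    (σ : ListPerm Γ₂ Γ₂') (τ : ListPerm Δ₂ Δ₂') (x : A.pos.obj Γ₁ Δ₁) (y : A.neg.obj Γ₂ Δ₂) :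
    A.pair x (A.neg.perm σ τ y) = P.perm (.appendLeft Γ₁ σ) (.appendLeft Δ₁ τ) (A.pair x y) :=
  map_perm_right A.pairing σ τ x y

omit hJ in
theorem self_perm_perm {Γ Γ' Γ'' Δ Δ' Δ'' : List P.Ob} (σ : ListPerm Γ Γ')
    (σ' : ListPerm Γ' Γ'') (τ : ListPerm Δ Δ') (τ' : ListPerm Δ' Δ'') (x : P.Hom Γ Δ) :
    P.perm σ' τ' (P.perm σ τ x) = P.perm (σ.trans σ') (τ.trans τ') x :=
  hP.out.perm_perm (U := ModuleStruct.self P) _ _ _ _ _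

/-- The dual `(A⁻, A⁺)` of an object `(A⁺, A⁻)`. -/
def star (A : Envelope P J) : Envelope P J where
  pos := A.neg
  neg := A.pos
  pair := flip A.pairing

/-- The symmetry `Hom(A, B*) ≅ Hom(B, A*)`. -/
def transpose (f : A ⟶ B.star) : B ⟶ A.star where
  pos := Hom.neg f
  neg := Hom.pos f
  compat b a := (congrArg (P.perm (.comm _ _) (.comm _ _)) (Hom.compat f a b).symm).trans
    (hP.out.perm_perm_self (U := ModuleStruct.self P))

/-- The action of the duality on morphisms. -/
def starMap (f : A ⟶ B) : B.star ⟶ A.star where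
  pos := Hom.neg f
  neg := Hom.pos f
  compat b a := congrArg (P.perm (.comm _ _) (.comm _ _)) (Hom.compat f a b).symm

namespace Hom₂

/-- Composition of a binary morphism with morphisms. -/
def precomp {A' B' : Envelope P J} (f : A' ⟶ A) (g : B' ⟶ B) (k : Hom₂ A B C) :
    Hom₂ A' B' C where
  pos := PJModule.precomp (Hom.pos f) (Hom.pos g) (k.pos : PJModule.Hom₂ A.pos B.pos C.pos)
  fst := compHom (PJModule.precomp (Hom.pos g) (.id _)
    (k.fst : PJModule.Hom₂ B.pos C.neg A.neg)) (Hom.neg f)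
  snd := compHom (PJModule.precomp (Hom.pos f) (.id _)
    (k.snd : PJModule.Hom₂ A.pos C.neg B.neg)) (Hom.neg g)
  compat_fst a b c := (k.compat_fst _ _ c).trans (Hom.compat f a _)
  compat_snd a b c := by
    refine Eq.trans (congrArg _ (Hom.compat f a (k.fst (Hom.pos g b) c)).symm) ?_
    exact (k.compat_snd _ _ c).trans (Hom.compat g b _)

/-- Composition of a binary morphism with a morphism. -/
def postcomp (k : Hom₂ A B C) (h : C ⟶ D) : Hom₂ A B D where
  pos := compHom (k.pos : PJModule.Hom₂ A.pos B.pos C.pos) (Hom.pos h)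
  fst := PJModule.precomp (.id _) (Hom.neg h) (k.fst : PJModule.Hom₂ B.pos C.neg A.neg)
  snd := PJModule.precomp (.id _) (Hom.neg h) (k.snd : PJModule.Hom₂ A.pos C.neg B.neg)
  compat_fst a b d := (congrArg _ (Hom.compat h (k.pos a b) d)).trans (k.compat_fst a b _)
  compat_snd a b _ := k.compat_snd a b _

/-- Exchange of the two arguments. -/
def flip (k : Hom₂ A B C) : Hom₂ B A C where
  pos := PJModule.flip (k.pos : PJModule.Hom₂ A.pos B.pos C.pos)
  fst := k.snd
  snd := k.fst
  compat_fst {Γ₁ Δ₁ Γ₂ Δ₂ Γ₃ Δ₃} b a c := by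
    rw [← k.compat_snd, ← k.compat_fst]
    refine (congrArg _ (pair_perm_left C (.comm Γ₂ Γ₁) (.comm Δ₂ Δ₁) (k.pos a b) c)).trans ?_
    exact hP.out.perm_eq₂₂ (U := ModuleStruct.self P)
  compat_snd b a c := by
    rw [← k.compat_snd]
    exact hP.out.perm_perm_self (U := ModuleStruct.self P)

/-- A binary morphism `(A, B) → C` as a binary morphism `(A, C*) → B*`. -/
def rotate (k : Hom₂ A B C) : Hom₂ A C.star B.star where
  pos := k.snd
  fst := PJModule.flip (k.fst : PJModule.Hom₂ B.pos C.neg A.neg)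
  snd := k.pos
  compat_fst {Γ₁ Δ₁ Γ₂ Δ₂ Γ₃ Δ₃} a c b := by
    refine Eq.trans ?_ (pair_perm_right A (.comm Γ₃ Γ₂) (.comm Δ₃ Δ₂) a (k.fst b c)).symm
    refine (perm_arg (U := ModuleStruct.self P) (perm_arg (U := ModuleStruct.self P)
      (k.compat_snd a b c).symm)).trans ?_
    exact hP.out.perm_eq₃₁ (U := ModuleStruct.self P)
  compat_snd {Γ₁ Δ₁ Γ₂ Δ₂ Γ₃ Δ₃} a c b := by
    refine (congrArg _ (pair_perm_right A (.comm Γ₃ Γ₂) (.comm Δ₃ Δ₂) a (k.fst b c))).trans ?_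
    refine (perm_arg (U := ModuleStruct.self P) (perm_arg (U := ModuleStruct.self P)
      (k.compat_fst a b c).symm)).trans ?_
    exact hP.out.perm_eq₃₁ (U := ModuleStruct.self P)

/-- A binary morphism `(A, C*) → B*` as a binary morphism `(A, B) → C`. -/
def unrotate (k : Hom₂ A C.star B.star) : Hom₂ A B C where
  pos := k.snd
  fst := PJModule.flip (k.fst : PJModule.Hom₂ C.neg B.pos A.neg)
  snd := k.pos
  compat_fst {Γ₁ Δ₁ Γ₂ Δ₂ Γ₃ Δ₃} a b c := by
    refine Eq.trans ?_ (pair_perm_right A (.comm Γ₃ Γ₂) (.comm Δ₃ Δ₂) a (k.fst c b)).symm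
    have h : P.perm (leftComm Γ₁ Γ₃ Γ₂) (leftComm Δ₁ Δ₃ Δ₂) (A.pair a (k.fst c b)) =
      P.perm (.comm _ _) (.comm _ _) (C.pair (k.snd a b) c) := k.compat_snd a c b
    refine Eq.trans ?_ (perm_arg (U := ModuleStruct.self P)
      (hP.out.eq_perm_symm (U := ModuleStruct.self P) h)).symm
    exact hP.out.perm_eq₁₃ (U := ModuleStruct.self P)
  compat_snd {Γ₁ Δ₁ Γ₂ Δ₂ Γ₃ Δ₃} a b c := by
    have h : P.perm (assoc Γ₁ Γ₃ Γ₂) (assoc Δ₁ Δ₃ Δ₂) (P.perm (.comm _ _) (.comm _ _)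
      (B.pair b (k.pos a c))) = A.pair a (k.fst c b) := k.compat_fst a c b
    refine (congrArg _ (pair_perm_right A (.comm Γ₃ Γ₂) (.comm Δ₃ Δ₂) a (k.fst c b))).trans ?_
    refine (perm_arg (U := ModuleStruct.self P) (perm_arg (U := ModuleStruct.self P) h.symm)).trans
        ?_
    refine (perm_arg (U := ModuleStruct.self P) (self_perm_perm _ _ _ _ _)).trans
      ((self_perm_perm _ _ _ _ _).trans ((self_perm_perm _ _ _ _ _).trans ?_))
    exact hP.out.perm_eq_self (U := ModuleStruct.self P)

end Hom₂

end Basic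

end Envelope

/-! ### Tensor product of morphisms, braiding and closed structure -/

namespace PJModule

open ModuleStruct ModuleStruct.IsModule

variable {P : PolycategoryStruct.{u, max u w}} {J : P.Distinguished}

theorem tensor_apply_ext {U V W : PJModule P J} {φ ψ : Hom (tensor U V) W}
    (h : ∀ {Γ₁ Δ₁ Γ₂ Δ₂ : List P.Ob} (x : U.obj Γ₁ Δ₁) (y : V.obj Γ₂ Δ₂),
      φ (tmul U V x y) = ψ (tmul U V x y)) {Γ Δ : List P.Ob} (t : (tensor U V).obj Γ Δ) :
    φ t = ψ t :=
  congrArg (fun χ : Hom (tensor U V) W => χ t) (tensor_hom_ext h)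

end PJModule

namespace Envelope

open ModuleStruct ModuleStruct.IsModule PJModule

variable {P : PolycategoryStruct.{u, max u w}} {J : P.Distinguished} [hP : Fact P.IsPolycategory]
  [hJ : Fact ((ModuleStruct.self P).Respects J)]

section

variable {A A' A'' B B' B'' C C' D E : Envelope P J}
  {Γ Δ Γ₁ Δ₁ Γ₂ Δ₂ Γ₃ Δ₃ Γ₄ Δ₄ : List P.Ob}

theorem pair_univ (a : A.pos.obj Γ₁ Δ₁) (b : B.pos.obj Γ₂ Δ₂) (n : (tensor A B).neg.obj Γ₃ Δ₃) :
    (tensor A B).pair ((univ A B).pos a b) n = P.perm (assoc Γ₁ Γ₂ Γ₃).symm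
      (assoc Δ₁ Δ₂ Δ₃).symm (A.pair a ((univ A B).fst b n)) := rfl

theorem tensorNeg_ext {m n : (tensor A B).neg.obj Γ Δ}
    (h₁ : ∀ {Γ₁ Δ₁ : List P.Ob} (b : B.pos.obj Γ₁ Δ₁),
      (univ A B).fst b m = (univ A B).fst b n)
    (h₂ : ∀ {Γ₁ Δ₁ : List P.Ob} (a : A.pos.obj Γ₁ Δ₁),
      (univ A B).snd a m = (univ A B).snd a n) : m = n :=
  Subtype.ext (Prod.ext (Hom.ext' fun _ _ b => h₁ b) (Hom.ext' fun _ _ a => h₂ a))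

/-- Equality of morphisms out of an iterated tensor product is an equality of one multimorphism to
the positive part and of one multimorphism to the negative part of each factor. -/
theorem tensor_ext₃ {f g : tensor (tensor A B) C ⟶ D}
    (hp : ∀ {Γ₁ Δ₁ Γ₂ Δ₂ Γ₃ Δ₃ : List P.Ob} (a : A.pos.obj Γ₁ Δ₁) (b : B.pos.obj Γ₂ Δ₂)
      (c : C.pos.obj Γ₃ Δ₃), mapPos f ((univ _ C).pos ((univ A B).pos a b) c) =
        mapPos g ((univ _ C).pos ((univ A B).pos a b) c))
    (h₁ : ∀ {Γ₁ Δ₁ Γ₂ Δ₂ Γ₃ Δ₃ : List P.Ob} (b : B.pos.obj Γ₁ Δ₁) (c : C.pos.obj Γ₂ Δ₂)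
      (d : D.neg.obj Γ₃ Δ₃), (univ A B).fst b ((univ _ C).fst c (mapNeg f d)) =
        (univ A B).fst b ((univ _ C).fst c (mapNeg g d)))
    (h₂ : ∀ {Γ₁ Δ₁ Γ₂ Δ₂ Γ₃ Δ₃ : List P.Ob} (a : A.pos.obj Γ₁ Δ₁) (c : C.pos.obj Γ₂ Δ₂)
      (d : D.neg.obj Γ₃ Δ₃), (univ A B).snd a ((univ _ C).fst c (mapNeg f d)) =
        (univ A B).snd a ((univ _ C).fst c (mapNeg g d)))
    (h₃ : ∀ {Γ₁ Δ₁ Γ₂ Δ₂ Γ₃ Δ₃ : List P.Ob} (a : A.pos.obj Γ₁ Δ₁) (b : B.pos.obj Γ₂ Δ₂)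
      (d : D.neg.obj Γ₃ Δ₃), (univ _ C).snd ((univ A B).pos a b) (mapNeg f d) =
        (univ _ C).snd ((univ A B).pos a b) (mapNeg g d)) : f = g := by
  refine tensor_ext (fun {Γ₁ Δ₁ Γ₂ Δ₂} t c => ?_)
    (fun c d => tensorNeg_ext (fun b => h₁ b c d) fun a => h₂ a c d)
    (fun {Γ₁ Δ₁ Γ₂ Δ₂} t d => ?_)
  · exact tensor_apply_ext (U := A.pos) (V := B.pos) (W := D.pos.shiftR Γ₂ Δ₂)
      (φ := (homR (univ (tensor A B) C).pos c).comp ((Hom.pos f).shiftR _ _))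
      (ψ := (homR (univ (tensor A B) C).pos c).comp ((Hom.pos g).shiftR _ _))
      (fun a b => hp a b c) t
  · exact tensor_apply_ext (U := A.pos) (V := B.pos) (W := C.neg.shiftR Γ₂ Δ₂)
      (φ := homR (univ (tensor A B) C).snd (mapNeg f d))
      (ψ := homR (univ (tensor A B) C).snd (mapNeg g d))
      (fun a b => h₃ a b d) t

/-- The fourfold analogue of `tensor_ext₃`. -/
theorem tensor_ext₄ {f g : tensor (tensor (tensor A B) C) D ⟶ E}
    (hp : ∀ {Γ₁ Δ₁ Γ₂ Δ₂ Γ₃ Δ₃ Γ₄ Δ₄ : List P.Ob} (a : A.pos.obj Γ₁ Δ₁) (b : B.pos.obj Γ₂ Δ₂)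
      (c : C.pos.obj Γ₃ Δ₃) (d : D.pos.obj Γ₄ Δ₄),
      mapPos f ((univ _ D).pos ((univ _ C).pos ((univ A B).pos a b) c) d) =
        mapPos g ((univ _ D).pos ((univ _ C).pos ((univ A B).pos a b) c) d))
    (h₁ : ∀ {Γ₁ Δ₁ Γ₂ Δ₂ Γ₃ Δ₃ Γ₄ Δ₄ : List P.Ob} (b : B.pos.obj Γ₁ Δ₁) (c : C.pos.obj Γ₂ Δ₂)
      (d : D.pos.obj Γ₃ Δ₃) (e : E.neg.obj Γ₄ Δ₄),
      (univ A B).fst b ((univ _ C).fst c ((univ _ D).fst d (mapNeg f e))) =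
        (univ A B).fst b ((univ _ C).fst c ((univ _ D).fst d (mapNeg g e))))
    (h₂ : ∀ {Γ₁ Δ₁ Γ₂ Δ₂ Γ₃ Δ₃ Γ₄ Δ₄ : List P.Ob} (a : A.pos.obj Γ₁ Δ₁) (c : C.pos.obj Γ₂ Δ₂)
      (d : D.pos.obj Γ₃ Δ₃) (e : E.neg.obj Γ₄ Δ₄),
      (univ A B).snd a ((univ _ C).fst c ((univ _ D).fst d (mapNeg f e))) =
        (univ A B).snd a ((univ _ C).fst c ((univ _ D).fst d (mapNeg g e))))
    (h₃ : ∀ {Γ₁ Δ₁ Γ₂ Δ₂ Γ₃ Δ₃ Γ₄ Δ₄ : List P.Ob} (a : A.pos.obj Γ₁ Δ₁) (b : B.pos.obj Γ₂ Δ₂)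
      (d : D.pos.obj Γ₃ Δ₃) (e : E.neg.obj Γ₄ Δ₄),
      (univ _ C).snd ((univ A B).pos a b) ((univ _ D).fst d (mapNeg f e)) =
        (univ _ C).snd ((univ A B).pos a b) ((univ _ D).fst d (mapNeg g e)))
    (h₄ : ∀ {Γ₁ Δ₁ Γ₂ Δ₂ Γ₃ Δ₃ Γ₄ Δ₄ : List P.Ob} (a : A.pos.obj Γ₁ Δ₁) (b : B.pos.obj Γ₂ Δ₂)
      (c : C.pos.obj Γ₃ Δ₃) (e : E.neg.obj Γ₄ Δ₄),
      (univ _ D).snd ((univ _ C).pos ((univ A B).pos a b) c) (mapNeg f e) =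
        (univ _ D).snd ((univ _ C).pos ((univ A B).pos a b) c) (mapNeg g e)) : f = g := by
  refine tensor_ext₃ (fun {Γ₁ Δ₁ Γ₂ Δ₂ Γ₃ Δ₃} t c d => ?_)
    (fun c d e => tensorNeg_ext (fun b => h₁ b c d e) fun a => h₂ a c d e)
    (fun {Γ₁ Δ₁ Γ₂ Δ₂ Γ₃ Δ₃} t d e => ?_) (fun {Γ₁ Δ₁ Γ₂ Δ₂ Γ₃ Δ₃} t c e => ?_)
  · exact tensor_apply_ext (U := A.pos) (V := B.pos) (W := (E.pos.shiftR Γ₃ Δ₃).shiftR Γ₂ Δ₂)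
      (φ := ((homR (univ _ C).pos c).comp ((homR (univ _ D).pos d).shiftR _ _)).comp
        (((Hom.pos f).shiftR _ _).shiftR _ _))
      (ψ := ((homR (univ _ C).pos c).comp ((homR (univ _ D).pos d).shiftR _ _)).comp
        (((Hom.pos g).shiftR _ _).shiftR _ _))
      (fun a b => hp a b c d) t
  · exact tensor_apply_ext (U := A.pos) (V := B.pos) (W := C.neg.shiftR (Γ₂ ++ Γ₃) (Δ₂ ++ Δ₃))
      (φ := homR (univ _ C).snd ((univ _ D).fst d (mapNeg f e)))
      (ψ := homR (univ _ C).snd ((univ _ D).fst d (mapNeg g e)))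
      (fun a b => h₃ a b d e) t
  · exact tensor_apply_ext (U := A.pos) (V := B.pos) (W := (D.neg.shiftR Γ₃ Δ₃).shiftR Γ₂ Δ₂)
      (φ := (homR (univ _ C).pos c).comp ((homR (univ _ D).snd (mapNeg f e)).shiftR _ _))
      (ψ := (homR (univ _ C).pos c).comp ((homR (univ _ D).snd (mapNeg g e)).shiftR _ _))
      (fun a b => h₄ a b c e) t

/-- The tensor product of two morphisms. -/
noncomputable def tensorMap (f : A ⟶ A') (g : B ⟶ B') : tensor A B ⟶ tensor A' B' :=
  desc ((univ A' B').precomp f g)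

theorem tensorMap_pos (f : A ⟶ A') (g : B ⟶ B') (a : A.pos.obj Γ₁ Δ₁) (b : B.pos.obj Γ₂ Δ₂) :
    mapPos (tensorMap f g) ((univ A B).pos a b) = (univ A' B').pos (mapPos f a) (mapPos g b) := rfl

theorem tensorMap_fst (f : A ⟶ A') (g : B ⟶ B') (b : B.pos.obj Γ₁ Δ₁)
    (c : (tensor A' B').neg.obj Γ₂ Δ₂) :
    (univ A B).fst b (mapNeg (tensorMap f g) c) = mapNeg f ((univ A' B').fst (mapPos g b) c) := rfl

theorem tensorMap_snd (f : A ⟶ A') (g : B ⟶ B') (a : A.pos.obj Γ₁ Δ₁)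
    (c : (tensor A' B').neg.obj Γ₂ Δ₂) :
    (univ A B).snd a (mapNeg (tensorMap f g) c) = mapNeg g ((univ A' B').snd (mapPos f a) c) := rfl

theorem tensorMap_id (A B : Envelope P J) : tensorMap (𝟙 A) (𝟙 B) = 𝟙 (tensor A B) :=
  tensor_ext (fun _ _ => rfl) (fun _ _ => rfl) (fun _ _ => rfl)

theorem tensorMap_comp (f : A ⟶ A') (f' : A' ⟶ A'') (g : B ⟶ B') (g' : B' ⟶ B'') :
    tensorMap (f ≫ f') (g ≫ g') = tensorMap f g ≫ tensorMap f' g' :=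
  tensor_ext (fun _ _ => rfl) (fun _ _ => rfl) (fun _ _ => rfl)

/-- The symmetry of the tensor product. -/
noncomputable def braid (A B : Envelope P J) : tensor A B ⟶ tensor B A :=
  desc (univ B A).flip

theorem braid_pos (a : A.pos.obj Γ₁ Δ₁) (b : B.pos.obj Γ₂ Δ₂) :
    mapPos (braid A B) ((univ A B).pos a b) =
      (tensor B A).pos.perm (.comm Γ₂ Γ₁) (.comm Δ₂ Δ₁) ((univ B A).pos b a) := rfl

theorem braid_fst (b : B.pos.obj Γ₁ Δ₁) (c : (tensor B A).neg.obj Γ₂ Δ₂) :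
    (univ A B).fst b (mapNeg (braid A B) c) = (univ B A).snd b c := rfl

theorem braid_snd (a : A.pos.obj Γ₁ Δ₁) (c : (tensor B A).neg.obj Γ₂ Δ₂) :
    (univ A B).snd a (mapNeg (braid A B) c) = (univ B A).fst a c := rfl

theorem braid_braid (A B : Envelope P J) : braid A B ≫ braid B A = 𝟙 (tensor A B) :=
  tensor_ext
    (fun {Γ₁ Δ₁ Γ₂ Δ₂} a b => (mapPos_perm (braid B A) (.comm Γ₂ Γ₁) (.comm Δ₂ Δ₁)
      ((univ B A).pos b a)).trans ((tensor A B).pos.isModule.perm_perm_self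
        (σ := .comm Γ₁ Γ₂) (σ' := .comm Γ₂ Γ₁) (τ := .comm Δ₁ Δ₂) (τ' := .comm Δ₂ Δ₁)
          (x := (univ A B).pos a b)))
    (fun _ _ => rfl) (fun _ _ => rfl)

theorem braid_naturality (f : A ⟶ A') (g : B ⟶ B') :
    tensorMap f g ≫ braid A' B' = braid A B ≫ tensorMap g f :=
  tensor_ext
    (fun {Γ₁ Δ₁ Γ₂ Δ₂} a b => (mapPos_perm (tensorMap g f) (.comm Γ₂ Γ₁) (.comm Δ₂ Δ₁)
      ((univ B A).pos b a)).symm)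
    (fun _ _ => rfl) (fun _ _ => rfl)

/-- The internal hom of the Chu construction. -/
noncomputable def internalHom (A B : Envelope P J) : Envelope P J :=
  (tensor A B.star).star

/-- Transposition `Hom(A ⊗ B, C) → Hom(B, A ⊸ C)`. A binary morphism `(A, B) → C` is the same as a
binary morphism `(A, C*) → B*`. -/
noncomputable def curryHom (h : tensor A B ⟶ C) : B ⟶ internalHom A C :=
  transpose (desc ((univ A B).postcomp h).rotate)

/-- The inverse of `curryHom`. -/
noncomputable def uncurryHom (h : B ⟶ internalHom A C) : tensor A B ⟶ C :=
  desc ((univ A C.star).postcomp (transpose h)).unrotate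

theorem uncurryHom_pos (h : B ⟶ internalHom A C) (a : A.pos.obj Γ₁ Δ₁) (b : B.pos.obj Γ₂ Δ₂) :
    mapPos (uncurryHom h) ((univ A B).pos a b) = (univ A C.star).snd a (mapPos h b) := rfl

theorem uncurryHom_fst (h : B ⟶ internalHom A C) (b : B.pos.obj Γ₁ Δ₁) (c : C.neg.obj Γ₂ Δ₂) :
    (univ A B).fst b (mapNeg (uncurryHom h) c) =
      A.neg.perm (.comm _ _) (.comm _ _) ((univ A C.star).fst c (mapPos h b)) := rfl

theorem uncurryHom_curryHom (h : tensor A B ⟶ C) : uncurryHom (curryHom h) = h :=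
  tensor_ext (fun _ _ => rfl) (fun _ _ => A.neg.isModule.perm_perm_self) (fun _ _ => rfl)

theorem curryHom_uncurryHom (h : B ⟶ internalHom A C) : curryHom (uncurryHom h) = h := by
  refine congrArg (transpose (A := tensor A C.star) (B := B)) (tensor_ext
    (f := transpose (curryHom (uncurryHom h))) (g := transpose h)
    (fun _ _ => rfl) (fun _ _ => A.neg.isModule.perm_perm_self) (fun _ _ => rfl))

theorem curryHom_naturality (f : B' ⟶ B) (h : tensor A B ⟶ C) :
    curryHom (tensorMap (𝟙 A) f ≫ h) = f ≫ curryHom h :=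
  congrArg (transpose (A := tensor A C.star) (B := B')) (tensor_ext
    (f := transpose (curryHom (tensorMap (𝟙 A) f ≫ h))) (g := transpose (f ≫ curryHom h))
    (fun _ _ => rfl) (fun _ _ => rfl) (fun _ _ => rfl))

/-- The adjunction between the tensor product and the internal hom. -/
noncomputable def curryEquiv (A B C : Envelope P J) :
    (tensor A B ⟶ C) ≃ (B ⟶ internalHom A C) where
  toFun := curryHom
  invFun := uncurryHom
  left_inv := uncurryHom_curryHom
  right_inv := curryHom_uncurryHom

end

/-! ### The associator -/

section

variable {A A' B B' C C' D : Envelope P J} {Γ Δ Γ₁ Δ₁ Γ₂ Δ₂ Γ₃ Δ₃ Γ₄ Δ₄ : List P.Ob}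

/-- A multimorphism to the negative part of a tensor product, from its two components. -/
def pairNeg {U V : PJModule P J} (k₁ : PJModule.Hom₂ U V (homModule B.pos A.neg))
    (k₂ : PJModule.Hom₂ U V (homModule A.pos B.neg))
    (h : ∀ {Γ₁ Δ₁ Γ₂ Δ₂ : List P.Ob} (x : U.obj Γ₁ Δ₁) (y : V.obj Γ₂ Δ₂),
      Compatible (A := A) (B := B) (k₁ x y) (k₂ x y)) : PJModule.Hom₂ U V (tensorNeg A B) where
  toFun x y := ⟨(k₁ x y, k₂ x y), h x y⟩
  map_perm _ _ _ _ _ _ := Subtype.ext (Prod.ext (k₁.map_perm _ _ _ _ _ _) (k₂.map_perm _ _ _ _ _ _))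
  map_left₁ _ _ _ := Subtype.ext (Prod.ext (k₁.map_left₁ _ _ _) (k₂.map_left₁ _ _ _))
  map_right₁ _ _ _ := Subtype.ext (Prod.ext (k₁.map_right₁ _ _ _) (k₂.map_right₁ _ _ _))
  map_left₂ _ _ _ := Subtype.ext (Prod.ext (k₁.map_left₂ _ _ _) (k₂.map_left₂ _ _ _))
  map_right₂ _ _ _ := Subtype.ext (Prod.ext (k₁.map_right₂ _ _ _) (k₂.map_right₂ _ _ _))

/-- The ternary multimorphism `(a, b, c) ↦ a ⊗ (b ⊗ c)`. -/
noncomputable def assocPos (A B C : Envelope P J) :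
    Hom₃ A.pos B.pos C.pos (tensor A (tensor B C)).pos :=
  .comp₂ (univ A (tensor B C)).pos (univ B C).pos

/-- Evaluation of an element of the negative part of `A ⊗ (B ⊗ C)` at elements of `B⁺` and `C⁺`. -/
noncomputable def assocFst (A B C : Envelope P J) :
    Hom₃ B.pos C.pos (tensor A (tensor B C)).neg A.neg :=
  .comp₁ (univ A (tensor B C)).fst (univ B C).pos

/-- Evaluation at elements of `A⁺` and `C⁺`. -/
noncomputable def assocSnd (A B C : Envelope P J) :
    Hom₃ A.pos C.pos (tensor A (tensor B C)).neg B.neg :=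
  (Hom₃.comp₂ (univ B C).fst (univ A (tensor B C)).snd).swap

/-- Evaluation at elements of `A⁺` and `B⁺`. -/
noncomputable def assocTrd (A B C : Envelope P J) :
    Hom₃ A.pos B.pos (tensor A (tensor B C)).neg C.neg :=
  (Hom₃.comp₂ (univ B C).snd (univ A (tensor B C)).snd).swap

theorem assocSnd_app (a : A.pos.obj Γ₁ Δ₁) (c : C.pos.obj Γ₂ Δ₂)
    (d : (tensor A (tensor B C)).neg.obj Γ₃ Δ₃) : (assocSnd A B C).app a c d =
      B.neg.perm (leftComm Γ₂ Γ₁ Γ₃) (leftComm Δ₂ Δ₁ Δ₃)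
        ((univ B C).fst c ((univ A (tensor B C)).snd a d)) :=
  Hom₃.swap_app _ c a d

theorem assocTrd_app (a : A.pos.obj Γ₁ Δ₁) (b : B.pos.obj Γ₂ Δ₂)
    (d : (tensor A (tensor B C)).neg.obj Γ₃ Δ₃) : (assocTrd A B C).app a b d =
      C.neg.perm (leftComm Γ₂ Γ₁ Γ₃) (leftComm Δ₂ Δ₁ Δ₃)
        ((univ B C).snd b ((univ A (tensor B C)).snd a d)) :=
  Hom₃.swap_app _ b a d

theorem pair_snd_assoc (a : A.pos.obj Γ₁ Δ₁) (b : B.pos.obj Γ₂ Δ₂) (c : C.pos.obj Γ₃ Δ₃)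
    (d : (tensor A (tensor B C)).neg.obj Γ₄ Δ₄) :
    B.pair b ((univ B C).fst c ((univ A (tensor B C)).snd a d)) =
      P.perm ((leftComm Γ₁ (Γ₂ ++ Γ₃) Γ₄).trans (assoc Γ₂ Γ₃ (Γ₁ ++ Γ₄)))
        ((leftComm Δ₁ (Δ₂ ++ Δ₃) Δ₄).trans (assoc Δ₂ Δ₃ (Δ₁ ++ Δ₄)))
        (A.pair a ((univ A (tensor B C)).fst ((univ B C).pos b c) d)) := by
  have h := (univ A (tensor B C)).compat_snd a ((univ B C).pos b c) d
  have h' := (univ B C).compat_fst b c ((univ A (tensor B C)).snd a d)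
  refine h'.symm.trans ((congrArg _ h.symm).trans ?_)
  exact self_perm_perm _ _ _ _ _

/-- The binary morphism that induces the associator. -/
noncomputable def assocHom₂ (A B C : Envelope P J) :
    Hom₂ (tensor A B) C (tensor A (tensor B C)) where
  pos := (assocPos A B C).lift
  fst := pairNeg (assocFst A B C).curry (assocSnd A B C).curry
    fun {Γ₃ Δ₃ Γ₄ Δ₄} c d {Γ₁ Δ₁ Γ₂ Δ₂} a b => by
      refine Eq.trans ?_ (congrArg (B.pair b) (assocSnd_app a c d)).symm
      refine Eq.trans ?_ (pair_perm_right B (leftComm Γ₃ Γ₁ Γ₄) (leftComm Δ₃ Δ₁ Δ₄) b _).symm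
      refine Eq.trans ?_ (congrArg _ (pair_snd_assoc a b c d)).symm
      refine (congrArg _ (pair_perm_right A (assoc Γ₂ Γ₃ Γ₄) (assoc Δ₂ Δ₃ Δ₄) a _)).trans ?_
      exact hP.out.perm_eq₂₂ (U := ModuleStruct.self P)
  snd := (assocTrd A B C).lift
  compat_fst {Γ Δ Γ₃ Δ₃ Γ₄ Δ₄} t c d := by
    refine tensor_apply_ext (U := A.pos) (V := B.pos)
      (W := (selfModule P J).shiftR (Γ₃ ++ Γ₄) (Δ₃ ++ Δ₄))
      (φ := ((homR (assocPos A B C).lift c).comp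
        ((homR (tensor A (tensor B C)).pairing d).shiftR Γ₃ Δ₃)).comp
          ((selfModule P J).isModule.assocRR _ _ _ _))
      (ψ := homR (tensor A B).pairing _) (fun {Γ₁ Δ₁ Γ₂ Δ₂} a b => ?_) t
    refine (congrArg (P.perm (assoc _ _ _) (assoc _ _ _)) (pair_perm_left (tensor A (tensor B C))
      (assoc Γ₁ Γ₂ Γ₃).symm (assoc Δ₁ Δ₂ Δ₃).symm
      ((univ A (tensor B C)).pos a ((univ B C).pos b c)) d)).trans ?_
    refine Eq.trans ?_ (congrArg (P.perm (assoc _ _ _).symm (assoc _ _ _).symm)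
      (pair_perm_right A (assoc Γ₂ Γ₃ Γ₄) (assoc Δ₂ Δ₃ Δ₄) a
        ((univ A (tensor B C)).fst ((univ B C).pos b c) d))).symm
    exact hP.out.perm_eq₃₂ (U := ModuleStruct.self P)
  compat_snd {Γ Δ Γ₃ Δ₃ Γ₄ Δ₄} t c d := by
    refine tensor_apply_ext (U := A.pos) (V := B.pos)
      (W := ((selfModule P J).shiftL Γ₃ Δ₃).shiftR Γ₄ Δ₄)
      (φ := (homR (tensor A B).pairing _).comp ((selfModule P J).isModule.leftCommRL _ _ _ _))
      (ψ := (homR (assocTrd A B C).lift d).comp ((homL C.pairing c).shiftR Γ₄ Δ₄))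
      (fun {Γ₁ Δ₁ Γ₂ Δ₂} a b => ?_) t
    refine (congrArg (fun z => P.perm (leftComm _ _ _) (leftComm _ _ _)
      (P.perm (assoc _ _ _).symm (assoc _ _ _).symm z))
      (pair_perm_right A (assoc Γ₂ Γ₃ Γ₄) (assoc Δ₂ Δ₃ Δ₄) a
        ((univ A (tensor B C)).fst ((univ B C).pos b c) d))).trans ?_
    refine Eq.trans ?_ (congrArg (fun z => C.pair c (C.neg.perm (assoc _ _ _).symm
      (assoc _ _ _).symm z)) (assocTrd_app a b d)).symm
    refine Eq.trans ?_ (congrArg (C.pair c) (perm_perm C.neg _ _ _ _ _)).symm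
    refine Eq.trans ?_ (pair_perm_right C _ _ c _).symm
    refine Eq.trans ?_ (congrArg _ ((univ B C).compat_snd b c
      ((univ A (tensor B C)).snd a d)))
    refine Eq.trans ?_ (congrArg _ (congrArg _ (pair_snd_assoc a b c d))).symm
    exact hP.out.perm_eq₃₃ (U := ModuleStruct.self P)

end

end Envelope

/-! ### Coherence of the associator and the braiding -/

namespace Envelope

open ModuleStruct ModuleStruct.IsModule PJModule

variable {P : PolycategoryStruct.{u, max u w}} {J : P.Distinguished} [hP : Fact P.IsPolycategory]
  [hJ : Fact ((ModuleStruct.self P).Respects J)]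
  {A A' B B' C C' D : Envelope P J} {Γ Δ Γ' Δ' Γ₁ Δ₁ Γ₂ Δ₂ Γ₃ Δ₃ Γ₄ Δ₄ : List P.Ob}

theorem univ_pos_perm_left (σ : ListPerm Γ Γ') (τ : ListPerm Δ Δ') (a : A.pos.obj Γ Δ)
    (b : B.pos.obj Γ₁ Δ₁) : (univ A B).pos (A.pos.perm σ τ a) b =
      (tensor A B).pos.perm (σ.appendRight Γ₁) (τ.appendRight Δ₁) ((univ A B).pos a b) :=
  map_perm_left (univ A B).pos σ τ a b

theorem univ_pos_perm_right (σ : ListPerm Γ Γ') (τ : ListPerm Δ Δ') (a : A.pos.obj Γ₁ Δ₁)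
    (b : B.pos.obj Γ Δ) : (univ A B).pos a (B.pos.perm σ τ b) =
      (tensor A B).pos.perm (.appendLeft Γ₁ σ) (.appendLeft Δ₁ τ) ((univ A B).pos a b) :=
  map_perm_right (univ A B).pos σ τ a b

theorem univ_fst_perm_left (σ : ListPerm Γ Γ') (τ : ListPerm Δ Δ') (b : B.pos.obj Γ Δ)
    (n : (tensor A B).neg.obj Γ₁ Δ₁) : (univ A B).fst (B.pos.perm σ τ b) n =
      A.neg.perm (σ.appendRight Γ₁) (τ.appendRight Δ₁) ((univ A B).fst b n) :=
  map_perm_left (univ A B).fst σ τ b n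

theorem univ_fst_perm_right (σ : ListPerm Γ Γ') (τ : ListPerm Δ Δ') (b : B.pos.obj Γ₁ Δ₁)
    (n : (tensor A B).neg.obj Γ Δ) : (univ A B).fst b ((tensor A B).neg.perm σ τ n) =
      A.neg.perm (.appendLeft Γ₁ σ) (.appendLeft Δ₁ τ) ((univ A B).fst b n) :=
  map_perm_right (univ A B).fst σ τ b n

theorem univ_snd_perm_left (σ : ListPerm Γ Γ') (τ : ListPerm Δ Δ') (a : A.pos.obj Γ Δ)
    (n : (tensor A B).neg.obj Γ₁ Δ₁) : (univ A B).snd (A.pos.perm σ τ a) n =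
      B.neg.perm (σ.appendRight Γ₁) (τ.appendRight Δ₁) ((univ A B).snd a n) :=
  map_perm_left (univ A B).snd σ τ a n

theorem univ_snd_perm_right (σ : ListPerm Γ Γ') (τ : ListPerm Δ Δ') (a : A.pos.obj Γ₁ Δ₁)
    (n : (tensor A B).neg.obj Γ Δ) : (univ A B).snd a ((tensor A B).neg.perm σ τ n) =
      B.neg.perm (.appendLeft Γ₁ σ) (.appendLeft Δ₁ τ) ((univ A B).snd a n) :=
  map_perm_right (univ A B).snd σ τ a n

/-- The associator of the tensor product. -/
noncomputable def assocMap (A B C : Envelope P J) :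
    tensor (tensor A B) C ⟶ tensor A (tensor B C) :=
  desc (assocHom₂ A B C)

theorem assocMap_pos (a : A.pos.obj Γ₁ Δ₁) (b : B.pos.obj Γ₂ Δ₂) (c : C.pos.obj Γ₃ Δ₃) :
    mapPos (assocMap A B C) ((univ _ C).pos ((univ A B).pos a b) c) =
      (tensor A (tensor B C)).pos.perm (assoc Γ₁ Γ₂ Γ₃).symm (assoc Δ₁ Δ₂ Δ₃).symm
        ((univ A _).pos a ((univ B C).pos b c)) := rfl

theorem assocMap_fst (b : B.pos.obj Γ₁ Δ₁) (c : C.pos.obj Γ₂ Δ₂)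
    (d : (tensor A (tensor B C)).neg.obj Γ₃ Δ₃) :
    (univ A B).fst b ((univ _ C).fst c (mapNeg (assocMap A B C) d)) =
      A.neg.perm (assoc Γ₁ Γ₂ Γ₃) (assoc Δ₁ Δ₂ Δ₃)
        ((univ A _).fst ((univ B C).pos b c) d) := rfl

theorem assocMap_snd (a : A.pos.obj Γ₁ Δ₁) (c : C.pos.obj Γ₂ Δ₂)
    (d : (tensor A (tensor B C)).neg.obj Γ₃ Δ₃) :
    (univ A B).snd a ((univ _ C).fst c (mapNeg (assocMap A B C) d)) =
      B.neg.perm (leftComm Γ₂ Γ₁ Γ₃) (leftComm Δ₂ Δ₁ Δ₃)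
        ((univ B C).fst c ((univ A _).snd a d)) :=
  assocSnd_app a c d

theorem assocMap_trd (a : A.pos.obj Γ₁ Δ₁) (b : B.pos.obj Γ₂ Δ₂)
    (d : (tensor A (tensor B C)).neg.obj Γ₃ Δ₃) :
    (univ _ C).snd ((univ A B).pos a b) (mapNeg (assocMap A B C) d) =
      C.neg.perm ((leftComm Γ₂ Γ₁ Γ₃).trans (assoc Γ₁ Γ₂ Γ₃).symm)
        ((leftComm Δ₂ Δ₁ Δ₃).trans (assoc Δ₁ Δ₂ Δ₃).symm)
        ((univ B C).snd b ((univ A _).snd a d)) :=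
  (congrArg (C.neg.perm _ _) (assocTrd_app a b d)).trans (C.neg.perm_perm _ _ _ _ _)

theorem assocMap_naturality (f : A ⟶ A') (g : B ⟶ B') (h : C ⟶ C') :
    tensorMap (tensorMap f g) h ≫ assocMap A' B' C' =
      assocMap A B C ≫ tensorMap f (tensorMap g h) := by
  apply tensor_ext₃ <;> intros <;>
    simp only [mapPos_comp.{u, w}, mapNeg_comp.{u, w}, tensorMap_pos.{u, w}, tensorMap_fst.{u, w},
        tensorMap_snd.{u, w}, assocMap_pos.{u, w},
      assocMap_fst.{u, w}, assocMap_snd.{u, w}, assocMap_trd.{u, w}, mapPos_perm.{u, w},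
          mapNeg_perm.{u, w}]

/-- Both sides move the universal element `((a ⊗ b) ⊗ c) ⊗ d`, and its four duals, by permutations
of the contexts, so the equation is one of permutations. -/
theorem assocMap_pentagon (A B C D : Envelope P J) :
    tensorMap (assocMap A B C) (𝟙 D) ≫ assocMap A (tensor B C) D ≫
        tensorMap (𝟙 A) (assocMap B C D) =
      assocMap (tensor A B) C D ≫ assocMap A B (tensor C D) := by
  apply tensor_ext₄ <;> intros <;>
    simp only [mapPos_comp.{u, w}, mapNeg_comp.{u, w}, tensorMap_pos.{u, w}, tensorMap_fst.{u, w},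
        tensorMap_snd.{u, w}, assocMap_pos.{u, w},
      assocMap_fst.{u, w}, assocMap_snd.{u, w}, assocMap_trd.{u, w}, mapPos_perm.{u, w},
          mapNeg_perm.{u, w}, mapPos_id.{u, w}, mapNeg_id.{u, w},
      univ_pos_perm_left.{u, w}, univ_pos_perm_right.{u, w}, univ_fst_perm_left.{u, w},
          univ_fst_perm_right.{u, w},
      univ_snd_perm_left.{u, w}, univ_snd_perm_right.{u, w}, PJModule.perm_perm.{u, w}]
  · exact (tensor _ _).pos.isModule.perm_eq
  · exact A.neg.isModule.perm_eq
  · exact B.neg.isModule.perm_eq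
  · exact C.neg.isModule.perm_eq
  · exact D.neg.isModule.perm_eq

theorem hexagon (A B C : Envelope P J) :
    assocMap A B C ≫ braid A (tensor B C) ≫ assocMap B C A =
      tensorMap (braid A B) (𝟙 C) ≫ assocMap B A C ≫ tensorMap (𝟙 B) (braid A C) := by
  apply tensor_ext₃ <;> intros <;>
    simp only [mapPos_comp.{u, w}, mapNeg_comp.{u, w}, tensorMap_pos.{u, w}, tensorMap_fst.{u, w},
        tensorMap_snd.{u, w}, assocMap_pos.{u, w},
      assocMap_fst.{u, w}, assocMap_snd.{u, w}, assocMap_trd.{u, w}, mapPos_perm.{u, w},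
          mapNeg_perm.{u, w}, mapPos_id.{u, w}, mapNeg_id.{u, w},
      univ_pos_perm_left.{u, w}, univ_pos_perm_right.{u, w}, univ_fst_perm_left.{u, w},
      univ_snd_perm_left.{u, w}, PJModule.perm_perm.{u, w}, braid_pos.{u, w}, braid_fst.{u, w},
          braid_snd.{u, w}]
  · exact (tensor _ _).pos.isModule.perm_eq
  · exact A.neg.isModule.perm_eq
  · exact B.neg.isModule.perm_eq
  · exact C.neg.isModule.perm_eq

/-- Reversal of the three factors of a tensor product. -/
noncomputable def reverse (A B C : Envelope P J) :
    tensor A (tensor B C) ⟶ tensor (tensor C B) A :=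
  braid A (tensor B C) ≫ tensorMap (braid B C) (𝟙 A)

/-- Conjugation of the associator by reversals gives its inverse, so no second family of
multimorphisms is needed to construct it. -/
theorem assocMap_reverse (A B C : Envelope P J) :
    assocMap A B C ≫ reverse A B C ≫ assocMap C B A ≫ reverse C B A = 𝟙 _ := by
  apply tensor_ext₃ <;> intros <;>
    simp only [mapPos_comp.{u, w}, mapNeg_comp.{u, w}, tensorMap_pos.{u, w}, tensorMap_fst.{u, w},
        tensorMap_snd.{u, w}, assocMap_pos.{u, w},
      assocMap_fst.{u, w}, assocMap_snd.{u, w}, assocMap_trd.{u, w}, mapPos_perm.{u, w},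
          mapNeg_perm.{u, w}, mapPos_id.{u, w}, mapNeg_id.{u, w},
      univ_pos_perm_left.{u, w},
      univ_snd_perm_left.{u, w}, PJModule.perm_perm.{u, w}, braid_pos.{u, w}, braid_fst.{u, w},
          braid_snd.{u, w}, reverse]
  · exact (tensor _ _).pos.isModule.perm_eq_self
  · exact A.neg.isModule.perm_eq_self
  · exact B.neg.isModule.perm_eq_self
  · exact C.neg.isModule.perm_eq_self

end Envelope

/-! ### Representable modules -/

namespace ModuleStruct

variable {P : PolycategoryStruct.{u, w}}

/-- A module that is isomorphic to a `(P,J)`-module is a `(P,J)`-module. -/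
theorem Respects.of_bijective {J : P.Distinguished} {U V : ModuleStruct P} (hV : V.Respects J)
    (φ : Hom U V) (h : φ.IsBijective) : U.Respects J where
  tensor t ht Γ Δ := by
    refine (Function.Bijective.of_comp_iff' (h _ _) _).1 ?_
    have e : (fun x : V.obj (_ :: Γ) Δ => V.left t x) ∘ (fun x => φ x) =
        (fun x => φ x) ∘ (fun x => U.left t x) := funext fun x => (φ.map_left t x).symm
    exact e ▸ (hV.tensor t ht Γ Δ).comp (h _ _)
  cotensor s hs Γ Δ := by
    refine (Function.Bijective.of_comp_iff' (h _ _) _).1 ?_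
    have e : (fun x : V.obj Γ (_ :: Δ) => V.right x s) ∘ (fun x => φ x) =
        (fun x => φ x) ∘ (fun x => U.right x s) := funext fun x => (φ.map_right x s).symm
    exact e ▸ (hV.cotensor s hs Γ Δ).comp (h _ _)

variable [hP : Fact P.IsPolycategory]

/-- The representable module at `X`, as a shift of `P`. -/
def yoShift (X : P.Ob) : Hom (yo X) ((self P).shiftL [] [X]) where
  toFun x := x
  map_perm _ _ _ := rfl
  map_left {Γ Δ S T A} f x := by
    refine Eq.trans ?_ (IsModule.perm_arg (U := self P) (congrArg (P.comp f)
      (hP.out.perm_refl (Γ := A :: S) (Δ := X :: T) x).symm))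
    exact hP.out.perm_eq (U := self P)
  map_right {Γ Δ S T A} x g := by
    have e : P.perm (.refl Γ) (front [X] A Δ) x = P.perm (.refl Γ) (.swap X A Δ) x :=
      hP.out.perm_eq (U := self P)
    refine Eq.trans ?_ (IsModule.perm_arg (U := self P) (congrArg (P.comp · g) e.symm))
    exact (hP.out.perm_eq_self (U := self P)).symm

/-- The other representable module at `X`, as a shift of `P`. -/
def noyShift (X : P.Ob) : Hom (noy X) ((self P).shiftL [X] []) where
  toFun x := x
  map_perm _ _ _ := rfl
  map_left {Γ Δ S T A} f x := by
    have e : P.perm (front [X] A S) (.refl T) x = P.perm (.swap X A S) (.refl T) x :=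
      hP.out.perm_eq (U := self P)
    refine Eq.trans ?_ (IsModule.perm_arg (U := self P) (congrArg (P.comp f) e.symm))
    exact hP.out.perm_eq (U := self P)
  map_right {Γ Δ S T A} x g := by
    refine Eq.trans ?_ (IsModule.perm_arg (U := self P) (congrArg (P.comp · g)
      (hP.out.perm_refl (Γ := X :: Γ) (Δ := A :: Δ) x).symm))
    exact (hP.out.perm_eq_self (U := self P)).symm

omit hP in
theorem yoShift_bijective [Fact P.IsPolycategory] (X : P.Ob) : (yoShift X).IsBijective :=
  fun _ _ => Function.bijective_id

omit hP in
theorem noyShift_bijective [Fact P.IsPolycategory] (X : P.Ob) : (noyShift X).IsBijective :=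
  fun _ _ => Function.bijective_id

namespace IsModule

variable {U : ModuleStruct P} (hU : U.IsModule)
include hU

/-- A module as its shift by empty lists. -/
def nilR : ModuleStruct.Hom U (U.shiftR [] []) where
  toFun {Γ Δ} x := U.perm (.appendNil Γ) (.appendNil Δ) x
  map_perm _ _ _ := hU.perm_eq₂₂
  map_left {Γ Δ S T A} f x := by
    refine Eq.trans ?_ (perm_arg (hU.left_of_eq hP.out (σ := .appendNil S) (τ := .appendNil T) f
      hU.perm_eq)).symm
    exact hU.perm_eq₁₂
  map_right {Γ Δ S T A} x g := by
    refine Eq.trans ?_ (perm_arg (hU.right_of_eq hP.out (σ := .appendNil Γ) (τ := .appendNil Δ)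
      hU.perm_eq g)).symm
    exact hU.perm_eq₁₂

/-- The inverse of `nilR`. -/
def nilRSymm : ModuleStruct.Hom (U.shiftR [] []) U :=
  hU.nilR.inverse (fun {Γ Δ} x => U.perm (ListPerm.appendNil Γ).symm (ListPerm.appendNil Δ).symm x)
    (fun _ => hU.perm_perm_self) (fun _ => hU.perm_perm_self)

/-- The shift by empty lists on the left, as the module. -/
def nilLSymm : ModuleStruct.Hom (U.shiftL [] []) U :=
  ((hU.commHom [] []).comp hU.nilRSymm).copy (fun x => x) fun _ => by
    exact (hU.perm_perm_self).symm

/-- An element of `U(X,S;T)`, as a morphism out of the representable module at `X`. -/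
def leftElem {X : P.Ob} {S T : List P.Ob} (w : U.obj (X :: S) T) :
    ModuleStruct.Hom (yo X) (U.shiftR S T) where
  toFun f := U.left f w
  map_perm {Γ Γ' Δ Δ'} σ τ f := by
    have h := hU.left_perm σ τ (.refl S) (.refl T) f w
    rw [show U.perm (.cons X (.refl S)) (.refl T) w = w from hU.perm_eq_self] at h
    exact h.trans hU.perm_eq
  map_left f x := hU.eq_perm_symm (hU.left_left f x w)
  map_right x g := (hU.right_left_comm x w g).symm

/-- An element of `U(Γ;X,Δ)`, as a morphism out of the other representable module at `X`. -/
def rightElem {X : P.Ob} {Γ Δ : List P.Ob} (w : U.obj Γ (X :: Δ)) :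
    ModuleStruct.Hom (noy X) (U.shiftL Γ Δ) where
  toFun g := U.right w g
  map_perm {S S' T T'} σ τ g := by
    have h := hU.right_perm (.refl Γ) (.refl Δ) σ τ w g
    rw [show U.perm (.refl Γ) (.cons X (.refl Δ)) w = w from hU.perm_eq_self] at h
    exact h.trans hU.perm_eq
  map_left {Γ' Δ' S T B} f x := (hU.left_right_comm w f x).symm
  map_right x g := (hU.right_right w x g).symm

omit hU in
/-- Every element of a representable module is the action of a morphism on the identity. -/
theorem yo_eq_left {X : P.Ob} {Γ Δ : List P.Ob} (f : (yo X).obj Γ Δ) :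
    f = (yo X).perm (ListPerm.appendNil Γ).symm (ListPerm.appendNil Δ).symm
      ((yo X).left f (P.id X : (yo X).obj [X] [])) := by
  refine Eq.trans ?_ (congrArg (fun z => P.perm (ListPerm.appendNil Γ).symm
    (.cons X (ListPerm.appendNil Δ).symm) (P.perm (.refl _) (front Δ X []) z))
    (hP.out.right_id f)).symm
  refine ((congrArg (P.perm _ _) (hP.out.perm_perm (U := self P) _ _ _ _ _)).trans
    ((hP.out.perm_perm (U := self P) _ _ _ _ _).trans ?_)).symm
  exact hP.out.perm_eq_self (U := self P)

omit hU in
theorem yo_ext {X : P.Ob} {U : ModuleStruct P} {φ ψ : ModuleStruct.Hom (yo X) U}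
    (h : φ (P.id X : (yo X).obj [X] []) = ψ (P.id X : (yo X).obj [X] [])) : φ = ψ := by
  refine Hom.ext' fun Γ Δ f => ?_
  have key : ∀ χ : ModuleStruct.Hom (yo X) U, χ f = U.perm (ListPerm.appendNil Γ).symm
      (ListPerm.appendNil Δ).symm (U.left f (χ (P.id X : (yo X).obj [X] []))) := fun χ =>
    (congrArg χ.toFun (yo_eq_left f)).trans ((χ.map_perm _ _ _).trans
      (congrArg _ (χ.map_left f _)))
  exact (key φ).trans ((congrArg (fun z => U.perm _ _ (U.left f z)) h).trans (key ψ).symm)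

omit hU in
theorem noy_ext {X : P.Ob} {U : ModuleStruct P} {φ ψ : ModuleStruct.Hom (noy X) U}
    (h : φ (P.id X : (noy X).obj [] [X]) = ψ (P.id X : (noy X).obj [] [X])) : φ = ψ := by
  refine Hom.ext' fun Γ Δ g => ?_
  have e : g = (noy X).right (P.id X : (noy X).obj [] [X]) g := (hP.out.id_left g).symm
  rw [e]
  exact (φ.map_right _ g).trans ((congrArg (U.right · g) h).trans (ψ.map_right _ g).symm)

/-- Yoneda's lemma: the morphism out of a representable module that an element determines. -/
def yoHom {X : P.Ob} (w : U.obj [X] []) : ModuleStruct.Hom (yo X) U :=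
  (hU.leftElem w).comp hU.nilRSymm

theorem yoHom_id {X : P.Ob} (w : U.obj [X] []) :
    hU.yoHom w (P.id X : (yo X).obj [X] []) = w := by
  refine (perm_arg (hU.id_left w)).trans ?_
  exact hU.perm_eq_self (fun _ => rfl) (fun _ => rfl)

/-- Yoneda's lemma for the other representable modules. -/
def noyHom {X : P.Ob} (w : U.obj [] [X]) : ModuleStruct.Hom (noy X) U :=
  (hU.rightElem w).comp hU.nilLSymm

theorem noyHom_id {X : P.Ob} (w : U.obj [] [X]) :
    hU.noyHom w (P.id X : (noy X).obj [] [X]) = w :=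
  (hU.right_id w).trans hU.perm_eq_self

end IsModule

end ModuleStruct

namespace Envelope

open ModuleStruct ModuleStruct.IsModule PJModule

variable {P : PolycategoryStruct.{u, max u w}} {J : P.Distinguished} [hP : Fact P.IsPolycategory]
  [hJ : Fact ((ModuleStruct.self P).Respects J)]

/-- The representable module `(Γ;Δ) ↦ P(Γ;X,Δ)`. -/
def yoModule (X : P.Ob) : PJModule P J where
  toModuleStruct := yo X
  isModule := ((selfModule P J).shiftL [] [X]).isModule.of_injective (yoShift X)
    fun Γ Δ => (yoShift_bijective X Γ Δ).1
  respects := ((selfModule P J).shiftL [] [X]).respects.of_bijective (yoShift X)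
    (yoShift_bijective X)

/-- The representable module `(Γ;Δ) ↦ P(X,Γ;Δ)`. -/
def noyModule (X : P.Ob) : PJModule P J where
  toModuleStruct := noy X
  isModule := ((selfModule P J).shiftL [X] []).isModule.of_injective (noyShift X)
    fun Γ Δ => (noyShift_bijective X Γ Δ).1
  respects := ((selfModule P J).shiftL [X] []).respects.of_bijective (noyShift X)
    (noyShift_bijective X)

/-- The object of the envelope that represents an object of `P`: the two representable modules,
paired by composition. -/
def yonedaObj (X : P.Ob) : Envelope P J where
  pos := yoModule X
  neg := noyModule X
  pair := ofHoms (U := yoModule X) (V := noyModule X) (W := selfModule P J)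
    (fun y => (selfModule P J).isModule.leftElem y)
    (fun x => (selfModule P J).isModule.rightElem x) (fun _ _ => rfl)

/-- The identity of `X`, as an element of the positive part of the object representing `X`. -/
def idPos (X : P.Ob) : (yonedaObj (J := J) X).pos.obj [X] [] := P.id X

/-- The identity of `X`, as an element of the negative part of the object representing `X`. -/
def idNeg (X : P.Ob) : (yonedaObj (J := J) X).neg.obj [] [X] := P.id X

/-- Yoneda's lemma: the morphism that an element of `G⁺(X;)` determines. -/
def yonedaDesc {X : P.Ob} {G : Envelope P J} (w : G.pos.obj [X] []) : yonedaObj X ⟶ G where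
  pos := G.pos.isModule.yoHom w
  neg := ModuleStruct.Hom.ofComp (noyShift X) (fun Γ Δ => (noyShift_bijective X Γ Δ).1)
      (homL G.pairing w)
    (fun c => G.pair w c) fun _ => rfl
  compat {_ _ Γ Δ} f c := by
    refine congrArg (fun φ : ModuleStruct.Hom (yo X) ((self P).shiftR Γ Δ) => φ f) (yo_ext
      (φ := (G.pos.isModule.yoHom w).comp (homR G.pairing c))
      (ψ := (selfModule P J).isModule.leftElem (G.pair w c)) ?_)
    refine (congrArg (fun z => G.pair z c) (G.pos.isModule.yoHom_id w)).trans ?_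
    exact (hP.out.id_left (G.pair w c)).symm

theorem yonedaDesc_id {X : P.Ob} {G : Envelope P J} (w : G.pos.obj [X] []) :
    mapPos (yonedaDesc w) (idPos X) = w :=
  G.pos.isModule.yoHom_id w

/-- Morphisms out of the object representing `X` are determined by the image of the identity. The
negative part is determined because pairing with the identity is the identity. -/
theorem yoneda_ext {X : P.Ob} {G : Envelope P J} {f g : yonedaObj X ⟶ G}
    (h : mapPos f (idPos X) = mapPos g (idPos X)) : f = g := by
  have h' : Hom.pos f = Hom.pos g := yo_ext h
  refine Hom.ext h' (Hom.ext' fun Γ Δ c => ?_)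
  have key : ∀ k : yonedaObj X ⟶ G, mapNeg k c = G.pair (mapPos k (idPos X)) c := fun k =>
    (hP.out.id_left (T := Δ) (S := Γ) (mapNeg k c)).symm.trans (pair_map k (idPos X) c).symm
  exact (key f).trans ((congrArg (fun z => G.pair z c) h).trans (key g).symm)

end Envelope

/-! ### The unit and the symmetric monoidal structure -/

/-- A distinguished unit: an object `𝟏` with a distinguished morphism `() → 𝟏`. -/
class PolycategoryStruct.Distinguished.HasUnit {P : PolycategoryStruct.{u, w}}
    (J : P.Distinguished) where
  unit : P.Ob
  unitMor : P.Hom [] [unit]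
  isTensor : J.IsTensor unitMor

namespace Envelope

open ModuleStruct ModuleStruct.IsModule PJModule PolycategoryStruct.Distinguished

variable {P : PolycategoryStruct.{u, max u w}} {J : P.Distinguished} [hP : Fact P.IsPolycategory]
  [hJ : Fact ((ModuleStruct.self P).Respects J)]
  {A B C G : Envelope P J} {Γ Δ Γ' Δ' Γ₁ Δ₁ Γ₂ Δ₂ Γ₃ Δ₃ Γ₄ Δ₄ : List P.Ob}

section Unit

variable [hI : J.HasUnit]

/-- The unit of the tensor product. -/
def unitObj (J : P.Distinguished) [Fact ((ModuleStruct.self P).Respects J)] [hI : J.HasUnit] :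
    Envelope P J :=
  yonedaObj (J := J) hI.unit

/-- The universal nullary morphism. -/
def unitElem (J : P.Distinguished) [Fact ((ModuleStruct.self P).Respects J)] [hI : J.HasUnit] :
    (unitObj J).pos.obj [] [] :=
  hI.unitMor

theorem mapPos_unitElem (f : unitObj J ⟶ G) :
    mapPos f (unitElem J) = G.pos.left hI.unitMor (mapPos f (idPos hI.unit)) := by
  have e : unitElem J = (unitObj J).pos.left hI.unitMor (idPos (J := J) hI.unit) := by
    refine Eq.trans ?_ (congrArg (P.perm (.refl _) (front [] hI.unit []))
      (hP.out.right_id (Γ := []) (Δ := []) hI.unitMor)).symm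
    refine Eq.trans ?_ (self_perm_perm _ _ _ _ _).symm
    exact (hP.out.perm_eq_self (U := self P) (fun _ => rfl) (fun _ => rfl)).symm
  exact (congrArg (mapPos f) e).trans ((Hom.pos f).map_left _ _)

/-- Morphisms out of the unit are determined by the image of the universal element. The unit
represents the unit of `P`, and every module respects the distinguished morphism `() → 𝟏`. -/
theorem unit_ext {f g : unitObj J ⟶ G}
    (h : mapPos f (unitElem J) = mapPos g (unitElem J)) : f = g :=
  yoneda_ext ((G.pos.respects.tensor _ hI.isTensor [] []).1
    ((mapPos_unitElem f).symm.trans (h.trans (mapPos_unitElem g))))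

/-- The morphism out of the unit that an element of `G⁺(;)` determines. -/
noncomputable def unitDesc (k : G.pos.obj [] []) : unitObj J ⟶ G :=
  yonedaDesc (Function.surjInv (G.pos.respects.tensor _ hI.isTensor [] []).2 k)

theorem unitDesc_unitElem (k : G.pos.obj [] []) : mapPos (unitDesc k) (unitElem J) = k :=
  (mapPos_unitElem _).trans ((congrArg (G.pos.left hI.unitMor) (yonedaDesc_id _)).trans
    (Function.surjInv_eq (G.pos.respects.tensor _ hI.isTensor [] []).2 k))

/-- The inverse of the right unitor, `a ↦ a ⊗ e`. -/
noncomputable def rightUnitorInv (A : Envelope P J) : A ⟶ tensor A (unitObj J) where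
  pos := (homR (univ A (unitObj J)).pos (unitElem J)).comp (tensor A _).pos.isModule.nilRSymm
  neg := (homL (univ A (unitObj J)).fst (unitElem J)).comp A.neg.isModule.nilLSymm
  compat {Γ₁ Δ₁ Γ₂ Δ₂} a c := by
    refine (pair_perm_left (tensor A (unitObj J)) (ListPerm.appendNil Γ₁).symm
      (ListPerm.appendNil Δ₁).symm ((univ A _).pos a (unitElem J)) c).trans ?_
    refine (congrArg (P.perm _ _) (pair_univ a (unitElem J) c)).trans ?_
    refine (self_perm_perm _ _ _ _ _).trans ?_
    exact hP.out.perm_eq_self (U := self P)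

/-- The map `a ↦ a ⊗ e` is epic: after transposition, a morphism out of `A ⊗ 𝟏` is a morphism out of
`𝟏`. -/
theorem rightUnitorInv_ext {f g : tensor A (unitObj J) ⟶ C}
    (h : rightUnitorInv A ≫ f = rightUnitorInv A ≫ g) : f = g := by
  rw [← uncurryHom_curryHom.{u, w} f, ← uncurryHom_curryHom.{u, w} g]
  refine congrArg uncurryHom (unit_ext (tensorNeg_ext (A := A) (B := C.star)
    (fun {Γ₁ Δ₁} c => ?_) (fun {Γ₁ Δ₁} a => ?_)))
  · exact congrArg (fun k : A ⟶ C => A.neg.perm (.comm [] Γ₁) (.comm [] Δ₁)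
      (mapNeg k (c : C.neg.obj Γ₁ Δ₁))) h
  · have key : ∀ k : tensor A (unitObj J) ⟶ C, mapPos k ((univ A _).pos a (unitElem J)) =
        C.pos.perm (.appendNil _) (.appendNil _) (mapPos (rightUnitorInv A ≫ k) a) := fun k =>
      (Eq.trans (congrArg (C.pos.perm (.appendNil _) (.appendNil _))
        (mapPos_perm k (ListPerm.appendNil Γ₁).symm (ListPerm.appendNil Δ₁).symm
          ((univ A _).pos a (unitElem J)))) C.pos.isModule.perm_perm_self).symm
    exact (key f).trans ((congrArg (fun k : A ⟶ C => C.pos.perm (.appendNil _) (.appendNil _)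
      (mapPos k a)) h).trans (key g).symm)

/-- A left inverse of `a ↦ a ⊗ e`, as the transpose of the element of `(A ⊸ A)⁺(;)` that is the
identity of `A`. -/
theorem exists_rightUnitor (A : Envelope P J) :
    ∃ h : tensor A (unitObj J) ⟶ A, rightUnitorInv A ≫ h = 𝟙 A := by
  let j : (internalHom A A).pos.obj [] [] := (⟨(A.neg.isModule.nilR, A.pos.isModule.nilR),
    fun {Γ₁ Δ₁ Γ₂ Δ₂} a b => by
      refine (congrArg (P.perm (leftComm _ _ _) (leftComm _ _ _)) (pair_perm_right A
        (.appendNil Γ₂) (.appendNil Δ₂) a b)).trans ?_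
      refine Eq.trans ?_ (congrArg (P.perm (.comm _ _) (.comm _ _)) (pair_perm_left A
        (.appendNil Γ₁) (.appendNil Δ₁) a b)).symm
      exact hP.out.perm_eq₂₂ (U := self P)⟩ :
    (tensorNeg A A.star).obj [] [])
  refine ⟨uncurryHom (unitDesc j), hom_ext (fun {Γ Δ} a => ?_) (fun {Γ Δ} c => ?_)⟩
  · refine (mapPos_perm (uncurryHom (unitDesc j)) (ListPerm.appendNil Γ).symm
      (ListPerm.appendNil Δ).symm
      ((univ A _).pos a (unitElem J))).trans ?_
    refine (congrArg (A.pos.perm _ _) ((uncurryHom_pos (unitDesc j) a (unitElem J)).trans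
      (congrArg ((univ A A.star).snd a) (unitDesc_unitElem j)))).trans ?_
    exact A.pos.isModule.perm_perm_self (σ := .appendNil Γ) (τ := .appendNil Δ) (x := a)
  · refine (uncurryHom_fst (unitDesc j) (unitElem J) c).trans ((congrArg (fun z =>
      A.neg.perm (.comm _ _) (.comm _ _) ((univ A A.star).fst c z))
        (unitDesc_unitElem j)).trans ?_)
    exact A.neg.isModule.perm_perm_self (σ := .appendNil Γ) (τ := .appendNil Δ)
      (σ' := .comm Γ []) (τ' := .comm Δ []) (x := c)

/-- The right unitor. -/
noncomputable def rightUnitorIso (A : Envelope P J) : tensor A (unitObj J) ≅ A where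
  hom := (exists_rightUnitor A).choose
  inv := rightUnitorInv A
  hom_inv_id := rightUnitorInv_ext (by
    rw [← Category.assoc, (exists_rightUnitor.{u, w} A).choose_spec, Category.id_comp,
      Category.comp_id])
  inv_hom_id := (exists_rightUnitor A).choose_spec

theorem rightUnitorIso_pos (a : A.pos.obj Γ Δ) :
    mapPos (rightUnitorIso A).hom ((univ A _).pos a (unitElem J)) =
      A.pos.perm (.appendNil Γ) (.appendNil Δ) a := by
  have h : mapPos (rightUnitorInv A ≫ (rightUnitorIso A).hom) a = a :=
    congrArg (fun k : A ⟶ A => mapPos k a) (rightUnitorIso A).inv_hom_id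
  exact A.pos.isModule.eq_perm_symm ((mapPos_perm _ _ _ _).symm.trans h) |>.trans
    (by rw [ListPerm.symm_symm, ListPerm.symm_symm])

theorem rightUnitorIso_fst (a : A.neg.obj Γ Δ) :
    (univ A _).fst (unitElem J) (mapNeg (rightUnitorIso A).hom a) = a :=
  congrArg (fun k : A ⟶ A => mapNeg k a) (rightUnitorIso A).inv_hom_id

end Unit

/-- The symmetry as an isomorphism. -/
noncomputable def braidIso (A B : Envelope P J) : tensor A B ≅ tensor B A :=
  ⟨braid A B, braid B A, braid_braid A B, braid_braid B A⟩

/-- The tensor product of two isomorphisms. -/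
noncomputable def tensorMapIso {A A' B B' : Envelope P J} (f : A ≅ A') (g : B ≅ B') :
    tensor A B ≅ tensor A' B' where
  hom := tensorMap f.hom g.hom
  inv := tensorMap f.inv g.inv
  hom_inv_id := by
    rw [← tensorMap_comp.{u, w}, f.hom_inv_id, g.hom_inv_id, tensorMap_id.{u, w}]
  inv_hom_id := by
    rw [← tensorMap_comp.{u, w}, f.inv_hom_id, g.inv_hom_id, tensorMap_id.{u, w}]

/-- The reversal of factors as an isomorphism. -/
noncomputable def reverseIso (A B C : Envelope P J) :
    tensor A (tensor B C) ≅ tensor (tensor C B) A :=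
  braidIso A (tensor B C) ≪≫ tensorMapIso (braidIso B C) (Iso.refl A)

/-- The associator as an isomorphism. -/
noncomputable def assocIso (A B C : Envelope P J) :
    tensor (tensor A B) C ≅ tensor A (tensor B C) where
  hom := assocMap A B C
  inv := reverse A B C ≫ assocMap C B A ≫ reverse C B A
  hom_inv_id := assocMap_reverse A B C
  inv_hom_id := by
    have h : (assocMap C B A ≫ reverse C B A ≫ assocMap A B C) ≫ (reverseIso A B C).hom = 𝟙 _ :=
      (Category.assoc _ _ _).trans ((congrArg _ (Category.assoc _ _ _)).trans
        (assocMap_reverse C B A))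
    have h' := ((reverseIso A B C).hom_comp_eq_id).2 (((reverseIso A B C).comp_hom_eq_id).1 h)
    exact (Category.assoc _ _ _).trans ((congrArg _ (Category.assoc _ _ _)).trans h')

variable [hI : J.HasUnit]

/-- The left unitor. -/
noncomputable def leftUnitorIso (A : Envelope P J) : tensor (unitObj J) A ≅ A :=
  braidIso (unitObj J) A ≪≫ rightUnitorIso A

theorem leftUnitorIso_pos (a : A.pos.obj Γ Δ) :
    mapPos (leftUnitorIso A).hom ((univ _ A).pos (unitElem J) a) = a := by
  refine (mapPos_perm (rightUnitorIso A).hom (.comm Γ []) (.comm Δ [])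
    ((univ A _).pos a (unitElem J))).trans ?_
  refine (congrArg (A.pos.perm _ _) (rightUnitorIso_pos a)).trans ?_
  exact A.pos.isModule.perm_perm_self (σ := .appendNil Γ) (τ := .appendNil Δ)
    (σ' := .comm Γ []) (τ' := .comm Δ []) (x := a)

theorem leftUnitorIso_snd (a : A.neg.obj Γ Δ) :
    (univ _ A).snd (unitElem J) (mapNeg (leftUnitorIso A).hom a) = a :=
  rightUnitorIso_fst a

/-- The triangle identity, with the right unitor moved to the other side. -/
theorem triangle_aux (A B : Envelope P J) :
    tensorMap (rightUnitorInv A) (𝟙 B) ≫ assocMap A (unitObj J) B ≫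
      tensorMap (𝟙 A) (leftUnitorIso B).hom = 𝟙 _ := by
  refine tensor_ext (fun {Γ₁ Δ₁ Γ₂ Δ₂} a b => ?_) (fun {Γ₁ Δ₁ Γ₂ Δ₂} b c => ?_)
    (fun {Γ₁ Δ₁ Γ₂ Δ₂} a c => ?_)
  · refine (congrArg (fun z => mapPos (assocMap A (unitObj J) B ≫
      tensorMap (𝟙 A) (leftUnitorIso B).hom) z) (univ_pos_perm_left (ListPerm.appendNil Γ₁).symm
        (ListPerm.appendNil Δ₁).symm ((univ A (unitObj J)).pos a (unitElem J)) b)).trans ?_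
    refine (mapPos_perm _ _ _ _).trans ((congrArg _ (mapPos_perm (tensorMap (𝟙 A)
      (leftUnitorIso B).hom) (assoc Γ₁ [] Γ₂).symm (assoc Δ₁ [] Δ₂).symm
        ((univ A _).pos a ((univ _ B).pos (unitElem J) b)))).trans ?_)
    refine (congrArg (fun z => (tensor A B).pos.perm _ _ ((tensor A B).pos.perm _ _
      ((univ A B).pos a z))) (leftUnitorIso_pos b)).trans ?_
    refine (PJModule.perm_perm _ _ _ _ _ _).trans ?_
    exact (tensor A B).pos.isModule.perm_eq_self
  · refine (assocMap_fst (unitElem J) b (mapNeg (tensorMap (𝟙 A) (leftUnitorIso B).hom) c)).trans ?_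
    refine (congrArg (fun z => A.neg.perm (assoc [] _ _) (assoc [] _ _) ((univ A B).fst z c))
      (leftUnitorIso_pos b)).trans ?_
    exact A.neg.isModule.perm_eq_self
  · refine (univ_snd_perm_left (ListPerm.appendNil Γ₁).symm (ListPerm.appendNil Δ₁).symm
      ((univ A (unitObj J)).pos a (unitElem J)) (mapNeg (assocMap A (unitObj J) B)
        (mapNeg (tensorMap (𝟙 A) (leftUnitorIso B).hom) c))).trans ?_
    refine (congrArg (B.neg.perm _ _) (assocMap_trd a (unitElem J)
      (mapNeg (tensorMap (𝟙 A) (leftUnitorIso B).hom) c))).trans ?_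
    refine (congrArg (fun z => B.neg.perm _ _ (B.neg.perm _ _ z))
      (leftUnitorIso_snd ((univ A B).snd a c))).trans ?_
    refine (PJModule.perm_perm _ _ _ _ _ _).trans ?_
    exact B.neg.isModule.perm_eq_self

/-- The monoidal structure of the envelope. The instances are scoped, to keep apart the
structures over which a statement quantifies. -/
noncomputable scoped instance monoidalCategoryStruct : MonoidalCategoryStruct (Envelope P J) where
  tensorObj := tensor
  whiskerLeft A _ _ f := tensorMap (𝟙 A) f
  whiskerRight f B := tensorMap f (𝟙 B)
  tensorHom f g := tensorMap f g
  tensorUnit := unitObj J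
  associator := assocIso
  leftUnitor := leftUnitorIso
  rightUnitor := rightUnitorIso

theorem rightUnitorInv_naturality (f : A ⟶ B) :
    rightUnitorInv A ≫ tensorMap f (𝟙 (unitObj J)) = f ≫ rightUnitorInv B :=
  hom_ext (fun {Γ Δ} a => (mapPos_perm (tensorMap f (𝟙 (unitObj J))) (ListPerm.appendNil Γ).symm
    (ListPerm.appendNil Δ).symm ((univ A _).pos a (unitElem J)))) (fun _ => rfl)

theorem rightUnitor_naturality (f : A ⟶ B) : tensorMap f (𝟙 (unitObj J)) ≫
    (rightUnitorIso B).hom = (rightUnitorIso A).hom ≫ f := by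
  rw [← Iso.eq_comp_inv, Category.assoc, ← Iso.inv_comp_eq]
  exact rightUnitorInv_naturality f

/-- The laws of the monoidal structure. -/
noncomputable scoped instance monoidalCategory : MonoidalCategory (Envelope P J) :=
  MonoidalCategory.ofTensorHom
    (id_tensorHom_id := tensorMap_id)
    (id_tensorHom := fun _ _ _ _ => rfl)
    (tensorHom_id := fun _ _ => rfl)
    (tensorHom_comp_tensorHom := fun f₁ f₂ g₁ g₂ => (tensorMap_comp f₁ g₁ f₂ g₂).symm)
    (associator_naturality := assocMap_naturality)
    (leftUnitor_naturality := fun {A B} f => by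
      refine (Category.assoc _ _ _).symm.trans ((congrArg (· ≫ (rightUnitorIso B).hom)
        (braid_naturality (𝟙 (unitObj J)) f)).trans ?_)
      exact (Category.assoc _ _ _).trans ((congrArg (braid (unitObj J) A ≫ ·)
        (rightUnitor_naturality f)).trans (Category.assoc _ _ _).symm))
    (rightUnitor_naturality := rightUnitor_naturality)
    (pentagon := assocMap_pentagon)
    (triangle := fun A B =>
      ((tensorMapIso (rightUnitorIso A) (Iso.refl B)).symm.hom_comp_eq_id).1 (triangle_aux A B))

/-- The braiding of the envelope. -/
noncomputable scoped instance symmetricCategory : SymmetricCategory (Envelope P J) where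
  braiding := braidIso
  braiding_naturality_right A _ _ f := braid_naturality (𝟙 A) f
  braiding_naturality_left f C := braid_naturality f (𝟙 C)
  hexagon_forward := hexagon
  hexagon_reverse A B C := by
    have h := congrArg Iso.inv (Iso.ext (hexagon C A B) :
      assocIso C A B ≪≫ braidIso C (tensor A B) ≪≫ assocIso A B C =
        tensorMapIso (braidIso C A) (Iso.refl B) ≪≫ assocIso A C B ≪≫
          tensorMapIso (Iso.refl A) (braidIso C B))
    exact (Category.assoc _ _ _).symm.trans (h.trans (Category.assoc _ _ _))
  symmetry := braid_braid

/-- The symmetric monoidal structure is that of the Chu construction. -/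
theorem isChuTensor : IsChuTensor (J := J) univ (unitElem J) where
  tensor_universal k := ⟨desc k, ⟨fun _ _ => rfl, fun _ _ => rfl, fun _ _ => rfl⟩,
    fun _ h => tensor_ext h.1 h.2.1 h.2.2⟩
  unit_universal k := ⟨unitDesc k, unitDesc_unitElem k, fun _ h =>
    unit_ext (h.trans (unitDesc_unitElem k).symm)⟩
  tensorHom_pos _ _ _ _ _ _ _ _ := rfl
  tensorHom_fst _ _ _ _ _ _ _ _ := rfl
  tensorHom_snd _ _ _ _ _ _ _ _ := rfl
  braiding_pos {A B Γ₁ Δ₁ Γ₂ Δ₂} a b := (tensor B A).pos.isModule.perm_perm_self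
    (σ := .comm Γ₂ Γ₁) (τ := .comm Δ₂ Δ₁) (σ' := .comm Γ₁ Γ₂) (τ' := .comm Δ₁ Δ₂)
    (x := (univ B A).pos b a)
  braiding_fst _ _ := rfl
  braiding_snd _ _ := rfl
  associator_pos {A B C Γ₁ Δ₁ Γ₂ Δ₂ Γ₃ Δ₃} a b c :=
    (tensor A (tensor B C)).pos.isModule.perm_perm_self
      (σ := (assoc Γ₁ Γ₂ Γ₃).symm) (τ := (assoc Δ₁ Δ₂ Δ₃).symm)
      (x := (univ A (tensor B C)).pos a ((univ B C).pos b c))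
  associator_fst _ _ _ := rfl
  associator_snd {_ B _ _ _ _ _ _ _} a c d :=
    (congrArg _ (assocMap_snd a c d)).trans B.neg.isModule.perm_perm_self
  associator_trd {_ _ C _ _ _ _ _ _} a b d :=
    (congrArg _ (assocMap_trd a b d)).trans C.neg.isModule.perm_perm_self
  leftUnitor_pos := leftUnitorIso_pos
  leftUnitor_snd := leftUnitorIso_snd
  rightUnitor_pos := rightUnitorIso_pos
  rightUnitor_fst := rightUnitorIso_fst

end Envelope

/-! ### Closed structure and duality -/

namespace Envelope

open ModuleStruct ModuleStruct.IsModule PJModule PolycategoryStruct.Distinguished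

variable {P : PolycategoryStruct.{u, max u w}} {J : P.Distinguished} [hP : Fact P.IsPolycategory]
  [hJ : Fact ((ModuleStruct.self P).Respects J)] [hI : J.HasUnit]
  {A B C D G : Envelope P J} {Γ Δ Γ' Δ' Γ₁ Δ₁ Γ₂ Δ₂ Γ₃ Δ₃ Γ₄ Δ₄ : List P.Ob}

/-- The closed structure of the envelope. -/
noncomputable scoped instance monoidalClosed : MonoidalClosed (Envelope P J) where
  closed A :=
    { rightAdj := Adjunction.rightAdjointOfEquiv (F := tensorLeft A)
        (fun X Y => curryEquiv A X Y) (fun _ _ _ f g => curryHom_naturality f g)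
      adj := Adjunction.adjunctionOfEquivRight (F := tensorLeft A)
        (fun X Y => curryEquiv A X Y) (fun _ _ _ f g => curryHom_naturality f g) }

theorem homEquiv_eq (A X Y : Envelope P J) :
    (ihom.adjunction A).homEquiv X Y = curryEquiv A X Y :=
  congrFun (congrFun (Adjunction.mkOfHomEquiv_homEquiv _) X) Y

theorem curry_eq_curryHom (f : A ⊗ B ⟶ C) : MonoidalClosed.curry f = curryHom f :=
  congrArg (fun e : (A ⊗ B ⟶ C) ≃ (B ⟶ (ihom A).obj C) => e f) (homEquiv_eq A B C)

theorem uncurry_eq_uncurryHom (f : B ⟶ (ihom A).obj C) :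
    MonoidalClosed.uncurry f = uncurryHom f :=
  congrArg (fun e : (A ⊗ B ⟶ C) ≃ (B ⟶ (ihom A).obj C) => e.symm f) (homEquiv_eq A B C)

theorem ev_eq_uncurryHom (A C : Envelope P J) :
    (ihom.ev A).app C = uncurryHom (𝟙 (internalHom A C)) :=
  (MonoidalClosed.uncurry_id_eq_ev A C).symm.trans (uncurry_eq_uncurryHom _)

/-- The double dual of an object is the object. -/
def starStarIso (A : Envelope P J) : A ≅ A.star.star where
  hom := ⟨.id _, .id _, fun a b => congrArg
    (fun k : PJModule.Hom₂ A.pos A.neg (selfModule P J) => k a b) (flip_flip A.pairing)⟩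
  inv := ⟨.id _, .id _, fun a b => congrArg
    (fun k : PJModule.Hom₂ A.pos A.neg (selfModule P J) => k a b) (flip_flip A.pairing).symm⟩
  hom_inv_id := rfl
  inv_hom_id := rfl

/-- The dual of an isomorphism. -/
def starMapIso (f : A ≅ B) : B.star ≅ A.star where
  hom := starMap f.hom
  inv := starMap f.inv
  hom_inv_id := congrArg (fun k => starMap k) f.inv_hom_id
  inv_hom_id := congrArg (fun k => starMap k) f.hom_inv_id

variable (J) in
/-- The dualizing object. -/
def bot : Envelope P J :=
  (unitObj J).star

/-- The isomorphism `A ⊗ ⊥* ≅ A`, as `⊥*` is isomorphic to the unit. -/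
noncomputable def tensorBotStarIso (A : Envelope P J) : tensor A (bot J).star ≅ A :=
  tensorMapIso (Iso.refl A) (starStarIso (unitObj J)).symm ≪≫ rightUnitorIso A

/-- The dual `A*` is the internal hom to the dualizing object. -/
noncomputable def starIso (A : Envelope P J) : A.star ≅ internalHom A (bot J) :=
  starMapIso (tensorBotStarIso A)

theorem tensorBotStarIso_naturality (f : A ⟶ B) :
    tensorMap f (𝟙 (bot J).star) ≫ (tensorBotStarIso B).hom = (tensorBotStarIso A).hom ≫ f := by
  refine Eq.trans ?_ ((congrArg ((tensorMapIso (Iso.refl A) (starStarIso (unitObj J)).symm).hom ≫ ·)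
    (rightUnitor_naturality f)).trans (Category.assoc _ _ _).symm)
  refine (Category.assoc _ _ _).symm.trans (Eq.trans (congrArg (· ≫ (rightUnitorIso B).hom) ?_)
    (Category.assoc _ _ _))
  exact (tensorMap_comp f (𝟙 B) (𝟙 _) (starStarIso (unitObj J)).inv).symm.trans
    (tensorMap_comp (𝟙 A) f (starStarIso (unitObj J)).inv (𝟙 _))

theorem tensorBotStarIso_pos (a : A.pos.obj Γ Δ) : mapPos (tensorBotStarIso A).hom
      ((univ A (bot J).star).pos a (unitElem J)) = A.pos.perm (.appendNil Γ) (.appendNil Δ) a :=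
  rightUnitorIso_pos a

theorem tensorBotStarIso_fst (a : A.neg.obj Γ Δ) : (univ A (bot J).star).fst (unitElem J)
    (mapNeg (tensorBotStarIso A).hom a) = a :=
  rightUnitorIso_fst a

/-- The action of the internal hom on its first argument is the dual of a tensor product of
morphisms. -/
theorem pre_app_eq (f : A ⟶ B) (X : Envelope P J) :
    (MonoidalClosed.pre f).app X = starMap (tensorMap f (𝟙 X.star)) := by
  apply MonoidalClosed.uncurry_injective
  refine (MonoidalClosed.uncurry_pre f X).trans ?_
  refine Eq.trans ?_ (uncurry_eq_uncurryHom _).symm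
  refine (congrArg (tensorMap f (𝟙 (internalHom B X)) ≫ ·) (ev_eq_uncurryHom B X)).trans ?_
  exact tensor_ext (fun _ _ => rfl) (fun _ _ => (mapNeg_perm f _ _ _)) (fun _ _ => rfl)

/-- Morphisms to the dualizing object are determined by the image of the universal element. -/
theorem bot_ext {f g : A ⟶ bot J} (h : mapNeg f (unitElem J) = mapNeg g (unitElem J)) : f = g :=
  congrArg (fun k : unitObj J ⟶ A.star => transpose (A := unitObj J) (B := A) k)
    (unit_ext (f := transpose f) (g := transpose g) h)

theorem isChuDuality : IsChuDuality (bot J) := by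
  refine ⟨fun A => Hom.neg (tensorBotStarIso A).hom, fun A => Hom.pos (tensorBotStarIso A).inv,
    fun A Γ Δ => ?_, fun A Γ Δ => ?_, fun A {Γ₁ Δ₁ Γ₂ Δ₂} a b => ?_, fun {A B} f {Γ Δ} b => ?_,
    fun {A B} f {Γ Δ} a => ?_⟩
  · exact Function.bijective_iff_has_inverse.2 ⟨fun z => mapNeg (tensorBotStarIso A).inv z,
      fun x => congrArg (fun k : A ⟶ A => mapNeg k x) (tensorBotStarIso A).inv_hom_id,
      fun x => congrArg (fun k : tensor A (bot J).star ⟶ _ => mapNeg k x)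
        (tensorBotStarIso A).hom_inv_id⟩
  · exact Function.bijective_iff_has_inverse.2 ⟨fun z => mapPos (tensorBotStarIso A).hom z,
      fun x => congrArg (fun k : A ⟶ A => mapPos k x) (tensorBotStarIso A).inv_hom_id,
      fun x => congrArg (fun k : tensor A (bot J).star ⟶ _ => mapPos k x)
        (tensorBotStarIso A).hom_inv_id⟩
  · refine congrArg (P.perm (.comm Γ₁ Γ₂) (.comm Δ₁ Δ₂)) ((Hom.compat (tensorBotStarIso A).hom
      (Hom.pos (tensorBotStarIso A).inv a) b).symm.trans ?_)
    exact congrArg (fun k : A ⟶ A => A.pair (mapPos k a) b) (tensorBotStarIso A).inv_hom_id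
  · refine (congrArg (fun k : internalHom B (bot J) ⟶ internalHom A (bot J) => mapPos k
      (mapNeg (tensorBotStarIso B).hom b)) (pre_app_eq f (bot J))).trans ?_
    exact congrArg (fun k : tensor A (bot J).star ⟶ B => mapNeg k b)
      (tensorBotStarIso_naturality f)
  · refine (congrArg (fun k : internalHom B (bot J) ⟶ internalHom A (bot J) => mapNeg k
      (mapPos (tensorBotStarIso A).inv a)) (pre_app_eq f (bot J))).trans ?_
    have h : (tensorBotStarIso A).inv ≫ tensorMap f (𝟙 (bot J).star) =
        f ≫ (tensorBotStarIso B).inv := by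
      rw [Iso.inv_comp_eq, ← Category.assoc, Iso.eq_comp_inv]
      exact tensorBotStarIso_naturality f
    exact congrArg (fun k : A ⟶ tensor B (bot J).star => mapPos k a) h

/-- The isomorphism of `A` with its double dual, through `A ≅ A**`. -/
noncomputable def doubleDualIso (A : Envelope P J) :
    A ≅ internalHom (internalHom A (bot J)) (bot J) :=
  starStarIso A ≪≫ starMapIso (starIso A).symm ≪≫ starIso (internalHom A (bot J))

/-- The canonical map to the double dual is the isomorphism `doubleDualIso`: both correspond to
morphisms to the dualizing object, which are compared at the universal element. -/
theorem isDualizing_bot : IsDualizing (bot J) := fun A => by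
  have key : toDoubleDual (bot J) A = (doubleDualIso A).hom := by
    apply MonoidalClosed.uncurry_injective
    refine (MonoidalClosed.uncurry_curry _).trans (Eq.trans ?_ (uncurry_eq_uncurryHom _).symm)
    refine (congrArg (braid (internalHom A (bot J)) A ≫ ·) (ev_eq_uncurryHom A (bot J))).trans ?_
    refine bot_ext (tensorNeg_ext (fun {Γ Δ} a => ?_) (fun {Γ Δ} d => ?_))
    · have h₁ : (univ (internalHom A (bot J)) (bot J).star).fst (unitElem J)
          (mapPos (doubleDualIso A).hom a) =
          (tensor A (bot J).star).pos.perm (ListPerm.appendNil Γ).symm (ListPerm.appendNil Δ).symm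
            ((univ A (bot J).star).pos a (unitElem J)) :=
        tensorBotStarIso_fst (A := internalHom A (bot J)) _
      exact ((congrArg ((tensor A (bot J).star).pos.perm (.comm [] Γ) (.comm [] Δ)) h₁).trans
        ((tensor A (bot J).star).pos.isModule.perm_perm_self (σ := (ListPerm.appendNil Γ).symm)
          (τ := (ListPerm.appendNil Δ).symm))).symm
    · have h₂ : mapPos (tensorBotStarIso (internalHom A (bot J))).hom
          ((univ (internalHom A (bot J)) (bot J).star).pos d (unitElem J)) =
          (internalHom A (bot J)).pos.perm (.appendNil Γ) (.appendNil Δ) d :=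
        tensorBotStarIso_pos (A := internalHom A (bot J)) d
      refine Eq.trans ?_ (congrArg (fun k => (univ A (bot J).star).fst (unitElem J) k) h₂).symm
      refine Eq.trans ?_ (PJModule.map_perm_right (univ A (bot J).star).fst (.appendNil Γ)
        (.appendNil Δ) (unitElem J) d).symm
      exact A.neg.isModule.perm_eq (σ := .comm [] Γ) (σ' := .appendNil Γ) (τ := .comm [] Δ)
        (τ' := .appendNil Δ)
  rw [key]
  exact (doubleDualIso A).isIso_hom

end Envelope

/-! ### The Yoneda embedding -/

namespace Envelope

open ModuleStruct ModuleStruct.IsModule PJModule PolycategoryStruct.Distinguished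

variable {P : PolycategoryStruct.{u, max u w}} {J : P.Distinguished} [hP : Fact P.IsPolycategory]
  [hJ : Fact ((ModuleStruct.self P).Respects J)]
  {A B C D G : Envelope P J} {X Y Z : P.Ob} {Γ Δ Γ' Δ' Γ₁ Δ₁ Γ₂ Δ₂ Γ₃ Δ₃ Γ₄ Δ₄ : List P.Ob}

/-- The action of the Yoneda embedding on a morphism of `P`. -/
def yonedaMap (h : P.Hom [X] [Y]) : yonedaObj (J := J) X ⟶ yonedaObj Y :=
  yonedaDesc (X := X) (G := yonedaObj Y) (h : (yonedaObj (J := J) Y).pos.obj [X] [])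

theorem yonedaMap_idPos (h : P.Hom [X] [Y]) :
    mapPos (yonedaMap (J := J) h) (idPos X) = (h : (yo Y).obj [X] []) :=
  yonedaDesc_id (X := X) (G := yonedaObj Y) (h : (yonedaObj (J := J) Y).pos.obj [X] [])

theorem yonedaMap_pos (h : P.Hom [X] [Y]) (f : P.Hom Γ (X :: Δ)) :
    mapPos (yonedaMap (J := J) h) (f : (yo X).obj Γ Δ) =
      (P.perm (ListPerm.appendNil Γ).symm (ListPerm.rotate Y Δ).symm
        (P.comp f h : P.Hom (Γ ++ []) (Δ ++ [Y])) : (yo Y).obj Γ Δ) := by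
  refine (self_perm_perm (ListPerm.refl (Γ ++ [])) (ListPerm.appendNil Γ).symm
    (front Δ Y []) (.cons Y (ListPerm.appendNil Δ).symm)
      (P.comp f h : P.Hom (Γ ++ []) (Δ ++ [Y]))).trans ?_
  exact hP.out.perm_eq (U := self P)

/-- The dual of Yoneda's lemma: the morphism out of the dual of a representable object that an
element of `G⁺(;X)` determines. -/
def starYonedaDesc {G : Envelope P J} (w : G.pos.obj [] [X]) : (yonedaObj X).star ⟶ G where
  pos := G.pos.isModule.noyHom w
  neg := ModuleStruct.Hom.ofComp (yoShift X) (fun Γ Δ => (yoShift_bijective X Γ Δ).1)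
    (homL G.pairing w) (fun c => G.pair w c) fun _ => rfl
  compat {_ _ Γ Δ} f c := by
    refine congrArg (fun φ : ModuleStruct.Hom (noy X) ((self P).shiftR Γ Δ) => φ f) (noy_ext
      (φ := (G.pos.isModule.noyHom w).comp (homR G.pairing c))
      (ψ := homR (yonedaObj (J := J) X).star.pairing
        (G.pair w c : (yonedaObj (J := J) X).pos.obj Γ Δ)) ?_)
    refine (congrArg (fun z => G.pair z c) (G.pos.isModule.noyHom_id w)).trans ?_
    refine Eq.trans ?_ (congrArg (P.perm (.comm Γ []) (.comm Δ [X]))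
      (hP.out.right_id (G.pair w c : P.Hom Γ (X :: Δ)))).symm
    refine Eq.trans ?_ (self_perm_perm _ _ _ _ _).symm
    exact (hP.out.perm_eq_self (U := self P)).symm

theorem starYonedaDesc_id (w : G.pos.obj [] [X]) :
    mapPos (starYonedaDesc w) (idNeg X) = w :=
  G.pos.isModule.noyHom_id w

/-- The elements of the negative part are determined by their pairings. -/
def Separated (A : Envelope P J) : Prop :=
  ∀ ⦃Γ Δ : List P.Ob⦄ (m n : A.neg.obj Γ Δ), (∀ {Γ' Δ' : List P.Ob} (a : A.pos.obj Γ' Δ'),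
    A.pair a m = A.pair a n) → m = n

omit hP hJ in
/-- Morphisms out of a separated object are determined by their positive part. -/
theorem Separated.hom_ext (hA : Separated A) {f g : A ⟶ B} (h : Hom.pos f = Hom.pos g) : f = g :=
  Envelope.hom_ext (fun a => congrArg (fun k : ModuleStruct.Hom _ _ => k a) h) (fun b =>
    hA _ _ fun a => (pair_map f a b).symm.trans ((congrArg (fun k : ModuleStruct.Hom
      A.pos.toModuleStruct B.pos.toModuleStruct => B.pair (k a) b) h).trans (pair_map g a b)))

theorem separated_yonedaObj (X : P.Ob) : Separated (yonedaObj (J := J) X) := fun _ _ _ _ h =>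
  (hP.out.id_left _).symm.trans ((h (idPos X)).trans (hP.out.id_left _))

theorem separated_star_yonedaObj (X : P.Ob) : Separated (yonedaObj (J := J) X).star :=
  fun Γ Δ m n h => by
    have key : ∀ f : P.Hom Γ (X :: Δ), f = P.perm (ListPerm.appendNil Γ).symm
        (ListPerm.comm Δ [X]) (P.comp f (P.id X)) := fun f => by
      refine Eq.trans ?_ (congrArg (P.perm _ _) (hP.out.right_id f)).symm
      refine Eq.trans ?_ (self_perm_perm _ _ _ _ _).symm
      exact (hP.out.perm_eq_self (U := self P)).symm
    have h' : P.comp (A := X) m (P.id X) = P.comp (A := X) n (P.id X) :=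
      (hP.out.perm_bijective (U := self P) (.comm Γ []) (.comm Δ [X])).1 (h (idNeg X))
    exact (key m).trans ((congrArg (P.perm _ _) h').trans (key n).symm)

theorem Separated.tensor (hA : Separated A) (hB : Separated B) : Separated (tensor A B) :=
  fun Γ Δ m n h => by
    have key : ∀ {Γ₁ Δ₁ Γ₂ Δ₂ : List P.Ob} (a : A.pos.obj Γ₁ Δ₁) (b : B.pos.obj Γ₂ Δ₂),
        A.pair a ((univ A B).fst b m) = A.pair a ((univ A B).fst b n) := fun {Γ₁ Δ₁ Γ₂ Δ₂} a b =>
      (hP.out.perm_bijective (U := self P) (assoc Γ₁ Γ₂ Γ).symm (assoc Δ₁ Δ₂ Δ).symm).1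
        (h ((univ A B).pos a b))
    refine tensorNeg_ext (fun b => hA _ _ fun a => key a b) (fun {Γ₁ Δ₁} a =>
      hB _ _ fun {Γ₂ Δ₂} b => ?_)
    exact ((univ A B).compat_snd a b m).symm.trans ((congrArg (P.perm (leftComm Γ₁ Γ₂ Γ)
      (leftComm Δ₁ Δ₂ Δ)) (key a b)).trans ((univ A B).compat_snd a b n))

/-- Two binary multimorphisms out of a representable module agree if they agree at the identity. -/
theorem hom₂_yo_ext {V W : PJModule P J} {k l : PJModule.Hom₂ (yoModule (J := J) X) V W}
    (y : V.obj Γ Δ) (h : k (P.id X : (yo X).obj [X] []) y = l (P.id X : (yo X).obj [X] []) y)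
    (f : (yo X).obj Γ' Δ') : k f y = l f y :=
  congrArg (fun φ : ModuleStruct.Hom (yo X) (W.shiftR Γ Δ).toModuleStruct => φ f)
    (yo_ext (φ := homR k y) (ψ := homR l y) h)

theorem hom₂_yo_ext' {V W : PJModule P J} {k l : PJModule.Hom₂ V (yoModule (J := J) X) W}
    (y : V.obj Γ Δ) (h : k y (P.id X : (yo X).obj [X] []) = l y (P.id X : (yo X).obj [X] []))
    (f : (yo X).obj Γ' Δ') : k y f = l y f :=
  congrArg (fun φ : ModuleStruct.Hom (yo X) (W.shiftL Γ Δ).toModuleStruct => φ f)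
    (yo_ext (φ := homL k y) (ψ := homL l y) h)

theorem hom₂_noy_ext' {V W : PJModule P J} {k l : PJModule.Hom₂ V (noyModule (J := J) X) W}
    (y : V.obj Γ Δ) (h : k y (P.id X : (noy X).obj [] [X]) = l y (P.id X : (noy X).obj [] [X]))
    (f : (noy X).obj Γ' Δ') : k y f = l y f :=
  congrArg (fun φ : ModuleStruct.Hom (noy X) (W.shiftL Γ Δ).toModuleStruct => φ f)
    (noy_ext (φ := homL k y) (ψ := homL l y) h)

/-- The pairing of the universal elements of two representable objects. -/
noncomputable def idTmul (X Y : P.Ob) :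
    (tensor (yonedaObj (J := J) X) (yonedaObj Y)).pos.obj [X, Y] [] :=
  (univ (yonedaObj (J := J) X) (yonedaObj Y)).pos (idPos X) (idPos Y)

/-- The positive part of a morphism, precomposed with the universal binary morphism. -/
noncomputable def posHom₂ (f : tensor A B ⟶ C) : PJModule.Hom₂ A.pos B.pos C.pos :=
  ((univ A B).postcomp f).pos

/-- Morphisms out of a tensor product of representable objects are determined by the image of
`id ⊗ id`. -/
theorem tensor_yoneda_ext {f g : tensor (yonedaObj X) (yonedaObj Y) ⟶ G}
    (h : mapPos f (idTmul X Y) = mapPos g (idTmul X Y)) : f = g := by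
  refine ((separated_yonedaObj X).tensor (separated_yonedaObj Y)).hom_ext
    (PJModule.tensor_hom_ext fun a b => ?_)
  refine hom₂_yo_ext (k := posHom₂ f) (l := posHom₂ g) b ?_ a
  exact hom₂_yo_ext' (k := posHom₂ f) (l := posHom₂ g) (P.id X : (yo X).obj [X] []) h b

/-- The threefold analogue of `tensor_yoneda_ext`. -/
theorem tensor_yoneda_ext₃
    {f g : tensor (tensor (yonedaObj X) (yonedaObj Y)) (yonedaObj Z) ⟶ G}
    (h : mapPos f ((univ _ (yonedaObj Z)).pos (idTmul X Y) (idPos Z)) =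
      mapPos g ((univ _ (yonedaObj Z)).pos (idTmul X Y) (idPos Z))) : f = g := by
  refine (((separated_yonedaObj X).tensor (separated_yonedaObj Y)).tensor
    (separated_yonedaObj Z)).hom_ext (PJModule.tensor_hom_ext fun t c => ?_)
  refine hom₂_yo_ext' (k := posHom₂ f) (l := posHom₂ g) t ?_ c
  let k : ∀ _ : tensor (tensor (yonedaObj X) (yonedaObj Y)) (yonedaObj Z) ⟶ G,
      PJModule.Hom₂ (yoModule (J := J) X) (yoModule (J := J) Y) (G.pos.shiftR [Z] []) := fun f =>
    compHom (univ (yonedaObj X) (yonedaObj Y)).pos (homR (posHom₂ f) (idPos Z))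
  refine tensor_apply_ext (φ := homR (posHom₂ f) (idPos Z)) (ψ := homR (posHom₂ g) (idPos Z))
    (fun a b => ?_) t
  refine hom₂_yo_ext (k := k f) (l := k g) b ?_ a
  exact hom₂_yo_ext' (k := k f) (l := k g) (P.id X : (yo X).obj [X] []) h b

theorem tensor_star_yoneda_ext {f g : tensor (yonedaObj X) (yonedaObj Y).star ⟶ G}
    (h : mapPos f ((univ (yonedaObj X) (yonedaObj Y).star).pos (idPos X) (idNeg Y)) =
      mapPos g ((univ (yonedaObj X) (yonedaObj Y).star).pos (idPos X) (idNeg Y))) : f = g := by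
  refine ((separated_yonedaObj X).tensor (separated_star_yonedaObj Y)).hom_ext
    (PJModule.tensor_hom_ext fun a b => ?_)
  refine hom₂_yo_ext (k := posHom₂ f) (l := posHom₂ g) b ?_ a
  exact hom₂_noy_ext' (k := posHom₂ f) (l := posHom₂ g) (P.id X : (yo X).obj [X] []) h b

/-- The morphism out of the tensor product of two representable objects that an element of
`G⁺(X,Y;)` determines. -/
noncomputable def tensorYonedaDesc {G : Envelope P J} (w : G.pos.obj [X, Y] []) :
    tensor (yonedaObj X) (yonedaObj Y) ⟶ G :=
  uncurryHom (yonedaDesc (G := internalHom (yonedaObj X) G)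
    (⟨(((ModuleStruct.Hom.ofComp ((noyShift X).shiftL [Y] [])
      (fun _ _ => noyShift_bijective X _ _ |>.1)
        ((homL G.pairing w).comp ((selfModule P J).isModule.assocLL [X] [] [Y] []))
        (fun c => G.pair w c) (fun {Γ Δ} _ => (hP.out.perm_eq_self (U := self P)
          (σ := .cons X (.refl (Y :: Γ))) (τ := .refl Δ)).symm)).comp
          ((noyModule (J := J) X).isModule.commHom [Y] [])),
      G.pos.isModule.leftElem w), fun {Γ₁ Δ₁ Γ₂ Δ₂} a c => by
        let c' : P.Hom (X :: ([Y] ++ Γ₂)) Δ₂ := G.pair w c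
        have h₁ : P.comp (A := X) a (P.perm (.cons X (.comm [Y] Γ₂)) (.comm [] Δ₂) c') =
            P.perm (.appendLeft Γ₁ (.comm [Y] Γ₂)) (.appendLeft Δ₁ (.comm [] Δ₂))
              (P.comp (A := X) a c') := hP.out.left_of_eq (U := self P) hP.out a rfl
        have h₂ : G.pair (G.pos.left a w) c = P.perm (assoc Γ₁ [Y] Γ₂).symm (assoc Δ₁ [] Δ₂).symm
            (P.comp (A := X) a c') := (homR G.pairing c).map_left a w
        refine (congrArg (P.perm (leftComm Γ₁ Γ₂ [Y]) (leftComm Δ₁ Δ₂ [])) h₁).trans ?_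
        refine Eq.trans ?_ (congrArg (P.perm (.comm _ _) (.comm _ _)) h₂).symm
        have hσ : ∀ (Φ : List P.Ob) (v : Lab (Γ₁ ++ (Φ ++ Γ₂))), (leftComm Γ₁ Γ₂ Φ).app
            ((ListPerm.appendLeft Γ₁ (.comm Φ Γ₂)).app v) =
              (ListPerm.comm (Γ₁ ++ Φ) Γ₂).app ((assoc Γ₁ Φ Γ₂).symm.app v) := by
          intro Φ
          simp
        exact hP.out.perm_eq₂₂ (U := self P) (hσ [Y])⟩ : (tensorNeg (yonedaObj X) G.star).obj [Y]
            []))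

theorem tensorYonedaDesc_idTmul (w : G.pos.obj [X, Y] []) :
    mapPos (tensorYonedaDesc w) (idTmul X Y) = w :=
  ((uncurryHom_pos _ (idPos X) (idPos Y)).trans (congrArg ((univ (yonedaObj X) G.star).snd
    (idPos X)) (yonedaDesc_id _))).trans (G.pos.isModule.id_left w)

/-- The values of a multimorphism out of a representable module are the action on its value at the
identity. -/
theorem yo_hom₂_apply {V W : PJModule P J} (k : PJModule.Hom₂ (yoModule (J := J) X) V W)
    (f : (yo X).obj Γ Δ) (y : V.obj Γ' Δ') : k f y = W.left f (k (P.id X : (yo X).obj [X] []) y) :=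
  congrArg (fun φ : ModuleStruct.Hom (yo X) (W.shiftR Γ' Δ').toModuleStruct => φ f)
    (yo_ext (φ := homR k y) (ψ := W.isModule.leftElem (k (P.id X : (yo X).obj [X] []) y))
      (W.isModule.id_left _).symm)

theorem yo_hom₂_apply' {V W : PJModule P J} (k : PJModule.Hom₂ V (yoModule (J := J) X) W)
    (y : V.obj Γ' Δ') (f : (yo X).obj Γ Δ) : k y f = W.perm (.comm Γ Γ') (.comm Δ Δ')
      (W.left f (W.perm (.comm Γ' [X]) (.comm Δ' []) (k y (P.id X : (yo X).obj [X] [])))) :=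
  (congrArg (fun l : PJModule.Hom₂ V (yoModule (J := J) X) W => l y f) (flip_flip k).symm).trans
    (congrArg (W.perm (.comm Γ Γ') (.comm Δ Δ')) (yo_hom₂_apply (PJModule.flip k) f y))

section Unit

variable [hI : J.HasUnit]

/-- Morphisms from the positive part of the unit are determined by the universal element. -/
theorem unitPos_ext {W : PJModule P J} {φ ψ : ModuleStruct.Hom (unitObj J).pos.toModuleStruct
    W.toModuleStruct} (h : φ (unitElem J) = ψ (unitElem J)) : φ = ψ := by
  have e : unitElem J = (unitObj J).pos.left hI.unitMor (idPos (J := J) hI.unit) :=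
    mapPos_unitElem (𝟙 (unitObj J))
  refine yo_ext (X := hI.unit) ((W.respects.tensor _ hI.isTensor [] []).1 ?_)
  exact ((φ.map_left _ _).symm.trans (congrArg (fun x => φ x) e.symm)).trans
    (h.trans ((congrArg (fun x => ψ x) e).trans (ψ.map_left _ _)))

theorem unit_tensor_ext {f g : tensor (unitObj J) (yonedaObj X) ⟶ G}
    (h : mapPos f ((univ (unitObj J) (yonedaObj X)).pos (unitElem J) (idPos X)) =
      mapPos g ((univ (unitObj J) (yonedaObj X)).pos (unitElem J) (idPos X))) : f = g :=
  tensor_yoneda_ext (congrArg (fun φ : ModuleStruct.Hom (unitObj J).pos.toModuleStruct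
    (G.pos.shiftR [X] []).toModuleStruct => φ (idPos hI.unit))
      (unitPos_ext (φ := homR (posHom₂ f) (idPos X)) (ψ := homR (posHom₂ g) (idPos X)) h))

theorem tensor_unit_ext {f g : tensor (yonedaObj X) (unitObj J) ⟶ G}
    (h : mapPos f ((univ (yonedaObj X) (unitObj J)).pos (idPos X) (unitElem J)) =
      mapPos g ((univ (yonedaObj X) (unitObj J)).pos (idPos X) (unitElem J))) : f = g :=
  tensor_yoneda_ext (congrArg (fun φ : ModuleStruct.Hom (unitObj J).pos.toModuleStruct
    (G.pos.shiftL [X] []).toModuleStruct => φ (idPos hI.unit))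
      (unitPos_ext (φ := homL (posHom₂ f) (idPos X)) (ψ := homL (posHom₂ g) (idPos X)) h))

end Unit

omit hJ in
/-- A morphism `(X, Y) → Z` is its own action on the identity of `Z`. -/
theorem left_id_pair (t : P.Hom [X, Y] [Z]) :
    (yo Z).left t (P.id Z : (yo Z).obj [Z] []) = (t : (yo Z).obj [X, Y] []) := by
  refine Eq.trans ?_ (yo_eq_left (t : (yo Z).obj [X, Y] [])).symm
  exact (hP.out.perm_eq_self (U := self P) (fun _ => rfl) (fun _ => rfl)).symm

/-- The element of `(X ⊗ Y)⁺(Z;)` that corresponds to the universal element, for a distinguished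
tensor product `Z`. -/
noncomputable def tensorElem (t : P.Hom [X, Y] [Z]) (ht : J.IsTensor t) :
    (tensor (yonedaObj (J := J) X) (yonedaObj Y)).pos.obj [Z] [] :=
  Function.surjInv ((tensor (yonedaObj X) (yonedaObj Y)).pos.respects.tensor t ht [] []).2
    (idTmul X Y)

theorem left_tensorElem (t : P.Hom [X, Y] [Z]) (ht : J.IsTensor t) :
    (tensor (yonedaObj (J := J) X) (yonedaObj Y)).pos.left t (tensorElem t ht) = idTmul X Y :=
  Function.surjInv_eq ((tensor (yonedaObj X) (yonedaObj Y)).pos.respects.tensor t ht [] []).2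
    (idTmul X Y)

/-- The morphism to the object representing `Z` that a morphism `(X, Y) → Z` determines. -/
noncomputable def tensorYonedaMap (t : P.Hom [X, Y] [Z]) :
    tensor (yonedaObj (J := J) X) (yonedaObj Y) ⟶ yonedaObj Z :=
  tensorYonedaDesc (G := yonedaObj Z) (t : (yo Z).obj [X, Y] [])

theorem tensorYonedaMap_idTmul (t : P.Hom [X, Y] [Z]) :
    mapPos (tensorYonedaMap (J := J) t) (idTmul X Y) = (t : (yo Z).obj [X, Y] []) :=
  tensorYonedaDesc_idTmul (G := yonedaObj Z) _

/-- A distinguished tensor product `Z` of `X` and `Y` in `P` represents the tensor product of the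
objects representing `X` and `Y`. -/
noncomputable def tensorYonedaIso (t : P.Hom [X, Y] [Z]) (ht : J.IsTensor t) :
    tensor (yonedaObj (J := J) X) (yonedaObj Y) ≅ yonedaObj Z where
  hom := tensorYonedaMap t
  inv := yonedaDesc (tensorElem t ht)
  hom_inv_id := by
    refine tensor_yoneda_ext (Eq.trans ?_ (left_tensorElem t ht))
    refine (congrArg (mapPos (yonedaDesc (tensorElem t ht)))
      ((tensorYonedaMap_idTmul t).trans (left_id_pair t).symm)).trans ?_
    exact ((Hom.pos (yonedaDesc (tensorElem t ht))).map_left t (idPos Z)).trans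
      (congrArg ((tensor (yonedaObj X) (yonedaObj Y)).pos.left t) (yonedaDesc_id _))
  inv_hom_id := by
    refine yoneda_ext (((yonedaObj (J := J) Z).pos.respects.tensor t ht [] []).1 ?_)
    refine ((Hom.pos (tensorYonedaMap (J := J) t)).map_left t _).symm.trans ?_
    refine (congrArg (mapPos (tensorYonedaMap (J := J) t)) ((congrArg ((tensor (yonedaObj X)
      (yonedaObj Y)).pos.left t) (yonedaDesc_id _)).trans (left_tensorElem t ht))).trans ?_
    exact (tensorYonedaMap_idTmul t).trans (left_id_pair t).symm

end Envelope

/-! ### Coherence for the action of permutations on tensor products -/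

namespace Counary

variable {C : Type u} [Category.{v} C] [MonoidalCategory C] [SymmetricCategory C]

/-- The interchange of the first two factors of a tensor product. -/
def sw (X Y Z : C) : X ⊗ (Y ⊗ Z) ⟶ Y ⊗ (X ⊗ Z) :=
  (α_ X Y Z).inv ≫ (β_ X Y).hom ▷ Z ≫ (α_ Y X Z).hom

theorem sw_sw (X Y Z : C) : sw X Y Z ≫ sw Y X Z = 𝟙 _ := by
  simp [sw, ← comp_whiskerRight_assoc]

theorem sw_naturality (X Y : C) {Z Z' : C} (f : Z ⟶ Z') :
    X ◁ Y ◁ f ≫ sw X Y Z' = sw X Y Z ≫ Y ◁ X ◁ f := by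
  simp only [sw, Category.assoc]
  rw [associator_inv_naturality_right_assoc, whisker_exchange_assoc, associator_naturality_right]

/-- The relation of the symmetric groups on three letters. -/
theorem sw_yang_baxter (X Y Z T : C) :
    sw X Y (Z ⊗ T) ≫ Y ◁ sw X Z T ≫ sw Y Z (X ⊗ T) =
      X ◁ sw Y Z T ≫ sw X Z (Y ⊗ T) ≫ Z ◁ sw X Y T := by
  have h := congrArg (· ▷ T) (BraidedCategory.yang_baxter X Y Z)
  have e₁ : sw X Y (Z ⊗ T) ≫ Y ◁ sw X Z T ≫ sw Y Z (X ⊗ T) =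
      𝟙 _ ⊗≫ ((α_ X Y Z).inv ≫ (β_ X Y).hom ▷ Z ≫ (α_ Y X Z).hom ≫ Y ◁ (β_ X Z).hom ≫
        (α_ Y Z X).inv ≫ (β_ Y Z).hom ▷ X ≫ (α_ Z Y X).hom) ▷ T ⊗≫ 𝟙 _ := by
    simp only [sw]
    monoidal
  have e₂ : X ◁ sw Y Z T ≫ sw X Z (Y ⊗ T) ≫ Z ◁ sw X Y T =
      𝟙 _ ⊗≫ (X ◁ (β_ Y Z).hom ≫ (α_ X Z Y).inv ≫ (β_ X Z).hom ▷ Y ≫ (α_ Z X Y).hom ≫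
        Z ◁ (β_ X Y).hom) ▷ T ⊗≫ 𝟙 _ := by
    simp only [sw]
    monoidal
  rw [e₁, e₂]
  exact congrArg (fun k => 𝟙 _ ⊗≫ k ⊗≫ 𝟙 _) h

/-- Two words act in the same way, and denote the same bijection of positions. -/
def Equi {Γ Γ' : List C} (σ τ : ListPerm Γ Γ') : Prop :=
  act σ = act τ ∧ ∀ v, σ.app v = τ.app v

namespace Equi

variable {Γ Γ' Γ'' Γ₃ : List C} {σ σ' σ'' : ListPerm Γ Γ'} {τ τ' : ListPerm Γ' Γ''}

theorem rfl' : Equi σ σ := ⟨rfl, fun _ => rfl⟩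

theorem symm' (h : Equi σ σ') : Equi σ' σ := ⟨h.1.symm, fun v => (h.2 v).symm⟩

theorem trans' (h : Equi σ σ') (h' : Equi σ' σ'') : Equi σ σ'' :=
  ⟨h.1.trans h'.1, fun v => (h.2 v).trans (h'.2 v)⟩

theorem comp (h : Equi σ σ') (h' : Equi τ τ') : Equi (σ.trans τ) (σ'.trans τ') :=
  ⟨by simp only [act, h.1, h'.1], fun v => by simp [h.2, h'.2]⟩

theorem cons (A : C) (h : Equi σ σ') : Equi (ListPerm.cons A σ) (.cons A σ') :=
  ⟨congrArg (A ◁ ·) h.1, fun v => Prod.ext rfl (h.2 v.2)⟩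

theorem assoc' (σ : ListPerm Γ Γ') (τ : ListPerm Γ' Γ'') (υ : ListPerm Γ'' Γ₃) :
    Equi ((σ.trans τ).trans υ) (σ.trans (τ.trans υ)) :=
  ⟨by simp only [act, Category.assoc], fun _ => rfl⟩

theorem refl_trans (σ : ListPerm Γ Γ') : Equi ((ListPerm.refl Γ).trans σ) σ :=
  ⟨by simp only [act, Category.comp_id], fun _ => rfl⟩

theorem trans_refl (σ : ListPerm Γ Γ') : Equi (σ.trans (.refl Γ')) σ :=
  ⟨by simp only [act, Category.id_comp], fun _ => rfl⟩

theorem cons_trans (A : C) (σ : ListPerm Γ Γ') (τ : ListPerm Γ' Γ'') :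
    Equi (.cons A (σ.trans τ)) ((ListPerm.cons A σ).trans (.cons A τ)) :=
  ⟨MonoidalCategory.whiskerLeft_comp _ _ _, fun _ => rfl⟩

theorem cons_refl (A : C) (Γ : List C) : Equi (.cons A (.refl Γ)) (.refl (A :: Γ)) :=
  ⟨by simp only [act, MonoidalCategory.whiskerLeft_id]; rfl, fun _ => rfl⟩

theorem swap_swap (A B : C) (Γ : List C) :
    Equi ((ListPerm.swap A B Γ).trans (.swap B A Γ)) (.refl _) :=
  ⟨sw_sw _ _ _, fun _ => rfl⟩

theorem swap_cons_cons (A B : C) (σ : ListPerm Γ Γ') :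
    Equi ((ListPerm.cons A (.cons B σ)).trans (.swap A B Γ'))
      ((ListPerm.swap A B Γ).trans (.cons B (.cons A σ))) :=
  ⟨(sw_naturality B A (act σ)).symm, fun _ => rfl⟩

theorem yang_baxter (A B D : C) (Γ : List C) :
    Equi ((ListPerm.swap A B (D :: Γ)).trans ((ListPerm.cons B (.swap A D Γ)).trans
        (.swap B D (A :: Γ))))
      ((ListPerm.cons A (.swap B D Γ)).trans ((ListPerm.swap A D (B :: Γ)).trans
        (.cons D (.swap A B Γ)))) := by
  exact ⟨(Category.assoc _ _ _).trans ((sw_yang_baxter D B A (tens Γ)).trans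
    (Category.assoc _ _ _).symm), fun _ => rfl⟩

end Equi

/-- Equality of lists as a permutation. -/
def ofEq {Γ Γ' : List C} (h : Γ = Γ') : ListPerm Γ Γ' :=
  h ▸ .refl Γ

/-- Every word moves a given entry `A` in the same way as a word that moves `A` to the front,
permutes the other entries, and moves `A` from the front to its new position. -/
theorem exists_front {Γ Γ' : List C} (τ : ListPerm Γ Γ') :
    ∀ (Φ : List C) (A : C) (Ψ : List C) (h : Φ ++ A :: Ψ = Γ), ∃ (Φ' Ψ' : List C)
      (h' : Φ' ++ A :: Ψ' = Γ') (τ₀ : ListPerm (Φ ++ Ψ) (Φ' ++ Ψ')),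
      Equi ((front Φ A Ψ).symm.trans ((ofEq h).trans τ))
        ((ListPerm.cons A τ₀).trans ((front Φ' A Ψ').symm.trans (ofEq h'))) := by
  induction τ with
  | refl Γ =>
    rintro Φ A Ψ rfl
    refine ⟨Φ, Ψ, rfl, .refl _, ?_⟩
    exact (Equi.rfl'.comp (Equi.trans_refl _)).trans' ((Equi.refl_trans _).symm'.trans'
      ((Equi.cons_refl _ _).symm'.comp Equi.rfl'))
  | @cons B Γ Γ' τ ih =>
    intro Φ A Ψ h
    cases Φ with
    | nil =>
      cases h
      refine ⟨[], Γ', rfl, τ, ?_⟩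
      exact (Equi.refl_trans _).trans' ((Equi.refl_trans _).trans'
        ((Equi.rfl'.comp (Equi.refl_trans _)).trans' (Equi.trans_refl _)).symm')
    | cons D Φ =>
      cases h
      obtain ⟨Φ', Ψ', rfl, τ₀, h₀⟩ := ih Φ A Ψ rfl
      refine ⟨B :: Φ', Ψ', rfl, .cons B τ₀, ?_⟩
      have h₁ : Equi ((front Φ A Ψ).symm.trans τ)
          ((ListPerm.cons A τ₀).trans (front Φ' A Ψ').symm) :=
        (Equi.rfl'.comp (Equi.refl_trans _).symm').trans' (h₀.trans'
          (Equi.rfl'.comp (Equi.trans_refl _)))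
      refine (Equi.rfl'.comp (Equi.refl_trans _)).trans' (Equi.trans' ?_
        (Equi.rfl'.comp (Equi.trans_refl _).symm'))
      refine (Equi.assoc' _ _ _).trans' ((Equi.rfl'.comp ((Equi.cons_trans _ _ _).symm'.trans'
        ((h₁.cons B).trans' (Equi.cons_trans _ _ _)))).trans' ?_)
      exact (Equi.assoc' _ _ _).symm'.trans' (((Equi.swap_cons_cons A B τ₀).symm'.comp
        Equi.rfl').trans' (Equi.assoc' _ _ _))
  | swap B D Γ =>
    intro Φ A Ψ h
    match Φ, h with
    | [], h =>
      cases h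
      refine ⟨[D], Γ, rfl, .refl _, ?_⟩
      refine ((Equi.refl_trans _).trans' (Equi.refl_trans _)).trans' (Equi.symm' ?_)
      exact ((Equi.cons_refl _ _).comp ((Equi.trans_refl _).trans' ((Equi.rfl'.comp
        (Equi.cons_refl _ _)).trans' (Equi.trans_refl _)))).trans' (Equi.refl_trans _)
    | [_], h =>
      cases h
      refine ⟨[], B :: Γ, rfl, .refl _, ?_⟩
      refine (((Equi.rfl'.comp (Equi.cons_refl _ _)).trans' (Equi.trans_refl _)).comp
        (Equi.refl_trans _)).trans' ((Equi.swap_swap _ _ _).trans' (Equi.symm' ?_))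
      exact ((Equi.cons_refl _ _).comp (Equi.refl_trans _)).trans' (Equi.refl_trans _)
    | _ :: _ :: Φ, h =>
      cases h
      refine ⟨D :: B :: Φ, Ψ, rfl, .swap B D _, ?_⟩
      have e : ∀ (X Y : C), Equi (front (X :: Y :: Φ) A Ψ).symm ((ListPerm.swap A X _).trans
          ((ListPerm.cons X (.swap A Y _)).trans (.cons X (.cons Y (front Φ A Ψ).symm)))) :=
        fun X Y => Equi.rfl'.comp (Equi.cons_trans _ _ _)
      refine ((e B D).comp (Equi.refl_trans _)).trans' (Equi.trans' ?_
        (Equi.rfl'.comp ((e D B).symm'.trans' (Equi.trans_refl _).symm')))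
      refine (Equi.assoc' _ _ _).trans' ((Equi.rfl'.comp ((Equi.assoc' _ _ _).trans'
        (Equi.rfl'.comp (Equi.swap_cons_cons B D (front Φ A Ψ).symm)))).trans' ?_)
      refine (Equi.rfl'.comp (Equi.assoc' _ _ _).symm').trans' ((Equi.assoc' _ _ _).symm'.trans' ?_)
      refine ((Equi.yang_baxter A B D _).comp Equi.rfl').trans' ?_
      exact (Equi.assoc' _ _ _).trans' (Equi.rfl'.comp (Equi.assoc' _ _ _))
  | trans σ τ ih₁ ih₂ =>
    intro Φ A Ψ h
    obtain ⟨Φ', Ψ', h', σ₀, h₁⟩ := ih₁ Φ A Ψ h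
    obtain ⟨Φ'', Ψ'', h'', τ₀, h₂⟩ := ih₂ Φ' A Ψ' h'
    refine ⟨Φ'', Ψ'', h'', σ₀.trans τ₀, ?_⟩
    refine (Equi.rfl'.comp (Equi.assoc' _ _ _).symm').trans' ((Equi.assoc' _ _ _).symm'.trans' ?_)
    refine (h₁.comp Equi.rfl').trans' ((Equi.assoc' _ _ _).trans' ?_)
    refine (Equi.rfl'.comp ((Equi.assoc' _ _ _).trans' h₂)).trans' ?_
    exact (Equi.assoc' _ _ _).symm'.trans' ((Equi.cons_trans _ _ _).symm'.comp Equi.rfl')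

/-- A word on the empty list acts as the identity. -/
theorem act_of_nil {Γ Γ' : List C} (σ : ListPerm Γ Γ') :
    Γ = [] → ∃ h : Γ = Γ', act σ = act (ofEq h) := by
  induction σ with
  | refl => exact fun _ => ⟨rfl, rfl⟩
  | cons => exact fun h => nomatch h
  | swap => exact fun h => nomatch h
  | trans σ τ ih₁ ih₂ =>
    intro h
    obtain ⟨rfl, h₁⟩ := ih₁ h
    obtain ⟨rfl, h₂⟩ := ih₂ h
    exact ⟨rfl, by simp only [act, h₁, h₂, ofEq, Category.comp_id]⟩

omit [Category.{v} C] [MonoidalCategory C] [SymmetricCategory C] in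
theorem idx_front_symm : (Φ : List C) → (A : C) → (Ψ : List C) →
    (front Φ A Ψ).symm.idx 0 = Φ.length
  | [], _, _ => rfl
  | _ :: Φ, A, Ψ => congrArg (· + 1) (idx_front_symm Φ A Ψ)

omit [Category.{v} C] [MonoidalCategory C] [SymmetricCategory C] in
theorem idx_ofEq {Γ Γ' : List C} (h : Γ = Γ') (i : ℕ) : (ofEq h).idx i = i := by
  subst h
  rfl

/-- Coherence: the action of a word depends only on the bijection of positions that it denotes. -/
theorem act_congr : {Γ Γ' : List C} → {σ τ : ListPerm Γ Γ'} → (∀ v, σ.app v = τ.app v) →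
    act σ = act τ
  | [], Γ', σ, τ, _ => by
    obtain ⟨h₁, h₁'⟩ := act_of_nil σ rfl
    obtain ⟨h₂, h₂'⟩ := act_of_nil τ rfl
    exact h₁'.trans h₂'.symm
  | A :: Γ, Γ', σ, τ, h => by
    obtain ⟨Φ, Ψ, rfl, σ₀, h₁⟩ := exists_front σ [] A Γ rfl
    obtain ⟨Φ', Ψ', h', τ₀, h₂⟩ := exists_front τ [] A Γ rfl
    have h₀ : ∀ v, ((ListPerm.cons A σ₀).trans ((front Φ A Ψ).symm.trans (ofEq rfl))).app v =
        ((ListPerm.cons A τ₀).trans ((front Φ' A Ψ').symm.trans (ofEq h'))).app v := fun v =>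
      (h₁.2 v).symm.trans ((h v).trans (h₂.2 v))
    -- Both words move `A` to the same position, which leaves words on the other entries.
    have hl : Φ.length = Φ'.length := by
      have h₃ := congrFun (ListPerm.idx_ext h₀) 0
      simpa only [ListPerm.idx, idx_ofEq, idx_front_symm] using h₃
    obtain ⟨rfl, h₄⟩ := List.append_inj h' hl.symm
    cases h₄
    have h₅ : act σ₀ = act τ₀ := act_congr fun v => by
      have h₆ := congrArg (front Φ' A Ψ).app (h₀ (.cons 0 v))
      exact congrArg Prod.snd ((ListPerm.app_app_symm _ _).symm.trans
        (h₆.trans (ListPerm.app_app_symm _ _)))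
    have h₇ := (Equi.refl_trans _).symm'.trans' ((Equi.refl_trans _).symm'.trans' h₁)
    have h₈ := (Equi.refl_trans _).symm'.trans' ((Equi.refl_trans _).symm'.trans' h₂)
    exact h₇.1.trans ((congrArg (fun k => act ((front Φ' A Ψ).symm.trans (ofEq rfl)) ≫ A ◁ k)
      h₅).trans h₈.1.symm)

end Counary

/-! ### The co-unary polycategory of a symmetric monoidal category -/

namespace Counary

variable {C : Type u} [Category.{v} C] [MonoidalCategory C] [SymmetricCategory C]

theorem sw_naturality_left {X X' : C} (f : X ⟶ X') (Y Z : C) :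
    f ▷ (Y ⊗ Z) ≫ sw X' Y Z = sw X Y Z ≫ Y ◁ (f ▷ Z) := by
  simp only [sw, Category.assoc]
  rw [associator_inv_naturality_left_assoc, ← comp_whiskerRight_assoc,
    BraidedCategory.braiding_naturality_left, comp_whiskerRight_assoc,
    associator_naturality_middle]

theorem sw_naturality_right (X : C) {Y Y' : C} (g : Y ⟶ Y') (Z : C) :
    X ◁ (g ▷ Z) ≫ sw X Y' Z = sw X Y Z ≫ g ▷ (X ⊗ Z) := by
  simp only [sw, Category.assoc]
  rw [associator_inv_naturality_middle_assoc, ← comp_whiskerRight_assoc,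
    BraidedCategory.braiding_naturality_right, comp_whiskerRight_assoc,
    associator_naturality_left]

/-! The induction steps of the lemmas on `split` and `act` below, for arbitrary objects in place of
the tensor products of lists. -/

section Steps

variable {A B E X X' D D' T M V W W' : C}

omit [SymmetricCategory C] in
theorem cons_step_right {q : W' ⟶ W} {s : W ⟶ X ⊗ D} {s' : W' ⟶ X' ⊗ D} {p : X' ⟶ X}
    (h : q ≫ s = s' ≫ p ▷ D) : A ◁ q ≫ (A ◁ s ≫ (α_ A X D).inv) =
      (A ◁ s' ≫ (α_ A X' D).inv) ≫ (A ◁ p) ▷ D := by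
  rw [← MonoidalCategory.whiskerLeft_comp_assoc, h]
  simp

omit [SymmetricCategory C] in
theorem cons_step_left {q : W' ⟶ W} {s : W ⟶ X ⊗ D} {s' : W' ⟶ X ⊗ D'} {p : D' ⟶ D}
    (h : q ≫ s = s' ≫ X ◁ p) : A ◁ q ≫ (A ◁ s ≫ (α_ A X D).inv) =
      (A ◁ s' ≫ (α_ A X D').inv) ≫ (A ⊗ X) ◁ p := by
  rw [← MonoidalCategory.whiskerLeft_comp_assoc, h]
  simp

theorem swap_step (s : W ⟶ X ⊗ D) :
    sw B A W ≫ (A ◁ (B ◁ s ≫ (α_ B X D).inv) ≫ (α_ A (B ⊗ X) D).inv) =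
      (B ◁ (A ◁ s ≫ (α_ A X D).inv) ≫ (α_ B (A ⊗ X) D).inv) ≫ sw B A X ▷ D := by
  have h : sw B A (X ⊗ D) ≫ A ◁ (α_ B X D).inv ≫ (α_ A (B ⊗ X) D).inv =
      B ◁ (α_ A X D).inv ≫ (α_ B (A ⊗ X) D).inv ≫ sw B A X ▷ D := by
    simp only [sw]
    monoidal
  simp only [MonoidalCategory.whiskerLeft_comp, Category.assoc]
  rw [← h, ← reassoc_of% (sw_naturality B A s)]

omit [SymmetricCategory C] in
theorem assoc_step {q : W' ⟶ W} {s : W ⟶ V ⊗ T} {p : V ⟶ X ⊗ D} {r : W' ⟶ X ⊗ M}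
    {m : M ⟶ D ⊗ T} (h : q ≫ s ≫ p ▷ T = r ≫ X ◁ m ≫ (α_ X D T).inv) :
    A ◁ q ≫ (A ◁ s ≫ (α_ A V T).inv) ≫ (A ◁ p ≫ (α_ A X D).inv) ▷ T =
      (A ◁ r ≫ (α_ A X M).inv) ≫ (A ⊗ X) ◁ m ≫ (α_ (A ⊗ X) D T).inv := by
  have e₁ : A ◁ q ≫ (A ◁ s ≫ (α_ A V T).inv) ≫ (A ◁ p ≫ (α_ A X D).inv) ▷ T =
      A ◁ (q ≫ s ≫ p ▷ T) ⊗≫ 𝟙 _ := by monoidal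
  have e₂ : (A ◁ r ≫ (α_ A X M).inv) ≫ (A ⊗ X) ◁ m ≫ (α_ (A ⊗ X) D T).inv =
      A ◁ (r ≫ X ◁ m ≫ (α_ X D T).inv) ⊗≫ 𝟙 _ := by monoidal
  rw [e₁, e₂, h]

theorem sw_tensor (A B X D : C) : sw A (B ⊗ X) D =
    A ◁ (α_ B X D).hom ≫ sw A B (X ⊗ D) ≫ B ◁ sw A X D ≫ (α_ B X (A ⊗ D)).inv := by
  simp only [sw, BraidedCategory.braiding_tensor_right_hom]
  monoidal

theorem front_step {q : A ⊗ W ⟶ V} {s : V ⟶ X ⊗ (A ⊗ D)} {r : W ⟶ X ⊗ D}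
    (h : q ≫ s = A ◁ r ≫ sw A X D) : (sw A B W ≫ B ◁ q) ≫ (B ◁ s ≫ (α_ B X (A ⊗ D)).inv) =
      A ◁ (B ◁ r ≫ (α_ B X D).inv) ≫ sw A (B ⊗ X) D := by
  rw [sw_tensor, Category.assoc, ← MonoidalCategory.whiskerLeft_comp_assoc, h,
    MonoidalCategory.whiskerLeft_comp_assoc, ← reassoc_of% (sw_naturality A B r)]
  simp

theorem front_nil_step (A D : C) : 𝟙 (A ⊗ D) ≫ (λ_ (A ⊗ D)).inv =
    A ◁ (λ_ D).inv ≫ sw A (𝟙_ C) D := by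
  simp only [sw, braiding_tensorUnit_right]
  monoidal

theorem comm_nil_step (s : W ⟶ D ⊗ 𝟙_ C) : (s ≫ (ρ_ D).hom) ≫ (λ_ D).inv =
    s ≫ (β_ D (𝟙_ C)).hom := by
  rw [braiding_tensorUnit_right, Category.assoc]

theorem sw_braiding (A D X : C) : sw A D X ≫ (β_ D (A ⊗ X)).hom =
    A ◁ (β_ D X).hom ≫ (α_ A X D).inv := by
  simp [sw, BraidedCategory.braiding_tensor_right_hom, ← comp_whiskerRight_assoc]

theorem comm_step {f : A ⊗ W ⟶ V} {f' : V ⟶ A ⊗ W} (hf : f' ≫ f = 𝟙 V) {q : W ⟶ M}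
    {s : M ⟶ X ⊗ D} {s' : W ⟶ D ⊗ X} {r : V ⟶ D ⊗ (A ⊗ X)} (h : q ≫ s = s' ≫ (β_ D X).hom)
    (hr : f ≫ r = A ◁ s' ≫ sw A D X) :
    (f' ≫ A ◁ q) ≫ (A ◁ s ≫ (α_ A X D).inv) = r ≫ (β_ D (A ⊗ X)).hom := by
  have e : r = f' ≫ A ◁ s' ≫ sw A D X := by rw [← hr, reassoc_of% hf]
  rw [e, Category.assoc, ← MonoidalCategory.whiskerLeft_comp_assoc, h]
  simp only [MonoidalCategory.whiskerLeft_comp, Category.assoc, sw_braiding]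

omit [SymmetricCategory C] in
theorem sub_sub_step {q : W' ⟶ W} {s : W ⟶ V ⊗ T} {p : V ⟶ X ⊗ D} {r : W' ⟶ X ⊗ M}
    {m : M ⟶ D ⊗ T} (h : q ≫ s ≫ p ▷ T = r ≫ X ◁ m ≫ (α_ X D T).inv) (f : X ⟶ A)
    (g : A ⊗ D ⟶ B) (k : B ⊗ T ⟶ E) : q ≫ s ≫ (p ≫ f ▷ D ≫ g) ▷ T ≫ k =
      r ≫ f ▷ M ≫ (A ◁ m ≫ (α_ A D T).inv) ≫ g ▷ T ≫ k := by
  simp only [comp_whiskerRight, Category.assoc]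
  rw [reassoc_of% h, ← associator_inv_naturality_left_assoc, whisker_exchange_assoc]

theorem front_sub_step {q : B ⊗ W ⟶ V} {s : V ⟶ X ⊗ (B ⊗ D)} {r : W ⟶ X ⊗ D}
    (h : q ≫ s = B ◁ r ≫ sw B X D) (f : X ⟶ A) (x : A ⊗ (B ⊗ D) ⟶ E) :
    q ≫ s ≫ f ▷ (B ⊗ D) ≫ x = B ◁ (r ≫ f ▷ D) ≫ sw B A D ≫ x := by
  rw [reassoc_of% h, MonoidalCategory.whiskerLeft_comp_assoc,
    reassoc_of% (sw_naturality_right B f D)]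

theorem sub_comm_step {q : W ⟶ W'} {s : W' ⟶ X' ⊗ V} {s' : V ⟶ X ⊗ T} {r : W ⟶ X ⊗ M}
    {r' : M ⟶ X' ⊗ T} (h : q ≫ s ≫ X' ◁ s' = r ≫ X ◁ r' ≫ sw X X' T) (f : X ⟶ A) (f' : X' ⟶ B)
    (x : A ⊗ (B ⊗ T) ⟶ E) :
    q ≫ s ≫ f' ▷ V ≫ B ◁ (s' ≫ f ▷ T) ≫ sw B A T ≫ x =
      r ≫ f ▷ M ≫ A ◁ (r' ≫ f' ▷ T) ≫ sw A B T ≫ sw B A T ≫ x := by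
  rw [reassoc_of% (sw_sw A B T), MonoidalCategory.whiskerLeft_comp_assoc,
    ← whisker_exchange_assoc, reassoc_of% h, ← reassoc_of% (sw_naturality_right X f' T),
    ← reassoc_of% (sw_naturality_left f B T), reassoc_of% (sw_sw A B T), ← whisker_exchange_assoc]
  simp

end Steps

theorem act_symm {Γ Γ' : List C} (σ : ListPerm Γ Γ') : act σ.symm ≫ act σ = 𝟙 _ :=
  act_congr (σ := σ.trans σ.symm) (τ := .refl Γ) fun v => ListPerm.app_symm_app σ v

theorem act_append_right {Γ Γ' : List C} (σ : ListPerm Γ Γ') (Δ : List C) :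
    act (σ.appendRight Δ) ≫ split Γ Δ = split Γ' Δ ≫ act σ ▷ tens Δ := by
  induction σ with
  | refl Γ => simp [act, ListPerm.appendRight]
  | cons A σ ih => exact cons_step_right ih
  | swap A B Γ => exact swap_step (split Γ Δ)
  | trans σ τ ih₁ ih₂ =>
    simp only [act, ListPerm.appendRight, Category.assoc, comp_whiskerRight]
    rw [ih₁, reassoc_of% ih₂]

theorem act_append_left : (Γ : List C) → {Δ Δ' : List C} → (τ : ListPerm Δ Δ') →
    act (ListPerm.appendLeft Γ τ) ≫ split Γ Δ = split Γ Δ' ≫ tens Γ ◁ act τ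
  | [], _, _, τ => leftUnitor_inv_naturality (act τ)
  | _ :: Γ, _, _, τ => cons_step_left (act_append_left Γ τ)

theorem act_append {Γ Γ' Δ Δ' : List C} (σ : ListPerm Γ Γ') (τ : ListPerm Δ Δ') :
    act (σ.append τ) ≫ split Γ Δ = split Γ' Δ' ≫ (act σ ⊗ₘ act τ) := by
  have h : act (σ.append τ) = act (ListPerm.appendLeft Γ' τ) ≫ act (σ.appendRight Δ) := rfl
  rw [h, Category.assoc, act_append_right, ← Category.assoc, act_append_left, Category.assoc,
    tensorHom_def']

theorem act_appendNil : (Γ : List C) →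
    act (.appendNil Γ) = split Γ [] ≫ (ρ_ (tens Γ)).hom
  | [] => show 𝟙 (𝟙_ C) = (λ_ (𝟙_ C)).inv ≫ (ρ_ (𝟙_ C)).hom by simp [← unitors_equal]
  | A :: Γ => by
    refine (congrArg (A ◁ ·) (act_appendNil Γ)).trans ?_
    have h : ∀ {W X : C} (s : W ⟶ X ⊗ 𝟙_ C), A ◁ (s ≫ (ρ_ X).hom) =
        (A ◁ s ≫ (α_ A X (𝟙_ C)).inv) ≫ (ρ_ (A ⊗ X)).hom := fun s => by simp
    exact h _

theorem act_assoc : (Γ Δ Θ : List C) → act (assoc Γ Δ Θ) ≫ split (Γ ++ Δ) Θ ≫ split Γ Δ ▷ tens Θ =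
    split Γ (Δ ++ Θ) ≫ tens Γ ◁ split Δ Θ ≫ (α_ (tens Γ) (tens Δ) (tens Θ)).inv
  | [], Δ, Θ => by
    have h : ∀ {W D T : C} (s : W ⟶ D ⊗ T), 𝟙 W ≫ s ≫ (λ_ D).inv ▷ T =
        (λ_ W).inv ≫ 𝟙_ C ◁ s ≫ (α_ (𝟙_ C) D T).inv := fun s => by simp
    exact h _
  | _ :: Γ, Δ, Θ => assoc_step (act_assoc Γ Δ Θ)

theorem act_front : (Γ : List C) → (A : C) → (Δ : List C) → act (front Γ A Δ) ≫ split Γ (A :: Δ) =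
    A ◁ split Γ Δ ≫ sw A (tens Γ) (tens Δ)
  | [], A, Δ => front_nil_step A (tens Δ)
  | _ :: Γ, A, Δ => front_step (act_front Γ A Δ)

/-- The word that exchanges two blocks acts as the braiding of their tensor products. -/
theorem act_comm : (Γ Δ : List C) → act (.comm Γ Δ) ≫ split Γ Δ =
    split Δ Γ ≫ (β_ (tens Δ) (tens Γ)).hom
  | [], Δ => (congrArg (· ≫ split [] Δ) (act_appendNil Δ)).trans (comm_nil_step (split Δ []))
  | A :: Γ, Δ => comm_step (act_symm (front Δ A Γ)) (act_comm Γ Δ) (act_front Δ A Γ)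

theorem act_leftComm (Γ Δ Θ : List C) :
    act (leftComm Γ Δ Θ) ≫ split Γ (Δ ++ Θ) ≫ tens Γ ◁ split Δ Θ =
      split Δ (Γ ++ Θ) ≫ tens Δ ◁ split Γ Θ ≫ sw (tens Δ) (tens Γ) (tens Θ) := by
  have h₁ : split Γ (Δ ++ Θ) ≫ tens Γ ◁ split Δ Θ = act (assoc Γ Δ Θ) ≫ split (Γ ++ Δ) Θ ≫
      split Γ Δ ▷ tens Θ ≫ (α_ (tens Γ) (tens Δ) (tens Θ)).hom := by
    rw [reassoc_of% act_assoc Γ Δ Θ, Iso.inv_hom_id, Category.comp_id]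
  have h₂ : act (leftComm Γ Δ Θ) = (act (assoc Δ Γ Θ) ≫
      act ((ListPerm.comm Γ Δ).appendRight Θ)) ≫ act (assoc Γ Δ Θ).symm := rfl
  rw [h₁, h₂, Category.assoc, Category.assoc, reassoc_of% act_symm (assoc Γ Δ Θ),
    reassoc_of% act_append_right, ← comp_whiskerRight_assoc, act_comm, comp_whiskerRight_assoc,
    reassoc_of% act_assoc Δ Γ Θ]
  rfl

/-- Substitution of a morphism for the first of the factors of a tensor product. -/
def sub {Γ S : List C} {A B : C} (f : tens Γ ⟶ A) (g : A ⊗ tens S ⟶ B) : tens (Γ ++ S) ⟶ B :=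
  split Γ S ≫ f ▷ tens S ≫ g

section Substitution

variable {Γ Γ' S S' Φ Γ₁ Γ₂ : List C} {A B D : C}

theorem act_sub (σ : ListPerm Γ Γ') (σ' : ListPerm S S') (f : tens Γ ⟶ A)
    (g : A ⊗ tens S ⟶ B) :
    sub (act σ ≫ f) (A ◁ act σ' ≫ g) = act (σ.append σ') ≫ sub f g := by
  simp only [sub]
  rw [reassoc_of% act_append σ σ', MonoidalCategory.tensorHom_def, comp_whiskerRight,
      Category.assoc,
    Category.assoc, whisker_exchange_assoc]

omit [SymmetricCategory C] in
theorem id_sub (g : A ⊗ tens S ⟶ B) : sub (Γ := [A]) (ρ_ A).hom g = g := by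
  have h : (A ◁ (λ_ (tens S)).inv ≫ (α_ A (𝟙_ C) (tens S)).inv) ≫ (ρ_ A).hom ▷ tens S ≫ g = g := by
    simp
  exact h

theorem sub_id (f : tens Γ ⟶ A) : sub (S := []) f (ρ_ A).hom = act (.appendNil Γ) ≫ f := by
  have h : ∀ {X W : C} (s : W ⟶ X ⊗ 𝟙_ C) (f : X ⟶ A), s ≫ f ▷ 𝟙_ C ≫ (ρ_ A).hom =
      (s ≫ (ρ_ X).hom) ≫ f := fun s f => by simp
  rw [act_appendNil]
  exact h (split Γ []) f

theorem sub_sub (f : tens Γ ⟶ A) (g : A ⊗ tens S ⟶ B) (k : B ⊗ tens Φ ⟶ D) :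
    act (assoc Γ S Φ) ≫ sub (sub f g) k = sub (S := S ++ Φ) f (sub (Γ := A :: S) g k) :=
  sub_sub_step (act_assoc Γ S Φ) f g k

theorem act_front_sub (f : tens Γ ⟶ A) (x : A ⊗ (B ⊗ tens S) ⟶ D) :
    act (front Γ B S) ≫ sub (S := B :: S) f x =
      B ◁ (split Γ S ≫ f ▷ tens S) ≫ sw B A (tens S) ≫ x :=
  front_sub_step (act_front Γ B S) f x

theorem sub_sub_comm (f₁ : tens Γ₁ ⟶ A) (f₂ : tens Γ₂ ⟶ B) (x : A ⊗ (B ⊗ tens S) ⟶ D) :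
    act (leftComm Γ₂ Γ₁ S) ≫ sub (S := Γ₁ ++ S) f₂ (act (front Γ₁ B S) ≫ sub (S := B :: S) f₁ x) =
      sub (S := Γ₂ ++ S) f₁
        (act (front Γ₂ A S) ≫ sub (S := A :: S) f₂ (sw B A (tens S) ≫ x)) :=
  (congrArg (fun k => act (leftComm Γ₂ Γ₁ S) ≫ sub (S := Γ₁ ++ S) f₂ k)
    (act_front_sub f₁ x)).trans ((sub_comm_step (act_leftComm Γ₂ Γ₁ S) f₁ f₂ x).trans
      (congrArg (fun k => sub (S := Γ₂ ++ S) f₁ k) (act_front_sub f₂ (sw B A (tens S) ≫ x)).symm))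

end Substitution

omit [SymmetricCategory C] in
theorem Hom.mk_congr {Γ Δ : List C} {B : C} {h h' : tens Γ ⟶ B} {e e' : Δ = [B]} (H : h = h') :
    (⟨B, h, e⟩ : Hom Γ Δ) = ⟨B, h', e'⟩ :=
  H ▸ rfl

section Poly

variable {Γ Γ' Δ Δ' S S' T T' Φ Ψ Γ₁ Δ₁ Γ₂ Δ₂ : List C} {A B : C}

theorem poly_perm_refl (f : Hom Γ Δ) : (poly C).perm (.refl Γ) (.refl Δ) f = f :=
  Hom.mk_congr (Category.id_comp f.hom)

theorem poly_perm_trans {Γ'' Δ'' : List C} (σ : ListPerm Γ Γ') (σ' : ListPerm Γ' Γ'')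
    (τ : ListPerm Δ Δ') (τ' : ListPerm Δ' Δ'') (f : Hom Γ Δ) :
    (poly C).perm (σ.trans σ') (τ.trans τ') f = (poly C).perm σ' τ' ((poly C).perm σ τ f) :=
  Hom.mk_congr (Category.assoc (act σ') (act σ) f.hom)

theorem poly_perm_congr {σ σ' : ListPerm Γ Γ'} (τ τ' : ListPerm Δ Δ') (h : σ.idx = σ'.idx)
    (f : Hom Γ Δ) : (poly C).perm σ τ f = (poly C).perm σ' τ' f :=
  Hom.mk_congr (congrArg (· ≫ f.hom) (act_congr (ListPerm.app_congr h)))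

theorem poly_perm_comp (σ : ListPerm Γ Γ') (τ : ListPerm Δ Δ') (σ' : ListPerm S S')
    (τ' : ListPerm T T') (f : Hom Γ (A :: Δ)) (g : Hom (A :: S) T) :
    (poly C).comp ((poly C).perm σ (.cons A τ) f) ((poly C).perm (.cons A σ') τ' g) =
      (poly C).perm (σ.append σ') (τ.append τ') ((poly C).comp f g) := by
  obtain ⟨_, f, e⟩ := f
  cases e
  exact Hom.mk_congr ((congrArg (fun k => sub k _) (Category.comp_id (act σ ≫ f))).trans
    ((act_sub σ σ' f g.hom).trans (congrArg (fun k => act (σ.append σ') ≫ sub k g.hom)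
      (Category.comp_id f).symm)))

theorem poly_id_comp (g : Hom (A :: S) T) : (poly C).comp ((poly C).id A) g = g :=
  Hom.mk_congr ((congrArg (fun k => sub (Γ := [A]) k g.hom) (Category.comp_id (ρ_ A).hom)).trans
    (id_sub g.hom))

theorem poly_comp_id (f : Hom Γ (A :: Δ)) :
    (poly C).comp f ((poly C).id A) = (poly C).perm (.appendNil Γ) (.rotate A Δ) f := by
  obtain ⟨_, f, e⟩ := f
  cases e
  exact Hom.mk_congr ((congrArg (fun k => sub (S := []) k (ρ_ A).hom) (Category.comp_id f)).trans
    (sub_id f))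

theorem poly_comp_comp (f : Hom Γ (A :: Δ)) (g : Hom (A :: S) (B :: T)) (h : Hom (B :: Φ) Ψ) :
    (poly C).perm (assoc Γ S Φ) (assoc Δ T Ψ)
        ((poly C).comp ((poly C).perm (.refl _) (front Δ B T) ((poly C).comp f g)) h) =
      (poly C).comp f ((poly C).comp g h) := by
  obtain ⟨_, f, e⟩ := f
  cases e
  obtain ⟨_, g, e⟩ := g
  cases e
  refine Hom.mk_congr (Eq.trans ?_ ((sub_sub f g h.hom).trans ?_))
  · refine congrArg (fun k => act (assoc Γ S Φ) ≫ sub k h.hom) ?_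
    exact (Category.comp_id _).trans ((Category.id_comp _).trans
      (congrArg (fun k => sub k g) (Category.comp_id f)))
  · exact (congrArg (fun k => sub (S := S ++ Φ) k (sub (Γ := A :: S) g h.hom))
      (Category.comp_id f).symm).trans (congrArg (fun k => sub (S := S ++ Φ) (f ≫ 𝟙 A)
        (sub (Γ := A :: S) k h.hom)) (Category.comp_id g).symm)

theorem poly_comm (f₁ : Hom Γ₁ (A :: Δ₁)) (f₂ : Hom Γ₂ (B :: Δ₂)) (x : Hom (A :: B :: S) T) :
    (poly C).perm (leftComm Γ₂ Γ₁ S) (leftComm Δ₂ Δ₁ T) ((poly C).comp f₂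
        ((poly C).perm (front Γ₁ B S) (.refl _) ((poly C).comp f₁ x))) =
      (poly C).comp f₁ ((poly C).perm (front Γ₂ A S) (.refl _)
        ((poly C).comp f₂ ((poly C).perm (.swap A B S) (.refl _) x))) := by
  obtain ⟨_, f₁, e⟩ := f₁
  cases e
  obtain ⟨_, f₂, e⟩ := f₂
  cases e
  refine Hom.mk_congr (Eq.trans ?_ ((sub_sub_comm f₁ f₂ x.hom).trans ?_))
  · exact (congrArg (fun k => act (leftComm Γ₂ Γ₁ S) ≫ sub (S := Γ₁ ++ S) k
      (act (front Γ₁ B S) ≫ sub (S := B :: S) (f₁ ≫ 𝟙 A) x.hom)) (Category.comp_id f₂)).trans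
        (congrArg (fun k => act (leftComm Γ₂ Γ₁ S) ≫ sub (S := Γ₁ ++ S) f₂
          (act (front Γ₁ B S) ≫ sub (S := B :: S) k x.hom)) (Category.comp_id f₁))
  · exact (congrArg (fun k => sub (S := Γ₂ ++ S) k (act (front Γ₂ A S) ≫ sub (S := A :: S) f₂
      (sw B A (tens S) ≫ x.hom))) (Category.comp_id f₁).symm).trans
        (congrArg (fun k => sub (S := Γ₂ ++ S) (f₁ ≫ 𝟙 A) (act (front Γ₂ A S) ≫
          sub (S := A :: S) k (sw B A (tens S) ≫ x.hom))) (Category.comp_id f₂).symm)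

omit [SymmetricCategory C] in
/-- There are no morphisms into a list of two or more objects. -/
theorem Hom.elim {p : Prop} (f : Hom Γ (A :: B :: Δ)) : p :=
  nomatch (List.cons.inj f.eq).2

end Poly

variable (C) in
theorem isPolycategory_poly : (poly C).IsPolycategory where
  perm_refl f := poly_perm_refl (C := C) f
  perm_trans := poly_perm_trans (C := C)
  perm_congr _ _ τ τ' h _ := poly_perm_congr (C := C) τ τ' h
  left_perm := poly_perm_comp (C := C)
  right_perm := poly_perm_comp (C := C)
  id_left := poly_id_comp (C := C)
  right_id := poly_comp_id (C := C)
  left_left := poly_comp_comp (C := C)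
  left_right := poly_comp_comp (C := C)
  right_right := poly_comp_comp (C := C)
  left_left_comm := poly_comm (C := C)
  left_right_comm := poly_comm (C := C)
  right_right_comm x := Hom.elim (C := C) x
  right_left_comm x := Hom.elim (C := C) x

end Counary

/-! ### Composition along objects in arbitrary positions -/

namespace Lab

variable {α : Type u}

/-- The label of the first entry. -/
def head {A : α} {Γ : List α} (v : Lab (A :: Γ)) : ℕ := v.1

/-- The labels of the entries after the first. -/
def tail {A : α} {Γ : List α} (v : Lab (A :: Γ)) : Lab Γ := v.2

@[simp] theorem head_cons {A : α} {Γ : List α} (n : ℕ) (v : Lab Γ) :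
    head (cons n v : Lab (A :: Γ)) = n := rfl

@[simp] theorem tail_cons {A : α} {Γ : List α} (n : ℕ) (v : Lab Γ) :
    tail (cons n v : Lab (A :: Γ)) = v := rfl

end Lab

namespace PolycategoryStruct

variable {P : PolycategoryStruct.{u, w}}

/-- The composite of `f` and `g` along an object `A` that `τ` and `σ` move to the head of the
codomain of `f` and of the domain of `g`, followed by permutations. -/
def cut {G D D' S S' T X Y : List P.Ob} {A : P.Ob} (τ : ListPerm D (A :: D'))
    (σ : ListPerm S (A :: S')) (m : ListPerm (G ++ S') X) (n : ListPerm (D' ++ T) Y)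
    (f : P.Hom G D) (g : P.Hom S T) : P.Hom X Y :=
  P.perm m n (P.comp (P.perm (.refl G) τ f) (P.perm σ (.refl T) g))

namespace IsPolycategory

variable (hP : P.IsPolycategory)
include hP

theorem perm_cut {G D D' S S' T X Y X' Y' : List P.Ob} {A : P.Ob} (τ : ListPerm D (A :: D'))
    (σ : ListPerm S (A :: S')) (m : ListPerm (G ++ S') X) (n : ListPerm (D' ++ T) Y)
    (m' : ListPerm X X') (n' : ListPerm Y Y') (f : P.Hom G D) (g : P.Hom S T) :
    P.perm m' n' (P.cut τ σ m n f g) = P.cut τ σ (m.trans m') (n.trans n') f g :=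
  ModuleStruct.IsModule.perm_perm hP _ _ _ _ _

/-- Associativity of composition, for composites along objects in arbitrary positions. The
permutations `μ` and `ν` rearrange the remaining entries of the middle morphism, and the hypotheses
say that the two sides move all entries in the same way. -/
theorem cut_assoc {G D D' S S' T T' Φ Φ' Ψ X X' X'' Y Y' Y'' Z W : List P.Ob} {A B : P.Ob}
    {f : P.Hom G D} {g : P.Hom S T} {h : P.Hom Φ Ψ} {τ : ListPerm D (A :: D')}
    {σ : ListPerm S (A :: S')} {τ' : ListPerm T (B :: T')} {ρ : ListPerm Φ (B :: Φ')}
    {m : ListPerm (G ++ S') X} {n : ListPerm (D' ++ T) Y} {τ₂ : ListPerm Y (B :: Y')}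
    {m₂ : ListPerm (X ++ Φ') Z} {n₂ : ListPerm (Y' ++ Ψ) W}
    {m' : ListPerm (S ++ Φ') X'} {n' : ListPerm (T' ++ Ψ) Y''} {σ₂ : ListPerm X' (A :: X'')}
    {m₃ : ListPerm (G ++ X'') Z} {n₃ : ListPerm (D' ++ Y'') W}
    (μ : ListPerm (S' ++ Φ') X'') (ν : ListPerm (D' ++ T') Y')
    (h₁ : ∀ (s : Lab S) (x : Lab Φ'), σ₂.app (m'.app (s.append x)) =
      .cons (σ.app s).head (μ.app ((σ.app s).tail.append x)))
    (h₂ : ∀ (v : Lab G) (s : Lab S') (x : Lab Φ'), m₂.app ((m.app (v.append s)).append x) = m₃.app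
      (v.append (μ.app (s.append x))))
    (h₃ : ∀ (d : Lab D') (t : Lab T), τ₂.app (n.app (d.append t)) =
      .cons (τ'.app t).head (ν.app (d.append (τ'.app t).tail)))
    (h₄ : ∀ (d : Lab D') (t : Lab T') (y : Lab Ψ), n₂.app ((ν.app (d.append t)).append y) =
      n₃.app (d.append (n'.app (t.append y)))) :
    P.cut τ₂ ρ m₂ n₂ (P.cut τ σ m n f g) h = P.cut τ σ₂ m₃ n₃ f (P.cut τ' ρ m' n' g h) := by
  have h₁' : ∀ a (s : Lab S') (x : Lab Φ'), σ₂.app (m'.app ((σ.symm.app (.cons a s)).append x)) =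
      .cons a (μ.app (s.append x)) := fun a s x => by simpa using h₁ (σ.symm.app (.cons a s)) x
  have h₃' : ∀ (d : Lab D') b (t : Lab T'), τ₂.app (n.app (d.append (τ'.symm.app (.cons b t)))) =
      .cons b (ν.app (d.append t)) := fun d b t => by simpa using h₃ d (τ'.symm.app (.cons b t))
  let f₁ := P.perm (.refl G) τ f
  let g₁ := P.perm σ τ' g
  let h₁ := P.perm ρ (.refl Ψ) h
  have e₁ : P.perm (.refl X) τ₂ (P.cut τ σ m n f g) =
      P.perm m (.cons B ν) (P.perm (.refl (G ++ S')) (front D' B T') (P.comp f₁ g₁)) := by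
    refine (congrArg (fun k => P.perm (.refl X) τ₂ (P.perm m n k))
      (ModuleStruct.IsModule.left_of_eq hP hP f₁ (σ := .refl S') (τ := τ'.symm) (x := g₁)
        (ModuleStruct.IsModule.perm_eq₁₂ hP (fun _ => rfl)))).trans
          (ModuleStruct.IsModule.perm_eq₃₂ hP ?_ ?_)
    · simp
    · simp [h₃']
  have e₂ : P.perm σ₂ (.refl Y'') (P.cut τ' ρ m' n' g h) =
      P.perm (.cons A μ) n' (P.comp g₁ h₁) := by
    refine (congrArg (fun k => P.perm σ₂ (.refl Y'') (P.perm m' n' k))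
      (ModuleStruct.IsModule.right_of_eq hP hP (σ := σ.symm) (τ := .refl T') (x := g₁)
        (ModuleStruct.IsModule.perm_eq₁₂ hP (h₂ := fun _ => rfl)) h₁)).trans
          (ModuleStruct.IsModule.perm_eq₃₁ hP ?_ ?_)
    · simp [h₁']
    · simp
  refine (congrArg (P.perm m₂ n₂) (ModuleStruct.IsModule.right_of_eq hP hP e₁ h₁)).trans
    (Eq.trans ?_ (congrArg (P.perm m₃ n₃) ((ModuleStruct.IsModule.left_of_eq hP hP f₁ e₂).trans
      (congrArg (P.perm _ _) (ModuleStruct.IsModule.left_left hP f₁ g₁ h₁).symm))).symm)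
  refine ModuleStruct.IsModule.perm_eq₂₃ hP ?_ ?_
  · simp [h₂]
  · simp [h₄]

/-- Interchange of two compositions into the domain of one morphism. -/
theorem cut_comm {G₁ D₁ D₁' G₂ D₂ D₂' S S' S₁ S₂ T X X' X₂ X₂' Y Y₂ Z W : List P.Ob} {A B : P.Ob}
    {f₁ : P.Hom G₁ D₁} {f₂ : P.Hom G₂ D₂} {x : P.Hom S T} {τ₁ : ListPerm D₁ (A :: D₁')}
    {τ₂ : ListPerm D₂ (B :: D₂')} {σ₁ : ListPerm S (A :: S₁)} {σ₂ : ListPerm S (B :: S₂)}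
    {m : ListPerm (G₁ ++ S₁) X} {n : ListPerm (D₁' ++ T) Y} {ρ : ListPerm X (B :: X')}
    {M : ListPerm (G₂ ++ X') Z} {N : ListPerm (D₂' ++ Y) W}
    {m' : ListPerm (G₂ ++ S₂) X₂} {n' : ListPerm (D₂' ++ T) Y₂} {ρ' : ListPerm X₂ (A :: X₂')}
    {M' : ListPerm (G₁ ++ X₂') Z} {N' : ListPerm (D₁' ++ Y₂) W}
    (α : ListPerm S (A :: B :: S')) (α₁ : ListPerm (B :: S') S₁) (α₂ : ListPerm (A :: S') S₂)
    (θ : ListPerm (G₁ ++ S') X') (θ' : ListPerm (G₂ ++ S') X₂')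
    (h₁ : ∀ s, σ₁.app s = .cons (α.app s).head (α₁.app (α.app s).tail))
    (h₂ : ∀ s, σ₂.app s =
      .cons (α.app s).tail.head (α₂.app (.cons (α.app s).head (α.app s).tail.tail)))
    (h₃ : ∀ (v : Lab G₁) b (s : Lab S'), ρ.app (m.app (v.append (α₁.app (.cons b s)))) = .cons b
      (θ.app (v.append s)))
    (h₄ : ∀ (v : Lab G₂) a (s : Lab S'), ρ'.app (m'.app (v.append (α₂.app (.cons a s)))) =
      .cons a (θ'.app (v.append s)))
    (h₅ : ∀ (v : Lab G₁) (w : Lab G₂) (s : Lab S'), M.app (w.append (θ.app (v.append s))) = M'.app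
      (v.append (θ'.app (w.append s))))
    (h₆ : ∀ (v : Lab D₁') (w : Lab D₂') (s : Lab T), N.app (w.append (n.app (v.append s))) = N'.app
      (v.append (n'.app (w.append s)))) :
    P.cut τ₂ ρ M N f₂ (P.cut τ₁ σ₁ m n f₁ x) = P.cut τ₁ ρ' M' N' f₁ (P.cut τ₂ σ₂ m' n' f₂ x) := by
  have h₁' : ∀ a b (s : Lab S'), σ₁.app (α.symm.app (.cons a (.cons b s))) =
      .cons a (α₁.app (.cons b s)) := fun a b s => by
    simpa using h₁ (α.symm.app (.cons a (.cons b s)))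
  have h₂' : ∀ a b (s : Lab S'), σ₂.app (α.symm.app (.cons a (.cons b s))) =
      .cons b (α₂.app (.cons a s)) := fun a b s => by
    simpa using h₂ (α.symm.app (.cons a (.cons b s)))
  let k₁ := P.perm (.refl G₁) τ₁ f₁
  let k₂ := P.perm (.refl G₂) τ₂ f₂
  let y := P.perm α (.refl T) x
  have h₀ : x = P.perm α.symm (.refl T) y := (ModuleStruct.IsModule.perm_perm_self hP
    (σ := α) (σ' := α.symm) (τ := .refl T) (τ' := .refl T) (x := x)).symm
  have e₁ : P.perm ρ (.refl Y) (P.cut τ₁ σ₁ m n f₁ x) =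
      P.perm (.cons B θ) n (P.perm (front G₁ B S') (.refl _) (P.comp k₁ y)) := by
    refine (congrArg (fun k => P.perm ρ (.refl Y) (P.perm m n k))
      (ModuleStruct.IsModule.left_of_eq hP hP k₁ (σ := α₁) (τ := .refl T) (x := y)
        ((congrArg (P.perm σ₁ (.refl T)) h₀).trans (ModuleStruct.IsModule.perm_eq₂₁ hP ?_
          ?_)))).trans
          (ModuleStruct.IsModule.perm_eq₃₂ hP ?_ ?_)
    · simp [h₁']
    · simp
    · simp [h₃]
    · simp
  have e₂ : P.perm ρ' (.refl Y₂) (P.cut τ₂ σ₂ m' n' f₂ x) =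
      P.perm (.cons A θ') n' (P.perm (front G₂ A S') (.refl _)
        (P.comp k₂ (P.perm (.swap A B S') (.refl T) y))) := by
    refine (congrArg (fun k => P.perm ρ' (.refl Y₂) (P.perm m' n' k))
      (ModuleStruct.IsModule.left_of_eq hP hP k₂ (σ := α₂) (τ := .refl T)
        (x := P.perm (.swap A B S') (.refl T) y)
        ((congrArg (P.perm σ₂ (.refl T)) h₀).trans (ModuleStruct.IsModule.perm_eq₂₂ hP ?_
          ?_)))).trans
          (ModuleStruct.IsModule.perm_eq₃₂ hP ?_ ?_)
    · simp [h₂']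
    · simp
    · simp [h₄]
    · simp
  refine (congrArg (P.perm M N) (ModuleStruct.IsModule.left_of_eq hP hP k₂ e₁)).trans
    (Eq.trans ?_ (congrArg (P.perm M' N') ((ModuleStruct.IsModule.left_of_eq hP hP k₁ e₂).trans
      (congrArg (P.perm _ _) (ModuleStruct.IsModule.left_left_comm hP k₁ k₂ y).symm))).symm)
  refine ModuleStruct.IsModule.perm_eq₂₃ hP ?_ ?_
  · simp [h₅]
  · simp [h₆]

/-- Interchange of two compositions out of the codomain of one morphism. -/
theorem cut_cocomm {G D D' D₁ D₂ S₁ S₁' T₁ S₂ S₂' T₂ X Y Y' X₂ Y₂ Y₂' Z W : List P.Ob}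
    {A B : P.Ob} {x : P.Hom G D} {g₁ : P.Hom S₁ T₁} {g₂ : P.Hom S₂ T₂}
    {τ₁ : ListPerm D (A :: D₁)} {τ₂ : ListPerm D (B :: D₂)} {σ₁ : ListPerm S₁ (A :: S₁')}
    {σ₂ : ListPerm S₂ (B :: S₂')}
    {m : ListPerm (G ++ S₁') X} {n : ListPerm (D₁ ++ T₁) Y} {ρ : ListPerm Y (B :: Y')}
    {M : ListPerm (X ++ S₂') Z} {N : ListPerm (Y' ++ T₂) W}
    {m' : ListPerm (G ++ S₂') X₂} {n' : ListPerm (D₂ ++ T₂) Y₂} {ρ' : ListPerm Y₂ (A :: Y₂')}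
    {M' : ListPerm (X₂ ++ S₁') Z} {N' : ListPerm (Y₂' ++ T₁) W}
    (α : ListPerm D (A :: B :: D')) (α₁ : ListPerm (B :: D') D₁) (α₂ : ListPerm (A :: D') D₂)
    (θ : ListPerm (D' ++ T₁) Y') (θ' : ListPerm (D' ++ T₂) Y₂')
    (h₁ : ∀ s, τ₁.app s = .cons (α.app s).head (α₁.app (α.app s).tail))
    (h₂ : ∀ s, τ₂.app s =
      .cons (α.app s).tail.head (α₂.app (.cons (α.app s).head (α.app s).tail.tail)))
    (h₃ : ∀ b (s : Lab D') (v : Lab T₁), ρ.app (n.app ((α₁.app (.cons b s)).append v)) = .cons b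
      (θ.app (s.append v)))
    (h₄ : ∀ a (s : Lab D') (v : Lab T₂), ρ'.app (n'.app ((α₂.app (.cons a s)).append v)) =
      .cons a (θ'.app (s.append v)))
    (h₅ : ∀ (s : Lab D') (v : Lab T₁) (w : Lab T₂), N.app ((θ.app (s.append v)).append w) = N'.app
      ((θ'.app (s.append w)).append v))
    (h₆ : ∀ (s : Lab G) (v : Lab S₁') (w : Lab S₂'), M.app ((m.app (s.append v)).append w) = M'.app
      ((m'.app (s.append w)).append v)) :
    P.cut ρ σ₂ M N (P.cut τ₁ σ₁ m n x g₁) g₂ = P.cut ρ' σ₁ M' N' (P.cut τ₂ σ₂ m' n' x g₂) g₁ := by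
  have h₁' : ∀ a b (s : Lab D'), τ₁.app (α.symm.app (.cons a (.cons b s))) =
      .cons a (α₁.app (.cons b s)) := fun a b s => by
    simpa using h₁ (α.symm.app (.cons a (.cons b s)))
  have h₂' : ∀ a b (s : Lab D'), τ₂.app (α.symm.app (.cons a (.cons b s))) =
      .cons b (α₂.app (.cons a s)) := fun a b s => by
    simpa using h₂ (α.symm.app (.cons a (.cons b s)))
  let k₁ := P.perm σ₁ (.refl T₁) g₁
  let k₂ := P.perm σ₂ (.refl T₂) g₂
  let y := P.perm (.refl G) α x
  have h₀ : x = P.perm (.refl G) α.symm y := (ModuleStruct.IsModule.perm_perm_self hP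
    (τ := α) (τ' := α.symm) (σ := .refl G) (σ' := .refl G) (x := x)).symm
  have e₁ : P.perm (.refl X) ρ (P.cut τ₁ σ₁ m n x g₁) =
      P.perm m (.cons B θ) (P.comp (Δ := B :: D') y k₁) := by
    refine (congrArg (fun k => P.perm (.refl X) ρ (P.perm m n k))
      (ModuleStruct.IsModule.right_of_eq hP hP (σ := .refl G) (τ := α₁) (x := y)
        ((congrArg (P.perm (.refl G) τ₁) h₀).trans (ModuleStruct.IsModule.perm_eq₂₁ hP ?_ ?_))
          k₁)).trans
          (ModuleStruct.IsModule.perm_eq₃₁ hP ?_ ?_)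
    · simp
    · simp [h₁']
    · simp
    · simp [h₃]
  have e₂ : P.perm (.refl X₂) ρ' (P.cut τ₂ σ₂ m' n' x g₂) =
      P.perm m' (.cons A θ')
        (P.comp (Δ := A :: D') (P.perm (.refl G) (.swap A B D') y) k₂) := by
    refine (congrArg (fun k => P.perm (.refl X₂) ρ' (P.perm m' n' k))
      (ModuleStruct.IsModule.right_of_eq hP hP (σ := .refl G) (τ := α₂)
        (x := P.perm (.refl G) (.swap A B D') y)
        ((congrArg (P.perm (.refl G) τ₂) h₀).trans (ModuleStruct.IsModule.perm_eq₂₂ hP ?_ ?_))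
          k₂)).trans
          (ModuleStruct.IsModule.perm_eq₃₁ hP ?_ ?_)
    · simp
    · simp [h₂']
    · simp
    · simp [h₄]
  refine (congrArg (P.perm M N) (ModuleStruct.IsModule.right_of_eq hP hP e₁ k₂)).trans
    (Eq.trans ?_ (congrArg (P.perm M' N') ((ModuleStruct.IsModule.right_of_eq hP hP e₂ k₁).trans
      (congrArg (P.perm _ _) (ModuleStruct.IsModule.right_right_comm hP y k₁ k₂).symm))).symm)
  refine ModuleStruct.IsModule.perm_eq₂₃ hP ?_ ?_
  · simp [h₆]
  · simp [h₅]

end IsPolycategory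

end PolycategoryStruct

/-! ### Associativity in the free `∗`-polycategory -/

namespace Signed

variable {α : Type u}

/-- The labels of the entries `A`, in a labelling of a list of entries `A` and `A̅`. -/
def posL : {Γ : List (Signed α)} → Lab Γ → Lab (posPart Γ)
  | [], _ => Lab.nil
  | pos A :: Γ, v => (Lab.cons v.1 (posL (Γ := Γ) v.2) : Lab (A :: posPart Γ))
  | neg _ :: Γ, v => (posL (Γ := Γ) v.2 : Lab (posPart Γ))

/-- The labels of the entries `A̅`, in a labelling of a list of entries `A` and `A̅`. -/
def negL : {Γ : List (Signed α)} → Lab Γ → Lab (negPart Γ)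
  | [], _ => Lab.nil
  | pos _ :: Γ, v => (negL (Γ := Γ) v.2 : Lab (negPart Γ))
  | neg A :: Γ, v => (Lab.cons v.1 (negL (Γ := Γ) v.2) : Lab (A :: negPart Γ))

@[simp] theorem posL_nil : posL (Lab.nil : Lab ([] : List (Signed α))) = Lab.nil := rfl

@[simp] theorem negL_nil : negL (Lab.nil : Lab ([] : List (Signed α))) = Lab.nil := rfl

@[simp] theorem posL_pos (A : α) {Γ : List (Signed α)} (n : ℕ) (v : Lab Γ) :
    posL (Lab.cons n v : Lab (pos A :: Γ)) = (Lab.cons n (posL v) : Lab (A :: posPart Γ)) := rfl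

@[simp] theorem posL_neg (A : α) {Γ : List (Signed α)} (n : ℕ) (v : Lab Γ) :
    posL (Lab.cons n v : Lab (neg A :: Γ)) = (posL v : Lab (posPart Γ)) := rfl

@[simp] theorem negL_pos (A : α) {Γ : List (Signed α)} (n : ℕ) (v : Lab Γ) :
    negL (Lab.cons n v : Lab (pos A :: Γ)) = (negL v : Lab (negPart Γ)) := rfl

@[simp] theorem negL_neg (A : α) {Γ : List (Signed α)} (n : ℕ) (v : Lab Γ) :
    negL (Lab.cons n v : Lab (neg A :: Γ)) = (Lab.cons n (negL v) : Lab (A :: negPart Γ)) := rfl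

theorem posL_surjective : (Γ : List (Signed α)) → Function.Surjective (posL (Γ := Γ))
  | [], _ => ⟨Lab.nil, rfl⟩
  | pos A :: Γ, v => (posL_surjective Γ v.2).elim fun w h =>
    ⟨(Lab.cons v.1 w : Lab (pos A :: Γ)), Prod.ext rfl h⟩
  | neg A :: Γ, v => (posL_surjective Γ v).elim fun w h =>
    ⟨(Lab.cons 0 w : Lab (neg A :: Γ)), h⟩

theorem negL_surjective : (Γ : List (Signed α)) → Function.Surjective (negL (Γ := Γ))
  | [], _ => ⟨Lab.nil, rfl⟩
  | pos A :: Γ, v => (negL_surjective Γ v).elim fun w h =>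
    ⟨(Lab.cons 0 w : Lab (pos A :: Γ)), h⟩
  | neg A :: Γ, v => (negL_surjective Γ v.2).elim fun w h =>
    ⟨(Lab.cons v.1 w : Lab (neg A :: Γ)), Prod.ext rfl h⟩

@[simp] theorem forall_posL {Γ : List (Signed α)} {p : Lab (posPart Γ) → Prop} :
    (∀ v, p v) ↔ ∀ v, p (posL v) :=
  ⟨fun h _ => h _, fun h v => (posL_surjective Γ v).elim fun w e => e ▸ h w⟩

@[simp] theorem forall_negL {Γ : List (Signed α)} {p : Lab (negPart Γ) → Prop} :
    (∀ v, p v) ↔ ∀ v, p (negL v) :=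
  ⟨fun h _ => h _, fun h v => (negL_surjective Γ v).elim fun w e => e ▸ h w⟩

@[simp] theorem app_posPerm {Γ Γ' : List (Signed α)} (σ : ListPerm Γ Γ') :
    ∀ v : Lab Γ, (posPerm σ).app (posL v) = posL (σ.app v) := by
  induction σ with
  | refl => exact fun _ => rfl
  | cons A σ ih =>
    cases A with
    | pos A => exact fun v => Prod.ext rfl (ih v.2)
    | neg A => exact fun v => ih v.2
  | swap A B Γ => cases A <;> cases B <;> exact fun _ => rfl
  | trans σ τ ih₁ ih₂ =>
    exact fun v => (congrArg (posPerm τ).app (ih₁ v)).trans (ih₂ _)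

@[simp] theorem app_negPerm {Γ Γ' : List (Signed α)} (σ : ListPerm Γ Γ') :
    ∀ v : Lab Γ, (negPerm σ).app (negL v) = negL (σ.app v) := by
  induction σ with
  | refl => exact fun _ => rfl
  | cons A σ ih =>
    cases A with
    | pos A => exact fun v => ih v.2
    | neg A => exact fun v => Prod.ext rfl (ih v.2)
  | swap A B Γ => cases A <;> cases B <;> exact fun _ => rfl
  | trans σ τ ih₁ ih₂ =>
    exact fun v => (congrArg (negPerm τ).app (ih₁ v)).trans (ih₂ _)

@[simp] theorem app_posAppend : (Γ Δ : List (Signed α)) → (v : Lab Γ) → (w : Lab Δ) →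
    (posAppend Γ Δ).app ((posL v).append (posL w)) = posL (v.append w)
  | [], _, _, _ => rfl
  | pos _ :: Γ, Δ, v, w => Prod.ext rfl (app_posAppend Γ Δ v.2 w)
  | neg _ :: Γ, Δ, v, w => app_posAppend Γ Δ v.2 w

@[simp] theorem app_negAppend : (Γ Δ : List (Signed α)) → (v : Lab Γ) → (w : Lab Δ) →
    (negAppend Γ Δ).app ((negL v).append (negL w)) = negL (v.append w)
  | [], _, _, _ => rfl
  | pos _ :: Γ, Δ, v, w => app_negAppend Γ Δ v.2 w
  | neg _ :: Γ, Δ, v, w => Prod.ext rfl (app_negAppend Γ Δ v.2 w)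

@[simp] theorem app_merge (Γ Δ S T : List (Signed α)) (v : Lab Γ) (w : Lab Δ) (x : Lab S)
    (y : Lab T) : (merge Γ Δ S T).app
      (((posL v).append (negL w)).append ((posL x).append (negL y))) =
        (posL (v.append x)).append (negL (w.append y)) := by
  simp [merge, ListPerm.interchange]


section Heads

variable (Γ Δ : List (Signed α)) (A : α) (S T : List (Signed α))

/-! The permutations that merge two contexts, one of which has a distinguished entry that is
kept at, or moved to, the head of its block. -/

/-- An entry `A` of the third block moves to the front. -/
def mergeHeadPos : ListPerm ((posPart Γ ++ negPart Δ) ++ A :: (posPart S ++ negPart T))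
    (A :: (posPart (Γ ++ S) ++ negPart (Δ ++ T))) :=
  (merge Γ Δ (pos A :: S) T).trans
    ((posPerm (front Γ (pos A) S)).append (negPerm (.refl (Δ ++ T))))

/-- An entry `A̅` of the fourth block moves to the front of the negative entries. -/
def mergeHeadNeg : ListPerm ((posPart Γ ++ negPart Δ) ++ (posPart S ++ A :: negPart T))
    (posPart (Γ ++ S) ++ A :: negPart (Δ ++ T)) :=
  (merge Γ Δ S (neg A :: T)).trans
    ((posPerm (.refl (Γ ++ S))).append (negPerm (front Δ (neg A) T)))

/-- An entry `A` of the fourth block moves to the front. Only the negative entries of this block are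
present, so no label moves. -/
def mergePassPos : ListPerm ((posPart Γ ++ negPart Δ) ++ (posPart S ++ negPart T))
    (posPart (Γ ++ S) ++ negPart (Δ ++ T)) :=
  (merge Γ Δ S (pos A :: T)).trans
    ((posPerm (.refl (Γ ++ S))).append
      (Δ' := negPart (Δ ++ T)) (negPerm (front Δ (pos A) T) :))

/-- An entry `A̅` of the third block moves to the front. Only the positive entries of this block are
present, so no label moves. -/
def mergePassNeg : ListPerm ((posPart Γ ++ negPart Δ) ++ (posPart S ++ negPart T))
    (posPart (Γ ++ S) ++ negPart (Δ ++ T)) :=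
  (merge Γ Δ (neg A :: S) T).trans
    (ListPerm.append (Γ' := posPart (Γ ++ S)) (posPerm (front Γ (neg A) S) :)
      (negPerm (.refl (Δ ++ T))))

/-- The permutation that merges two contexts, followed by further permutations. -/
def mergeThen {Γ Δ S T Γ' Δ' : List (Signed α)} (σ : ListPerm (Γ ++ S) Γ')
    (τ : ListPerm (Δ ++ T) Δ') :
    ListPerm ((posPart Γ ++ negPart Δ) ++ (posPart S ++ negPart T)) (posPart Γ' ++ negPart Δ') :=
  (merge Γ Δ S T).trans ((posPerm σ).append (negPerm τ))

/-- The permutation that interchanges and merges two contexts. -/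
def commMerge : ListPerm ((posPart S ++ negPart T) ++ (posPart Γ ++ negPart Δ))
    (posPart (Γ ++ S) ++ negPart (Δ ++ T)) :=
  (ListPerm.comm _ _).trans (merge Γ Δ S T)

/-- The permutation that interchanges and merges two contexts, followed by further permutations. -/
def commMergeThen {Γ Δ S T Γ' Δ' : List (Signed α)} (σ : ListPerm (Γ ++ S) Γ')
    (τ : ListPerm (Δ ++ T) Δ') :
    ListPerm ((posPart S ++ negPart T) ++ (posPart Γ ++ negPart Δ)) (posPart Γ' ++ negPart Δ') :=
  (ListPerm.comm _ _).trans (mergeThen σ τ)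

/-- An entry `A` at the front of the first block stays at the front. -/
def consMergePos : ListPerm ((A :: (posPart Γ ++ negPart Δ)) ++ (posPart S ++ negPart T))
    (A :: (posPart (Γ ++ S) ++ negPart (Δ ++ T))) :=
  merge (pos A :: Γ) Δ S T

/-- An entry `A̅` at the front of the second block stays at the front of the negative entries. -/
def consMergeNeg : ListPerm ((posPart Γ ++ A :: negPart Δ) ++ (posPart S ++ negPart T))
    (posPart (Γ ++ S) ++ A :: negPart (Δ ++ T)) :=
  merge Γ (neg A :: Δ) S T

/-- An entry `A` at the front of the second block, whose negative entries only are present. -/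
def mergeConsPos : ListPerm ((posPart Γ ++ negPart Δ) ++ (posPart S ++ negPart T))
    (posPart (Γ ++ S) ++ negPart (Δ ++ T)) :=
  merge Γ (pos A :: Δ) S T

/-- An entry `A̅` at the front of the first block, whose positive entries only are present. -/
def mergeConsNeg : ListPerm ((posPart Γ ++ negPart Δ) ++ (posPart S ++ negPart T))
    (posPart (Γ ++ S) ++ negPart (Δ ++ T)) :=
  merge (neg A :: Γ) Δ S T

variable (v : Lab Γ) (w : Lab Δ) (n : ℕ) (x : Lab S) (y : Lab T)

@[simp] theorem app_mergeHeadPos : (mergeHeadPos Γ Δ A S T).app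
    (((posL v).append (negL w)).append (.cons n ((posL x).append (negL y)))) =
      .cons n ((posL (v.append x)).append (negL (w.append y))) := by
  have h := app_merge Γ Δ (pos A :: S) T v w (.cons n x) y
  have h' := app_posPerm (front Γ (pos A) S) (v.append (.cons n x))
  rw [ListPerm.app_front] at h'
  refine (congrArg ((posPerm (front Γ (pos A) S)).append (negPerm (.refl (Δ ++ T)))).app h).trans ?_
  refine (ListPerm.app_append _ _ _ _).trans ?_
  rw [h']
  rfl

@[simp] theorem app_mergeHeadNeg : (mergeHeadNeg Γ Δ A S T).app
    (((posL v).append (negL w)).append ((posL x).append (.cons n (negL y)))) =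
      (posL (v.append x)).append (.cons n (negL (w.append y))) := by
  have h := app_merge Γ Δ S (neg A :: T) v w x (.cons n y)
  have h' := app_negPerm (front Δ (neg A) T) (w.append (.cons n y))
  rw [ListPerm.app_front] at h'
  refine (congrArg ((posPerm (.refl (Γ ++ S))).append (negPerm (front Δ (neg A) T))).app h).trans ?_
  refine (ListPerm.app_append _ _ _ _).trans ?_
  rw [h']
  rfl

@[simp] theorem app_mergePassPos : (mergePassPos Γ Δ A S T).app
    (((posL v).append (negL w)).append ((posL x).append (negL y))) =
      (posL (v.append x)).append (negL (w.append y)) := by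
  -- The label `0` of `A` is arbitrary, as this entry is dropped.
  have h := app_merge Γ Δ S (pos A :: T) v w x (.cons 0 y)
  have h' := app_negPerm (front Δ (pos A) T) (w.append (.cons 0 y))
  rw [ListPerm.app_front] at h'
  refine (congrArg ((posPerm (.refl (Γ ++ S))).append
    (Δ' := negPart (Δ ++ T)) (negPerm (front Δ (pos A) T) :)).app h).trans ?_
  exact (ListPerm.app_append _ _ _ _).trans (congrArg (fun k : Lab (negPart (Δ ++ T)) =>
    (posL (v.append x)).append k) h')

@[simp] theorem app_mergePassNeg : (mergePassNeg Γ Δ A S T).app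
    (((posL v).append (negL w)).append ((posL x).append (negL y))) =
      (posL (v.append x)).append (negL (w.append y)) := by
  have h := app_merge Γ Δ (neg A :: S) T v w (.cons 0 x) y
  have h' := app_posPerm (front Γ (neg A) S) (v.append (.cons 0 x))
  rw [ListPerm.app_front] at h'
  refine (congrArg (ListPerm.append (Γ' := posPart (Γ ++ S)) (posPerm (front Γ (neg A) S) :)
    (negPerm (.refl (Δ ++ T)))).app h).trans ?_
  exact (ListPerm.app_append _ _ _ _).trans (congrArg (fun k : Lab (posPart (Γ ++ S)) =>
    k.append (negL (w.append y))) h')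

@[simp] theorem app_consMergePos : (consMergePos Γ Δ A S T).app
    (.cons n (((posL v).append (negL w)).append ((posL x).append (negL y)))) =
      .cons n ((posL (v.append x)).append (negL (w.append y))) :=
  app_merge (pos A :: Γ) Δ S T (.cons n v) w x y

@[simp] theorem app_consMergeNeg : (consMergeNeg Γ Δ A S T).app
    (((posL v).append (.cons n (negL w))).append ((posL x).append (negL y))) =
      (posL (v.append x)).append (.cons n (negL (w.append y))) :=
  app_merge Γ (neg A :: Δ) S T v (.cons n w) x y

@[simp] theorem app_mergeConsPos : (mergeConsPos Γ Δ A S T).app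
    (((posL v).append (negL w)).append ((posL x).append (negL y))) =
      (posL (v.append x)).append (negL (w.append y)) :=
  app_merge Γ (pos A :: Δ) S T v (.cons 0 w) x y

@[simp] theorem app_mergeConsNeg : (mergeConsNeg Γ Δ A S T).app
    (((posL v).append (negL w)).append ((posL x).append (negL y))) =
      (posL (v.append x)).append (negL (w.append y)) :=
  app_merge (neg A :: Γ) Δ S T (.cons 0 v) w x y

@[simp] theorem app_mergeThen {Γ' Δ' : List (Signed α)} (σ : ListPerm (Γ ++ S) Γ')
    (τ : ListPerm (Δ ++ T) Δ') : (mergeThen σ τ).app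
      (((posL v).append (negL w)).append ((posL x).append (negL y))) =
        (posL (σ.app (v.append x))).append (negL (τ.app (w.append y))) := by
  simp [mergeThen]

@[simp] theorem app_commMerge : (commMerge Γ Δ S T).app
    (((posL x).append (negL y)).append ((posL v).append (negL w))) =
      (posL (v.append x)).append (negL (w.append y)) := by
  simp [commMerge]

@[simp] theorem app_commMergeThen {Γ' Δ' : List (Signed α)} (σ : ListPerm (Γ ++ S) Γ')
    (τ : ListPerm (Δ ++ T) Δ') : (commMergeThen σ τ).app
      (((posL x).append (negL y)).append ((posL v).append (negL w))) =
        (posL (σ.app (v.append x))).append (negL (τ.app (w.append y))) := by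
  simp [commMergeThen]

end Heads

end Signed

namespace PolycategoryStruct.IsPolycategory

open Signed

variable {P : PolycategoryStruct.{u, w}} (hP : P.IsPolycategory)
include hP

variable {Γ Δ S T Φ Ψ Γ' Δ' : List (Signed P.Ob)} {A B : P.Ob}

theorem freeStar_comp_pos (f : P.freeStar.Hom Γ (pos A :: Δ)) (g : P.freeStar.Hom (pos A :: S) T) :
    P.freeStar.comp f g = P.cut (.refl (A :: (posPart Δ ++ negPart Γ)))
      (.refl (A :: (posPart S ++ negPart T))) (merge Γ Δ S T) (merge Δ Γ T S) f g :=
  congrArg (P.perm (merge Γ Δ S T) (merge Δ Γ T S))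
    (congrArg₂ (P.comp (A := A)) (ModuleStruct.IsModule.perm_refl hP f)
      (ModuleStruct.IsModule.perm_refl hP g)).symm

theorem freeStar_perm_comp_pos (σ : ListPerm (Γ ++ S) Γ') (τ : ListPerm (Δ ++ T) Δ')
    (f : P.freeStar.Hom Γ (pos A :: Δ)) (g : P.freeStar.Hom (pos A :: S) T) :
    P.freeStar.perm σ τ (P.freeStar.comp f g) = P.cut (.refl (A :: (posPart Δ ++ negPart Γ)))
      (.refl (A :: (posPart S ++ negPart T))) (mergeThen σ τ) (mergeThen τ σ) f g :=
  (congrArg (P.freeStar.perm σ τ) (hP.freeStar_comp_pos f g)).trans (hP.perm_cut _ _ _ _ _ _ _ _)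

theorem freeStar_perm_comp_neg (σ : ListPerm (Γ ++ S) Γ') (τ : ListPerm (Δ ++ T) Δ')
    (f : P.freeStar.Hom Γ (neg A :: Δ)) (g : P.freeStar.Hom (neg A :: S) T) :
    P.freeStar.perm σ τ (P.freeStar.comp f g) = P.cut (front (posPart T) A (negPart S))
      (front (posPart Γ) A (negPart Δ)) (commMergeThen σ τ) (commMergeThen τ σ) g f :=
  (hP.perm_cut _ _ _ _ _ _ _ _).trans (ModuleStruct.IsModule.perm_eq hP (fun _ => rfl)
    (fun _ => rfl))

omit hP in
/-- Composition along `A̅` is composition along `A` in the other order. -/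
theorem freeStar_comp_neg (f : P.freeStar.Hom Γ (neg A :: Δ))
    (g : P.freeStar.Hom (neg A :: S) T) :
    P.freeStar.comp f g = P.cut (front (posPart T) A (negPart S))
      (front (posPart Γ) A (negPart Δ)) (commMerge Γ Δ S T) (commMerge Δ Γ T S) g f :=
  rfl

/-- Associativity, by the signs of the two objects. When both are positive it is associativity in
`P`. -/
theorem freeStar_assoc_pos_pos (f : P.freeStar.Hom Γ (pos A :: Δ))
    (g : P.freeStar.Hom (pos A :: S) (pos B :: T)) (h : P.freeStar.Hom (pos B :: Φ) Ψ) :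
    P.freeStar.perm (assoc Γ S Φ) (assoc Δ T Ψ) (P.freeStar.comp
      (P.freeStar.perm (.refl _) (front Δ (pos B) T) (P.freeStar.comp f g)) h) =
        P.freeStar.comp f (P.freeStar.comp g h) := by
  refine ((hP.freeStar_perm_comp_pos _ _ _ h).trans (congrArg (fun k => P.cut _ _ _ _ k h)
    (hP.freeStar_perm_comp_pos _ _ f g))).trans (Eq.trans ?_ ((hP.freeStar_comp_pos f _).trans
      (congrArg (fun k => P.cut _ _ _ _ f k) (hP.freeStar_comp_pos g h))).symm)
  refine hP.cut_assoc
    (τ := .refl (A :: (posPart Δ ++ negPart Γ))) (σ := .refl (A :: (posPart S ++ negPart T)))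
    (τ' := .refl (B :: (posPart T ++ negPart S))) (ρ := .refl (B :: (posPart Φ ++ negPart Ψ)))
    (m := mergePassPos Γ Δ B S T) (n := mergeHeadPos Δ Γ B T S)
    (τ₂ := .refl (B :: (posPart (Δ ++ T) ++ negPart (Γ ++ S))))
    (m₂ := mergeThen (assoc Γ S Φ) (assoc Δ T Ψ)) (n₂ := mergeThen (assoc Δ T Ψ) (assoc Γ S Φ))
    (m' := consMergePos S T A Φ Ψ) (n' := mergeConsPos T S A Ψ Φ)
    (σ₂ := .refl (A :: (posPart (S ++ Φ) ++ negPart (T ++ Ψ))))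
    (m₃ := merge Γ Δ (S ++ Φ) (T ++ Ψ)) (n₃ := merge Δ Γ (T ++ Ψ) (S ++ Φ)) (merge S T Φ Ψ)
    (merge Δ Γ T S) ?_ ?_ ?_ ?_
  all_goals simp

/-- For objects of different signs, associativity is an interchange law of `P`. Here `f` and `h` are
both composed into `g`. -/
theorem freeStar_assoc_pos_neg (f : P.freeStar.Hom Γ (pos A :: Δ))
    (g : P.freeStar.Hom (pos A :: S) (neg B :: T)) (h : P.freeStar.Hom (neg B :: Φ) Ψ) :
    P.freeStar.perm (assoc Γ S Φ) (assoc Δ T Ψ) (P.freeStar.comp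
      (P.freeStar.perm (.refl _) (front Δ (neg B) T) (P.freeStar.comp f g)) h) =
        P.freeStar.comp f (P.freeStar.comp g h) := by
  refine ((hP.freeStar_perm_comp_neg _ _ _ h).trans (congrArg (fun k => P.cut _ _ _ _ h k)
    (hP.freeStar_perm_comp_pos _ _ f g))).trans (Eq.trans ?_ ((hP.freeStar_comp_pos f _).trans
      (congrArg (fun k => P.cut _ _ _ _ f k) (freeStar_comp_neg g h))).symm)
  refine hP.cut_comm
    (τ₁ := .refl (A :: (posPart Δ ++ negPart Γ))) (τ₂ := front (posPart Ψ) B (negPart Φ))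
    (σ₁ := .refl (A :: (posPart S ++ B :: negPart T)))
    (σ₂ := front (A :: posPart S) B (negPart T)) (m := mergeHeadNeg Γ Δ B S T)
    (n := mergePassNeg Δ Γ B T S) (ρ := front (posPart (Γ ++ S)) B (negPart (Δ ++ T)))
    (M := commMergeThen (assoc Γ S Φ) (assoc Δ T Ψ))
    (N := commMergeThen (assoc Δ T Ψ) (assoc Γ S Φ))
    (m' := (ListPerm.comm _ _).trans (consMergePos S T A Φ Ψ))
    (n' := (ListPerm.comm _ _).trans (mergeConsPos T S A Ψ Φ))
    (ρ' := .refl (A :: (posPart (S ++ Φ) ++ negPart (T ++ Ψ))))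
    (M' := merge Γ Δ (S ++ Φ) (T ++ Ψ)) (N' := merge Δ Γ (T ++ Ψ) (S ++ Φ))
    (.cons A (front (posPart S) B (negPart T))) ((front (posPart S) B (negPart T)).symm)
    (.refl (A :: (posPart S ++ negPart T))) (merge Γ Δ S T)
    ((ListPerm.comm _ _).trans (merge S T Φ Ψ)) ?_ ?_ ?_ ?_ ?_ ?_
  all_goals simp

theorem freeStar_assoc_neg_pos (f : P.freeStar.Hom Γ (neg A :: Δ))
    (g : P.freeStar.Hom (neg A :: S) (pos B :: T)) (h : P.freeStar.Hom (pos B :: Φ) Ψ) :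
    P.freeStar.perm (assoc Γ S Φ) (assoc Δ T Ψ) (P.freeStar.comp
      (P.freeStar.perm (.refl _) (front Δ (pos B) T) (P.freeStar.comp f g)) h) =
        P.freeStar.comp f (P.freeStar.comp g h) := by
  refine ((hP.freeStar_perm_comp_pos _ _ _ h).trans (congrArg (fun k => P.cut _ _ _ _ k h)
    (hP.freeStar_perm_comp_neg _ _ f g))).trans (Eq.trans ?_ ((freeStar_comp_neg f _).trans
      (congrArg (fun k => P.cut _ _ _ _ k f) (hP.freeStar_comp_pos g h))).symm)
  refine hP.cut_cocomm
    (τ₁ := front (B :: posPart T) A (negPart S))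
    (τ₂ := .refl (B :: (posPart T ++ A :: negPart S))) (σ₁ := front (posPart Γ) A (negPart Δ))
    (σ₂ := .refl (B :: (posPart Φ ++ negPart Ψ)))
    (m := (ListPerm.comm _ _).trans (mergePassPos Γ Δ B S T))
    (n := (ListPerm.comm _ _).trans (mergeHeadPos Δ Γ B T S))
    (ρ := .refl (B :: (posPart (Δ ++ T) ++ negPart (Γ ++ S))))
    (M := mergeThen (assoc Γ S Φ) (assoc Δ T Ψ)) (N := mergeThen (assoc Δ T Ψ) (assoc Γ S Φ))
    (m' := mergeConsNeg S T A Φ Ψ) (n' := consMergeNeg T S A Ψ Φ)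
    (ρ' := front (posPart (T ++ Ψ)) A (negPart (S ++ Φ))) (M' := commMerge Γ Δ (S ++ Φ) (T ++ Ψ))
    (N' := commMerge Δ Γ (T ++ Ψ) (S ++ Φ)) (front (B :: posPart T) A (negPart S))
    (.refl (B :: (posPart T ++ negPart S))) ((front (posPart T) A (negPart S)).symm)
    ((ListPerm.comm _ _).trans (merge Δ Γ T S)) (merge T S Ψ Φ) ?_ ?_ ?_ ?_ ?_ ?_
  all_goals simp

theorem freeStar_assoc_neg_neg (f : P.freeStar.Hom Γ (neg A :: Δ))
    (g : P.freeStar.Hom (neg A :: S) (neg B :: T)) (h : P.freeStar.Hom (neg B :: Φ) Ψ) :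
    P.freeStar.perm (assoc Γ S Φ) (assoc Δ T Ψ) (P.freeStar.comp
      (P.freeStar.perm (.refl _) (front Δ (neg B) T) (P.freeStar.comp f g)) h) =
        P.freeStar.comp f (P.freeStar.comp g h) := by
  refine ((hP.freeStar_perm_comp_neg _ _ _ h).trans (congrArg (fun k => P.cut _ _ _ _ h k)
    (hP.freeStar_perm_comp_neg _ _ f g))).trans (Eq.trans ?_ ((freeStar_comp_neg f _).trans
      (congrArg (fun k => P.cut _ _ _ _ k f) (freeStar_comp_neg g h))).symm)
  refine Eq.symm (hP.cut_assoc
    (τ := front (posPart Ψ) B (negPart Φ)) (σ := front (posPart S) B (negPart T))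
    (τ' := front (posPart T) A (negPart S)) (ρ := front (posPart Γ) A (negPart Δ))
    (m := (ListPerm.comm _ _).trans (mergeConsNeg S T A Φ Ψ))
    (n := (ListPerm.comm _ _).trans (consMergeNeg T S A Ψ Φ))
    (τ₂ := front (posPart (T ++ Ψ)) A (negPart (S ++ Φ))) (m₂ := commMerge Γ Δ (S ++ Φ) (T ++ Ψ))
    (n₂ := commMerge Δ Γ (T ++ Ψ) (S ++ Φ))
    (m' := (ListPerm.comm _ _).trans (mergeHeadNeg Γ Δ B S T))
    (n' := (ListPerm.comm _ _).trans (mergePassNeg Δ Γ B T S))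
    (σ₂ := front (posPart (Γ ++ S)) B (negPart (Δ ++ T)))
    (m₃ := commMergeThen (assoc Γ S Φ) (assoc Δ T Ψ))
    (n₃ := commMergeThen (assoc Δ T Ψ) (assoc Γ S Φ)) ((ListPerm.comm _ _).trans (merge Γ Δ S T))
    ((ListPerm.comm _ _).trans (merge T S Ψ Φ)) ?_ ?_ ?_ ?_)
  all_goals simp

end PolycategoryStruct.IsPolycategory

/-! ### Interchange of compositions in the free `∗`-polycategory -/

namespace PolycategoryStruct.IsPolycategory

open Signed

variable {P : PolycategoryStruct.{u, w}} (hP : P.IsPolycategory)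
include hP

theorem cut_perm_left {G D D' S S' T X Y E : List P.Ob} {A : P.Ob} {τ : ListPerm D (A :: D')}
    {σ : ListPerm S (A :: S')} {m : ListPerm (G ++ S') X} {n : ListPerm (D' ++ T) Y}
    (α : ListPerm E D) {f : P.Hom G D} {e : P.Hom G E} (g : P.Hom S T)
    (h : f = P.perm (.refl G) α e) : P.cut τ σ m n f g = P.cut (α.trans τ) σ m n e g :=
  congrArg (fun k => P.perm m n (P.comp k (P.perm σ (.refl T) g)))
    ((congrArg _ h).trans (ModuleStruct.IsModule.perm_eq₂₁ hP (U := .self P)))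

theorem cut_perm_right {G D D' S S' T X Y E : List P.Ob} {A : P.Ob} {τ : ListPerm D (A :: D')}
    {σ : ListPerm S (A :: S')} {m : ListPerm (G ++ S') X} {n : ListPerm (D' ++ T) Y}
    (α : ListPerm E S) (f : P.Hom G D) {g : P.Hom S T} {e : P.Hom E T}
    (h : g = P.perm α (.refl T) e) : P.cut τ σ m n f g = P.cut τ (α.trans σ) m n f e :=
  congrArg (fun k => P.perm m n (P.comp (P.perm (.refl G) τ f) k))
    ((congrArg _ h).trans (ModuleStruct.IsModule.perm_eq₂₁ hP (U := .self P)))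

variable {Γ Δ S T Γ₁ Δ₁ Γ₂ Δ₂ S₁ T₁ S₂ T₂ : List (Signed P.Ob)} {A B : P.Ob}

theorem freeStar_swap_pos_pos (x : P.freeStar.Hom (pos A :: pos B :: S) T) :
    P.freeStar.perm (.swap (pos A) (pos B) S) (.refl T) x =
      P.perm (.swap A B (posPart S ++ negPart T)) (.refl (posPart T ++ negPart S)) x := by
  refine ModuleStruct.IsModule.perm_eq hP (σ := (ListPerm.swap A B (posPart S)).append
    (.refl (negPart T))) (τ := (ListPerm.refl (posPart T)).append (.refl (negPart S))) ?_ ?_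
  · exact Lab.forall_append.2 fun v w => ListPerm.app_append _ _ _ _
  · simp

theorem freeStar_swap_pos_neg (x : P.freeStar.Hom (pos A :: neg B :: S) T) :
    P.freeStar.perm (.swap (pos A) (neg B) S) (.refl T) x = x := by
  refine ModuleStruct.IsModule.perm_eq_self hP (σ := (ListPerm.refl (A :: posPart S)).append
    (.refl (negPart T))) (τ := (ListPerm.refl (posPart T)).append (.refl (B :: negPart S))) ?_ ?_
  · exact Lab.forall_append.2 fun v w => ListPerm.app_append _ _ _ _
  · exact Lab.forall_append.2 fun v w => ListPerm.app_append _ _ _ _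

theorem freeStar_swap_neg_pos (x : P.freeStar.Hom (neg A :: pos B :: S) T) :
    P.freeStar.perm (.swap (neg A) (pos B) S) (.refl T) x = x := by
  refine ModuleStruct.IsModule.perm_eq_self hP (σ := (ListPerm.refl (B :: posPart S)).append
    (.refl (negPart T))) (τ := (ListPerm.refl (posPart T)).append (.refl (A :: negPart S))) ?_ ?_
  · exact Lab.forall_append.2 fun v w => ListPerm.app_append _ _ _ _
  · exact Lab.forall_append.2 fun v w => ListPerm.app_append _ _ _ _

theorem freeStar_swap_neg_neg (x : P.freeStar.Hom (neg A :: neg B :: S) T) :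
    P.freeStar.perm (.swap (neg A) (neg B) S) (.refl T) x =
      P.perm (.refl (posPart S ++ negPart T))
        (.appendLeft (posPart T) (.swap A B (negPart S))) x := by
  refine ModuleStruct.IsModule.perm_eq hP (σ := (ListPerm.refl (posPart S)).append
    (.refl (negPart T))) (τ := (ListPerm.refl (posPart T)).append (.swap A B (negPart S))) ?_ ?_
  · simp
  · simp

theorem freeStar_coswap_pos_pos (x : P.freeStar.Hom Γ (pos A :: pos B :: Δ)) :
    P.freeStar.perm (.refl Γ) (.swap (pos A) (pos B) Δ) x =
      P.perm (.refl (posPart Γ ++ negPart Δ)) (.swap A B (posPart Δ ++ negPart Γ)) x := by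
  refine ModuleStruct.IsModule.perm_eq hP (τ := (ListPerm.swap A B (posPart Δ)).append
    (.refl (negPart Γ))) (σ := (ListPerm.refl (posPart Γ)).append (.refl (negPart Δ))) ?_ ?_
  · simp
  · exact Lab.forall_append.2 fun v w => ListPerm.app_append _ _ _ _

theorem freeStar_coswap_pos_neg (x : P.freeStar.Hom Γ (pos A :: neg B :: Δ)) :
    P.freeStar.perm (.refl Γ) (.swap (pos A) (neg B) Δ) x = x := by
  refine ModuleStruct.IsModule.perm_eq_self hP (τ := (ListPerm.refl (A :: posPart Δ)).append
    (.refl (negPart Γ))) (σ := (ListPerm.refl (posPart Γ)).append (.refl (B :: negPart Δ))) ?_ ?_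
  · exact Lab.forall_append.2 fun v w => ListPerm.app_append _ _ _ _
  · exact Lab.forall_append.2 fun v w => ListPerm.app_append _ _ _ _

theorem freeStar_coswap_neg_pos (x : P.freeStar.Hom Γ (neg A :: pos B :: Δ)) :
    P.freeStar.perm (.refl Γ) (.swap (neg A) (pos B) Δ) x = x := by
  refine ModuleStruct.IsModule.perm_eq_self hP (τ := (ListPerm.refl (B :: posPart Δ)).append
    (.refl (negPart Γ))) (σ := (ListPerm.refl (posPart Γ)).append (.refl (A :: negPart Δ))) ?_ ?_
  · exact Lab.forall_append.2 fun v w => ListPerm.app_append _ _ _ _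
  · exact Lab.forall_append.2 fun v w => ListPerm.app_append _ _ _ _

theorem freeStar_coswap_neg_neg (x : P.freeStar.Hom Γ (neg A :: neg B :: Δ)) :
    P.freeStar.perm (.refl Γ) (.swap (neg A) (neg B) Δ) x =
      P.perm (.appendLeft (posPart Γ) (.swap A B (negPart Δ)))
        (.refl (posPart Δ ++ negPart Γ)) x := by
  refine ModuleStruct.IsModule.perm_eq hP (σ := (ListPerm.refl (posPart Γ)).append
    (.swap A B (negPart Δ))) (τ := (ListPerm.refl (posPart Δ)).append (.refl (negPart Γ))) ?_ ?_
  · simp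
  · simp

/-- The interchange laws, by the signs of the two objects. For objects of the same sign they are the
interchange laws of `P`, and for objects of different signs they are associativity in `P`. -/
theorem freeStar_comm_pos_pos (f₁ : P.freeStar.Hom Γ₁ (pos A :: Δ₁))
    (f₂ : P.freeStar.Hom Γ₂ (pos B :: Δ₂)) (x : P.freeStar.Hom (pos A :: pos B :: S) T) :
    P.freeStar.perm (leftComm Γ₂ Γ₁ S) (leftComm Δ₂ Δ₁ T) (P.freeStar.comp f₂
      (P.freeStar.perm (front Γ₁ (pos B) S) (.refl _) (P.freeStar.comp f₁ x))) =
        P.freeStar.comp f₁ (P.freeStar.perm (front Γ₂ (pos A) S) (.refl _) (P.freeStar.comp f₂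
          (P.freeStar.perm (.swap (pos A) (pos B) S) (.refl _) x))) := by
  refine ((hP.freeStar_perm_comp_pos _ _ f₂ _).trans (congrArg (fun k => P.cut _ _ _ _ f₂ k)
    (hP.freeStar_perm_comp_pos _ _ f₁ x))).trans (Eq.trans ?_ ((hP.freeStar_comp_pos f₁ _).trans
      (congrArg (fun k => P.cut _ _ _ _ f₁ k) ((hP.freeStar_perm_comp_pos _ _ f₂ _).trans
        (hP.cut_perm_right (.swap A B (posPart S ++ negPart T)) _
          (hP.freeStar_swap_pos_pos x))))).symm)
  refine hP.cut_comm
    (τ₁ := .refl (A :: (posPart Δ₁ ++ negPart Γ₁)))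
    (τ₂ := .refl (B :: (posPart Δ₂ ++ negPart Γ₂)))
    (σ₁ := .refl (A :: B :: (posPart S ++ negPart T)))
    (σ₂ := (ListPerm.swap A B (posPart S ++ negPart T)).trans (.refl _))
    (m := mergeHeadPos Γ₁ Δ₁ B S T) (n := mergePassPos Δ₁ Γ₁ B T S)
    (ρ := .refl (B :: (posPart (Γ₁ ++ S) ++ negPart (Δ₁ ++ T))))
    (M := mergeThen (leftComm Γ₂ Γ₁ S) (leftComm Δ₂ Δ₁ T))
    (N := mergeThen (leftComm Δ₂ Δ₁ T) (leftComm Γ₂ Γ₁ S)) (m' := mergeHeadPos Γ₂ Δ₂ A S T)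
    (n' := mergePassPos Δ₂ Γ₂ A T S) (ρ' := .refl (A :: (posPart (Γ₂ ++ S) ++ negPart (Δ₂ ++ T))))
    (M' := merge Γ₁ Δ₁ (Γ₂ ++ S) (Δ₂ ++ T)) (N' := merge Δ₁ Γ₁ (Δ₂ ++ T) (Γ₂ ++ S))
    (.refl (A :: B :: (posPart S ++ negPart T))) (.refl (B :: (posPart S ++ negPart T)))
    (.refl (A :: (posPart S ++ negPart T))) (merge Γ₁ Δ₁ S T) (merge Γ₂ Δ₂ S T) ?_ ?_ ?_ ?_ ?_ ?_
  all_goals simp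

theorem freeStar_comm_pos_neg (f₁ : P.freeStar.Hom Γ₁ (pos A :: Δ₁))
    (f₂ : P.freeStar.Hom Γ₂ (neg B :: Δ₂)) (x : P.freeStar.Hom (pos A :: neg B :: S) T) :
    P.freeStar.perm (leftComm Γ₂ Γ₁ S) (leftComm Δ₂ Δ₁ T) (P.freeStar.comp f₂
      (P.freeStar.perm (front Γ₁ (neg B) S) (.refl _) (P.freeStar.comp f₁ x))) =
        P.freeStar.comp f₁ (P.freeStar.perm (front Γ₂ (pos A) S) (.refl _) (P.freeStar.comp f₂
          (P.freeStar.perm (.swap (pos A) (neg B) S) (.refl _) x))) := by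
  refine ((hP.freeStar_perm_comp_neg _ _ f₂ _).trans (congrArg (fun k => P.cut _ _ _ _ k f₂)
    (hP.freeStar_perm_comp_pos _ _ f₁ x))).trans (Eq.trans ?_ ((hP.freeStar_comp_pos f₁ _).trans
      (congrArg (fun k => P.cut _ _ _ _ f₁ k) ((congrArg (fun k => P.freeStar.perm _ _
        (P.freeStar.comp f₂ k)) (hP.freeStar_swap_pos_neg x)).trans
          (hP.freeStar_perm_comp_neg _ _ f₂ _)))).symm)
  refine hP.cut_assoc
    (τ := .refl (A :: (posPart Δ₁ ++ negPart Γ₁))) (σ := .refl (A :: (posPart S ++ negPart T)))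
    (τ' := front (posPart T) B (negPart S)) (ρ := front (posPart Γ₂) B (negPart Δ₂))
    (m := mergePassNeg Γ₁ Δ₁ B S T) (n := mergeHeadNeg Δ₁ Γ₁ B T S)
    (τ₂ := front (posPart (Δ₁ ++ T)) B (negPart (Γ₁ ++ S)))
    (m₂ := commMergeThen (leftComm Γ₂ Γ₁ S) (leftComm Δ₂ Δ₁ T))
    (n₂ := commMergeThen (leftComm Δ₂ Δ₁ T) (leftComm Γ₂ Γ₁ S))
    (m' := (ListPerm.comm _ _).trans (mergeHeadPos Γ₂ Δ₂ A S T))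
    (n' := (ListPerm.comm _ _).trans (mergePassPos Δ₂ Γ₂ A T S))
    (σ₂ := .refl (A :: (posPart (Γ₂ ++ S) ++ negPart (Δ₂ ++ T))))
    (m₃ := merge Γ₁ Δ₁ (Γ₂ ++ S) (Δ₂ ++ T)) (n₃ := merge Δ₁ Γ₁ (Δ₂ ++ T) (Γ₂ ++ S))
    (commMerge Γ₂ Δ₂ S T) (merge Δ₁ Γ₁ T S) ?_ ?_ ?_ ?_
  all_goals simp

theorem freeStar_comm_neg_pos (f₁ : P.freeStar.Hom Γ₁ (neg A :: Δ₁))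
    (f₂ : P.freeStar.Hom Γ₂ (pos B :: Δ₂)) (x : P.freeStar.Hom (neg A :: pos B :: S) T) :
    P.freeStar.perm (leftComm Γ₂ Γ₁ S) (leftComm Δ₂ Δ₁ T) (P.freeStar.comp f₂
      (P.freeStar.perm (front Γ₁ (pos B) S) (.refl _) (P.freeStar.comp f₁ x))) =
        P.freeStar.comp f₁ (P.freeStar.perm (front Γ₂ (neg A) S) (.refl _) (P.freeStar.comp f₂
          (P.freeStar.perm (.swap (neg A) (pos B) S) (.refl _) x))) := by
  refine ((hP.freeStar_perm_comp_pos _ _ f₂ _).trans (congrArg (fun k => P.cut _ _ _ _ f₂ k)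
    (hP.freeStar_perm_comp_neg _ _ f₁ x))).trans (Eq.trans ?_ ((freeStar_comp_neg f₁ _).trans
      (congrArg (fun k => P.cut _ _ _ _ k f₁) ((congrArg (fun k => P.freeStar.perm _ _
        (P.freeStar.comp f₂ k)) (hP.freeStar_swap_neg_pos x)).trans
          (hP.freeStar_perm_comp_pos _ _ f₂ _)))).symm)
  refine Eq.symm (hP.cut_assoc
    (τ := .refl (B :: (posPart Δ₂ ++ negPart Γ₂))) (σ := .refl (B :: (posPart S ++ negPart T)))
    (τ' := front (posPart T) A (negPart S)) (ρ := front (posPart Γ₁) A (negPart Δ₁))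
    (m := mergePassNeg Γ₂ Δ₂ A S T) (n := mergeHeadNeg Δ₂ Γ₂ A T S)
    (τ₂ := front (posPart (Δ₂ ++ T)) A (negPart (Γ₂ ++ S)))
    (m₂ := commMerge Γ₁ Δ₁ (Γ₂ ++ S) (Δ₂ ++ T)) (n₂ := commMerge Δ₁ Γ₁ (Δ₂ ++ T) (Γ₂ ++ S))
    (m' := (ListPerm.comm _ _).trans (mergeHeadPos Γ₁ Δ₁ B S T))
    (n' := (ListPerm.comm _ _).trans (mergePassPos Δ₁ Γ₁ B T S))
    (σ₂ := .refl (B :: (posPart (Γ₁ ++ S) ++ negPart (Δ₁ ++ T))))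
    (m₃ := mergeThen (leftComm Γ₂ Γ₁ S) (leftComm Δ₂ Δ₁ T))
    (n₃ := mergeThen (leftComm Δ₂ Δ₁ T) (leftComm Γ₂ Γ₁ S)) (commMerge Γ₁ Δ₁ S T)
    (merge Δ₂ Γ₂ T S) ?_ ?_ ?_ ?_)
  all_goals simp

theorem freeStar_comm_neg_neg (f₁ : P.freeStar.Hom Γ₁ (neg A :: Δ₁))
    (f₂ : P.freeStar.Hom Γ₂ (neg B :: Δ₂)) (x : P.freeStar.Hom (neg A :: neg B :: S) T) :
    P.freeStar.perm (leftComm Γ₂ Γ₁ S) (leftComm Δ₂ Δ₁ T) (P.freeStar.comp f₂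
      (P.freeStar.perm (front Γ₁ (neg B) S) (.refl _) (P.freeStar.comp f₁ x))) =
        P.freeStar.comp f₁ (P.freeStar.perm (front Γ₂ (neg A) S) (.refl _) (P.freeStar.comp f₂
          (P.freeStar.perm (.swap (neg A) (neg B) S) (.refl _) x))) := by
  refine ((hP.freeStar_perm_comp_neg _ _ f₂ _).trans (congrArg (fun k => P.cut _ _ _ _ k f₂)
    (hP.freeStar_perm_comp_neg _ _ f₁ x))).trans (Eq.trans ?_ ((freeStar_comp_neg f₁ _).trans
      (congrArg (fun k => P.cut _ _ _ _ k f₁) ((hP.freeStar_perm_comp_neg _ _ f₂ _).trans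
        (hP.cut_perm_left (.appendLeft (posPart T) (.swap A B (negPart S))) _
          (hP.freeStar_swap_neg_neg x))))).symm)
  refine hP.cut_cocomm
    (τ₁ := front (posPart T) A (B :: negPart S))
    (τ₂ := (ListPerm.appendLeft (posPart T) (.swap A B (negPart S))).trans
      (front (posPart T) B (A :: negPart S)))
    (σ₁ := front (posPart Γ₁) A (negPart Δ₁)) (σ₂ := front (posPart Γ₂) B (negPart Δ₂))
    (m := (ListPerm.comm _ _).trans (mergePassNeg Γ₁ Δ₁ B S T))
    (n := (ListPerm.comm _ _).trans (mergeHeadNeg Δ₁ Γ₁ B T S))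
    (ρ := front (posPart (Δ₁ ++ T)) B (negPart (Γ₁ ++ S)))
    (M := commMergeThen (leftComm Γ₂ Γ₁ S) (leftComm Δ₂ Δ₁ T))
    (N := commMergeThen (leftComm Δ₂ Δ₁ T) (leftComm Γ₂ Γ₁ S))
    (m' := (ListPerm.comm _ _).trans (mergePassNeg Γ₂ Δ₂ A S T))
    (n' := (ListPerm.comm _ _).trans (mergeHeadNeg Δ₂ Γ₂ A T S))
    (ρ' := front (posPart (Δ₂ ++ T)) A (negPart (Γ₂ ++ S)))
    (M' := commMerge Γ₁ Δ₁ (Γ₂ ++ S) (Δ₂ ++ T)) (N' := commMerge Δ₁ Γ₁ (Δ₂ ++ T) (Γ₂ ++ S))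
    ((front (posPart T) A (B :: negPart S)).trans (.cons A (front (posPart T) B (negPart S))))
    ((front (posPart T) B (negPart S)).symm) ((front (posPart T) A (negPart S)).symm)
    (commMerge Δ₁ Γ₁ T S) (commMerge Δ₂ Γ₂ T S) ?_ ?_ ?_ ?_ ?_ ?_
  all_goals simp

theorem freeStar_cocomm_pos_pos (x : P.freeStar.Hom Γ (pos A :: pos B :: Δ))
    (g₁ : P.freeStar.Hom (pos A :: S₁) T₁) (g₂ : P.freeStar.Hom (pos B :: S₂) T₂) :
    P.freeStar.perm (rightComm Γ S₁ S₂) (rightComm Δ T₁ T₂)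
      (P.freeStar.comp (P.freeStar.comp x g₁ : P.freeStar.Hom _ (pos B :: _)) g₂) =
        P.freeStar.comp (P.freeStar.comp (P.freeStar.perm (.refl _) (.swap (pos A) (pos B) Δ) x) g₂
            :
          P.freeStar.Hom _ (pos A :: _)) g₁ := by
  refine ((hP.freeStar_perm_comp_pos _ _ _ g₂).trans (congrArg (fun k => P.cut _ _ _ _ k g₂)
    (hP.freeStar_comp_pos x g₁))).trans (Eq.trans ?_ ((hP.freeStar_comp_pos _ g₁).trans
      (congrArg (fun k => P.cut _ _ _ _ k g₁) ((hP.freeStar_comp_pos _ g₂).trans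
        (hP.cut_perm_left (.swap A B (posPart Δ ++ negPart Γ)) _
          (hP.freeStar_coswap_pos_pos x))))).symm)
  refine hP.cut_cocomm
    (τ₁ := .refl (A :: B :: (posPart Δ ++ negPart Γ)))
    (τ₂ := (ListPerm.swap A B (posPart Δ ++ negPart Γ)).trans (.refl _))
    (σ₁ := .refl (A :: (posPart S₁ ++ negPart T₁)))
    (σ₂ := .refl (B :: (posPart S₂ ++ negPart T₂))) (m := mergeConsPos Γ Δ B S₁ T₁)
    (n := consMergePos Δ Γ B T₁ S₁) (ρ := .refl (B :: (posPart (Δ ++ T₁) ++ negPart (Γ ++ S₁))))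
    (M := mergeThen (rightComm Γ S₁ S₂) (rightComm Δ T₁ T₂))
    (N := mergeThen (rightComm Δ T₁ T₂) (rightComm Γ S₁ S₂)) (m' := mergeConsPos Γ Δ A S₂ T₂)
    (n' := consMergePos Δ Γ A T₂ S₂) (ρ' := .refl (A :: (posPart (Δ ++ T₂) ++ negPart (Γ ++ S₂))))
    (M' := merge (Γ ++ S₂) (Δ ++ T₂) S₁ T₁) (N' := merge (Δ ++ T₂) (Γ ++ S₂) T₁ S₁)
    (.refl (A :: B :: (posPart Δ ++ negPart Γ))) (.refl (B :: (posPart Δ ++ negPart Γ)))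
    (.refl (A :: (posPart Δ ++ negPart Γ))) (merge Δ Γ T₁ S₁) (merge Δ Γ T₂ S₂) ?_ ?_ ?_ ?_ ?_ ?_
  all_goals simp

theorem freeStar_cocomm_pos_neg (x : P.freeStar.Hom Γ (pos A :: neg B :: Δ))
    (g₁ : P.freeStar.Hom (pos A :: S₁) T₁) (g₂ : P.freeStar.Hom (neg B :: S₂) T₂) :
    P.freeStar.perm (rightComm Γ S₁ S₂) (rightComm Δ T₁ T₂)
      (P.freeStar.comp (P.freeStar.comp x g₁ : P.freeStar.Hom _ (neg B :: _)) g₂) =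
        P.freeStar.comp (P.freeStar.comp (P.freeStar.perm (.refl _) (.swap (pos A) (neg B) Δ) x) g₂
            :
          P.freeStar.Hom _ (pos A :: _)) g₁ := by
  refine ((hP.freeStar_perm_comp_neg _ _ _ g₂).trans (congrArg (fun k => P.cut _ _ _ _ g₂ k)
    (hP.freeStar_comp_pos x g₁))).trans (Eq.trans ?_ ((hP.freeStar_comp_pos _ g₁).trans
      (congrArg (fun k => P.cut _ _ _ _ k g₁) ((congrArg (fun k =>
        P.freeStar.comp k g₂) (hP.freeStar_coswap_pos_neg x)).trans
            (freeStar_comp_neg _ g₂)))).symm)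
  refine Eq.symm (hP.cut_assoc
    (τ := front (posPart T₂) B (negPart S₂)) (σ := front (posPart Γ) B (negPart Δ))
    (τ' := .refl (A :: (posPart Δ ++ negPart Γ))) (ρ := .refl (A :: (posPart S₁ ++ negPart T₁)))
    (m := (ListPerm.comm _ _).trans (mergeConsPos Γ Δ A S₂ T₂))
    (n := (ListPerm.comm _ _).trans (consMergePos Δ Γ A T₂ S₂))
    (τ₂ := .refl (A :: (posPart (Δ ++ T₂) ++ negPart (Γ ++ S₂))))
    (m₂ := merge (Γ ++ S₂) (Δ ++ T₂) S₁ T₁) (n₂ := merge (Δ ++ T₂) (Γ ++ S₂) T₁ S₁)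
    (m' := consMergeNeg Γ Δ B S₁ T₁) (n' := mergeConsNeg Δ Γ B T₁ S₁)
    (σ₂ := front (posPart (Γ ++ S₁)) B (negPart (Δ ++ T₁)))
    (m₃ := commMergeThen (rightComm Γ S₁ S₂) (rightComm Δ T₁ T₂))
    (n₃ := commMergeThen (rightComm Δ T₁ T₂) (rightComm Γ S₁ S₂)) (merge Γ Δ S₁ T₁)
    (commMerge Δ Γ T₂ S₂) ?_ ?_ ?_ ?_)
  all_goals simp

theorem freeStar_cocomm_neg_pos (x : P.freeStar.Hom Γ (neg A :: pos B :: Δ))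
    (g₁ : P.freeStar.Hom (neg A :: S₁) T₁) (g₂ : P.freeStar.Hom (pos B :: S₂) T₂) :
    P.freeStar.perm (rightComm Γ S₁ S₂) (rightComm Δ T₁ T₂)
      (P.freeStar.comp (P.freeStar.comp x g₁ : P.freeStar.Hom _ (pos B :: _)) g₂) =
        P.freeStar.comp (P.freeStar.comp (P.freeStar.perm (.refl _) (.swap (neg A) (pos B) Δ) x) g₂
            :
          P.freeStar.Hom _ (neg A :: _)) g₁ := by
  refine ((hP.freeStar_perm_comp_pos _ _ _ g₂).trans (congrArg (fun k => P.cut _ _ _ _ k g₂)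
    (freeStar_comp_neg x g₁))).trans (Eq.trans ?_ ((freeStar_comp_neg _ g₁).trans
      (congrArg (fun k => P.cut _ _ _ _ g₁ k) ((congrArg (fun k =>
        P.freeStar.comp k g₂) (hP.freeStar_coswap_neg_pos x)).trans
            (hP.freeStar_comp_pos _ g₂)))).symm)
  refine hP.cut_assoc
    (τ := front (posPart T₁) A (negPart S₁)) (σ := front (posPart Γ) A (negPart Δ))
    (τ' := .refl (B :: (posPart Δ ++ negPart Γ))) (ρ := .refl (B :: (posPart S₂ ++ negPart T₂)))
    (m := (ListPerm.comm _ _).trans (mergeConsPos Γ Δ B S₁ T₁))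
    (n := (ListPerm.comm _ _).trans (consMergePos Δ Γ B T₁ S₁))
    (τ₂ := .refl (B :: (posPart (Δ ++ T₁) ++ negPart (Γ ++ S₁))))
    (m₂ := mergeThen (rightComm Γ S₁ S₂) (rightComm Δ T₁ T₂))
    (n₂ := mergeThen (rightComm Δ T₁ T₂) (rightComm Γ S₁ S₂)) (m' := consMergeNeg Γ Δ A S₂ T₂)
    (n' := mergeConsNeg Δ Γ A T₂ S₂) (σ₂ := front (posPart (Γ ++ S₂)) A (negPart (Δ ++ T₂)))
    (m₃ := commMerge (Γ ++ S₂) (Δ ++ T₂) S₁ T₁) (n₃ := commMerge (Δ ++ T₂) (Γ ++ S₂) T₁ S₁)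
    (merge Γ Δ S₂ T₂) (commMerge Δ Γ T₁ S₁) ?_ ?_ ?_ ?_
  all_goals simp

theorem freeStar_cocomm_neg_neg (x : P.freeStar.Hom Γ (neg A :: neg B :: Δ))
    (g₁ : P.freeStar.Hom (neg A :: S₁) T₁) (g₂ : P.freeStar.Hom (neg B :: S₂) T₂) :
    P.freeStar.perm (rightComm Γ S₁ S₂) (rightComm Δ T₁ T₂)
      (P.freeStar.comp (P.freeStar.comp x g₁ : P.freeStar.Hom _ (neg B :: _)) g₂) =
        P.freeStar.comp (P.freeStar.comp (P.freeStar.perm (.refl _) (.swap (neg A) (neg B) Δ) x) g₂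
            :
          P.freeStar.Hom _ (neg A :: _)) g₁ := by
  refine ((hP.freeStar_perm_comp_neg _ _ _ g₂).trans (congrArg (fun k => P.cut _ _ _ _ g₂ k)
    (freeStar_comp_neg x g₁))).trans (Eq.trans ?_ ((freeStar_comp_neg _ g₁).trans
      (congrArg (fun k => P.cut _ _ _ _ g₁ k) ((freeStar_comp_neg _ g₂).trans
        (hP.cut_perm_right (.appendLeft (posPart Γ) (.swap A B (negPart Δ))) _
          (hP.freeStar_coswap_neg_neg x))))).symm)
  refine hP.cut_comm
    (τ₁ := front (posPart T₁) A (negPart S₁)) (τ₂ := front (posPart T₂) B (negPart S₂))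
    (σ₁ := front (posPart Γ) A (B :: negPart Δ))
    (σ₂ := (ListPerm.appendLeft (posPart Γ) (.swap A B (negPart Δ))).trans
      (front (posPart Γ) B (A :: negPart Δ)))
    (m := (ListPerm.comm _ _).trans (consMergeNeg Γ Δ B S₁ T₁))
    (n := (ListPerm.comm _ _).trans (mergeConsNeg Δ Γ B T₁ S₁))
    (ρ := front (posPart (Γ ++ S₁)) B (negPart (Δ ++ T₁)))
    (M := commMergeThen (rightComm Γ S₁ S₂) (rightComm Δ T₁ T₂))
    (N := commMergeThen (rightComm Δ T₁ T₂) (rightComm Γ S₁ S₂))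
    (m' := (ListPerm.comm _ _).trans (consMergeNeg Γ Δ A S₂ T₂))
    (n' := (ListPerm.comm _ _).trans (mergeConsNeg Δ Γ A T₂ S₂))
    (ρ' := front (posPart (Γ ++ S₂)) A (negPart (Δ ++ T₂)))
    (M' := commMerge (Γ ++ S₂) (Δ ++ T₂) S₁ T₁) (N' := commMerge (Δ ++ T₂) (Γ ++ S₂) T₁ S₁)
    ((front (posPart Γ) A (B :: negPart Δ)).trans (.cons A (front (posPart Γ) B (negPart Δ))))
    ((front (posPart Γ) B (negPart Δ)).symm) ((front (posPart Γ) A (negPart Δ)).symm)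
    (commMerge Γ Δ S₁ T₁) (commMerge Γ Δ S₂ T₂) ?_ ?_ ?_ ?_ ?_ ?_
  all_goals simp

end PolycategoryStruct.IsPolycategory

/-! ### The duality of the free `∗`-polycategory -/

namespace Signed

variable {α : Type u}

theorem forall_lab {Γ Δ : List (Signed α)} {p : Lab (posPart Γ ++ negPart Δ) → Prop} :
    (∀ v, p v) ↔ ∀ (v : Lab Γ) (w : Lab Δ), p ((posL v).append (negL w)) := by
  simp

theorem app_posPerm_append_negPerm {Γ Γ' Δ Δ' : List (Signed α)} (σ : ListPerm Γ Γ')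
    (τ : ListPerm Δ Δ') (v : Lab Γ) (w : Lab Δ) {v' : Lab Γ'} {w' : Lab Δ'} (h : σ.app v = v')
    (h' : τ.app w = w') : ((posPerm σ).append (negPerm τ)).app ((posL v).append (negL w)) =
      (posL v').append (negL w') := by
  simp [h, h']

end Signed

namespace PolycategoryStruct.IsPolycategory

open Signed

variable {P : PolycategoryStruct.{u, w}} (hP : P.IsPolycategory)
include hP

/-- Equivariance of composition, for composites along objects in arbitrary positions. -/
theorem cut_perm {G G₁ D D' D₁ D₁' S S' S₁ S₁' T T₁ X Y : List P.Ob} {A : P.Ob}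
    {τ : ListPerm D (A :: D')} {σ : ListPerm S (A :: S')} {m : ListPerm (G ++ S') X}
    {n : ListPerm (D' ++ T) Y} {τ₁ : ListPerm D₁ (A :: D₁')} {σ₁ : ListPerm S₁ (A :: S₁')}
    {m₁ : ListPerm (G₁ ++ S₁') X} {n₁ : ListPerm (D₁' ++ T₁) Y}
    {a : ListPerm G₁ G} {b : ListPerm D₁ D} {c : ListPerm S₁ S} {d : ListPerm T₁ T}
    (f : P.Hom G₁ D₁) (g : P.Hom S₁ T₁) (β : ListPerm D₁' D') (γ : ListPerm S₁' S')
    (h₁ : ∀ v, τ.app (b.app v) = .cons (τ₁.app v).head (β.app (τ₁.app v).tail))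
    (h₂ : ∀ v, σ.app (c.app v) = .cons (σ₁.app v).head (γ.app (σ₁.app v).tail))
    (h₃ : ∀ (v : Lab G₁) (w : Lab S₁'), m.app ((a.app v).append (γ.app w)) = m₁.app (v.append w))
    (h₄ : ∀ (v : Lab D₁') (w : Lab T₁), n.app ((β.app v).append (d.app w)) =
      n₁.app (v.append w)) :
    P.cut τ σ m n (P.perm a b f) (P.perm c d g) = P.cut τ₁ σ₁ m₁ n₁ f g := by
  have e₁ : P.perm (.refl G) τ (P.perm a b f) =
      P.perm a (.cons A β) (P.perm (.refl G₁) τ₁ f) :=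
    ModuleStruct.IsModule.perm_eq₂₂ hP (h₂ := h₁)
  have e₂ : P.perm σ (.refl T) (P.perm c d g) =
      P.perm (.cons A γ) d (P.perm σ₁ (.refl T₁) g) :=
    ModuleStruct.IsModule.perm_eq₂₂ hP (h₁ := h₂)
  refine (congrArg (P.perm m n) ((congrArg₂ (P.comp (A := A)) e₁ e₂).trans
    (ModuleStruct.IsModule.left_perm hP _ _ _ _ _ _))).trans
      (ModuleStruct.IsModule.perm_eq₂₁ hP ?_ ?_)
  · simp [h₃]
  · simp [h₄]

variable {Γ Δ S T Γ' Δ' S' T' : List (Signed P.Ob)} {A B : P.Ob}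

theorem freeStar_perm_comp_perm_pos (σ : ListPerm Γ Γ') (τ : ListPerm Δ Δ') (σ' : ListPerm S S')
    (τ' : ListPerm T T') (f : P.freeStar.Hom Γ (pos A :: Δ)) (g : P.freeStar.Hom (pos A :: S) T) :
    P.freeStar.comp (P.freeStar.perm σ (.cons (pos A) τ) f)
        (P.freeStar.perm (.cons (pos A) σ') τ' g) =
      P.freeStar.perm (σ.append σ') (τ.append τ') (P.freeStar.comp f g) := by
  refine (hP.freeStar_comp_pos _ _).trans (Eq.trans ?_ (hP.freeStar_perm_comp_pos _ _ f g).symm)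
  refine hP.cut_perm (τ₁ := .refl (A :: (posPart Δ ++ negPart Γ)))
    (σ₁ := .refl (A :: (posPart S ++ negPart T))) (m₁ := mergeThen (σ.append σ') (τ.append τ'))
    (n₁ := mergeThen (τ.append τ') (σ.append σ')) (a := (posPerm σ).append (negPerm τ))
    (b := (ListPerm.cons A (posPerm τ)).append (negPerm σ))
    (d := (posPerm τ').append (negPerm σ')) (c := (ListPerm.cons A (posPerm σ')).append
      (negPerm τ')) f g
    ((posPerm τ).append (negPerm σ)) ((posPerm σ').append (negPerm τ')) ?_ ?_ ?_ ?_
  · exact fun v => rfl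
  · exact fun v => rfl
  · simp
  · simp

theorem freeStar_perm_comp_perm_neg (σ : ListPerm Γ Γ') (τ : ListPerm Δ Δ') (σ' : ListPerm S S')
    (τ' : ListPerm T T') (f : P.freeStar.Hom Γ (neg A :: Δ)) (g : P.freeStar.Hom (neg A :: S) T) :
    P.freeStar.comp (P.freeStar.perm σ (.cons (neg A) τ) f)
        (P.freeStar.perm (.cons (neg A) σ') τ' g) =
      P.freeStar.perm (σ.append σ') (τ.append τ') (P.freeStar.comp f g) := by
  refine (freeStar_comp_neg _ _).trans (Eq.trans ?_ (hP.freeStar_perm_comp_neg _ _ f g).symm)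
  refine hP.cut_perm (τ₁ := front (posPart T) A (negPart S))
    (σ₁ := front (posPart Γ) A (negPart Δ)) (m₁ := commMergeThen (σ.append σ') (τ.append τ'))
    (n₁ := commMergeThen (τ.append τ') (σ.append σ')) (a := (posPerm σ').append (negPerm τ'))
    (b := (posPerm τ').append (.cons A (negPerm σ')))
    (d := (posPerm τ).append (negPerm σ)) (c := (posPerm σ).append (.cons A (negPerm τ))) g f
    ((posPerm τ').append (negPerm σ')) ((posPerm σ).append (negPerm τ)) ?_ ?_ ?_ ?_
  · simp
  · simp
  · simp
  · simp

theorem freeStar_id_comp_pos (g : P.freeStar.Hom (pos A :: S) T) :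
    P.freeStar.comp (P.freeStar.id (pos A)) g = g := by
  refine (congrArg (P.perm _ _) (ModuleStruct.IsModule.id_left hP (A := A) g)).trans ?_
  refine ModuleStruct.IsModule.perm_eq_self hP ?_ ?_
  · refine forall_lab.2 fun (x : Lab (pos A :: S)) y => ?_
    exact app_merge [pos A] [] S T (.cons x.head .nil) .nil x.tail y
  · refine (forall_lab (Δ := S)).2 fun x y => ?_
    exact app_merge [] [pos A] T S .nil (.cons 0 .nil) x y

theorem freeStar_comp_id_pos (f : P.freeStar.Hom Γ (pos A :: Δ)) :
    P.freeStar.comp f (P.freeStar.id (pos A)) =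
      P.freeStar.perm (.appendNil Γ) (.rotate (pos A) Δ) f := by
  refine (congrArg (P.perm _ _) (ModuleStruct.IsModule.right_id hP (A := A) f)).trans ?_
  refine ModuleStruct.IsModule.perm_eq₂₁ hP ?_ ?_
  · refine (forall_lab (Δ := Δ)).2 fun x y => ?_
    exact (congrArg (merge Γ Δ [] [pos A]).app (ListPerm.app_appendNil _ _)).trans
      ((app_merge Γ Δ [] [pos A] x y .nil (.cons 0 .nil)).trans
        (app_posPerm_append_negPerm (.appendNil Γ) (.rotate (pos A) Δ) x (.cons 0 y)
          (by simp) (by simp)).symm)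
  · refine forall_lab.2 fun (x : Lab (pos A :: Δ)) y => ?_
    exact (congrArg (merge Δ Γ [pos A] []).app (ListPerm.app_rotate A _ x.head _)).trans
      ((app_merge Δ Γ [pos A] [] x.tail y (.cons x.head .nil) .nil).trans
        (app_posPerm_append_negPerm (.rotate (pos A) Δ) (.appendNil Γ) (.cons x.head x.tail) y
          (ListPerm.app_rotate _ _ _ _) (by simp)).symm)

theorem freeStar_comp_id_neg (f : P.freeStar.Hom Γ (neg A :: Δ)) :
    P.freeStar.comp f (P.freeStar.id (neg A)) =
      P.freeStar.perm (.appendNil Γ) (.rotate (neg A) Δ) f := by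
  refine (congrArg (P.perm _ _) ((congrArg (fun k => P.comp k _)
    (ModuleStruct.IsModule.perm_refl hP (P.id A))).trans
      (ModuleStruct.IsModule.id_left hP _))).trans ?_
  refine ModuleStruct.IsModule.perm_eq₂₁ hP ?_ ?_
  · refine forall_lab.2 fun x (y : Lab (neg A :: Δ)) => ?_
    exact (congrArg (commMerge Γ Δ [] [neg A]).app
        (ListPerm.app_front _ A _ (posL x) y.head (negL y.tail))).trans
      ((app_commMerge Γ Δ [] [neg A] x y.tail .nil (.cons y.head .nil)).trans
        (app_posPerm_append_negPerm (.appendNil Γ) (.rotate (neg A) Δ) x (.cons y.head y.tail)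
          (by simp) (ListPerm.app_rotate _ _ _ _)).symm)
  · refine forall_lab.2 fun x y => ?_
    exact (app_commMerge Δ Γ [neg A] [] x y (.cons 0 .nil) .nil).trans
        (app_posPerm_append_negPerm (.rotate (neg A) Δ) (.appendNil Γ) (.cons 0 x) y
          (by simp) (by simp)).symm

theorem freeStar_id_comp_neg (g : P.freeStar.Hom (neg A :: S) T) :
    P.freeStar.comp (P.freeStar.id (neg A)) g = g := by
  refine (congrArg (P.perm _ _) ((congrArg (P.comp _)
    (ModuleStruct.IsModule.perm_refl hP (P.id A))).trans
      (ModuleStruct.IsModule.right_id hP _))).trans ?_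
  refine (ModuleStruct.IsModule.perm_perm hP _ _ _ _ _).trans
    (ModuleStruct.IsModule.perm_perm_self hP ?_ ?_)
  · refine (forall_lab (Γ := S)).2 fun x y => ?_
    exact (congrArg (commMerge [neg A] [] S T).app (ListPerm.app_appendNil _ _)).trans
      (app_commMerge [neg A] [] S T (.cons 0 .nil) .nil x y)
  · refine forall_lab.2 fun x (y : Lab (neg A :: S)) => ?_
    exact (congrArg (fun k => (commMerge [] [neg A] T S).app ((ListPerm.rotate A _).app k))
        (ListPerm.app_front _ A _ (posL x) y.head (negL y.tail))).trans
      ((congrArg (commMerge [] [neg A] T S).app (ListPerm.app_rotate A _ y.head _)).trans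
        (app_commMerge [] [neg A] T S .nil (.cons y.head .nil) x y.tail))

theorem freeStar_perm_refl (f : P.freeStar.Hom Γ Δ) :
    P.freeStar.perm (.refl Γ) (.refl Δ) f = f :=
  ModuleStruct.IsModule.perm_eq_self hP (σ := (posPerm (.refl Γ)).append (negPerm (.refl Δ)))
    (τ := (posPerm (.refl Δ)).append (negPerm (.refl Γ)))

theorem freeStar_perm_trans {Γ'' Δ'' : List (Signed P.Ob)} (σ : ListPerm Γ Γ')
    (σ' : ListPerm Γ' Γ'') (τ : ListPerm Δ Δ') (τ' : ListPerm Δ' Δ'') (f : P.freeStar.Hom Γ Δ) :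
    P.freeStar.perm (σ.trans σ') (τ.trans τ') f =
      P.freeStar.perm σ' τ' (P.freeStar.perm σ τ f) :=
  ModuleStruct.IsModule.perm_eq₁₂ hP (σ₁ := (posPerm (σ.trans σ')).append (negPerm (τ.trans τ')))
    (τ₁ := (posPerm (τ.trans τ')).append (negPerm (σ.trans σ')))
    (σ₁' := (posPerm σ).append (negPerm τ)) (τ₁' := (posPerm τ).append (negPerm σ))
    (σ₂' := (posPerm σ').append (negPerm τ')) (τ₂' := (posPerm τ').append (negPerm σ'))

theorem freeStar_perm_congr (σ σ' : ListPerm Γ Γ') (τ τ' : ListPerm Δ Δ') (h : σ.idx = σ'.idx)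
    (h' : τ.idx = τ'.idx) (f : P.freeStar.Hom Γ Δ) :
    P.freeStar.perm σ τ f = P.freeStar.perm σ' τ' f :=
  ModuleStruct.IsModule.perm_eq hP (σ := (posPerm σ).append (negPerm τ))
    (τ := (posPerm τ).append (negPerm σ)) (σ' := (posPerm σ').append (negPerm τ'))
    (τ' := (posPerm τ').append (negPerm σ'))
    (by simp [ListPerm.app_congr h, ListPerm.app_congr h'])
    (by simp [ListPerm.app_congr h, ListPerm.app_congr h'])

/-- The free `∗`-polycategory on a polycategory is a polycategory. -/
theorem freeStar : P.freeStar.IsPolycategory :=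
  have assoc' : ∀ {Γ Δ S T Φ Ψ : List (Signed P.Ob)} {A B : Signed P.Ob}
      (f : P.freeStar.Hom Γ (A :: Δ)) (g : P.freeStar.Hom (A :: S) (B :: T))
      (h : P.freeStar.Hom (B :: Φ) Ψ),
      P.freeStar.perm (assoc Γ S Φ) (assoc Δ T Ψ) (P.freeStar.comp
        (P.freeStar.perm (.refl _) (front Δ B T) (P.freeStar.comp f g)) h) =
          P.freeStar.comp f (P.freeStar.comp g h) := fun {_ _ _ _ _ _ A B} => match A, B with
    | pos _, pos _ => hP.freeStar_assoc_pos_pos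
    | pos _, neg _ => hP.freeStar_assoc_pos_neg
    | neg _, pos _ => hP.freeStar_assoc_neg_pos
    | neg _, neg _ => hP.freeStar_assoc_neg_neg
  have comm' : ∀ {Γ₁ Δ₁ Γ₂ Δ₂ S T : List (Signed P.Ob)} {A B : Signed P.Ob}
      (f₁ : P.freeStar.Hom Γ₁ (A :: Δ₁)) (f₂ : P.freeStar.Hom Γ₂ (B :: Δ₂))
      (x : P.freeStar.Hom (A :: B :: S) T),
      P.freeStar.perm (leftComm Γ₂ Γ₁ S) (leftComm Δ₂ Δ₁ T) (P.freeStar.comp f₂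
        (P.freeStar.perm (front Γ₁ B S) (.refl _) (P.freeStar.comp f₁ x))) =
          P.freeStar.comp f₁ (P.freeStar.perm (front Γ₂ A S) (.refl _) (P.freeStar.comp f₂
            (P.freeStar.perm (.swap A B S) (.refl _) x))) :=
      fun {_ _ _ _ _ _ A B} => match A, B with
    | pos _, pos _ => hP.freeStar_comm_pos_pos
    | pos _, neg _ => hP.freeStar_comm_pos_neg
    | neg _, pos _ => hP.freeStar_comm_neg_pos
    | neg _, neg _ => hP.freeStar_comm_neg_neg
  have cocomm' : ∀ {Γ Δ S₁ T₁ S₂ T₂ : List (Signed P.Ob)} {A B : Signed P.Ob}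
      (x : P.freeStar.Hom Γ (A :: B :: Δ)) (g₁ : P.freeStar.Hom (A :: S₁) T₁)
      (g₂ : P.freeStar.Hom (B :: S₂) T₂),
      P.freeStar.perm (rightComm Γ S₁ S₂) (rightComm Δ T₁ T₂)
        (P.freeStar.comp (P.freeStar.comp x g₁ : P.freeStar.Hom _ (B :: _)) g₂) =
          P.freeStar.comp (P.freeStar.comp (P.freeStar.perm (.refl _) (.swap A B Δ) x) g₂ :
            P.freeStar.Hom _ (A :: _)) g₁ :=
      fun {_ _ _ _ _ _ A B} => match A, B with
    | pos _, pos _ => hP.freeStar_cocomm_pos_pos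
    | pos _, neg _ => hP.freeStar_cocomm_pos_neg
    | neg _, pos _ => hP.freeStar_cocomm_neg_pos
    | neg _, neg _ => hP.freeStar_cocomm_neg_neg
  have perm' : ∀ {Γ Γ' Δ Δ' S S' T T' : List (Signed P.Ob)} {A : Signed P.Ob}
      (σ : ListPerm Γ Γ') (τ : ListPerm Δ Δ') (σ' : ListPerm S S') (τ' : ListPerm T T')
      (f : P.freeStar.Hom Γ (A :: Δ)) (g : P.freeStar.Hom (A :: S) T),
      P.freeStar.comp (P.freeStar.perm σ (.cons A τ) f) (P.freeStar.perm (.cons A σ') τ' g) =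
        P.freeStar.perm (σ.append σ') (τ.append τ') (P.freeStar.comp f g) :=
      fun {_ _ _ _ _ _ _ _ A} => match A with
    | pos _ => hP.freeStar_perm_comp_perm_pos
    | neg _ => hP.freeStar_perm_comp_perm_neg
  { perm_refl := hP.freeStar_perm_refl
    perm_trans := hP.freeStar_perm_trans
    perm_congr := hP.freeStar_perm_congr
    left_perm := perm'
    right_perm := perm'
    id_left {_ _ A} := match A with
      | pos _ => hP.freeStar_id_comp_pos
      | neg _ => hP.freeStar_id_comp_neg
    right_id {_ _ A} := match A with
      | pos _ => hP.freeStar_comp_id_pos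
      | neg _ => hP.freeStar_comp_id_neg
    left_left := assoc'
    left_right := assoc'
    right_right := assoc'
    left_left_comm := comm'
    left_right_comm := comm'
    right_right_comm := cocomm'
    right_left_comm := cocomm' }

theorem freeStar_comp_counit_pos (f : P.freeStar.Hom Γ (neg A :: Δ)) :
    P.freeStar.comp f (P.freeStarCounit (pos A) (neg A) rfl) =
      P.perm (commMerge Γ Δ [pos A] []) (commMerge Δ Γ [] [pos A])
        (P.perm (front (posPart Γ) A (negPart Δ)) (.refl (posPart Δ ++ negPart Γ)) f) :=
  congrArg (P.perm _ _) ((congrArg (fun k => P.comp k _)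
    (ModuleStruct.IsModule.perm_refl hP (P.id A))).trans (ModuleStruct.IsModule.id_left hP _))

theorem freeStar_comp_counit_neg (f : P.freeStar.Hom Γ (pos A :: Δ)) :
    P.freeStar.comp f (P.freeStarCounit (neg A) (pos A) rfl) =
      P.perm (merge Γ Δ [neg A] []) (merge Δ Γ [] [neg A])
        (P.perm (.appendNil (posPart Γ ++ negPart Δ)) (.rotate A (posPart Δ ++ negPart Γ)) f) :=
  congrArg (P.perm _ _) (ModuleStruct.IsModule.right_id hP _)

theorem isStarPolycategory_freeStar :
    P.freeStar.IsStarPolycategory Signed.star P.freeStarCounit where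
  isPolycategory := hP.freeStar
  star_star
    | .pos _ => rfl
    | .neg _ => rfl
  ε_symm
    | .pos _, _, rfl, _ => ModuleStruct.IsModule.perm_eq_self hP (fun _ => rfl) (fun _ => rfl)
    | .neg _, _, rfl, _ => ModuleStruct.IsModule.perm_eq_self hP (fun _ => rfl) (fun _ => rfl)
  bijective
    | .pos _, _, _ => by
      refine (congrArg Function.Bijective (funext hP.freeStar_comp_counit_pos)).mpr ?_
      exact (ModuleStruct.IsModule.perm_bijective hP _ _).comp
        (ModuleStruct.IsModule.perm_bijective hP _ _)
    | .neg _, _, _ => by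
      refine (congrArg Function.Bijective (funext hP.freeStar_comp_counit_neg)).mpr ?_
      exact (ModuleStruct.IsModule.perm_bijective hP _ _).comp
        (ModuleStruct.IsModule.perm_bijective hP _ _)

end PolycategoryStruct.IsPolycategory

/-! ### The tensor products and internal homs of `C` in the free `∗`-polycategory -/

namespace Counary

variable {C : Type u} [Category.{v} C] [MonoidalCategory C]

/-- The morphism `split Γ Δ` is composed of associators and a unitor. -/
instance isIso_split : (Γ Δ : List C) → IsIso (split Γ Δ)
  | [], Δ => inferInstanceAs (IsIso (λ_ (tens Δ)).inv)
  | A :: Γ, Δ => by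
    have := isIso_split Γ Δ
    exact inferInstanceAs (IsIso (A ◁ split Γ Δ ≫ (α_ A (tens Γ) (tens Δ)).inv))

theorem precomp_bijective {Γ Γ' : List C} (k : tens Γ' ⟶ tens Γ) (_ : IsIso k) (Δ : List C) :
    Function.Bijective (fun x : Hom Γ Δ => (⟨x.cod, k ≫ x.hom, x.eq⟩ : Hom Γ' Δ)) := by
  refine Function.bijective_iff_has_inverse.2 ⟨fun y => ⟨y.cod, inv k ≫ y.hom, y.eq⟩, ?_, ?_⟩
  · rintro ⟨B, x, e⟩
    simp
  · rintro ⟨B, x, e⟩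
    simp

variable [SymmetricCategory C]

/-- Composition with an isomorphism out of a tensor product is invertible. -/
theorem comp_left_bijective {As : List C} {X : C} (t : tens As ⟶ X) (ht : IsIso t)
    (S T : List C) : Function.Bijective (fun x : Hom (X :: S) T =>
      ((poly C).comp (Δ := []) (⟨X, t, rfl⟩ : Hom As [X]) x : Hom (As ++ S) T)) := by
  have h : (fun x : Hom (X :: S) T =>
      ((poly C).comp (Δ := []) (⟨X, t, rfl⟩ : Hom As [X]) x : Hom (As ++ S) T)) =
      fun x => ⟨x.cod, (split As S ≫ t ▷ tens S) ≫ x.hom, x.eq⟩ := funext fun x =>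
    Hom.mk_congr ((congrArg (fun k => sub k x.hom) (Category.comp_id t)).trans
      (Category.assoc _ _ _).symm)
  exact h ▸ precomp_bijective (Γ := X :: S) _
    (IsIso.comp_isIso (f := split As S) (h := t ▷ tens S)) T

omit [SymmetricCategory C] in
theorem Hom.mk_inj {Γ Δ : List C} {B : C} {h h' : tens Γ ⟶ B} {e e' : Δ = [B]}
    (H : (⟨B, h, e⟩ : Hom Γ Δ) = ⟨B, h', e'⟩) : h = h' := by
  cases H
  rfl

variable [MonoidalClosed C]

section

variable {W M A B : C}

theorem ev_step (s : W ⟶ M ⊗ (A ⊗ 𝟙_ C)) (k : M ⟶ (ihom A).obj B) :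
    s ≫ (k ≫ 𝟙 _) ▷ (A ⊗ 𝟙_ C) ≫ (ihom A).obj B ◁ (ρ_ A).hom ≫ (β_ ((ihom A).obj B) A).hom ≫
      (ihom.ev A).app B = (s ≫ M ◁ (ρ_ A).hom ≫ (β_ M A).hom) ≫ MonoidalClosed.uncurry k := by
  rw [Category.comp_id, MonoidalClosed.uncurry_eq, ← whisker_exchange_assoc,
    BraidedCategory.braiding_naturality_left_assoc]
  simp only [Category.assoc]

theorem ev_step_surjective (s : W ⟶ M ⊗ (A ⊗ 𝟙_ C)) (_ : IsIso s) (y : W ⟶ B) :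
    ∃ k : M ⟶ (ihom A).obj B, (s ≫ M ◁ (ρ_ A).hom ≫ (β_ M A).hom) ≫ MonoidalClosed.uncurry k = y :=
  ⟨MonoidalClosed.curry (inv (s ≫ M ◁ (ρ_ A).hom ≫ (β_ M A).hom) ≫ y), by
    rw [MonoidalClosed.uncurry_curry, IsIso.hom_inv_id_assoc]⟩

theorem ev_step_injective (s : W ⟶ M ⊗ (A ⊗ 𝟙_ C)) (_ : IsIso s) {k k' : M ⟶ (ihom A).obj B}
    (h : (s ≫ M ◁ (ρ_ A).hom ≫ (β_ M A).hom) ≫ MonoidalClosed.uncurry k =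
      (s ≫ M ◁ (ρ_ A).hom ≫ (β_ M A).hom) ≫ MonoidalClosed.uncurry k') : k = k' :=
  MonoidalClosed.uncurry_injective ((cancel_epi _).1 h)

end

/-- The evaluation `(A ⊸ B, A) → B`. -/
def evMor (A B : C) : Hom [(ihom A).obj B, A] [B] :=
  ⟨B, (ihom A).obj B ◁ (ρ_ A).hom ≫ (β_ ((ihom A).obj B) A).hom ≫ (ihom.ev A).app B, rfl⟩

theorem comp_evMor {Θ : List C} {A B : C} (k : tens Θ ⟶ (ihom A).obj B) :
    ((poly C).comp (Δ := []) (⟨_, k, rfl⟩ : Hom Θ [(ihom A).obj B]) (evMor A B) :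
      Hom (Θ ++ [A]) [B]) = ⟨B, (split Θ [A] ≫ tens Θ ◁ (ρ_ A).hom ≫ (β_ (tens Θ) A).hom) ≫
        MonoidalClosed.uncurry k, rfl⟩ :=
  Hom.mk_congr (ev_step (M := tens Θ) (split Θ [A]) k)

/-- Composition with the evaluation is invertible, by currying. -/
theorem comp_evMor_bijective (A B : C) (Θ Ξ : List C) :
    Function.Bijective (fun x : Hom Θ ((ihom A).obj B :: Ξ) =>
      ((poly C).comp x (evMor A B) : Hom (Θ ++ [A]) (Ξ ++ [B]))) := by
  constructor
  · rintro ⟨_, x, e⟩ ⟨_, y, e'⟩ h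
    cases e
    cases e'
    have h' := (comp_evMor x).symm.trans (h.trans (comp_evMor y))
    rw [ev_step_injective (M := tens Θ) (split Θ [A]) (isIso_split Θ [A]) (Hom.mk_inj h')]
  · rintro ⟨D, y, e⟩
    cases Ξ with
    | cons X Ξ => exact (List.cons_ne_nil _ _
        (List.append_eq_nil_iff.1 (List.cons.inj e).2).2).elim
    | nil =>
      cases e
      obtain ⟨k, hk⟩ := ev_step_surjective (M := tens Θ) (A := A) (split Θ [A]) (isIso_split Θ [A])
          y
      exact ⟨⟨_, k, rfl⟩, (comp_evMor k).trans (Hom.mk_congr hk)⟩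

end Counary

namespace SMCC

open Counary

variable {C : Type u} [Category.{v} C] [MonoidalCategory C] [SymmetricCategory C]

variable (C) in
theorem isPolycategory_starPoly : (starPoly C).IsPolycategory :=
  (isPolycategory_poly C).freeStar

instance : Fact (starPoly C).IsPolycategory := ⟨isPolycategory_starPoly C⟩

variable [MonoidalClosed C]

variable (C) in
/-- The distinguished morphisms of the free `∗`-polycategory are universal: the first two are
isomorphisms of `C`, and composition with the third is currying. -/
theorem self_respects : (ModuleStruct.self (starPoly C)).Respects (distinguished C) where
  tensor t ht Γ Δ := by
    cases ht with
    | tensor A B =>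
      exact (ModuleStruct.IsModule.perm_bijective (isPolycategory_poly C)
        (Signed.merge [pos A, pos B] [] Γ Δ) (Signed.merge [] [pos A, pos B] Δ Γ)).comp
        (comp_left_bijective (As := [A, B]) (A ◁ (ρ_ B).hom)
          (inferInstanceAs (IsIso (A ◁ (ρ_ B).hom))) _ _)
    | unit =>
      exact (ModuleStruct.IsModule.perm_bijective (isPolycategory_poly C)
        (Signed.merge [] [] Γ Δ) (Signed.merge [] [] Δ Γ)).comp
        (comp_left_bijective (As := []) (𝟙 (𝟙_ C))
          (inferInstanceAs (IsIso (𝟙 (𝟙_ C)))) _ _)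
  cotensor s hs Γ Δ := by
    cases hs with
    | hom A B =>
      exact (ModuleStruct.IsModule.perm_bijective (isPolycategory_poly C)
        (Signed.merge Γ Δ [] [neg A, pos B]) (Signed.merge Δ Γ [neg A, pos B] [])).comp
        (comp_evMor_bijective A B _ _)

instance : Fact ((ModuleStruct.self (starPoly C)).Respects (distinguished C)) :=
  ⟨self_respects C⟩

/-- The morphism `() → 𝟏`, as a distinguished unit. -/
instance : (distinguished C).HasUnit where
  unit := pos (𝟙_ C)
  unitMor := unitMor C
  isTensor := .unit

end SMCC

/-! ### The embedding as a functor -/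

namespace SMCC

open Counary Envelope

variable {C : Type u} [Category.{v} C] [MonoidalCategory C] [SymmetricCategory C]

/-- The morphisms `A → B` of the free `∗`-polycategory are those of `C`. -/
theorem ofHom_bijective (A B : C) : Function.Bijective (ofHom : (A ⟶ B) → _) := by
  constructor
  · intro f g h
    exact (cancel_epi (ρ_ A).hom).1 (Hom.mk_inj (C := C) h)
  · rintro ⟨D, f, e⟩
    cases e
    exact ⟨(ρ_ A).inv ≫ f, Hom.mk_congr (C := C) (Iso.hom_inv_id_assoc (ρ_ A) f)⟩

omit [SymmetricCategory C] in
theorem sub_ofHom {A B D : C} (f : A ⟶ B) (g : B ⟶ D) :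
    sub (Γ := [A]) (S := []) ((ρ_ A).hom ≫ f) ((ρ_ B).hom ≫ g) = (ρ_ A).hom ≫ f ≫ g := by
  have h : (A ◁ (λ_ (𝟙_ C)).inv ≫ (α_ A (𝟙_ C) (𝟙_ C)).inv) ≫ ((ρ_ A).hom ≫ f) ▷ 𝟙_ C ≫
      (ρ_ B).hom ≫ g = (ρ_ A).hom ≫ f ≫ g := by
    simp
  exact h

theorem ofHom_id (A : C) : ofHom (𝟙 A) = (starPoly C).id (pos A) :=
  Hom.mk_congr (C := C) (Category.comp_id (ρ_ A).hom)

theorem comp_ofHom {A B D : C} (f : A ⟶ B) (g : B ⟶ D) :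
    ((starPoly C).comp (Δ := []) (ofHom f) (ofHom g) : (starPoly C).Hom [pos A] [pos D]) =
      ofHom (f ≫ g) :=
  -- On lists of given entries, the structural permutations act on labellings by definition.
  ((isPolycategory_poly C).perm_eq_self (fun _ => rfl) (fun _ => rfl)).trans
    (Hom.mk_congr (C := C) ((congrArg (sub (Γ := [A]) (S := []) · _) (Category.comp_id _)).trans
      (sub_ofHom f g)))

variable [MonoidalClosed C]

variable (C) in
/-- The embedding of `C` into its envelope. -/
def embedding : C ⥤ Env C where
  obj A := yonedaObj (pos A)
  map h := yonedaMap (ofHom h)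
  map_id A := yoneda_ext ((yonedaMap_idPos _).trans (ofHom_id A))
  map_comp {A B D} f g := yoneda_ext <| by
    refine (yonedaMap_idPos _).trans (Eq.symm ?_)
    refine (congrArg (mapPos (yonedaMap (ofHom g))) (yonedaMap_idPos (ofHom f))).trans ?_
    refine (yonedaMap_pos (ofHom g) (ofHom f)).trans ?_
    refine ((isPolycategory_starPoly C).perm_eq_self (Γ := [pos A]) (Δ := [pos D]) (fun _ => rfl)
      (fun _ => rfl)).trans ?_
    exact comp_ofHom f g

instance : (embedding C).Full where
  map_surjective {A B} f := by
    obtain ⟨g, hg⟩ := (ofHom_bijective A B).2 (mapPos f (idPos (pos A)))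
    exact ⟨g, yoneda_ext ((yonedaMap_idPos (ofHom g)).trans hg)⟩

instance : (embedding C).Faithful where
  map_injective {A B} f g h := (ofHom_bijective A B).1 <|
    (yonedaMap_idPos (J := distinguished C) (ofHom f)).symm.trans
      ((congrArg (fun k : (embedding C).obj A ⟶ (embedding C).obj B => mapPos k (idPos (pos A)))
        h).trans (yonedaMap_idPos (ofHom g)))

theorem isYoneda_embedding : IsYoneda (embedding C) := by
  refine ⟨fun A => .id _, fun A => .id _, fun A _ _ => Function.bijective_id,
    fun A _ _ => Function.bijective_id, fun _ _ _ _ _ _ _ => rfl, ?_, fun _ _ _ _ => rfl⟩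
  intro A B h Γ Δ f k hk
  refine (yonedaMap_pos (ofHom h) f).trans ?_
  refine (congrArg ((starPoly C).perm _ _) hk.symm).trans ?_
  exact (isPolycategory_starPoly C).perm_perm_self

end SMCC

/-! ### Elements of the representable modules from morphisms of `C` -/

namespace Envelope

open ModuleStruct ModuleStruct.IsModule PJModule

variable {P : PolycategoryStruct.{u, max u w}} {J : P.Distinguished} [hP : Fact P.IsPolycategory]
  [hJ : Fact ((ModuleStruct.self P).Respects J)] {X Y Z : P.Ob} {Γ Δ : List P.Ob}

/-- Values of `tensorYonedaMap`, computed by composition in `P`. -/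
theorem tensorYonedaMap_left (t : P.Hom [X, Y] [Z]) (f : P.Hom Γ (X :: Δ)) :
    mapPos (tensorYonedaMap (J := J) t) ((univ (yonedaObj X) (yonedaObj Y)).pos
      (f : (yo X).obj Γ Δ) (idPos Y)) = (yo Z).left f (t : (yo Z).obj [X, Y] []) :=
  (yo_hom₂_apply (posHom₂ (tensorYonedaMap (J := J) t)) f (idPos Y)).trans
    (congrArg ((yo Z).left f) (tensorYonedaMap_idTmul t))

theorem tensorYonedaMap_right (t : P.Hom [X, Y] [Z]) (f : P.Hom Γ (Y :: Δ)) :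
    mapPos (tensorYonedaMap (J := J) t) ((univ (yonedaObj X) (yonedaObj Y)).pos (idPos X)
      (f : (yo Y).obj Γ Δ)) = (yo Z).perm (.comm Γ [X]) (.comm Δ []) ((yo Z).left f
        ((yo Z).perm (.comm [X] [Y]) (.comm [] []) (t : (yo Z).obj [X, Y] []))) :=
  (yo_hom₂_apply' (posHom₂ (tensorYonedaMap (J := J) t)) (idPos X) f).trans
    (congrArg (fun x => (yo Z).perm (.comm Γ [X]) (.comm Δ []) ((yo Z).left f
      ((yo Z).perm (.comm [X] [Y]) (.comm [] []) x))) (tensorYonedaMap_idTmul t))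

end Envelope

namespace SMCC

open Counary Envelope

variable {C : Type u} [Category.{v} C] [MonoidalCategory C] [SymmetricCategory C]

/-- Composition along the second object of a context. -/
theorem sub_right {Γ : List C} {A B D : C} (f : tens Γ ⟶ A) (g : B ⊗ (A ⊗ 𝟙_ C) ⟶ D) :
    act (front Γ B []) ≫ sub (S := [B]) f (act (.swap B A []) ≫ g) =
      B ◁ (split Γ [] ≫ f ▷ 𝟙_ C) ≫ g :=
  (act_front_sub f _).trans (congrArg (B ◁ (split Γ [] ≫ f ▷ 𝟙_ C) ≫ ·)
    ((Category.assoc _ _ _).symm.trans ((congrArg (· ≫ g) (sw_sw B A (𝟙_ C))).trans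
      (Category.id_comp g))))

theorem sub_unary {Γ : List C} {A B : C} (f : tens Γ ⟶ A) (g : A ⟶ B) :
    sub (S := []) f ((ρ_ A).hom ≫ g) = act (.appendNil Γ) ≫ f ≫ g := by
  have h : ∀ {X W : C} (s : W ⟶ X ⊗ 𝟙_ C) (f : X ⟶ A), s ≫ f ▷ 𝟙_ C ≫ (ρ_ A).hom ≫ g =
      (s ≫ (ρ_ X).hom) ≫ f ≫ g := fun s f => by simp
  exact (h (split Γ []) f).trans (congrArg (· ≫ f ≫ g) (act_appendNil Γ).symm)

/-- The positive part of the object of the envelope that represents `Z`. -/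
abbrev yoPos (Z : C) : ModuleStruct (starPoly C) := ModuleStruct.yo (P := starPoly C) (pos Z)

section Elements

variable {X Y T Z W : C}

/-- The element of the representable module at `Z` that a morphism `𝟏 ⟶ Z` determines. -/
def nullary (t : 𝟙_ C ⟶ Z) : (yoPos Z).obj [] [] :=
  (⟨Z, t, rfl⟩ : Counary.Hom [] [Z])

/-- The element with one input. A list of objects is interpreted as a tensor product that ends with
the unit. -/
def unary (t : X ⊗ 𝟙_ C ⟶ Z) : (yoPos Z).obj [pos X] [] :=
  (⟨Z, t, rfl⟩ : Counary.Hom [X] [Z])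

/-- The element with two inputs. -/
def binary (t : X ⊗ (Y ⊗ 𝟙_ C) ⟶ Z) : (yoPos Z).obj [pos X, pos Y] [] :=
  (⟨Z, t, rfl⟩ : Counary.Hom [X, Y] [Z])

/-- The element with three inputs. -/
def ternary (t : X ⊗ (Y ⊗ (T ⊗ 𝟙_ C)) ⟶ Z) : (yoPos Z).obj [pos X, pos Y, pos T] [] :=
  (⟨Z, t, rfl⟩ : Counary.Hom [X, Y, T] [Z])

theorem nullary_left_binary (f : 𝟙_ C ⟶ W) (t : W ⊗ (Y ⊗ 𝟙_ C) ⟶ Z) :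
    (yoPos Z).left (nullary f) (binary t) = unary ((λ_ _).inv ≫ f ▷ _ ≫ t) := by
  refine ((isPolycategory_starPoly C).perm_eq_self (Γ := [pos Y]) (Δ := [pos Z]) (fun _ => rfl)
    (fun _ => rfl)).trans ?_
  refine ((isPolycategory_poly C).perm_eq_self (fun _ => rfl) (fun _ => rfl)).trans ?_
  exact Hom.mk_congr (C := C) (congrArg (sub (Γ := []) (S := [Y]) · t) (Category.comp_id f))

theorem binary_left_binary (f : X ⊗ (Y ⊗ 𝟙_ C) ⟶ W) (t : W ⊗ (T ⊗ 𝟙_ C) ⟶ Z) :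
    (yoPos Z).left (binary f) (binary t) = ternary (sub (Γ := [X, Y]) (S := [T]) f t) := by
  refine ((isPolycategory_starPoly C).perm_eq_self (Γ := [pos X, pos Y, pos T]) (Δ := [pos Z])
    (fun _ => rfl) (fun _ => rfl)).trans ?_
  refine ((isPolycategory_poly C).perm_eq_self (fun _ => rfl) (fun _ => rfl)).trans ?_
  exact Hom.mk_congr (C := C) (congrArg (sub (Γ := [X, Y]) (S := [T]) · t) (Category.comp_id f))

theorem unary_left_binary (f : X ⊗ 𝟙_ C ⟶ W) (t : W ⊗ (Y ⊗ 𝟙_ C) ⟶ Z) :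
    (yoPos Z).left (unary f) (binary t) = binary (sub (Γ := [X]) (S := [Y]) f t) := by
  refine ((isPolycategory_starPoly C).perm_eq_self (Γ := [pos X, pos Y]) (Δ := [pos Z])
    (fun _ => rfl) (fun _ => rfl)).trans ?_
  refine ((isPolycategory_poly C).perm_eq_self (fun _ => rfl) (fun _ => rfl)).trans ?_
  exact Hom.mk_congr (C := C) (congrArg (sub (Γ := [X]) (S := [Y]) · t) (Category.comp_id f))

theorem perm_unary (t : X ⊗ 𝟙_ C ⟶ Z) :
    (yoPos Z).perm (.comm [] [pos X]) (.comm [] []) (unary t) = unary t :=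
  (isPolycategory_starPoly C).perm_eq_self (Γ := [pos X]) (Δ := [pos Z]) (fun _ => rfl)
    (fun _ => rfl)

theorem perm_binary (t : X ⊗ (Y ⊗ 𝟙_ C) ⟶ Z) :
    (yoPos Z).perm (.comm [pos X] [pos Y]) (.comm [] []) (binary t) =
      binary (act (.swap X Y []) ≫ t) :=
  Hom.mk_congr (C := C) (congrArg (· ≫ t) (act_congr (τ := .swap X Y []) fun _ => rfl))

theorem perm_ternary (t : X ⊗ (Y ⊗ (T ⊗ 𝟙_ C)) ⟶ Z) :
    (yoPos Z).perm (.comm [pos X, pos Y] [pos T]) (.comm [] []) (ternary t) =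
      ternary (act (front [X, Y] T []) ≫ t) :=
  Hom.mk_congr (C := C) (congrArg (· ≫ t) (act_congr (τ := front [X, Y] T []) fun _ => rfl))

theorem unary_right_binary (f : Y ⊗ 𝟙_ C ⟶ W) (t : X ⊗ (W ⊗ 𝟙_ C) ⟶ Z) :
    (yoPos Z).perm (.comm [pos Y] [pos X]) (.comm [] []) ((yoPos Z).left (unary f)
      ((yoPos Z).perm (.comm [pos X] [pos W]) (.comm [] []) (binary t))) =
        binary (X ◁ (split [Y] [] ≫ f ▷ 𝟙_ C) ≫ t) := by
  rw [perm_binary, unary_left_binary]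
  refine (perm_binary _).trans (congrArg binary (Eq.trans ?_ (sub_right (Γ := [Y]) f t)))
  exact congrArg (· ≫ _) (act_congr (σ := .swap Y X []) (τ := front [Y] X []) fun _ => rfl)

theorem binary_right_binary (f : Y ⊗ (T ⊗ 𝟙_ C) ⟶ W) (t : X ⊗ (W ⊗ 𝟙_ C) ⟶ Z) :
    (yoPos Z).perm (.comm [pos Y, pos T] [pos X]) (.comm [] []) ((yoPos Z).left (binary f)
      ((yoPos Z).perm (.comm [pos X] [pos W]) (.comm [] []) (binary t))) =
        ternary (X ◁ (split [Y, T] [] ≫ f ▷ 𝟙_ C) ≫ t) := by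
  rw [perm_binary, binary_left_binary]
  exact (perm_ternary _).trans (congrArg ternary (sub_right (Γ := [Y, T]) f t))

theorem nullary_right_binary (f : 𝟙_ C ⟶ W) (t : X ⊗ (W ⊗ 𝟙_ C) ⟶ Z) :
    (yoPos Z).perm (.comm [] [pos X]) (.comm [] []) ((yoPos Z).left (nullary f)
      ((yoPos Z).perm (.comm [pos X] [pos W]) (.comm [] []) (binary t))) =
        unary (X ◁ (split [] [] ≫ f ▷ 𝟙_ C) ≫ t) := by
  rw [perm_binary, nullary_left_binary, perm_unary]
  exact congrArg unary ((Category.id_comp _).symm.trans (sub_right (Γ := []) f t))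

variable [MonoidalClosed C]

theorem mapPos_unary (t : X ⊗ 𝟙_ C ⟶ Z) (g : Z ⟶ W) :
    mapPos ((embedding C).map g) (unary t) = unary (t ≫ g) := by
  refine (yonedaMap_pos (ofHom g) (unary t)).trans ?_
  refine ((isPolycategory_starPoly C).perm_eq_self (Γ := [pos X]) (Δ := [pos W])
    (fun _ => rfl) (fun _ => rfl)).trans ?_
  refine ((isPolycategory_poly C).perm_eq_self (fun _ => rfl) (fun _ => rfl)).trans ?_
  exact Hom.mk_congr (C := C) (((congrArg (sub (Γ := [X]) (S := []) · ((ρ_ Z).hom ≫ g))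
    (Category.comp_id t)).trans (sub_unary (Γ := [X]) t g)).trans ((congrArg (· ≫ t ≫ g)
      (act_congr (σ := (ListPerm.appendNil [X] : ListPerm [X] [X])) (τ := .refl [X]) fun _ =>
        rfl)).trans (Category.id_comp _)))

theorem mapPos_binary (t : X ⊗ (Y ⊗ 𝟙_ C) ⟶ Z) (g : Z ⟶ W) :
    mapPos ((embedding C).map g) (binary t) = binary (t ≫ g) := by
  refine (yonedaMap_pos (ofHom g) (binary t)).trans ?_
  refine ((isPolycategory_starPoly C).perm_eq_self (Γ := [pos X, pos Y]) (Δ := [pos W])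
    (fun _ => rfl) (fun _ => rfl)).trans ?_
  refine ((isPolycategory_poly C).perm_eq_self (fun _ => rfl) (fun _ => rfl)).trans ?_
  exact Hom.mk_congr (C := C) (((congrArg (sub (Γ := [X, Y]) (S := []) · ((ρ_ Z).hom ≫ g))
    (Category.comp_id t)).trans (sub_unary (Γ := [X, Y]) t g)).trans ((congrArg (· ≫ t ≫ g)
      (act_congr (σ := (ListPerm.appendNil [X, Y] : ListPerm [X, Y] [X, Y])) (τ := .refl [X, Y]) fun
        _ => rfl)).trans (Category.id_comp _)))

theorem mapPos_ternary (t : X ⊗ (Y ⊗ (T ⊗ 𝟙_ C)) ⟶ Z) (g : Z ⟶ W) :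
    mapPos ((embedding C).map g) (ternary t) = ternary (t ≫ g) := by
  refine (yonedaMap_pos (ofHom g) (ternary t)).trans ?_
  refine ((isPolycategory_starPoly C).perm_eq_self (Γ := [pos X, pos Y, pos T]) (Δ := [pos W])
    (fun _ => rfl) (fun _ => rfl)).trans ?_
  refine ((isPolycategory_poly C).perm_eq_self (fun _ => rfl) (fun _ => rfl)).trans ?_
  exact Hom.mk_congr (C := C) (((congrArg (sub (Γ := [X, Y, T]) (S := []) · ((ρ_ Z).hom ≫ g))
    (Category.comp_id t)).trans (sub_unary (Γ := [X, Y, T]) t g)).trans ((congrArg (· ≫ t ≫ g)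
      (act_congr (σ := (ListPerm.appendNil [X, Y, T] : ListPerm [X, Y, T] [X, Y, T]))
        (τ := .refl [X, Y, T]) fun _ => rfl)).trans (Category.id_comp _)))

end Elements

end SMCC

/-! ### The monoidal structure of the embedding -/

namespace SMCC

open Counary Envelope

variable {C : Type u} [Category.{v} C] [MonoidalCategory C] [SymmetricCategory C]

section Coherence

variable {X X' Y Y' Z : C}

omit [SymmetricCategory C] in
theorem sub_natural_left (f : X ⟶ X') : sub (Γ := [X]) (S := [Y]) ((ρ_ X).hom ≫ f)
    (X' ◁ (ρ_ Y).hom) = X ◁ (ρ_ Y).hom ≫ f ▷ Y := by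
  have h : (X ◁ (λ_ (Y ⊗ 𝟙_ C)).inv ≫ (α_ X (𝟙_ C) (Y ⊗ 𝟙_ C)).inv) ≫
      ((ρ_ X).hom ≫ f) ▷ (Y ⊗ 𝟙_ C) ≫ X' ◁ (ρ_ Y).hom = X ◁ (ρ_ Y).hom ≫ f ▷ Y := by
    rw [← whisker_exchange]
    simp
  exact h

omit [SymmetricCategory C] in
theorem sub_natural_right (f : Y ⟶ Y') :
    X ◁ (split [Y] [] ≫ ((ρ_ Y).hom ≫ f) ▷ 𝟙_ C) ≫ X ◁ (ρ_ Y').hom =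
      X ◁ (ρ_ Y).hom ≫ X ◁ f := by
  have h : X ◁ ((Y ◁ (λ_ (𝟙_ C)).inv ≫ (α_ Y (𝟙_ C) (𝟙_ C)).inv) ≫
      ((ρ_ Y).hom ≫ f) ▷ 𝟙_ C) ≫ X ◁ (ρ_ Y').hom = X ◁ (ρ_ Y).hom ≫ X ◁ f := by
    rw [← MonoidalCategory.whiskerLeft_comp, ← MonoidalCategory.whiskerLeft_comp]
    simp
  exact h

omit [SymmetricCategory C] in
theorem sub_assoc : sub (Γ := [X, Y]) (S := [Z]) (X ◁ (ρ_ Y).hom) ((X ⊗ Y) ◁ (ρ_ Z).hom) ≫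
    (α_ X Y Z).hom =
      X ◁ (split [Y, Z] [] ≫ (Y ◁ (ρ_ Z).hom) ▷ 𝟙_ C) ≫ X ◁ (ρ_ (Y ⊗ Z)).hom := by
  have h : ((X ◁ (Y ◁ (λ_ (Z ⊗ 𝟙_ C)).inv ≫ (α_ Y (𝟙_ C) (Z ⊗ 𝟙_ C)).inv) ≫
      (α_ X (Y ⊗ 𝟙_ C) (Z ⊗ 𝟙_ C)).inv) ≫ (X ◁ (ρ_ Y).hom) ▷ (Z ⊗ 𝟙_ C) ≫
        (X ⊗ Y) ◁ (ρ_ Z).hom) ≫ (α_ X Y Z).hom =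
      X ◁ ((Y ◁ (Z ◁ (λ_ (𝟙_ C)).inv ≫ (α_ Z (𝟙_ C) (𝟙_ C)).inv) ≫
        (α_ Y (Z ⊗ 𝟙_ C) (𝟙_ C)).inv) ≫ (Y ◁ (ρ_ Z).hom) ▷ 𝟙_ C) ≫ X ◁ (ρ_ (Y ⊗ Z)).hom := by
    monoidal
  exact h

omit [SymmetricCategory C] in
theorem sub_left_unit : ((λ_ (X ⊗ 𝟙_ C)).inv ≫ 𝟙 (𝟙_ C) ▷ (X ⊗ 𝟙_ C) ≫ 𝟙_ C ◁ (ρ_ X).hom) ≫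
    (λ_ X).hom = (ρ_ X).hom := by
  monoidal

omit [SymmetricCategory C] in
theorem sub_right_unit : (X ◁ (split [] [] ≫ 𝟙 (𝟙_ C) ▷ 𝟙_ C) ≫ X ◁ (ρ_ (𝟙_ C)).hom) ≫
    (ρ_ X).hom = (ρ_ X).hom := by
  have h : (X ◁ ((λ_ (𝟙_ C)).inv ≫ 𝟙 (𝟙_ C) ▷ 𝟙_ C) ≫ X ◁ (ρ_ (𝟙_ C)).hom) ≫
      (ρ_ X).hom = (ρ_ X).hom := by
    monoidal
  exact h

theorem braiding_unit : X ◁ (ρ_ Y).hom ≫ (β_ X Y).hom =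
    act (.swap Y X []) ≫ Y ◁ (ρ_ X).hom := by
  have h : X ◁ (ρ_ Y).hom ≫ (β_ X Y).hom =
      ((α_ X Y (𝟙_ C)).inv ≫ (β_ X Y).hom ▷ 𝟙_ C ≫ (α_ Y X (𝟙_ C)).hom) ≫ Y ◁ (ρ_ X).hom := by
    simp
  exact h

end Coherence

variable [MonoidalClosed C]

theorem isTensor_tensorMor (X Y : C) : (distinguished C).IsTensor (tensorMor X Y) :=
  .tensor X Y

/-- The structure isomorphism `F X ⊗ F Y ≅ F (X ⊗ Y)` of the embedding. -/
noncomputable def muIso (X Y : C) :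
    (embedding C).obj X ⊗ (embedding C).obj Y ≅ (embedding C).obj (X ⊗ Y) :=
  tensorYonedaIso (tensorMor X Y) (isTensor_tensorMor X Y)

section Values

variable {X Y Z T W : C}

theorem muIso_binary : mapPos (muIso X Y).hom (idTmul (pos X) (pos Y)) =
    binary (X ◁ (ρ_ Y).hom) :=
  tensorYonedaMap_idTmul (J := distinguished C) (tensorMor X Y)

end Values

theorem muIso_natural_left {X X' : C} (f : X ⟶ X') (Y : C) :
    (embedding C).map f ▷ (embedding C).obj Y ≫ (muIso X' Y).hom =
      (muIso X Y).hom ≫ (embedding C).map (f ▷ Y) := by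
  refine tensor_yoneda_ext ?_
  refine Eq.trans ?_ ((congrArg (mapPos ((embedding C).map (f ▷ Y))) muIso_binary).trans
    (mapPos_binary _ _)).symm
  refine (congrArg (fun x => mapPos (muIso X' Y).hom ((univ _ _).pos x (idPos (pos Y))))
    (yonedaMap_idPos (ofHom f))).trans ?_
  refine (tensorYonedaMap_left (tensorMor X' Y) (ofHom f)).trans ?_
  refine (unary_left_binary ((ρ_ X).hom ≫ f) (X' ◁ (ρ_ Y).hom)).trans ?_
  exact congrArg binary (sub_natural_left f)

theorem muIso_natural_right (X : C) {Y Y' : C} (f : Y ⟶ Y') :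
    (embedding C).obj X ◁ (embedding C).map f ≫ (muIso X Y').hom =
      (muIso X Y).hom ≫ (embedding C).map (X ◁ f) := by
  refine tensor_yoneda_ext ?_
  refine Eq.trans ?_ ((congrArg (mapPos ((embedding C).map (X ◁ f))) muIso_binary).trans
    (mapPos_binary _ _)).symm
  refine (congrArg (fun x => mapPos (muIso X Y').hom ((univ _ _).pos (idPos (pos X)) x))
    (yonedaMap_idPos (ofHom f))).trans ?_
  refine (tensorYonedaMap_right (tensorMor X Y') (ofHom f)).trans ?_
  refine (unary_right_binary ((ρ_ Y).hom ≫ f) (X ◁ (ρ_ Y').hom)).trans ?_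
  exact congrArg binary (sub_natural_right f)

/-- Both sides send `(id ⊗ id) ⊗ id` to the element with three inputs that the associator of `C`
determines. -/
theorem muIso_assoc (X Y Z : C) :
    (muIso X Y).hom ▷ (embedding C).obj Z ≫ (muIso (X ⊗ Y) Z).hom ≫
      (embedding C).map (α_ X Y Z).hom =
    (α_ ((embedding C).obj X) ((embedding C).obj Y) ((embedding C).obj Z)).hom ≫
      (embedding C).obj X ◁ (muIso Y Z).hom ≫ (muIso X (Y ⊗ Z)).hom := by
  refine tensor_yoneda_ext₃ ?_
  have e₁ : mapPos (muIso (X ⊗ Y) Z).hom ((univ _ _).pos (mapPos (muIso X Y).hom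
      (idTmul (pos X) (pos Y))) (idPos (pos Z))) =
      ternary (sub (Γ := [X, Y]) (S := [Z]) (X ◁ (ρ_ Y).hom) ((X ⊗ Y) ◁ (ρ_ Z).hom)) :=
    (congrArg (fun x => mapPos (muIso (X ⊗ Y) Z).hom ((univ _ _).pos x (idPos (pos Z))))
      muIso_binary).trans ((tensorYonedaMap_left (tensorMor (X ⊗ Y) Z) (binary
        (X ◁ (ρ_ Y).hom))).trans (binary_left_binary (X ◁ (ρ_ Y).hom) ((X ⊗ Y) ◁ (ρ_ Z).hom)))
  have e₂ : mapPos (muIso X (Y ⊗ Z)).hom ((univ _ _).pos (idPos (pos X)) (mapPos (muIso Y Z).hom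
      (idTmul (pos Y) (pos Z)))) = ternary
        (X ◁ (split [Y, Z] [] ≫ (Y ◁ (ρ_ Z).hom) ▷ 𝟙_ C) ≫ X ◁ (ρ_ (Y ⊗ Z)).hom) :=
    (congrArg (fun x => mapPos (muIso X (Y ⊗ Z)).hom ((univ _ _).pos (idPos (pos X)) x))
      muIso_binary).trans ((tensorYonedaMap_right (tensorMor X (Y ⊗ Z)) (binary
        (Y ◁ (ρ_ Z).hom))).trans (binary_right_binary (Y ◁ (ρ_ Z).hom) (X ◁ (ρ_ (Y ⊗ Z)).hom)))
  refine ((congrArg (mapPos ((embedding C).map (α_ X Y Z).hom)) e₁).trans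
    (mapPos_ternary _ _)).trans ((congrArg ternary sub_assoc).trans (e₂.symm.trans ?_))
  have e₃ : (univ (yonedaObj (pos X)) (tensor (yonedaObj (pos Y)) (yonedaObj (pos Z)))).pos
      (idPos (pos X)) (idTmul (pos Y) (pos Z)) =
      mapPos (α_ ((embedding C).obj X) ((embedding C).obj Y) ((embedding C).obj Z)).hom
        ((univ (tensor (yonedaObj (pos X)) (yonedaObj (pos Y))) (yonedaObj (pos Z))).pos
          (idTmul (pos X) (pos Y)) (idPos (pos Z))) :=
    ((isChuTensor (J := distinguished C)).associator_pos (idPos (pos X)) (idPos (pos Y))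
      (idPos (pos Z))).symm.trans
        ((tensor _ _).pos.isModule.perm_eq_self (fun _ => rfl) (fun _ => rfl))
  exact congrArg (mapPos ((embedding C).obj X ◁ (muIso Y Z).hom ≫ (muIso X (Y ⊗ Z)).hom)) e₃

theorem muIso_left_unit (X : C) : (λ_ ((embedding C).obj X)).hom =
    𝟙 ((embedding C).obj (𝟙_ C)) ▷ (embedding C).obj X ≫ (muIso (𝟙_ C) X).hom ≫
      (embedding C).map (λ_ X).hom := by
  refine unit_tensor_ext (J := distinguished C) (X := pos X) ?_
  refine ((isChuTensor (J := distinguished C)).leftUnitor_pos (idPos (pos X))).trans (Eq.symm ?_)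
  refine (congrArg (mapPos ((embedding C).map (λ_ X).hom)) ((tensorYonedaMap_left
    (tensorMor (𝟙_ C) X) (unitMor C)).trans
      (nullary_left_binary (𝟙 (𝟙_ C)) (𝟙_ C ◁ (ρ_ X).hom)))).trans ?_
  exact (mapPos_unary _ _).trans (congrArg unary sub_left_unit)

theorem muIso_right_unit (X : C) : (ρ_ ((embedding C).obj X)).hom =
    (embedding C).obj X ◁ 𝟙 ((embedding C).obj (𝟙_ C)) ≫ (muIso X (𝟙_ C)).hom ≫
      (embedding C).map (ρ_ X).hom := by
  refine tensor_unit_ext (J := distinguished C) (X := pos X) ?_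
  refine ((isChuTensor (J := distinguished C)).rightUnitor_pos (idPos (pos X))).trans (Eq.symm ?_)
  refine (congrArg (mapPos ((embedding C).map (ρ_ X).hom)) ((tensorYonedaMap_right
    (tensorMor X (𝟙_ C)) (unitMor C)).trans
      (nullary_right_binary (𝟙 (𝟙_ C)) (X ◁ (ρ_ (𝟙_ C)).hom)))).trans ?_
  refine ((mapPos_unary _ _).trans (congrArg unary sub_right_unit)).trans ?_
  exact ((yonedaObj (pos X)).pos.isModule.perm_eq_self (fun _ => rfl) (fun _ => rfl)).symm

theorem muIso_braided (X Y : C) : (muIso X Y).hom ≫ (embedding C).map (β_ X Y).hom =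
    (β_ ((embedding C).obj X) ((embedding C).obj Y)).hom ≫ (muIso Y X).hom := by
  refine tensor_yoneda_ext ?_
  refine ((congrArg (mapPos ((embedding C).map (β_ X Y).hom)) muIso_binary).trans
    (mapPos_binary _ _)).trans ((congrArg binary braiding_unit).trans ?_)
  refine ((perm_binary (Y ◁ (ρ_ X).hom)).symm.trans ?_)
  refine (congrArg ((yoPos (Y ⊗ X)).perm (.comm [pos Y] [pos X]) (.comm [] []))
    (muIso_binary (X := Y) (Y := X)).symm).trans ?_
  exact (mapPos_perm (muIso Y X).hom (.comm [pos Y] [pos X]) (.comm [] []) _).symm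

/-- The strong monoidal structure of the embedding. The unit of the envelope is the object
representing the unit of `C`. -/
noncomputable def coreMonoidal : (embedding C).CoreMonoidal where
  εIso := Iso.refl _
  μIso := muIso
  μIso_hom_natural_left := fun f X => muIso_natural_left f X
  μIso_hom_natural_right := fun X f => muIso_natural_right X f
  associativity := muIso_assoc
  left_unitality := muIso_left_unit
  right_unitality := muIso_right_unit

/-- The embedding is a strong symmetric monoidal functor. -/
noncomputable instance braidedEmbedding : (embedding C).Braided where
  toMonoidal := coreMonoidal.toMonoidal
  braided X Y := muIso_braided X Y

end SMCC

/-! ### The embedding preserves internal homs -/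

namespace ModuleStruct.IsModule

variable {P : PolycategoryStruct.{u, w}} {U : ModuleStruct P} (hU : U.IsModule)
include hU

/-- The action of the unit of a duality between `X` and `X'` is injective, by one of the
triangle identities. -/
theorem left_injective_of_triangle {X X' : P.Ob} {η : P.Hom [] [X, X']} {ε : P.Hom [X', X] []}
    (h : (P.comp (P.perm (.refl []) (.swap X X' []) η) ε : P.Hom [X] [X]) = P.id X)
    {S T : List P.Ob} {x y : U.obj (X :: S) T} (hxy : U.left η x = U.left η y) : x = y := by
  have key : ∀ x : U.obj (X :: S) T, U.perm (rightComm [] S [X]) (rightComm [] T [])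
      (U.right (U.left η x : U.obj ([] ++ S) (X' :: ([] ++ T))) ε) = x := fun x =>
    (hU.right_left_comm η x ε).trans ((congrArg (fun k : P.Hom [X] [X] => U.left k x) h).trans
      (hU.id_left x))
  exact (key x).symm.trans ((congrArg (fun k : U.obj S (X' :: T) =>
    U.perm (rightComm [] S [X]) (rightComm [] T []) (U.right k ε)) hxy).trans (key y))

end ModuleStruct.IsModule

namespace Envelope

open ModuleStruct ModuleStruct.IsModule PJModule

variable {P : PolycategoryStruct.{u, max u w}} {J : P.Distinguished} [hP : Fact P.IsPolycategory]
  [hJ : Fact ((ModuleStruct.self P).Respects J)] {X X' Y Z : P.Ob} {G : Envelope P J}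

/-- The universal element `id ⊗ id` of `(X ⊗ Y*)⁺(X;Y)`. -/
noncomputable def idTmulStar (X Y : P.Ob) :
    (tensor (yonedaObj (J := J) X) (yonedaObj Y).star).pos.obj [X] [Y] :=
  (univ (yonedaObj X) (yonedaObj Y).star).pos (idPos X) (idNeg Y)

theorem star_yoneda_ext {f g : (yonedaObj (J := J) X).star ⟶ G}
    (h : mapPos f (idNeg X) = mapPos g (idNeg X)) : f = g :=
  (separated_star_yonedaObj X).hom_ext (noy_ext h)

/-- A distinguished cotensor product `Z` of a dual of `X` with `Y` in `P` represents the internal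
hom of the objects representing `X` and `Y`. The inverse is found on the duals: on the
representable module at `Z` it is determined by the element `w` of `(X ⊗ Y*)⁺(;Z)` that the
cotensor product assigns to `id ⊗ id`. -/
theorem isIso_of_isCotensor (η : P.Hom [] [X, X']) (ε : P.Hom [X', X] [])
    (h : (P.comp (P.perm (.refl []) (.swap X X' []) η) ε : P.Hom [X] [X]) = P.id X)
    (e : P.Hom [Z, X] [Y]) (s : P.Hom [Z] [X', Y]) (hs : J.IsCotensor s)
    (hes : (noy Z).left η (e : (noy Z).obj [X] [Y]) = (s : (noy Z).obj [] [X', Y]))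
    (f : yonedaObj (J := J) Z ⟶ internalHom (yonedaObj X) (yonedaObj Y))
    (hf : mapNeg f (idTmulStar X Y) = (e : (noy Z).obj [X] [Y])) : IsIso f := by
  let T := tensor (yonedaObj (J := J) X) (yonedaObj Y).star
  let f' : T ⟶ (yonedaObj Z).star := transpose f
  obtain ⟨w, hw⟩ : ∃ w : T.pos.obj [] [Z], T.pos.right w s = T.pos.left η (idTmulStar X Y) :=
    (T.pos.respects.cotensor s hs [] []).2 _
  have he : T.pos.right w e = idTmulStar X Y := by
    refine T.pos.isModule.left_injective_of_triangle h (Eq.trans ?_ hw)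
    refine Eq.trans ?_ ((T.pos.isModule.left_right_comm w η e).trans
      (congrArg (fun k : P.Hom [Z] [X', Y] => T.pos.right w k) hes))
    refine Eq.trans ?_ (T.pos.isModule.perm_eq_self (Γ := []) (Δ := [X', Y]) (fun _ => rfl)
      (fun _ => rfl)).symm
    exact congrArg (T.pos.left η) (T.pos.isModule.perm_refl (Γ := [X]) (Δ := [Y]) _).symm
  have h₁ : f' ≫ starYonedaDesc w = 𝟙 T := tensor_star_yoneda_ext
    ((congrArg (mapPos (starYonedaDesc w)) hf).trans he)
  have h₂ : starYonedaDesc w ≫ f' = 𝟙 (yonedaObj Z).star := by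
    refine star_yoneda_ext ((congrArg (mapPos f') (starYonedaDesc_id w)).trans ?_)
    refine ((yonedaObj Z).star.pos.respects.cotensor s hs [] []).1 ?_
    refine ((Hom.pos f').map_right w s).symm.trans ?_
    refine (congrArg (mapPos f') hw).trans (((Hom.pos f').map_left η (idTmulStar X Y)).trans ?_)
    refine (congrArg ((noy Z).left η) hf).trans (hes.trans ?_)
    exact (hP.out.id_left s).symm
  have h₃ : f = (starStarIso (yonedaObj Z)).hom ≫ starMap f' := rfl
  have h₄ : IsIso (starMap f') := ⟨starMap (starYonedaDesc w), congrArg (fun k => starMap k) h₂,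
    congrArg (fun k => starMap k) h₁⟩
  exact h₃ ▸ IsIso.comp_isIso' (Iso.isIso_hom _) h₄

/-- The value of the negative part of a transposed morphism at `id ⊗ id`. -/
theorem curryHom_neg (k : tensor (yonedaObj X) (yonedaObj Z) ⟶ yonedaObj (J := J) Y) :
    mapNeg (curryHom k) (idTmulStar X Y) = ((P.perm (.swap X Z []) (.refl [Y])
      (mapPos k (idTmul X Z) : P.Hom [X, Z] [Y]) : P.Hom [Z, X] [Y]) : (noy Z).obj [X] [Y]) := by
  have h₁ := (univ (yonedaObj X) (yonedaObj Z)).compat_fst (idPos X) (idPos Z)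
    (mapNeg k (idNeg Y))
  have h₂ := (univ (yonedaObj X) (yonedaObj Z)).compat_snd (idPos X) (idPos Z)
    (mapNeg k (idNeg Y))
  refine (hP.out.id_left (T := [Y]) (S := [X]) _).symm.trans (h₂.symm.trans ?_)
  refine (congrArg _ h₁.symm).trans ((congrArg (fun x => P.perm _ _ (P.perm _ _ x))
    (pair_map k (idTmul X Z) (idNeg Y)).symm).trans ?_)
  refine (congrArg (fun x => P.perm _ _ (P.perm _ _ x)) (hP.out.right_id (Γ := [X, Z]) (Δ := [])
    (mapPos k (idTmul X Z)))).trans ?_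
  exact hP.out.perm_eq₃₁ (U := self P) (fun _ => rfl) (fun _ => rfl)

end Envelope

namespace SMCC

open Counary Envelope

variable {C : Type u} [Category.{v} C] [MonoidalCategory C] [SymmetricCategory C]

/-- The unit `() → (A, A̅)` of the duality. -/
def dualUnit (A : C) : (starPoly C).Hom [] [pos A, neg A] :=
  (poly C).id A

/-- The counit `(A̅, A) → ()` of the duality. -/
def dualCounit (A : C) : (starPoly C).Hom [neg A, pos A] [] :=
  (poly C).id A

theorem dual_triangle (A : C) : ((starPoly C).comp ((starPoly C).perm (.refl [])
    (.swap (pos A) (neg A) []) (dualUnit A)) (dualCounit A) : (starPoly C).Hom [pos A] [pos A]) =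
      (starPoly C).id (pos A) := by
  have hP := isPolycategory_poly C
  have h₁ : (poly C).perm (.refl [A]) (.refl [A]) ((poly C).id A) = (poly C).id A :=
    hP.perm_refl _
  have h₂ : (starPoly C).perm (.refl []) (.swap (pos A) (neg A) []) (dualUnit A) =
      ((poly C).id A : (starPoly C).Hom [] [neg A, pos A]) :=
    hP.perm_eq_self (Γ := [A]) (Δ := [A]) (fun _ => rfl) (fun _ => rfl)
  refine (congrArg (fun k : (starPoly C).Hom [] [neg A, pos A] => ((starPoly C).comp k
    (dualCounit A) : (starPoly C).Hom [pos A] [pos A])) h₂).trans ?_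
  refine (hP.perm_eq_self (Γ := [A]) (Δ := [A]) (fun _ => rfl) (fun _ => rfl)).trans ?_
  refine (congrArg (fun k : Hom [A] [A] => (poly C).comp (Δ := []) k _) h₁).trans ?_
  exact (hP.id_left (S := []) (T := [A]) _).trans h₁

variable [MonoidalClosed C]

/-- The evaluation `(A ⊸ B, A) → B`, in the free `∗`-polycategory. -/
def evalMor (A B : C) : (starPoly C).Hom [pos ((ihom A).obj B), pos A] [pos B] :=
  evMor A B

/-- The distinguished morphism `A ⊸ B → (A̅, B)` is the evaluation, transposed along the duality of
`A` and `A̅`. -/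
theorem dualUnit_left_evalMor (A B : C) :
    (ModuleStruct.noy (P := starPoly C) (pos ((ihom A).obj B))).left (dualUnit A)
      (evalMor A B) = homMor A B := by
  have hP := isPolycategory_poly C
  refine ((isPolycategory_starPoly C).perm_eq_self (Γ := [pos ((ihom A).obj B)])
    (Δ := [neg A, pos B]) (fun _ => rfl) (fun _ => rfl)).trans ?_
  let σ : ListPerm [pos ((ihom A).obj B), pos A] [pos A, pos ((ihom A).obj B)] := .swap _ _ []
  let m := Signed.merge [] [neg A] [pos ((ihom A).obj B)] [pos B]
  let m' := Signed.merge [neg A] [] [pos B] [pos ((ihom A).obj B)]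
  refine (congrArg ((poly C).perm m m') (hP.id_left (S := [(ihom A).obj B]) (T := [B]) _)).trans ?_
  refine (hP.perm_perm ((Signed.posPerm σ).append (Signed.negPerm (.refl [pos B]))) m
    ((Signed.posPerm (.refl [pos B])).append (Signed.negPerm σ)) m' (evMor A B)).trans ?_
  exact hP.perm_eq_self (Γ := [(ihom A).obj B, A]) (Δ := [B]) (fun _ => rfl) (fun _ => rfl)

/-- The comparison is the transpose of the evaluation, to which `isIso_of_isCotensor` applies. -/
theorem isIso_ihomComparison (A B : C) : IsIso (ihomComparison (embedding C) A B) := by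
  refine isIso_of_isCotensor (J := distinguished C) (dualUnit A) (dualCounit A) (dual_triangle A)
    (evalMor A B) (homMor A B) (.hom A B) (dualUnit_left_evalMor A B) _ ?_
  refine (congrArg (fun k : (embedding C).obj ((ihom A).obj B) ⟶
    internalHom ((embedding C).obj A) ((embedding C).obj B) => mapNeg k
      (idTmulStar (pos A) (pos B))) (curry_eq_curryHom _)).trans ?_
  refine (curryHom_neg _).trans ?_
  have h : mapPos ((muIso A ((ihom A).obj B)).hom ≫ (embedding C).map ((ihom.ev A).app B))
      (idTmul (pos A) (pos ((ihom A).obj B))) =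
        binary (A ◁ (ρ_ ((ihom A).obj B)).hom ≫ (ihom.ev A).app B) :=
    (congrArg (mapPos ((embedding C).map ((ihom.ev A).app B))) muIso_binary).trans
      (mapPos_binary _ _)
  refine (congrArg ((starPoly C).perm (.swap (pos A) (pos ((ihom A).obj B)) []) (.refl [pos B]))
    h).trans (Hom.mk_congr (C := C) ?_)
  refine (congrArg (· ≫ A ◁ (ρ_ ((ihom A).obj B)).hom ≫ (ihom.ev A).app B) (act_congr
    (C := C) (σ := (Signed.posPerm (.swap (pos A) (pos ((ihom A).obj B)) [])).append
      (Signed.negPerm (.refl [pos B]))) (τ := .swap A ((ihom A).obj B) []) fun _ => rfl)).trans ?_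
  refine (Category.assoc _ _ _).symm.trans ((congrArg (· ≫ (ihom.ev A).app B)
    braiding_unit.symm).trans (Category.assoc _ _ _))

end SMCC

/-! ### The envelope theorem -/

theorem mainTheorem4 (C : Type u) [Category.{v} C] [MonoidalCategory C] [SymmetricCategory C]
    [MonoidalClosed C] :
    (SMCC.starPoly C).IsStarPolycategory Signed.star (Counary.poly C).freeStarCounit ∧
    (ModuleStruct.self (SMCC.starPoly C)).Respects (SMCC.distinguished C) ∧
    ∃ (_ : MonoidalCategory (SMCC.Env C)) (_ : SymmetricCategory (SMCC.Env C))
      (_ : MonoidalClosed (SMCC.Env C)) (bot : SMCC.Env C),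
      IsDualizing bot ∧
      Envelope.IsChuDuality bot ∧
      (∃ (u : ∀ A B : SMCC.Env C, Envelope.Hom₂ A B (A ⊗ B))
        (e : (𝟙_ (SMCC.Env C)).pos.obj [] []), Envelope.IsChuTensor u e) ∧
      ∃ (F : C ⥤ SMCC.Env C) (_ : F.Braided),
        F.Full ∧ F.Faithful ∧
        (∀ A B : C, IsIso (ihomComparison F A B)) ∧
        SMCC.IsYoneda F := by
  exact ⟨(Counary.isPolycategory_poly C).isStarPolycategory_freeStar, SMCC.self_respects C,
    Envelope.monoidalCategory, Envelope.symmetricCategory, Envelope.monoidalClosed,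
    Envelope.bot (SMCC.distinguished C),
    Envelope.isDualizing_bot, Envelope.isChuDuality,
    ⟨Envelope.univ, Envelope.unitElem (SMCC.distinguished C), Envelope.isChuTensor⟩,
    SMCC.embedding C, SMCC.braidedEmbedding, inferInstance, inferInstance,
        SMCC.isIso_ihomComparison,
    SMCC.isYoneda_embedding⟩
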